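/- **Setting.** Let $\sigma$ be a stored energy function of class $C^3$ on the $3\times3$ matrices $F$ with $\det F>0$, frame indifferent and isotropic: $\sigma(QF)=\sigma(F)=\sigma(FQ)$ for every proper orthogonal $Q$. Fix $\lambda>0$ and put (repeated indices are summed) $$A^{ij}_{\ell m}=\frac{\partial^2\sigma}{\partial F^i_\ell\,\partial F^j_m}(\lambda I),\qquad B^{ijk}_{\ell mn}=\frac{\partial^3\sigma}{\partial F^i_\ell\,\partial F^j_m\,\partial F^k_n}(\lambda I),$$ $$(Au)^i=A^{ij}_{\ell m}\partial_\ell\partial_m u^j,\qquad N(u,v)^i=B^{ijk}_{\ell mn}\,\partial_\ell(\partial_m u^j\,\partial_n v^k).$$ Let $c_1,c_2\ge 0$ be the propagation speeds, given by $c_1^2=A^{11}_{11}$, $c_2^2=A^{22}_{11}$ (so that $A=c_2^2\Delta I+(c_1^2-c_2^2)\nabla\otimes\nabla$), and assume the hyperbolicity condition $c_1^2>\tfrac43c_2^2>0$. The equation is $$\partial_t^2u-Au=N(u,u).\tag{1.9a}$$ **Vector fields.** Let $\Gamma=(\Gamma_0,\dots,\Gamma_7)=(\partial_t,\partial_1,\partial_2,\partial_3,\tilde\Omega_1,\tilde\Omega_2,\tilde\Omega_3,\tilde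 S)$, where $\tilde S=t\partial_t+r\partial_r-1$, $r=|x|$, and $\tilde\Omega_\ell=(x\wedge\nabla)_\ell I+U_\ell$, with $U_\ell$ the matrix of $w\mapsto -e_\ell\wedge w$. For a word $a=(a_1,\dots,a_k)$ write $\Gamma^a=\Gamma_{a_1}\cdots\Gamma_{a_k}$ and $|a|=k$. **Energies and weighted norms.** Let $$E_1(u(t))=\tfrac12\int_{\mathbb R^3}\Big[|\partial_tu|^2+c_2^2|\nabla u|^2+(c_1^2-c_2^2)(\nabla\cdot u)^2\Big]dx,\qquad E_\kappa(u(t))=\sum_{|a|\le\kappa-1}E_1(\Gamma^au(t)),$$ $$\mathcal X_\kappa(u(t))=\sum_{\alpha=1}^2\sum_{\beta=0}^3\sum_{\ell=1}^3\sum_{|a|\le\kappa-2}\big\|\langle c_\alpha t-r\rangle P_\alpha\partial_\beta\partial_\ell\Gamma^au(t)\big\|_{L^2(\mathbb R^3)}\in[0,\infty],$$ where $\partial_0=\partial_t$, $\langle\rho\rangle=(1+\rho^2)^{1/2}$, $P_1w=\frac xr\langle\frac xr,w\rangle$ and $P_2=I-P_1$. **Solution space.** $\dot H^\kappa_\Gamma(T)$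 is the closure of $C^\infty([0,T];C_0^\infty(\mathbb R^3)^3)$ in the norm $\sup_{0\le t<T}E_\kappa^{1/2}(u(t))$. For $\kappa\ge2$ its elements are realized as functions on $[0,T)\times\mathbb R^3$, the pointwise limits of Cauchy sequences of smooth functions, and the functions $\partial_\beta\Gamma^au(t)$, $|a|\le\kappa-1$, are the corresponding limits in $L^2(\mathbb R^3)$. **Proposition 3.4.** Let $\kappa\ge8$ and $\mu=\kappa-2$. There are constants $\varepsilon>0$ and $C>0$, depending only on $\sigma$, $\lambda$ and $\kappa$, such that for every $T>0$ the following holds. If $u\in\dot H^\kappa_\Gamma(T)$ solves (1.9a) on $(0,T)\times\mathbb R^3$ and $E_\mu(u(t))\le\varepsilon$ for all $0\le t<T$, then for all $0\le t<T$ $$\mathcal X_\mu(u(t))\le C\,E_\mu^{1/2}(u(t)),\qquad \mathcal X_\kappa(u(t))\le C\,E_\kappa^{1/2}(u(t))\big[1+E_\mu^{1/2}(u(t))\big].$$ In particular both weighted norms are finite. -/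

import Mathlib

open Set Filter Topology MeasureTheory
open scoped ENNReal ContDiff

attribute [local instance] Matrix.normedAddCommGroup Matrix.normedSpace

namespace PrestressedElastic

noncomputable section

/-! ### Vector fields on space-time and the generators -/

/-- Euclidean three-space. -/
abbrev E3 := EuclideanSpace ℝ (Fin 3)

/-- Time-dependent vector fields `u (t, x)`. -/
abbrev VField := ℝ × E3 → E3

/-- The time derivative. -/
def dT (u : VField) : VField := fun p => fderiv ℝ u p (1, 0)

/-- The spatial partial derivatives. -/
def dX (l : Fin 3) (u : VField) : VField :=
  fun p => fderiv ℝ u p (0, EuclideanSpace.single l 1)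

/-- The angular momentum operators, the components of `x ∧ ∇` (the indices are cyclic). -/
def angular (l : Fin 3) (u : VField) : VField :=
  fun p => p.2 (l + 1) • dX (l + 2) u p - p.2 (l + 2) • dX (l + 1) u p

/-- The matrices by which the angular momentum operators are corrected. -/
def rotMatrix : Fin 3 → Matrix (Fin 3) (Fin 3) ℝ :=
  ![!![0, 0, 0; 0, 0, 1; 0, -1, 0],
    !![0, 0, -1; 0, 0, 0; 1, 0, 0],
    !![0, 1, 0; -1, 0, 0; 0, 0, 0]]

/-- The generators of simultaneous rotations. -/
def rot (l : Fin 3) (u : VField) : VField :=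
  fun p => angular l u p + WithLp.toLp 2 ((rotMatrix l).mulVec (u p).ofLp)

/-- The generator of the changes of scale, `t ∂_t + r ∂_r - 1`, where `r ∂_r = x · ∇`. -/
def scal (u : VField) : VField :=
  fun p => p.1 • dT u p + ∑ l : Fin 3, p.2 l • dX l u p - u p

/-- The eight generators: `0` is the time derivative, `1, 2, 3` the spatial derivatives,
`4, 5, 6` the rotations and `7` the scaling. -/
def gen : Fin 8 → VField → VField :=
  ![dT, dX 0, dX 1, dX 2, rot 0, rot 1, rot 2, scal]

/-- The index, among the eight generators, of a first order derivative `∂_β`, `β = 0, 1, 2, 3`. -/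
def dIdx (β : Fin 4) : Fin 8 := Fin.castLE (by norm_num) β

/-- The index, among the eight generators, of a spatial derivative. -/
def xIdx (l : Fin 3) : Fin 8 := dIdx l.succ

/-- The ordered product of generators along a word. -/
def genWord : List (Fin 8) → VField → VField
  | [], u => u
  | i :: a, u => gen i (genWord a u)

/-! ### Energies and the weighted norm

They only depend on the functions `Γ^a u (t, ·)` at one time. A `Jet` collects these functions
for all words `a`, so that the same formulas serve for smooth fields and for their limits. -/

/-- The functions `Γ^a u (t, ·)` at one time, indexed by the words `a`. -/
abbrev Jet := List (Fin 8) → E3 → E3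

/-- The jet of a smooth field at time `t`, by classical differentiation. -/
def classicalJet (u : VField) (t : ℝ) : Jet := fun a x => genWord a u (t, x)

/-- The energy `E_1 (Γ^a u (t))`; `c 0` and `c 1` are the first and the second speed. -/
def energyOne (c : Fin 2 → ℝ) (D : Jet) (a : List (Fin 8)) : ℝ :=
  1 / 2 * ∫ x : E3, (‖D (dIdx 0 :: a) x‖ ^ 2 + c 1 ^ 2 * ∑ l : Fin 3, ‖D (xIdx l :: a) x‖ ^ 2
    + (c 0 ^ 2 - c 1 ^ 2) * (∑ l : Fin 3, D (xIdx l :: a) x l) ^ 2)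

/-- The energy `E_κ`, the sum of `E_1 (Γ^a u)` over the words `a` of length at most `κ - 1`. -/
def energy (c : Fin 2 → ℝ) (κ : ℕ) (D : Jet) : ℝ :=
  ∑ k ∈ Finset.range κ, ∑ a : Fin k → Fin 8, energyOne c D (List.ofFn a)

/-- The projection onto the radial direction at `x`. -/
def radialProj (x w : E3) : E3 := inner ℝ (‖x‖⁻¹ • x) w • (‖x‖⁻¹ • x)

/-- The radial (index `0`) and the transverse (index `1`) projection at `x`. -/
def proj (α : Fin 2) (x w : E3) : E3 := ![radialProj x w, w - radialProj x w] α

/-- The weighted norm at time `t`; the words `a` have length at most `κ - 2`.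
The value may be infinite. -/
def weightedNorm (c : Fin 2 → ℝ) (κ : ℕ) (t : ℝ) (D : Jet) : ℝ≥0∞ :=
  ∑ α : Fin 2, ∑ β : Fin 4, ∑ l : Fin 3,
    ∑ k ∈ Finset.range (κ - 1), ∑ a : Fin k → Fin 8,
      eLpNorm (fun x : E3 => √(1 + (c α * t - ‖x‖) ^ 2) •
        proj α x (D (dIdx β :: xIdx l :: List.ofFn a) x)) 2 volume

/-! ### The solution space -/

/-- Smooth compactly supported fields on the whole space-time. Their restrictions to
`[0, T] × ℝ³` are the smooth curves `[0, T] → C_0^∞(ℝ³)³`. -/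
def IsTest (φ : VField) : Prop := ContDiff ℝ ∞ φ ∧ HasCompactSupport φ

/-- `φ` is a sequence of test fields that is Cauchy for the norm `sup_{0 ≤ t < T} E_κ^{1/2}` and
has limit `u`. For `κ ≥ 2` the Sobolev inequality makes every such Cauchy sequence converge
uniformly on `[0, T) × ℝ³`, so that its limit in the completion is given by a function. -/
def Approximates (c : Fin 2 → ℝ) (κ : ℕ) (T : ℝ) (φ : ℕ → VField) (u : VField) : Prop :=
  (∀ n, IsTest (φ n)) ∧
  (∀ ε : ℝ, 0 < ε → ∃ N : ℕ, ∀ m n : ℕ, N ≤ m → N ≤ n → ∀ t ∈ Ico 0 T,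
    √(energy c κ (classicalJet (φ m - φ n) t)) ≤ ε) ∧
  (∀ t ∈ Ico 0 T, ∀ x : E3, Tendsto (fun n => φ n (t, x)) atTop (𝓝 (u (t, x))))

/-- Membership in the closure of the test fields in the norm `sup_{0 ≤ t < T} E_κ^{1/2}`. -/
def MemSpace (c : Fin 2 → ℝ) (κ : ℕ) (T : ℝ) (u : VField) : Prop :=
  ∃ φ : ℕ → VField, Approximates c κ T φ u

/-- The function `g` is the square integrable limit, at time `t`, of `Γ^a φ_n` along an
approximating sequence of `u`. -/
def IsStrongDeriv (c : Fin 2 → ℝ) (κ : ℕ) (T : ℝ) (u : VField) (t : ℝ) (a : List (Fin 8))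
    (g : E3 → E3) : Prop :=
  MemLp g 2 volume ∧ ∃ φ : ℕ → VField, Approximates c κ T φ u ∧
    Tendsto (fun n => eLpNorm (fun x => classicalJet (φ n) t a x - g x) 2 volume) atTop (𝓝 0)

/-- The jet of an element of the solution space: `Γ^a u (t, ·)` is the strong `L²` limit
of `Γ^a φ_n (t, ·)`. The limit exists for the words that start with one of the derivatives `∂_β`
and have length at most `κ`, the only ones that occur in the energies and weighted norms up
to `κ`; up to null sets it does not depend on the sequence. -/
def jet (c : Fin 2 → ℝ) (κ : ℕ) (T : ℝ) (u : VField) (t : ℝ) : Jet :=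
  fun a => Classical.epsilon (IsStrongDeriv c κ T u t a)

/-! ### The equations of motion -/

/-- Frame indifference and isotropy of a stored energy function, which is a function of the
deformation gradients `F` with `det F > 0`. -/
def IsIsotropic (σ : Matrix (Fin 3) (Fin 3) ℝ → ℝ) : Prop :=
  ∀ F : Matrix (Fin 3) (Fin 3) ℝ, 0 < F.det →
    ∀ Q ∈ Matrix.specialOrthogonalGroup (Fin 3) ℝ, σ (Q * F) = σ F ∧ σ (F * Q) = σ F

/-- The second derivative of `σ` at `lam I` in the entries `(i, l)` and `(j, m)`. -/
def coeffA (σ : Matrix (Fin 3) (Fin 3) ℝ → ℝ) (lam : ℝ) (i j l m : Fin 3) : ℝ :=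
  iteratedFDeriv ℝ 2 σ (lam • 1) ![Matrix.single i l 1, Matrix.single j m 1]

/-- The third derivative of `σ` at `lam I` in the entries `(i, l)`, `(j, m)` and `(k, n)`. -/
def coeffB (σ : Matrix (Fin 3) (Fin 3) ℝ → ℝ) (lam : ℝ) (i j k l m n : Fin 3) : ℝ :=
  iteratedFDeriv ℝ 3 σ (lam • 1)
    ![Matrix.single i l 1, Matrix.single j m 1, Matrix.single k n 1]

/-- The linear operator `A`. -/
def opA (σ : Matrix (Fin 3) (Fin 3) ℝ → ℝ) (lam : ℝ) (u : VField) : VField :=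
  fun p => WithLp.toLp 2 fun i =>
    ∑ j, ∑ l, ∑ m, coeffA σ lam i j l m * dX l (dX m u) p j

/-- The quadratic operator `N (u, v)`. -/
def opN (σ : Matrix (Fin 3) (Fin 3) ℝ → ℝ) (lam : ℝ) (u v : VField) : VField :=
  fun p => WithLp.toLp 2 fun i =>
    ∑ j, ∑ k, ∑ l, ∑ m, ∑ n, coeffB σ lam i j k l m n *
      fderiv ℝ (fun q => dX m u q j * dX n v q k) p (0, EuclideanSpace.single l 1)

/-- The propagation speeds. For an isotropic `σ` the second derivative of `σ` at `lam I` in the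
rank one direction `x ⊗ ξ` is `c₁² ⟨x, ξ⟩² + c₂² |x ∧ ξ|²`; the two squared speeds are read off at
`x = ξ = e₁` and at `x = e₂`, `ξ = e₁`. Index `0` is the longitudinal speed `c₁`, index `1` the
transverse speed `c₂`. -/
def speed (σ : Matrix (Fin 3) (Fin 3) ℝ → ℝ) (lam : ℝ) : Fin 2 → ℝ :=
  ![√(coeffA σ lam 0 0 0 0), √(coeffA σ lam 1 1 0 0)]

/-- The hyperbolicity condition `c₁² > (4/3) c₂² > 0`. -/
def IsHyperbolic (σ : Matrix (Fin 3) (Fin 3) ℝ → ℝ) (lam : ℝ) : Prop :=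
  0 < speed σ lam 1 ^ 2 ∧ 4 / 3 * speed σ lam 1 ^ 2 < speed σ lam 0 ^ 2

/-- `u` solves `∂_t² u - A u = N (u, u)` for `0 < t < T`. -/
def IsSolution (σ : Matrix (Fin 3) (Fin 3) ℝ → ℝ) (lam T : ℝ) (u : VField) : Prop :=
  ∀ t ∈ Ioo 0 T, ∀ x : E3,
    dT (dT u) (t, x) - opA σ lam u (t, x) = opN σ lam u u (t, x)

end

end PrestressedElastic

open PrestressedElastic

/-!
The weighted estimates are proved first for test fields, smooth with compact support in space, at
one time `t`, with an error for the residual `R = □φ - N(φ, φ)`; a limit along an approximating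
sequence of the solution then removes the residual.

*Linear estimate.* The wave operator `∂ₜ² - A` commutes with the generators up to multiples of
itself (`waveOp_gen`), so it is enough to bound the weighted second derivatives of a field `u` by
`e`, the first derivatives of `u` and of `Γu`, and by `t |∂ₜ²u - Au|` (`exists_weighted_le`).
Away from the time axis this is pointwise (`exists_outer_bound`). Rotations make the Hessian of
rank one, `∂ₗ∂ₘu = nₗ nₘ q + O(e / r)` with `n = x / r` (`SecondDerivs.rankOne`), and on such a
Hessian the Lamé operator acts by `c_α²` on the range of `P_α` (`projL_lame_rankOne`). Scaling,
used twice, gives `t² ∂ₜ²u = r² q + O((t + r) e)`. Comparing the two, `(c_α² t² - r²) P_α q` is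
controlled, and division by `c_α t + r` leaves the weight. Near the time axis the scaling identity
says that `∂ₜ²u` is small against the Hessian, so that `Au` is essentially given and Gårding's
inequality with a cutoff controls the Hessian with the weight `t` (`exists_inner_sq_le`).

*Supremum norms.* The first derivatives have an `L^∞` bound with the weight `1 + |x|` in terms of
the energy (`exists_sup_dir_le`). It comes from the one-dimensional Sobolev inequality, used three
times: along the coordinate axes, and in spherical coordinates, whose angular derivatives are
rotation fields and whose Jacobian supplies the weight. Near the time axis, second derivatives
gain a factor `t` from the weighted norm instead.

*Nonlinear estimate.* In a product of a first and a second derivative the factor `t` is carried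
either by the weight of the second derivative or by `|x|`, since at most one of the two is small
compared to `t`. The first derivative goes into `L^∞` unless it carries nearly all the generators,
and then the second derivative does (`exists_mul_sup_size₁_le`, `exists_mul_sup_size₂_le`). For test fields the weighted norms are
finite, so that when the low energy is small they can be absorbed into the left-hand side
(`exists_weighted_quad_le`).

*Isotropy.* Conjugation by rotations leaves the second derivative of `σ` at `λI` invariant, which
makes `A` the Lamé operator with the speeds `c₁ > c₂ > 0` (`opA_eq_lame`). The quadratic term
enters only through its form, a bilinear expression in first and second derivatives
(`opN_eq_quad`).

*Limits.* By the Sobolev inequality the approximants converge with their second derivatives, so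
the residuals tend to zero at every point of the open slab. With generators applied they are
still uniformly Cauchy in `L²`, because the residual is bounded in the energy norm. Their limit
vanishes: a generator acts on a weakly null sequence by integration by parts in space, and in time
by differentiating the pairings with cutoffs, which converge uniformly with their derivatives
(`WeakNull.dT`, `Approximates.l2Null_residual`). Finally, the derivatives of the solution are the
limits of those of every approximating sequence (`Approximates.tendsto_jet`), and the weighted norm
is lower semicontinuous (`weightedNorm_le_of_tendsto`).
-/

namespace PrestressedElastic

noncomputable section

/-! ### Calculus of the generators on test fields -/

/-- The direction of the derivative `∂_β` in space-time. -/
def dirv (β : Fin 4) : ℝ × E3 :=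
  Fin.cons (α := fun _ => ℝ × E3) (1, 0) (fun l => (0, EuclideanSpace.single l (1 : ℝ))) β

/-- The derivative in a fixed direction of space-time. -/
def dir (v : ℝ × E3) (u : VField) : VField := fun p => fderiv ℝ u p v

theorem dT_eq (u : VField) : dT u = dir (dirv 0) u := rfl

theorem dX_eq (l : Fin 3) (u : VField) : dX l u = dir (dirv l.succ) u := rfl

theorem gen_dIdx (β : Fin 4) (u : VField) : gen (dIdx β) u = dir (dirv β) u := by
  fin_cases β <;> rfl

theorem gen_xIdx (l : Fin 3) (u : VField) : gen (xIdx l) u = dX l u := by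
  fin_cases l <;> rfl

/-- The matrix of a generator, acting on the values of the field. -/
def genM (i : Fin 8) : E3 →L[ℝ] E3 :=
  (![0, 0, 0, 0, (Matrix.toEuclideanLin (rotMatrix 0)).toContinuousLinearMap,
    (Matrix.toEuclideanLin (rotMatrix 1)).toContinuousLinearMap,
    (Matrix.toEuclideanLin (rotMatrix 2)).toContinuousLinearMap,
    -ContinuousLinearMap.id ℝ E3] : Fin 8 → E3 →L[ℝ] E3) i

/-- The vector field of a rotation, as a linear map of space-time. -/
def rotA (l : Fin 3) : ℝ × E3 →L[ℝ] ℝ × E3 :=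
  (ContinuousLinearMap.inr ℝ ℝ E3).comp
    (((EuclideanSpace.proj (l + 1) : E3 →L[ℝ] ℝ).smulRight (EuclideanSpace.single (l + 2) (1 : ℝ))
      - (EuclideanSpace.proj (l + 2) : E3 →L[ℝ] ℝ).smulRight
          (EuclideanSpace.single (l + 1) (1 : ℝ))).comp (ContinuousLinearMap.snd ℝ ℝ E3))

/-- The linear part of the affine vector field of a generator. -/
def genA (i : Fin 8) : ℝ × E3 →L[ℝ] ℝ × E3 :=
  (![0, 0, 0, 0, rotA 0, rotA 1, rotA 2, ContinuousLinearMap.id ℝ (ℝ × E3)] :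
    Fin 8 → ℝ × E3 →L[ℝ] ℝ × E3) i

/-- The constant part of the affine vector field of a generator. -/
def genV (i : Fin 8) : ℝ × E3 :=
  (![dirv 0, dirv 1, dirv 2, dirv 3, 0, 0, 0, 0] : Fin 8 → ℝ × E3) i

theorem space_eq_sum (x : E3) : x = ∑ l : Fin 3, x l • (EuclideanSpace.single l (1 : ℝ) : E3) := by
  ext i
  fin_cases i <;> simp [Fin.sum_univ_three]

theorem spacetime_eq_sum (v : ℝ × E3) :
    v = v.1 • dirv 0 + ∑ l : Fin 3, v.2 l • dirv l.succ := by
  have h := space_eq_sum v.2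
  refine Prod.ext ?_ ?_
  · simp [dirv, Fin.sum_univ_three]
  · rw [Prod.snd_add, Prod.snd_sum]
    simpa [dirv] using h

theorem dir_eq_sum (u : VField) (v p : ℝ × E3) :
    dir v u p = v.1 • dT u p + ∑ l : Fin 3, v.2 l • dX l u p := by
  have h := congrArg (fderiv ℝ u p) (spacetime_eq_sum v)
  simp only [map_add, map_sum, map_smul] at h
  exact h

/-- Every generator is an affine vector field plus a constant matrix. -/
theorem gen_apply (i : Fin 8) (u : VField) (p : ℝ × E3) :
    gen i u p = fderiv ℝ u p (genV i + genA i p) + genM i (u p) := by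
  have hsum : fderiv ℝ u p p = p.1 • dT u p + ∑ l : Fin 3, p.2 l • dX l u p := dir_eq_sum u p p
  have hrot : ∀ l : Fin 3, fderiv ℝ u p (rotA l p) = angular l u p := by
    intro l
    have : rotA l p = p.2 (l + 1) • ((0, EuclideanSpace.single (l + 2) 1) : ℝ × E3)
        - p.2 (l + 2) • ((0, EuclideanSpace.single (l + 1) 1) : ℝ × E3) := by
      refine Prod.ext ?_ ?_ <;> simp [rotA]
    rw [this, map_sub, map_smul, map_smul]
    rfl
  fin_cases i
  · simp [gen, genV, genA, genM, dT, dirv]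
  · simp [gen, genV, genA, genM, dX]; rfl
  · simp [gen, genV, genA, genM, dX]; rfl
  · simp [gen, genV, genA, genM, dX]; rfl
  · simp [gen, genV, genA, genM, rot, hrot, Matrix.toLpLin_apply]
  · simp [gen, genV, genA, genM, rot, hrot, Matrix.toLpLin_apply]
  · simp [gen, genV, genA, genM, rot, hrot, Matrix.toLpLin_apply]
  · simp [gen, genV, genA, genM, scal, hsum]
    abel

theorem IsTest.differentiable {u : VField} (hu : IsTest u) : Differentiable ℝ u :=
  hu.1.differentiable (by simp)

theorem IsTest.continuous {u : VField} (hu : IsTest u) : Continuous u := hu.1.continuous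

theorem IsTest.fderiv_contDiff {u : VField} (hu : IsTest u) : ContDiff ℝ ∞ (fderiv ℝ u) :=
  hu.1.fderiv_right (by simp)

theorem IsTest.fderiv_differentiable {u : VField} (hu : IsTest u) :
    Differentiable ℝ (fderiv ℝ u) :=
  hu.fderiv_contDiff.differentiable (by simp)

theorem IsTest.dir {u : VField} (hu : IsTest u) (v : ℝ × E3) : IsTest (dir v u) :=
  ⟨hu.fderiv_contDiff.clm_apply contDiff_const, hu.2.fderiv_apply ℝ v⟩

theorem IsTest.dT {u : VField} (hu : IsTest u) : IsTest (dT u) := hu.dir _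

theorem IsTest.dX {u : VField} (hu : IsTest u) (l : Fin 3) : IsTest (dX l u) := hu.dir _

theorem IsTest.gen {u : VField} (hu : IsTest u) (i : Fin 8) : IsTest (gen i u) := by
  have h : PrestressedElastic.gen i u
      = fun p => fderiv ℝ u p (genV i + genA i p) + genM i (u p) := funext (gen_apply i u)
  rw [h]
  refine ⟨?_, ?_⟩
  · exact (hu.fderiv_contDiff.clm_apply (contDiff_const.add (genA i).contDiff)).add
      ((genM i).contDiff.comp hu.1)
  · refine hu.2.mono' (fun p hp => ?_)
    by_contra hc
    apply hp
    have h1 : u p = 0 := image_eq_zero_of_notMem_tsupport hc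
    have h2 : fderiv ℝ u p = 0 := by
      by_contra h2
      exact hc (support_fderiv_subset ℝ h2)
    simp [h1, h2]

theorem IsTest.genWord {u : VField} (hu : IsTest u) (a : List (Fin 8)) : IsTest (genWord a u) := by
  induction a with
  | nil => exact hu
  | cons i a ih => exact ih.gen i

theorem IsTest.add {u v : VField} (hu : IsTest u) (hv : IsTest v) : IsTest (u + v) :=
  ⟨hu.1.add hv.1, hu.2.add hv.2⟩

theorem IsTest.const_smul {u : VField} (hu : IsTest u) (c : ℝ) : IsTest (c • u) :=
  ⟨contDiff_const.smul hu.1, hu.2.mono fun p hp h => hp (by simp [h])⟩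

theorem IsTest.neg {u : VField} (hu : IsTest u) : IsTest (-u) := by
  simpa using hu.const_smul (-1)

theorem IsTest.sub {u v : VField} (hu : IsTest u) (hv : IsTest v) : IsTest (u - v) := by
  simpa [sub_eq_add_neg] using hu.add hv.neg

theorem isTest_zero : IsTest (0 : VField) := ⟨contDiff_const, HasCompactSupport.zero⟩

theorem IsTest.sum {ι : Type*} {s : Finset ι} {u : ι → VField} (hu : ∀ i ∈ s, IsTest (u i)) :
    IsTest (∑ i ∈ s, u i) := by
  classical
  induction s using Finset.induction_on with
  | empty => simpa using isTest_zero
  | insert i s hi ih =>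
    rw [Finset.sum_insert hi]
    exact (hu i (by simp)).add (ih fun j hj => hu j (by simp [hj]))

theorem IsTest.clm {u : VField} (hu : IsTest u) (K : E3 →L[ℝ] E3) : IsTest (fun p => K (u p)) :=
  ⟨K.contDiff.comp hu.1, hu.2.comp_left (map_zero K)⟩

theorem IsTest.bil {u v : VField} (hu : IsTest u) (hv : IsTest v) (Q : E3 →L[ℝ] E3 →L[ℝ] E3) :
    IsTest (fun p => Q (u p) (v p)) := by
  refine ⟨(Q.contDiff.comp hu.1).clm_apply hv.1, hv.2.mono fun p hp h => hp ?_⟩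
  simp [h]

theorem gen_add (i : Fin 8) {u v : VField} (hu : IsTest u) (hv : IsTest v) :
    gen i (u + v) = gen i u + gen i v := by
  funext p
  simp only [gen_apply, Pi.add_apply, map_add,
    fderiv_add hu.differentiable.differentiableAt hv.differentiable.differentiableAt,
    add_apply]
  abel

theorem gen_smul (i : Fin 8) {u : VField} (hu : IsTest u) (c : ℝ) :
    gen i (c • u) = c • gen i u := by
  funext p
  simp only [gen_apply, Pi.smul_apply, map_smul,
    fderiv_const_smul hu.differentiable.differentiableAt, smul_apply, smul_add]

theorem gen_sub (i : Fin 8) {u v : VField} (hu : IsTest u) (hv : IsTest v) :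
    gen i (u - v) = gen i u - gen i v := by
  have h := gen_add i hu (hv.const_smul (-1))
  rw [gen_smul i hv] at h
  simpa [sub_eq_add_neg] using h

theorem genWord_add (a : List (Fin 8)) {u v : VField} (hu : IsTest u) (hv : IsTest v) :
    genWord a (u + v) = genWord a u + genWord a v := by
  induction a with
  | nil => rfl
  | cons i a ih => simp only [genWord, ih, gen_add i (hu.genWord a) (hv.genWord a)]

theorem genWord_smul (a : List (Fin 8)) {u : VField} (hu : IsTest u) (c : ℝ) :
    genWord a (c • u) = c • genWord a u := by
  induction a with
  | nil => rfl
  | cons i a ih => simp only [genWord, ih, gen_smul i (hu.genWord a)]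

theorem genWord_sub (a : List (Fin 8)) {u v : VField} (hu : IsTest u) (hv : IsTest v) :
    genWord a (u - v) = genWord a u - genWord a v := by
  induction a with
  | nil => rfl
  | cons i a ih => simp only [genWord, ih, gen_sub i (hu.genWord a) (hv.genWord a)]

theorem genWord_sum (a : List (Fin 8)) {ι : Type*} {s : Finset ι} {u : ι → VField}
    (hu : ∀ i ∈ s, IsTest (u i)) : genWord a (∑ i ∈ s, u i) = ∑ i ∈ s, genWord a (u i) := by
  classical
  induction s using Finset.induction_on with
  | empty =>
    have h := genWord_smul a isTest_zero 0
    simpa using h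
  | insert i s hi ih =>
    rw [Finset.sum_insert hi, Finset.sum_insert hi,
      genWord_add a (hu i (by simp)) (IsTest.sum fun j hj => hu j (by simp [hj])),
      ih fun j hj => hu j (by simp [hj])]

theorem genWord_append (a b : List (Fin 8)) (u : VField) :
    genWord (a ++ b) u = genWord a (genWord b u) := by
  induction a with
  | nil => rfl
  | cons i a ih => simp only [List.cons_append, genWord, ih]

/-! ### Commutators -/

theorem hasFDerivAt_dir {u : VField} (hu : IsTest u) (v p w : ℝ × E3) :
    fderiv ℝ (dir v u) p w = fderiv ℝ (fderiv ℝ u) p w v := by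
  have h : HasFDerivAt (dir v u) ((fderiv ℝ (fderiv ℝ u) p).flip v) p := by
    have := (hu.fderiv_differentiable p).hasFDerivAt.clm_apply (hasFDerivAt_const v p)
    simp only [ContinuousLinearMap.comp_zero, zero_add] at this
    exact this
  rw [h.fderiv]
  rfl

theorem IsTest.symm_snd {u : VField} (hu : IsTest u) (p v w : ℝ × E3) :
    fderiv ℝ (fderiv ℝ u) p v w = fderiv ℝ (fderiv ℝ u) p w v :=
  (hu.1.contDiffAt.isSymmSndFDerivAt 
    (by simpa using WithTop.coe_le_coe.2 (le_top : (2 : ℕ∞) ≤ ⊤))) v w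

theorem dir_comm {u : VField} (hu : IsTest u) (v w : ℝ × E3) :
    dir v (dir w u) = dir w (dir v u) := by
  funext p
  change fderiv ℝ (dir w u) p v = fderiv ℝ (dir v u) p w
  rw [hasFDerivAt_dir hu, hasFDerivAt_dir hu, hu.symm_snd]

theorem dir_gen {u : VField} (hu : IsTest u) (i : Fin 8) (v : ℝ × E3) :
    dir v (gen i u) = gen i (dir v u) + dir (genA i v) u := by
  funext p
  have h : PrestressedElastic.gen i u
      = fun p => fderiv ℝ u p (genV i + genA i p) + genM i (u p) := funext (gen_apply i u)
  have hd : HasFDerivAt (gen i u) ((fderiv ℝ u p).comp (genA i)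
      + (fderiv ℝ (fderiv ℝ u) p).flip (genV i + genA i p)
      + (genM i).comp (fderiv ℝ u p)) p := by
    rw [h]
    have h1 := (hu.fderiv_differentiable p).hasFDerivAt.clm_apply
      (((genA i).hasFDerivAt (x := p)).const_add (genV i))
    exact h1.add ((genM i).hasFDerivAt.comp p (hu.differentiable p).hasFDerivAt)
  change fderiv ℝ (gen i u) p v = _
  rw [hd.fderiv]
  simp only [Pi.add_apply, gen_apply i (dir v u), hasFDerivAt_dir hu]
  simp only [dir, add_apply, ContinuousLinearMap.comp_apply,
    ContinuousLinearMap.flip_apply]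
  rw [hu.symm_snd p v]
  abel

theorem gen_clm {u : VField} (hu : IsTest u) (i : Fin 8) (K : E3 →L[ℝ] E3) (p : ℝ × E3) :
    gen i (fun q => K (u q)) p
      = K (gen i u p) + (genM i (K (u p)) - K (genM i (u p))) := by
  have hd : HasFDerivAt (fun q => K (u q)) (K.comp (fderiv ℝ u p)) p :=
    K.hasFDerivAt.comp p (hu.differentiable p).hasFDerivAt
  rw [gen_apply, gen_apply, hd.fderiv]
  simp only [ContinuousLinearMap.comp_apply, map_add]
  abel

/-- The bilinear map that measures how far a generator is from a derivation of `Q`. -/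
def genQ (i : Fin 8) (Q : E3 →L[ℝ] E3 →L[ℝ] E3) : E3 →L[ℝ] E3 →L[ℝ] E3 :=
  (ContinuousLinearMap.compL ℝ E3 E3 E3 (genM i)).comp Q - Q.comp (genM i)
    - ((ContinuousLinearMap.compL ℝ E3 E3 E3).flip (genM i)).comp Q

theorem gen_bil {u v : VField} (hu : IsTest u) (hv : IsTest v) (i : Fin 8)
    (Q : E3 →L[ℝ] E3 →L[ℝ] E3) :
    gen i (fun q => Q (u q) (v q)) = (fun p => Q (gen i u p) (v p))
      + (fun p => Q (u p) (gen i v p)) + fun p => genQ i Q (u p) (v p) := by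
  funext p
  have hd : HasFDerivAt (fun q => Q (u q) (v q))
      ((Q (u p)).comp (fderiv ℝ v p) + (Q.comp (fderiv ℝ u p)).flip (v p)) p :=
    (Q.hasFDerivAt.comp p (hu.differentiable p).hasFDerivAt).clm_apply
      (hv.differentiable p).hasFDerivAt
  simp only [Pi.add_apply]
  rw [gen_apply, gen_apply, gen_apply, hd.fderiv]
  simp only [add_apply, ContinuousLinearMap.comp_apply,
    ContinuousLinearMap.flip_apply, map_add, genQ, sub_apply,
    ContinuousLinearMap.compL_apply]
  abel

/-! ### Words and pointwise reordering estimates -/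

theorem genWord_nil (u : VField) : genWord [] u = u := rfl

/-- The words of length less than `n`. -/
def words (n : ℕ) : Finset (List (Fin 8)) :=
  (Finset.range n).biUnion fun k =>
    (Finset.univ : Finset (Fin k → Fin 8)).image List.ofFn

theorem mem_words {n : ℕ} {a : List (Fin 8)} : a ∈ words n ↔ a.length < n := by
  simp only [words, Finset.mem_biUnion, Finset.mem_range, Finset.mem_image, Finset.mem_univ,
    true_and]
  constructor
  · rintro ⟨k, hk, b, rfl⟩
    simpa using hk
  · intro h
    exact ⟨a.length, h, a.get, List.ofFn_get a⟩

theorem sum_words {M : Type*} [AddCommMonoid M] (n : ℕ) (F : List (Fin 8) → M) :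
    ∑ k ∈ Finset.range n, ∑ a : Fin k → Fin 8, F (List.ofFn a) = ∑ a ∈ words n, F a := by
  rw [words, Finset.sum_biUnion]
  · refine Finset.sum_congr rfl fun k _ => ?_
    rw [Finset.sum_image]
    intro a _ b _ h
    exact List.ofFn_injective h
  · intro j _ k _ hjk
    rw [Function.onFun, Finset.disjoint_left]
    intro a ha hb
    simp only [Finset.mem_image, Finset.mem_univ, true_and] at ha hb
    obtain ⟨x, rfl⟩ := ha
    obtain ⟨y, hy⟩ := hb
    apply hjk
    have := congrArg List.length hy
    simpa using this.symm

attribute [irreducible] words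

theorem words_mono {m n : ℕ} (h : m ≤ n) : words m ⊆ words n := fun _ ha =>
  mem_words.2 ((mem_words.1 ha).trans_le h)

/-- A sum over words, evaluated at the words extended on the right by `b`. -/
theorem sum_words_append_le (F : List (Fin 8) → ℝ) (hF : ∀ a, 0 ≤ F a) (b : List (Fin 8))
    {m n : ℕ} (h : m + b.length ≤ n) : ∑ a ∈ words m, F (a ++ b) ≤ ∑ a ∈ words n, F a := by
  classical
  have hinj : Set.InjOn (fun a : List (Fin 8) => a ++ b) (words m) := fun x _ y _ hxy =>
    List.append_cancel_right hxy
  rw [← Finset.sum_image (f := F) hinj]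
  refine Finset.sum_le_sum_of_subset_of_nonneg ?_ fun a _ _ => hF a
  intro a ha
  obtain ⟨x, hx, rfl⟩ := Finset.mem_image.1 ha
  have := mem_words.1 hx
  exact mem_words.2 (by rw [List.length_append]; omega)

/-- The pointwise size of `∂_β Γ^a u`, over all words `a` of length less than `k`. -/
def size₁ (k : ℕ) (u : VField) (p : ℝ × E3) : ℝ :=
  ∑ a ∈ words k, ∑ β : Fin 4, ‖dir (dirv β) (genWord a u) p‖

/-- The pointwise size of `∂_β ∂_l Γ^a u`, over all words `a` of length less than `k`. -/
def size₂ (k : ℕ) (u : VField) (p : ℝ × E3) : ℝ :=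
  ∑ a ∈ words k, ∑ β : Fin 4, ∑ l : Fin 3, ‖dir (dirv β) (dX l (genWord a u)) p‖

theorem size₁_nonneg (k : ℕ) (u : VField) (p : ℝ × E3) : 0 ≤ size₁ k u p :=
  Finset.sum_nonneg fun _ _ => Finset.sum_nonneg fun _ _ => norm_nonneg _

theorem sum_norm_le_size₁ {k : ℕ} {a : List (Fin 8)} (ha : a.length < k) (u : VField)
    (p : ℝ × E3) : ∑ β : Fin 4, ‖dir (dirv β) (genWord a u) p‖ ≤ size₁ k u p :=
  Finset.single_le_sum (f := fun a => ∑ β : Fin 4, ‖dir (dirv β) (genWord a u) p‖)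
    (fun _ _ => Finset.sum_nonneg fun _ _ => norm_nonneg _) (mem_words.2 ha)

theorem sum_norm_le_size₂ {k : ℕ} {a : List (Fin 8)} (ha : a.length < k) (u : VField)
    (p : ℝ × E3) :
    ∑ β : Fin 4, ∑ l : Fin 3, ‖dir (dirv β) (dX l (genWord a u)) p‖ ≤ size₂ k u p :=
  Finset.single_le_sum
    (f := fun a => ∑ β : Fin 4, ∑ l : Fin 3, ‖dir (dirv β) (dX l (genWord a u)) p‖)
    (fun _ _ => Finset.sum_nonneg fun _ _ => Finset.sum_nonneg fun _ _ => norm_nonneg _)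
    (mem_words.2 ha)

theorem size₂_nonneg (k : ℕ) (u : VField) (p : ℝ × E3) : 0 ≤ size₂ k u p :=
  Finset.sum_nonneg fun _ _ => Finset.sum_nonneg fun _ _ => Finset.sum_nonneg fun _ _ =>
    norm_nonneg _

theorem size₁_genWord_le (b : List (Fin 8)) {m n : ℕ} (h : m + b.length ≤ n) (u : VField)
    (p : ℝ × E3) : size₁ m (genWord b u) p ≤ size₁ n u p := by
  have := sum_words_append_le (fun a => ∑ β : Fin 4, ‖dir (dirv β) (genWord a u) p‖)
    (fun _ => Finset.sum_nonneg fun _ _ => norm_nonneg _) b h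
  simpa only [size₁, genWord_append] using this

theorem size₂_genWord_le (b : List (Fin 8)) {m n : ℕ} (h : m + b.length ≤ n) (u : VField)
    (p : ℝ × E3) : size₂ m (genWord b u) p ≤ size₂ n u p := by
  have := sum_words_append_le
    (fun a => ∑ β : Fin 4, ∑ l : Fin 3, ‖dir (dirv β) (dX l (genWord a u)) p‖)
    (fun a => Finset.sum_nonneg fun _ _ => Finset.sum_nonneg fun _ _ => norm_nonneg _) b h
  simpa only [size₂, genWord_append] using this

theorem size₁_mono {m n : ℕ} (h : m ≤ n) (u : VField) (p : ℝ × E3) :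
    size₁ m u p ≤ size₁ n u p := size₁_genWord_le [] (by simpa using h) u p

theorem size₂_mono {m n : ℕ} (h : m ≤ n) (u : VField) (p : ℝ × E3) :
    size₂ m u p ≤ size₂ n u p := size₂_genWord_le [] (by simpa using h) u p

theorem norm_le_size₁ {k : ℕ} {a : List (Fin 8)} (ha : a.length < k) (β : Fin 4) (u : VField)
    (p : ℝ × E3) : ‖dir (dirv β) (genWord a u) p‖ ≤ size₁ k u p :=
  (Finset.single_le_sum (f := fun β : Fin 4 => ‖dir (dirv β) (genWord a u) p‖)
    (fun _ _ => norm_nonneg _) (Finset.mem_univ β)).trans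
  (sum_norm_le_size₁ ha u p)

/-- The `ℓ¹` norm of a direction. -/
def dirNorm (v : ℝ × E3) : ℝ := |v.1| + ∑ l : Fin 3, |v.2 l|

theorem dirNorm_nonneg (v : ℝ × E3) : 0 ≤ dirNorm v := by unfold dirNorm; positivity

theorem norm_dir_le (u : VField) (v p : ℝ × E3) :
    ‖dir v u p‖ ≤ dirNorm v * ∑ β : Fin 4, ‖dir (dirv β) u p‖ := by
  rw [dir_eq_sum, dT_eq]
  have hβ : ∀ β, ‖dir (dirv β) u p‖ ≤ ∑ β : Fin 4, ‖dir (dirv β) u p‖ := fun β =>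
    Finset.single_le_sum (f := fun β : Fin 4 => ‖dir (dirv β) u p‖)
      (fun _ _ => norm_nonneg _) (Finset.mem_univ β)
  refine (norm_add_le _ _).trans ?_
  rw [dirNorm, add_mul, Finset.sum_mul]
  refine add_le_add ?_ ((norm_sum_le _ _).trans (Finset.sum_le_sum fun l _ => ?_))
  · rw [norm_smul]
    exact mul_le_mul_of_nonneg_left (hβ 0) (abs_nonneg _)
  · rw [norm_smul, dX_eq]
    exact mul_le_mul_of_nonneg_left (hβ l.succ) (abs_nonneg _)

/-- A derivative can be moved to the left of a word. -/
theorem exists_genWord_dir_le (a : List (Fin 8)) (v : ℝ × E3) :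
    ∃ C : ℝ, 0 ≤ C ∧ ∀ u, IsTest u → ∀ p,
      ‖genWord a (dir v u) p‖ ≤ C * size₁ (a.length + 1) u p := by
  induction a using List.reverseRecOn generalizing v with
  | nil =>
    refine ⟨dirNorm v, dirNorm_nonneg v, fun u _ p => (norm_dir_le u v p).trans ?_⟩
    refine mul_le_mul_of_nonneg_left ?_ (dirNorm_nonneg v)
    exact sum_norm_le_size₁ (a := []) (by simp) u p
  | append_singleton a i ih =>
    obtain ⟨C, hC, h⟩ := ih v
    obtain ⟨C', hC', h'⟩ := ih (genA i v)
    refine ⟨C + C', add_nonneg hC hC', fun u hu p => ?_⟩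
    have e : genWord (a ++ [i]) (dir v u) p
        = genWord a (dir v (gen i u)) p - genWord a (dir (genA i v) u) p := by
      rw [genWord_append, dir_gen hu, genWord_add a ((hu.dir v).gen i) (hu.dir _)]
      simp [genWord]
    rw [e, add_mul, List.length_append]
    refine (norm_sub_le _ _).trans (add_le_add ((h _ (hu.gen i) p).trans ?_)
      ((h' u hu p).trans ?_))
    · exact mul_le_mul_of_nonneg_left (size₁_genWord_le [i] le_rfl u p) hC
    · exact mul_le_mul_of_nonneg_left (size₁_mono (by omega) u p) hC'

theorem genA_fst (i : Fin 8) {w : ℝ × E3} (hw : w.1 = 0) : (genA i w).1 = 0 := by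
  fin_cases i <;> simp [genA, rotA, hw]

theorem dir_dir_gen {u : VField} (hu : IsTest u) (i : Fin 8) (v w : ℝ × E3) :
    dir v (dir w (gen i u))
      = gen i (dir v (dir w u)) + dir (genA i v) (dir w u) + dir v (dir (genA i w) u) := by
  rw [dir_gen hu]
  have : dir v (gen i (dir w u) + dir (genA i w) u)
      = dir v (gen i (dir w u)) + dir v (dir (genA i w) u) := by
    funext p
    simp only [dir, Pi.add_apply]
    rw [fderiv_add ((hu.dir w).gen i).differentiable.differentiableAt
      (hu.dir _).differentiable.differentiableAt]
    rfl
  rw [this, dir_gen (hu.dir w)]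

theorem norm_dir_dir_le {u : VField} (hu : IsTest u) (v : ℝ × E3) {w : ℝ × E3} (hw : w.1 = 0)
    (p : ℝ × E3) : ‖dir v (dir w u) p‖
      ≤ dirNorm v * dirNorm w * ∑ β : Fin 4, ∑ l : Fin 3, ‖dir (dirv β) (dX l u) p‖ := by
  have hdd : ∀ β, ‖dir (dirv β) (dir w u) p‖
      ≤ dirNorm w * ∑ l : Fin 3, ‖dir (dirv β) (dX l u) p‖ := by
    intro β
    rw [dir_comm hu, dir_eq_sum (dir (dirv β) u) w p, hw, zero_smul, zero_add, dirNorm, hw,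
      abs_zero, zero_add, Finset.sum_mul]
    refine (norm_sum_le _ _).trans (Finset.sum_le_sum fun l _ => ?_)
    rw [norm_smul]
    refine mul_le_mul_of_nonneg_left ?_ (abs_nonneg _)
    have : dX l (dir (dirv β) u) = dir (dirv β) (dX l u) := dir_comm hu _ _
    rw [this]
    exact Finset.single_le_sum (f := fun l : Fin 3 => ‖dir (dirv β) (dX l u) p‖)
      (fun _ _ => norm_nonneg _) (Finset.mem_univ l)
  refine (norm_dir_le (dir w u) v p).trans ?_
  rw [mul_assoc, Finset.mul_sum (a := dirNorm w)]
  exact mul_le_mul_of_nonneg_left (Finset.sum_le_sum fun β _ => hdd β) (dirNorm_nonneg v)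

/-- Two derivatives, one of them spatial, can be moved to the left of a word. -/
theorem exists_genWord_dir_dir_le (a : List (Fin 8)) (v w : ℝ × E3) (hw : w.1 = 0) :
    ∃ C : ℝ, 0 ≤ C ∧ ∀ u, IsTest u → ∀ p,
      ‖genWord a (dir v (dir w u)) p‖ ≤ C * size₂ (a.length + 1) u p := by
  induction a using List.reverseRecOn generalizing v w with
  | nil =>
    refine ⟨dirNorm v * dirNorm w, mul_nonneg (dirNorm_nonneg v) (dirNorm_nonneg w),
      fun u hu p => (norm_dir_dir_le hu v hw p).trans ?_⟩
    refine mul_le_mul_of_nonneg_left ?_ (mul_nonneg (dirNorm_nonneg v) (dirNorm_nonneg w))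
    exact sum_norm_le_size₂ (a := []) (by simp) u p
  | append_singleton a i ih =>
    obtain ⟨C₁, hC₁, h₁⟩ := ih v w hw
    obtain ⟨C₂, hC₂, h₂⟩ := ih (genA i v) w hw
    obtain ⟨C₃, hC₃, h₃⟩ := ih v (genA i w) (genA_fst i hw)
    refine ⟨C₁ + C₂ + C₃, by positivity, fun u hu p => ?_⟩
    have e : genWord (a ++ [i]) (dir v (dir w u)) p
        = genWord a (dir v (dir w (gen i u))) p - genWord a (dir (genA i v) (dir w u)) p
          - genWord a (dir v (dir (genA i w) u)) p := by
      rw [genWord_append, dir_dir_gen hu,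
        genWord_add a ((((hu.dir w).dir v).gen i).add ((hu.dir w).dir _)) ((hu.dir _).dir v),
        genWord_add a (((hu.dir w).dir v).gen i) ((hu.dir w).dir _)]
      simp only [genWord, Pi.add_apply]
      abel
    rw [e, add_mul, add_mul, List.length_append]
    refine (norm_sub_le _ _).trans (add_le_add ((norm_sub_le _ _).trans
      (add_le_add ((h₁ _ (hu.gen i) p).trans ?_) ((h₂ u hu p).trans ?_))) ((h₃ u hu p).trans ?_))
    · exact mul_le_mul_of_nonneg_left (size₂_genWord_le [i] le_rfl u p) hC₁
    · exact mul_le_mul_of_nonneg_left (size₂_mono (by omega) u p) hC₂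
    · exact mul_le_mul_of_nonneg_left (size₂_mono (by omega) u p) hC₃

/-- The pairs of words of total length at most `n`. -/
def wordPairs (n : ℕ) : Finset (List (Fin 8) × List (Fin 8)) :=
  (words (n + 1) ×ˢ words (n + 1)).filter fun q => q.1.length + q.2.length ≤ n

theorem mem_wordPairs {n : ℕ} {q : List (Fin 8) × List (Fin 8)} :
    q ∈ wordPairs n ↔ q.1.length + q.2.length ≤ n := by
  simp only [wordPairs, Finset.mem_filter, Finset.mem_product, mem_words]
  omega

theorem sum_wordPairs_append_le (F : List (Fin 8) → List (Fin 8) → ℝ) (hF : ∀ a b, 0 ≤ F a b)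
    (x y : List (Fin 8)) {m n : ℕ} (h : m + x.length + y.length ≤ n) :
    ∑ q ∈ wordPairs m, F (q.1 ++ x) (q.2 ++ y) ≤ ∑ q ∈ wordPairs n, F q.1 q.2 := by
  classical
  have hinj : Set.InjOn (fun q : List (Fin 8) × List (Fin 8) => (q.1 ++ x, q.2 ++ y))
      (wordPairs m) := by
    rintro ⟨a, b⟩ _ ⟨a', b'⟩ _ hab
    simpa using hab
  rw [← Finset.sum_image (f := fun q : List (Fin 8) × List (Fin 8) => F q.1 q.2) hinj]
  refine Finset.sum_le_sum_of_subset_of_nonneg ?_ fun a _ _ => hF _ _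
  intro a ha
  obtain ⟨q, hq, rfl⟩ := Finset.mem_image.1 ha
  have := mem_wordPairs.1 hq
  exact mem_wordPairs.2 (by simp only [List.length_append]; omega)

theorem mul_le_sum_wordPairs {n : ℕ} {x y : List (Fin 8)} (h : x.length + y.length ≤ n)
    (F : List (Fin 8) → List (Fin 8) → ℝ) (hF : ∀ a b, 0 ≤ F a b) :
    F x y ≤ ∑ q ∈ wordPairs n, F q.1 q.2 :=
  Finset.single_le_sum (f := fun q : List (Fin 8) × List (Fin 8) => F q.1 q.2)
    (fun _ _ => hF _ _) (mem_wordPairs.2 h : (x, y) ∈ wordPairs n)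

/-- The Leibniz rule for words of generators, up to constants. -/
theorem exists_genWord_bil_le (a : List (Fin 8)) (Q : E3 →L[ℝ] E3 →L[ℝ] E3) :
    ∃ C : ℝ, 0 ≤ C ∧ ∀ u v, IsTest u → IsTest v → ∀ p,
      ‖genWord a (fun q => Q (u q) (v q)) p‖
        ≤ C * ∑ q ∈ wordPairs a.length, ‖genWord q.1 u p‖ * ‖genWord q.2 v p‖ := by
  induction a using List.reverseRecOn generalizing Q with
  | nil =>
    refine ⟨‖Q‖, norm_nonneg Q, fun u v _ _ p => (Q.le_opNorm₂ _ _).trans ?_⟩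
    rw [mul_assoc]
    refine mul_le_mul_of_nonneg_left ?_ (norm_nonneg Q)
    exact mul_le_sum_wordPairs (n := 0) (x := []) (y := []) le_rfl
      (fun b c => ‖genWord b u p‖ * ‖genWord c v p‖) (fun _ _ => by positivity)
  | append_singleton a i ih =>
    obtain ⟨C, hC, h⟩ := ih Q
    obtain ⟨C', hC', h'⟩ := ih (genQ i Q)
    refine ⟨C + C + C', by positivity, fun u v hu hv p => ?_⟩
    have e : genWord (a ++ [i]) (fun q => Q (u q) (v q)) p
        = genWord a (fun q => Q (gen i u q) (v q)) p + genWord a (fun q => Q (u q) (gen i v q)) p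
          + genWord a (fun q => genQ i Q (u q) (v q)) p := by
      rw [genWord_append]
      simp only [genWord]
      rw [gen_bil hu hv, genWord_add a (((hu.gen i).bil hv Q).add (hu.bil (hv.gen i) Q))
          (hu.bil hv _), genWord_add a ((hu.gen i).bil hv Q) (hu.bil (hv.gen i) Q)]
      rfl
    have key : ∀ x y : List (Fin 8), a.length + x.length + y.length ≤ (a ++ [i]).length →
        ∑ q ∈ wordPairs a.length, ‖genWord q.1 (genWord x u) p‖ * ‖genWord q.2 (genWord y v) p‖
          ≤ ∑ q ∈ wordPairs (a ++ [i]).length, ‖genWord q.1 u p‖ * ‖genWord q.2 v p‖ := by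
      intro x y hxy
      have := sum_wordPairs_append_le (fun b c => ‖genWord b u p‖ * ‖genWord c v p‖)
        (fun _ _ => by positivity) x y hxy
      simpa only [genWord_append] using this
    rw [e, add_mul, add_mul]
    refine (norm_add_le _ _).trans (add_le_add ((norm_add_le _ _).trans
      (add_le_add ((h _ _ (hu.gen i) hv p).trans ?_) ((h _ _ hu (hv.gen i) p).trans ?_)))
      ((h' _ _ hu hv p).trans ?_))
    · exact mul_le_mul_of_nonneg_left (key [i] [] (by simp)) hC
    · exact mul_le_mul_of_nonneg_left (key [] [i] (by simp)) hC
    · exact mul_le_mul_of_nonneg_left (key [] [] (by simp)) hC'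

/-! ### The linear operator -/

/-- The symbol of the isotropic operator `c₂² Δ + (c₁² - c₂²) ∇ ⊗ ∇`. -/
def lameK (c : Fin 2 → ℝ) (a b : Fin 3) : E3 →L[ℝ] E3 :=
  (if a = b then c 1 ^ 2 else 0) • ContinuousLinearMap.id ℝ E3
    + (c 0 ^ 2 - c 1 ^ 2) •
      (EuclideanSpace.proj b : E3 →L[ℝ] ℝ).smulRight (EuclideanSpace.single a (1 : ℝ))

/-- The isotropic operator `c₂² Δ + (c₁² - c₂²) ∇ ⊗ ∇`. -/
def lame (c : Fin 2 → ℝ) (u : VField) : VField :=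
  ∑ a, ∑ b, fun p => lameK c a b (dX a (dX b u) p)

/-- The isotropic wave operator `∂_t² - c₂² Δ - (c₁² - c₂²) ∇ ⊗ ∇`. -/
def waveOp (c : Fin 2 → ℝ) (u : VField) : VField := dT (dT u) - lame c u

theorem IsTest.lame {u : VField} (hu : IsTest u) (c : Fin 2 → ℝ) : IsTest (lame c u) :=
  IsTest.sum fun a _ => IsTest.sum fun b _ => ((hu.dX b).dX a).clm _

theorem IsTest.waveOp {u : VField} (hu : IsTest u) (c : Fin 2 → ℝ) : IsTest (waveOp c u) :=
  hu.dT.dT.sub (hu.lame c)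

theorem gen_sum (i : Fin 8) {ι : Type*} {s : Finset ι} {u : ι → VField}
    (hu : ∀ i ∈ s, IsTest (u i)) : gen i (∑ j ∈ s, u j) = ∑ j ∈ s, gen i (u j) :=
  genWord_sum [i] hu

theorem lameK_apply (c : Fin 2 → ℝ) (a b i : Fin 3) (w : E3) :
    lameK c a b w i = (if a = b then c 1 ^ 2 else 0) * w i
      + (c 0 ^ 2 - c 1 ^ 2) * (w b * if i = a then 1 else 0) := by
  by_cases h : a = b <;> simp [lameK, h]

theorem genA_dirv (i : Fin 8) (a m : Fin 3) : (genA i (dirv a.succ)).2 m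
    = if i = 7 then (if m = a then 1 else 0) else
      ![0, 0, 0, 0,
        !![0, 0, 0; 0, 0, -1; 0, 1, 0] m a,
        !![0, 0, 1; 0, 0, 0; -1, 0, 0] m a,
        !![0, -1, 0; 1, 0, 0; 0, 0, 0] m a, 0] i := by
  change (genA i (0, EuclideanSpace.single a 1)).2 m = _
  fin_cases i <;> fin_cases a <;> fin_cases m <;> simp [genA, rotA]

theorem genM_apply (i : Fin 8) (w : E3) (m : Fin 3) : genM i w m
    = if i = 7 then -w m else
      ![0, 0, 0, 0, ![0, w 2, -w 1] m, ![-w 2, 0, w 0] m, ![w 1, -w 0, 0] m, 0] i := by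
  fin_cases i <;> fin_cases m <;>
    simp [genM, rotMatrix, Matrix.toLpLin_apply, dotProduct, Fin.sum_univ_three]

set_option maxHeartbeats 1000000 in
/-- The symbol of the isotropic operator is invariant under simultaneous rotations and homogeneous
of degree two under scaling. -/
theorem lame_commutator (c : Fin 2 → ℝ) (i : Fin 8) (H : Fin 3 → Fin 3 → E3)
    (hH : ∀ a b, H a b = H b a) :
    ∑ a, ∑ b, lameK c a b (∑ m, (genA i (dirv a.succ)).2 m • H m b
        + ∑ m, (genA i (dirv b.succ)).2 m • H a m)
      = ∑ a, ∑ b, (genM i (lameK c a b (H a b)) - lameK c a b (genM i (H a b)))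
        + (if i = 7 then (2 : ℝ) else 0) • ∑ a, ∑ b, lameK c a b (H a b) := by
  have h10 := hH 1 0
  have h20 := hH 2 0
  have h21 := hH 2 1
  ext j
  simp only [PiLp.add_apply, PiLp.sub_apply, PiLp.smul_apply, lameK_apply, genA_dirv, genM_apply,
    Fin.sum_univ_three, smul_eq_mul, h10, h20, h21]
  fin_cases i <;> fin_cases j <;>
    simp <;> ring

/-- The wave operator commutes with translations and rotations; with the scaling field it
commutes up to twice itself, being homogeneous of degree two. -/
theorem waveOp_gen {u : VField} (hu : IsTest u) (c : Fin 2 → ℝ) (i : Fin 8) :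
    waveOp c (gen i u) = gen i (waveOp c u) + (if i = 7 then (2 : ℝ) else 0) • waveOp c u := by
  funext p
  have hK : ∀ a b, IsTest (fun p => lameK c a b (dX a (dX b u) p)) := fun a b =>
    ((hu.dX b).dX a).clm _
  have h1 : waveOp c (gen i u) p = gen i (dT (dT u)) p
      + (dir (genA i (dirv 0)) (dT u) p + dT (dir (genA i (dirv 0)) u) p)
      - ∑ a, ∑ b, lameK c a b (gen i (dX a (dX b u)) p + (dir (genA i (dirv a.succ)) (dX b u) p
        + dX a (dir (genA i (dirv b.succ)) u) p)) := by
    simp only [waveOp, lame, Pi.sub_apply, Finset.sum_apply, dT_eq, dX_eq, dir_dir_gen hu,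
      Pi.add_apply, add_assoc]
  have h2 : gen i (waveOp c u) p = gen i (dT (dT u)) p
      - ∑ a, ∑ b, (lameK c a b (gen i (dX a (dX b u)) p)
        + (genM i (lameK c a b (dX a (dX b u) p)) - lameK c a b (genM i (dX a (dX b u) p)))) := by
    simp only [waveOp, lame]
    rw [gen_sub i hu.dT.dT (IsTest.sum fun a _ => IsTest.sum fun b _ => hK a b),
      gen_sum i fun a _ => IsTest.sum fun b _ => hK a b]
    simp only [Pi.sub_apply, Finset.sum_apply]
    congr 1
    refine Finset.sum_congr rfl fun a _ => ?_
    rw [gen_sum i fun b _ => hK a b, Finset.sum_apply]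
    refine Finset.sum_congr rfl fun b _ => ?_
    rw [gen_clm ((hu.dX b).dX a)]
  have h3 : waveOp c u p = dT (dT u) p - ∑ a, ∑ b, lameK c a b (dX a (dX b u) p) := by
    simp only [waveOp, lame, Pi.sub_apply, Finset.sum_apply]
  have hz : ∀ f : VField, dir 0 f = 0 := fun f => by funext q; simp [dir]
  have hz' : ∀ v, dir v 0 = 0 := fun v => by funext q; simp [dir]
  have hA : ∀ (b : Fin 3) (f : VField), dir (genA i (dirv b.succ)) f p
      = ∑ m, (genA i (dirv b.succ)).2 m • dX m f p := fun b f => by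
    rw [dir_eq_sum, genA_fst i (by rfl), zero_smul, zero_add]
  have hA' : ∀ (a b : Fin 3), dX a (dir (genA i (dirv b.succ)) u) p
      = ∑ m, (genA i (dirv b.succ)).2 m • dX a (dX m u) p := fun a b => by
    have : dX a (dir (genA i (dirv b.succ)) u) = dir (genA i (dirv b.succ)) (dX a u) :=
      dir_comm hu _ _
    rw [this, hA]
    exact Finset.sum_congr rfl fun m _ => congrArg _ (congrFun (dir_comm hu _ _) p)
  have h0 : genA i (dirv 0) = if i = 7 then dirv 0 else 0 := by
    change genA i (1, 0) = if i = 7 then (1, 0) else 0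
    refine Prod.ext ?_ ?_ <;> fin_cases i <;> simp [genA, rotA]
  have h0' : dir (genA i (dirv 0)) (dT u) p + dT (dir (genA i (dirv 0)) u) p
      = (if i = 7 then (2 : ℝ) else 0) • dT (dT u) p := by
    rw [h0]
    split_ifs
    · rw [two_smul]; rfl
    · have hz : dir 0 u = 0 := by funext q; simp [dir]
      rw [hz]
      simp [dir, dT]
  have key := lame_commutator c i (fun a b => dX a (dX b u) p)
    (fun a b => congrFun (dir_comm hu _ _) p)
  simp only [Pi.add_apply, Pi.smul_apply]
  simp only [h1, h2, h3, hA, hA', h0', map_add, Finset.sum_add_distrib,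
    smul_sub] at key ⊢
  rw [← sub_eq_zero] at key ⊢
  rw [← neg_eq_zero, ← key]
  abel

/-- The wave operator applied to `Γ^a u` costs only words of length at most `|a|` on
`waveOp c u`. -/
theorem exists_waveOp_genWord_le (c : Fin 2 → ℝ) (a : List (Fin 8)) :
    ∃ C : ℝ, 0 ≤ C ∧ ∀ u, IsTest u → ∀ p,
      ‖waveOp c (genWord a u) p‖
        ≤ C * ∑ b ∈ words (a.length + 1), ‖genWord b (waveOp c u) p‖ := by
  suffices h : ∀ b : List (Fin 8), ∃ C : ℝ, 0 ≤ C ∧ ∀ u, IsTest u → ∀ p,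
      ‖genWord b (waveOp c (genWord a u)) p‖
        ≤ C * ∑ b ∈ words (b.length + a.length + 1), ‖genWord b (waveOp c u) p‖ by
    simpa [genWord] using h []
  induction a with
  | nil =>
    refine fun b => ⟨1, zero_le_one, fun u hu p => ?_⟩
    rw [one_mul]
    exact Finset.single_le_sum (f := fun b => ‖genWord b (waveOp c u) p‖)
      (fun _ _ => norm_nonneg _) (mem_words.2 (by simp))
  | cons i a ih =>
    intro b
    obtain ⟨C, hC, h⟩ := ih (b ++ [i])
    obtain ⟨C', hC', h'⟩ := ih b
    refine ⟨C + 2 * C', by positivity, fun u hu p => ?_⟩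
    have e : genWord b (waveOp c (genWord (i :: a) u)) p
        = genWord (b ++ [i]) (waveOp c (genWord a u)) p
          + (if i = 7 then (2 : ℝ) else 0) • genWord b (waveOp c (genWord a u)) p := by
      have ht := hu.genWord a
      simp only [genWord]
      rw [waveOp_gen ht, genWord_add b ((ht.waveOp c).gen i) ((ht.waveOp c).const_smul _),
        genWord_smul b (ht.waveOp c), genWord_append]
      rfl
    have hk : ‖(if i = 7 then (2 : ℝ) else 0)‖ ≤ 2 := by split_ifs <;> simp
    have hm : ∀ m n : ℕ, m ≤ n → ∑ b ∈ words m, ‖genWord b (waveOp c u) p‖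
        ≤ ∑ b ∈ words n, ‖genWord b (waveOp c u) p‖ := fun m n hmn =>
      Finset.sum_le_sum_of_subset_of_nonneg (words_mono hmn) fun _ _ _ => norm_nonneg _
    rw [e, add_mul]
    refine (norm_add_le _ _).trans (add_le_add ((h u hu p).trans ?_) ?_)
    · refine mul_le_mul_of_nonneg_left (hm _ _ ?_) hC
      simp only [List.length_append, List.length_cons, List.length_nil]; omega
    · rw [norm_smul, mul_assoc]
      refine mul_le_mul hk ((h' u hu p).trans ?_) (norm_nonneg _) zero_le_two
      refine mul_le_mul_of_nonneg_left (hm _ _ ?_) hC'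
      simp only [List.length_cons]; omega

/-! ### Pointwise bounds by integrals along curves -/

/-- The pointwise sum of squares of `Γ^a u` over all words `a` of length less than `k`. -/
def sqSize (k : ℕ) (u : VField) (p : ℝ × E3) : ℝ := ∑ a ∈ words k, ‖genWord a u p‖ ^ 2

theorem sqSize_continuous (k : ℕ) {u : VField} (hu : IsTest u) : Continuous (sqSize k u) :=
  continuous_finsetSum _ fun a _ => ((hu.genWord a).continuous.norm.pow 2)

theorem sqSize_genWord_le (b : List (Fin 8)) {m n : ℕ} (h : m + b.length ≤ n) (u : VField)
    (p : ℝ × E3) : sqSize m (genWord b u) p ≤ sqSize n u p := by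
  have := sum_words_append_le (fun a => ‖genWord a u p‖ ^ 2) (fun a => sq_nonneg _) b h
  simpa only [sqSize, genWord_append] using this

theorem norm_le_sum_words {k : ℕ} (hk : 0 < k) (u : VField) (p : ℝ × E3) :
    ‖u p‖ ≤ ∑ a ∈ words k, ‖genWord a u p‖ := by
  have h := Finset.single_le_sum (f := fun a => ‖genWord a u p‖)
    (fun _ _ => norm_nonneg _) (mem_words.2 (by simpa using hk) : ([] : List (Fin 8)) ∈ words k)
  simpa only [genWord_nil] using h

theorem sq_norm_le_sqSize {k : ℕ} (hk : 0 < k) (u : VField) (p : ℝ × E3) :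
    ‖u p‖ ^ 2 ≤ sqSize k u p := by
  have h := Finset.single_le_sum (f := fun a => ‖genWord a u p‖ ^ 2)
    (fun _ _ => sq_nonneg _) (mem_words.2 (by simpa using hk) : ([] : List (Fin 8)) ∈ words k)
  rw [sqSize]
  simpa only [genWord_nil] using h

/-- The one-dimensional Sobolev inequality on the unit interval, at its left end point. -/
theorem sq_norm_le_lintegral {h h' : ℝ → E3} (hd : ∀ s, HasDerivAt h (h' s) s)
    (hc : Continuous h') :
    ENNReal.ofReal (‖h 0‖ ^ 2)
      ≤ ∫⁻ s in Icc (0 : ℝ) 1, ENNReal.ofReal (2 * (‖h s‖ ^ 2 + ‖h' s‖ ^ 2)) := by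
  have hcont : Continuous h := continuous_iff_continuousAt.2 fun s => (hd s).continuousAt
  have hI : ∀ g : ℝ → ℝ, Continuous g → IntervalIntegrable g volume 0 1 := fun g hg =>
    hg.intervalIntegrable 0 1
  set m := ∫ s in (0 : ℝ)..1, ‖h' s‖ with hm
  have hm0 : 0 ≤ m := intervalIntegral.integral_nonneg zero_le_one fun _ _ => norm_nonneg _
  have hm2 : m ^ 2 ≤ ∫ s in (0 : ℝ)..1, ‖h' s‖ ^ 2 := by
    have h0 : 0 ≤ ∫ s in (0 : ℝ)..1, (‖h' s‖ - m) ^ 2 :=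
      intervalIntegral.integral_nonneg zero_le_one fun _ _ => sq_nonneg _
    have e : ∫ s in (0 : ℝ)..1, (‖h' s‖ - m) ^ 2
        = (∫ s in (0 : ℝ)..1, ‖h' s‖ ^ 2) - 2 * m * m + m ^ 2 := by
      have : ∀ s, (‖h' s‖ - m) ^ 2 = ‖h' s‖ ^ 2 - 2 * m * ‖h' s‖ + m ^ 2 := fun s => by ring
      simp_rw [this]
      rw [intervalIntegral.integral_add (hI _ (by fun_prop)) (hI _ (by fun_prop)),
        intervalIntegral.integral_sub (hI _ (by fun_prop)) (hI _ (by fun_prop)),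
        intervalIntegral.integral_const_mul]
      simp [hm]
    nlinarith
  have hpt : ∀ s ∈ Icc (0 : ℝ) 1, ‖h 0‖ ^ 2 ≤ 2 * (‖h s‖ ^ 2 + m ^ 2) := by
    intro s hs
    have h1 : h s - h 0 = ∫ r in (0 : ℝ)..s, h' r :=
      (intervalIntegral.integral_eq_sub_of_hasDerivAt (fun r _ => hd r)
        (hc.intervalIntegrable 0 s)).symm
    have h2 : ‖h s - h 0‖ ≤ m := by
      rw [h1]
      refine (intervalIntegral.norm_integral_le_integral_norm hs.1).trans ?_
      exact intervalIntegral.integral_mono_interval le_rfl hs.1 hs.2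
        (Eventually.of_forall fun _ => norm_nonneg _) (hI _ (by fun_prop))
    have h3 : ‖h 0‖ ≤ ‖h s‖ + m := by
      have := norm_sub_norm_le (h 0) (h s)
      rw [norm_sub_rev] at this
      linarith
    have := pow_le_pow_left₀ (norm_nonneg _) h3 2
    nlinarith [sq_nonneg (‖h s‖ - m)]
  have hint : ‖h 0‖ ^ 2 ≤ ∫ s in (0 : ℝ)..1, 2 * (‖h s‖ ^ 2 + ‖h' s‖ ^ 2) := by
    have h1 : ∫ s in (0 : ℝ)..1, ‖h 0‖ ^ 2 ≤ ∫ s in (0 : ℝ)..1, 2 * (‖h s‖ ^ 2 + m ^ 2) :=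
      intervalIntegral.integral_mono_on zero_le_one (hI _ (by fun_prop)) (hI _ (by fun_prop)) hpt
    rw [intervalIntegral.integral_const_mul, intervalIntegral.integral_add
      (hI _ (by fun_prop)) (hI _ (by fun_prop))] at h1 ⊢
    simp only [intervalIntegral.integral_const, sub_zero, one_smul] at h1
    linarith
  refine (ENNReal.ofReal_le_ofReal hint).trans (le_of_eq ?_)
  rw [intervalIntegral.integral_of_le zero_le_one, ← integral_Icc_eq_integral_Ioc,
    ofReal_integral_eq_lintegral_ofReal]
  · exact (Continuous.continuousOn (by fun_prop)).integrableOn_Icc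
  · exact Eventually.of_forall fun _ => by positivity

/-- The constant in the one-dimensional Sobolev inequality `sqSize_le_lintegral`. -/
def curveConst (k : ℕ) : ℝ :=
  2 * (1 + 16 * (words 2).card) * (words k).card

theorem curveConst_nonneg (k : ℕ) : 0 ≤ curveConst k := by unfold curveConst; positivity

/-- The one-dimensional Sobolev inequality along a curve on which the generators control the
derivative. -/
theorem sqSize_le_lintegral {k m : ℕ} (hm : m = k + 1) {u : VField} (hu : IsTest u) (t : ℝ) {γ γ' : ℝ → E3}
    (hγ : ∀ s, HasDerivAt γ (γ' s) s) (hc : Continuous γ')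
    (hb : ∀ v, IsTest v → ∀ s ∈ Icc (0 : ℝ) 1,
      ‖fderiv ℝ v (t, γ s) (0, γ' s)‖ ≤ 4 * ∑ a ∈ words 2, ‖genWord a v (t, γ s)‖) :
    ENNReal.ofReal (sqSize k u (t, γ 0))
      ≤ ∫⁻ s in Icc (0 : ℝ) 1,
          ENNReal.ofReal (curveConst k * sqSize m u (t, γ s)) := by
  subst hm
  have hγc : Continuous γ := continuous_iff_continuousAt.2 fun s => (hγ s).continuousAt
  have hone : ∀ v, IsTest v → ENNReal.ofReal (‖v (t, γ 0)‖ ^ 2)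
      ≤ ∫⁻ s in Icc (0 : ℝ) 1,
          ENNReal.ofReal (2 * (1 + 16 * (words 2).card) * sqSize 2 v (t, γ s)) := by
    intro v hv
    have hd : ∀ s, HasDerivAt (fun s => v (t, γ s)) (fderiv ℝ v (t, γ s) (0, γ' s)) s := fun s =>
      (hv.differentiable (t, γ s)).hasFDerivAt.comp_hasDerivAt s
        ((hasDerivAt_const s t).prodMk (hγ s))
    have hcd : Continuous fun s => fderiv ℝ v (t, γ s) (0, γ' s) :=
      (hv.fderiv_contDiff.continuous.comp (continuous_const.prodMk hγc)).clm_apply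
        (continuous_const.prodMk hc)
    refine (sq_norm_le_lintegral hd hcd).trans (setLIntegral_mono' measurableSet_Icc fun s hs => ?_)
    refine ENNReal.ofReal_le_ofReal ?_
    have h1 := sq_norm_le_sqSize zero_lt_two v (t, γ s)
    have h2 : (∑ a ∈ words 2, ‖genWord a v (t, γ s)‖) ^ 2
        ≤ (words 2).card * sqSize 2 v (t, γ s) := sq_sum_le_card_mul_sum_sq
    have h3 := pow_le_pow_left₀ (norm_nonneg _) (hb v hv s hs) 2
    nlinarith
  have hm : ∀ a ∈ words k, ENNReal.ofReal (‖genWord a u (t, γ 0)‖ ^ 2) ≤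
      ∫⁻ s in Icc (0 : ℝ) 1,
        ENNReal.ofReal (2 * (1 + 16 * (words 2).card) * sqSize (k + 1) u (t, γ s)) := by
    intro a ha
    refine (hone _ (hu.genWord a)).trans (lintegral_mono fun s => ENNReal.ofReal_le_ofReal ?_)
    refine mul_le_mul_of_nonneg_left (sqSize_genWord_le a ?_ u _) (by positivity)
    have := mem_words.1 ha
    omega
  rw [sqSize, ENNReal.ofReal_sum_of_nonneg fun _ _ => sq_nonneg _]
  refine (Finset.sum_le_sum hm).trans ?_
  rw [Finset.sum_const, nsmul_eq_mul, ← lintegral_const_mul']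
  · refine le_of_eq (lintegral_congr fun s => ?_)
    rw [← ENNReal.ofReal_natCast, ← ENNReal.ofReal_mul (by positivity), curveConst]
    congr 1
    ring
  · simp

theorem sum_three_le_sum_words {F : List (Fin 8) → ℝ} (hF : ∀ a, 0 ≤ F a) (f : Fin 3 → Fin 8)
    (hf : Function.Injective f) : ∑ l, F [f l] ≤ ∑ a ∈ words 2, F a := by
  classical
  have hinj : Set.InjOn (fun l : Fin 3 => [f l]) (Finset.univ : Finset (Fin 3)) :=
    fun x _ y _ hxy => hf (by simpa using hxy)
  rw [← Finset.sum_image (f := F) hinj]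
  refine Finset.sum_le_sum_of_subset_of_nonneg (fun a ha => ?_) fun a _ _ => hF a
  obtain ⟨l, -, rfl⟩ := Finset.mem_image.1 ha
  exact mem_words.2 (by simp)

/-- Along a straight line the spatial derivatives control the derivative. -/
theorem norm_fderiv_le_of_norm_le (v : VField) (p : ℝ × E3) {w : E3} (hw : ‖w‖ ≤ 1) :
    ‖fderiv ℝ v p (0, w)‖ ≤ ∑ a ∈ words 2, ‖genWord a v p‖ := by
  have h1 : fderiv ℝ v p (0, w) = ∑ l, w l • dX l v p := by
    have := dir_eq_sum v (0, w) p
    simpa [dir] using this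
  rw [h1]
  have h2 := sum_three_le_sum_words (F := fun a => ‖genWord a v p‖) (fun _ => norm_nonneg _) xIdx
    (by intro a b h; revert a b; decide)
  simp only [genWord, gen_xIdx] at h2
  refine (norm_sum_le _ _).trans (le_trans (Finset.sum_le_sum fun l _ => ?_) h2)
  rw [norm_smul]
  have : ‖w l‖ ≤ 1 := (PiLp.norm_apply_le w l).trans hw
  exact mul_le_of_le_one_left (norm_nonneg _) this

theorem norm_toLp_rotMatrix_le (l : Fin 3) (w : E3) :
    ‖(WithLp.toLp 2 ((rotMatrix l).mulVec w.ofLp) : E3)‖ ≤ ‖w‖ := by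
  rw [EuclideanSpace.norm_eq, EuclideanSpace.norm_eq]
  refine Real.sqrt_le_sqrt ?_
  fin_cases l <;>
    simp [rotMatrix, Fin.sum_univ_three, Matrix.mulVec, dotProduct] <;> nlinarith [sq_nonneg (w 0),
      sq_nonneg (w 1), sq_nonneg (w 2)]

theorem norm_angular_le (l : Fin 3) (v : VField) (p : ℝ × E3) :
    ‖angular l v p‖ ≤ ‖rot l v p‖ + ‖v p‖ := by
  have h : angular l v p = rot l v p - WithLp.toLp 2 ((rotMatrix l).mulVec (v p).ofLp) := by
    simp [rot]
  rw [h]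
  exact (norm_sub_le _ _).trans (add_le_add le_rfl (norm_toLp_rotMatrix_le l _))

/-- A derivative that is tangential to a sphere around the origin is controlled by the angular
momentum operators. -/
theorem norm_fderiv_le_angular (v : VField) (t : ℝ) {x w : E3} (hx : x ≠ 0)
    (hxw : inner ℝ x w = 0) (hw : ‖w‖ ≤ ‖x‖) :
    ‖fderiv ℝ v (t, x) (0, w)‖ ≤ ∑ l, ‖angular l v (t, x)‖ := by
  have h1 : fderiv ℝ v (t, x) (0, w) = ∑ l, w l • dX l v (t, x) := by
    have := dir_eq_sum v (0, w) (t, x)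
    simpa [dir] using this
  have hx0 : 0 < ‖x‖ := norm_pos_iff.2 hx
  have hxs : ‖x‖ ^ 2 = x 0 ^ 2 + x 1 ^ 2 + x 2 ^ 2 := by
    rw [EuclideanSpace.norm_sq_eq]; simp [Fin.sum_univ_three]
  have hws : ‖w‖ ^ 2 = w 0 ^ 2 + w 1 ^ 2 + w 2 ^ 2 := by
    rw [EuclideanSpace.norm_sq_eq]; simp [Fin.sum_univ_three]
  have hip : x 0 * w 0 + x 1 * w 1 + x 2 * w 2 = 0 := by
    rw [← hxw, PiLp.inner_apply]
    simp [Fin.sum_univ_three]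
    ring
  -- Lagrange's identity `⟨x ∧ w, x ∧ g⟩ = |x|² ⟨w, g⟩ - ⟨x, w⟩ ⟨x, g⟩`, with `g = ∇ v`.
  have h2 : ‖x‖ ^ 2 • fderiv ℝ v (t, x) (0, w)
      = ∑ l, (x (l + 1) * w (l + 2) - x (l + 2) * w (l + 1)) • angular l v (t, x) := by
    rw [h1, hxs]
    have e : ∀ l : Fin 3, angular l v (t, x)
        = x (l + 1) • dX (l + 2) v (t, x) - x (l + 2) • dX (l + 1) v (t, x) := fun l => rfl
    ext i
    simp only [Fin.sum_univ_three, e, PiLp.smul_apply, PiLp.add_apply, PiLp.sub_apply, smul_eq_mul]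
    simp only [Fin.isValue, zero_add, show (1 : Fin 3) + 1 = 2 from rfl,
      show (1 : Fin 3) + 2 = 0 from rfl, show (2 : Fin 3) + 1 = 0 from rfl,
      show (2 : Fin 3) + 2 = 1 from rfl]
    linear_combination (x 0 * dX 0 v (t, x) i + x 1 * dX 1 v (t, x) i + x 2 * dX 2 v (t, x) i) * hip
  have h3 : ∀ l : Fin 3, |x (l + 1) * w (l + 2) - x (l + 2) * w (l + 1)| ≤ ‖x‖ ^ 2 := by
    intro l
    have hxw2 : ‖w‖ ^ 2 ≤ ‖x‖ ^ 2 := pow_le_pow_left₀ (norm_nonneg _) hw 2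
    refine abs_le_of_sq_le_sq ?_ (sq_nonneg _)
    have : (x (l + 1) * w (l + 2) - x (l + 2) * w (l + 1)) ^ 2 ≤ ‖x‖ ^ 2 * ‖w‖ ^ 2 := by
      rw [hxs, hws]
      fin_cases l
      · change (x 1 * w 2 - x 2 * w 1) ^ 2 ≤ _
        nlinarith [sq_nonneg (x 1 * w 1 + x 2 * w 2), sq_nonneg (x 0 * w 0),
          sq_nonneg (x 0 * w 1), sq_nonneg (x 0 * w 2), sq_nonneg (x 1 * w 0),
          sq_nonneg (x 2 * w 0)]
      · change (x 2 * w 0 - x 0 * w 2) ^ 2 ≤ _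
        nlinarith [sq_nonneg (x 2 * w 2 + x 0 * w 0), sq_nonneg (x 1 * w 1),
          sq_nonneg (x 1 * w 2), sq_nonneg (x 1 * w 0), sq_nonneg (x 2 * w 1),
          sq_nonneg (x 0 * w 1)]
      · change (x 0 * w 1 - x 1 * w 0) ^ 2 ≤ _
        nlinarith [sq_nonneg (x 0 * w 0 + x 1 * w 1), sq_nonneg (x 2 * w 2),
          sq_nonneg (x 2 * w 0), sq_nonneg (x 2 * w 1), sq_nonneg (x 0 * w 2),
          sq_nonneg (x 1 * w 2)]
    calc _ ≤ ‖x‖ ^ 2 * ‖w‖ ^ 2 := this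
      _ ≤ ‖x‖ ^ 2 * ‖x‖ ^ 2 := by gcongr
      _ = _ := by ring
  have h4 : ‖x‖ ^ 2 * ‖fderiv ℝ v (t, x) (0, w)‖ ≤ ‖x‖ ^ 2 * ∑ l, ‖angular l v (t, x)‖ := by
    have := congrArg norm h2
    rw [norm_smul, norm_pow, norm_norm] at this
    rw [this, Finset.mul_sum]
    refine (norm_sum_le _ _).trans (Finset.sum_le_sum fun l _ => ?_)
    rw [norm_smul]
    exact mul_le_mul_of_nonneg_right (h3 l) (norm_nonneg _)
  exact le_of_mul_le_mul_left h4 (by positivity)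

theorem norm_fderiv_le_words (v : VField) (t : ℝ) {x w : E3} (hx : x ≠ 0)
    (hxw : inner ℝ x w = 0) (hw : ‖w‖ ≤ ‖x‖) :
    ‖fderiv ℝ v (t, x) (0, w)‖ ≤ 4 * ∑ a ∈ words 2, ‖genWord a v (t, x)‖ := by
  refine (norm_fderiv_le_angular v t hx hxw hw).trans ?_
  have h2 := sum_three_le_sum_words (F := fun a => ‖genWord a v (t, x)‖) (fun _ => norm_nonneg _)
    ![4, 5, 6] (by intro a b h; revert a b; decide)
  have hr : ∑ l, ‖rot l v (t, x)‖ ≤ ∑ a ∈ words 2, ‖genWord a v (t, x)‖ := by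
    simpa [Fin.sum_univ_three, genWord, gen] using h2
  have h1 := norm_le_sum_words zero_lt_two v (t, x)
  have h3 : ∑ l, ‖angular l v (t, x)‖ ≤ ∑ l : Fin 3, (‖rot l v (t, x)‖ + ‖v (t, x)‖) :=
    Finset.sum_le_sum fun l _ => norm_angular_le l v _
  rw [Finset.sum_add_distrib, Finset.sum_const, Finset.card_univ, Fintype.card_fin,
    nsmul_eq_mul] at h3
  push_cast at h3
  linarith

/-! ### Sobolev inequalities -/

theorem lintegral_pi_three (G : (Fin 3 → ℝ) → ℝ≥0∞) (hG : Measurable G) :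
    ∫⁻ y, G y = ∫⁻ a, ∫⁻ b, ∫⁻ c, G ![a, b, c] := by
  have h1 := (volume_preserving_piFinSuccAbove (fun _ : Fin 3 => ℝ) 0).symm
  have h2 := (volume_preserving_finTwoArrow ℝ).symm
  rw [← h1.lintegral_comp hG, Measure.volume_eq_prod, lintegral_prod _ (by
    exact (hG.comp h1.measurable).aemeasurable)]
  refine lintegral_congr fun a => ?_
  have hm : Measurable fun y : Fin 2 → ℝ =>
      G ((MeasurableEquiv.piFinSuccAbove (fun _ : Fin 3 => ℝ) 0).symm (a, y)) :=
    (hG.comp h1.measurable).comp measurable_prodMk_left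
  rw [← h2.lintegral_comp hm, Measure.volume_eq_prod, lintegral_prod _ (by
    exact (hm.comp h2.measurable).aemeasurable)]
  refine lintegral_congr fun b => lintegral_congr fun c => congrArg G ?_
  ext i
  fin_cases i <;> rfl

/-- The unit cube. -/
def unitCube : Set (Fin 3 → ℝ) := Set.pi univ fun _ => Icc 0 1

theorem mem_unitCube {y : Fin 3 → ℝ} : y ∈ unitCube ↔ ∀ i, y i ∈ Icc (0 : ℝ) 1 := by
  simp [unitCube, -pi_univ_Icc]

theorem measurableSet_unitCube : MeasurableSet unitCube :=
  MeasurableSet.univ_pi fun _ => measurableSet_Icc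

theorem lintegral_iterated (G : (Fin 3 → ℝ) → ℝ≥0∞) (hG : Measurable G) :
    ∫⁻ a in Icc (0 : ℝ) 1, ∫⁻ b in Icc (0 : ℝ) 1, ∫⁻ c in Icc (0 : ℝ) 1, G ![a, b, c]
      = ∫⁻ y in unitCube, G y := by
  rw [← lintegral_indicator measurableSet_unitCube,
    lintegral_pi_three _ (hG.indicator measurableSet_unitCube),
    ← lintegral_indicator measurableSet_Icc]
  refine lintegral_congr fun a => ?_
  by_cases ha : a ∈ Icc (0 : ℝ) 1
  · rw [indicator_of_mem ha, ← lintegral_indicator measurableSet_Icc]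
    refine lintegral_congr fun b => ?_
    by_cases hb : b ∈ Icc (0 : ℝ) 1
    · rw [indicator_of_mem hb, ← lintegral_indicator measurableSet_Icc]
      refine lintegral_congr fun c => ?_
      by_cases hc : c ∈ Icc (0 : ℝ) 1
      · rw [indicator_of_mem hc, indicator_of_mem]
        rw [mem_unitCube]
        intro i
        fin_cases i
        exacts [ha, hb, hc]
      · rw [indicator_of_notMem hc, indicator_of_notMem]
        exact fun h => hc (mem_unitCube.1 h 2)
    · rw [indicator_of_notMem hb]
      refine (lintegral_eq_zero_of_ae_eq_zero (Eventually.of_forall fun c => ?_)).symm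
      exact indicator_of_notMem (fun h => hb (mem_unitCube.1 h 1)) _
  · rw [indicator_of_notMem ha]
    refine (lintegral_eq_zero_of_ae_eq_zero (Eventually.of_forall fun b => ?_)).symm
    refine lintegral_eq_zero_of_ae_eq_zero (Eventually.of_forall fun c => ?_)
    exact indicator_of_notMem (fun h => ha (mem_unitCube.1 h 0)) _

/-- Three successive applications of the one-dimensional Sobolev inequality. -/
theorem sq_norm_le_lintegral_cube {u : VField} (hu : IsTest u) (t : ℝ)
    {Ψ Ψ₁ Ψ₂ Ψ₃ : ℝ → ℝ → ℝ → E3}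
    (h₁ : ∀ s, HasDerivAt (fun s => Ψ s 0 0) (Ψ₁ s 0 0) s) (c₁ : Continuous fun s => Ψ₁ s 0 0)
    (h₂ : ∀ a s, HasDerivAt (fun s => Ψ a s 0) (Ψ₂ a s 0) s)
    (c₂ : ∀ a, Continuous fun s => Ψ₂ a s 0)
    (h₃ : ∀ a b s, HasDerivAt (fun s => Ψ a b s) (Ψ₃ a b s) s)
    (c₃ : ∀ a b, Continuous fun s => Ψ₃ a b s)
    (b₁ : ∀ v, IsTest v → ∀ s ∈ Icc (0 : ℝ) 1, ‖fderiv ℝ v (t, Ψ s 0 0) (0, Ψ₁ s 0 0)‖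
      ≤ 4 * ∑ a ∈ words 2, ‖genWord a v (t, Ψ s 0 0)‖)
    (b₂ : ∀ v, IsTest v → ∀ a ∈ Icc (0 : ℝ) 1, ∀ s ∈ Icc (0 : ℝ) 1,
      ‖fderiv ℝ v (t, Ψ a s 0) (0, Ψ₂ a s 0)‖
        ≤ 4 * ∑ w ∈ words 2, ‖genWord w v (t, Ψ a s 0)‖)
    (b₃ : ∀ v, IsTest v → ∀ a ∈ Icc (0 : ℝ) 1, ∀ b ∈ Icc (0 : ℝ) 1, ∀ s ∈ Icc (0 : ℝ) 1,
      ‖fderiv ℝ v (t, Ψ a b s) (0, Ψ₃ a b s)‖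
        ≤ 4 * ∑ w ∈ words 2, ‖genWord w v (t, Ψ a b s)‖)
    (hΨ : Continuous fun y : Fin 3 → ℝ => Ψ (y 0) (y 1) (y 2)) :
    ENNReal.ofReal (‖u (t, Ψ 0 0 0)‖ ^ 2) ≤
      ∫⁻ y in unitCube, ENNReal.ofReal (curveConst 1 * (curveConst 2 * (curveConst 3 *
        sqSize 4 u (t, Ψ (y 0) (y 1) (y 2))))) := by
  have hmul : ∀ (k : ℕ) (x : ℝ), ENNReal.ofReal (curveConst k * x)
      = ENNReal.ofReal (curveConst k) * ENNReal.ofReal x := fun k x =>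
    ENNReal.ofReal_mul (curveConst_nonneg k)
  calc ENNReal.ofReal (‖u (t, Ψ 0 0 0)‖ ^ 2) ≤ ENNReal.ofReal (sqSize 1 u (t, Ψ 0 0 0)) :=
        ENNReal.ofReal_le_ofReal (sq_norm_le_sqSize zero_lt_one u _)
    _ ≤ ∫⁻ a in Icc (0 : ℝ) 1, ENNReal.ofReal (curveConst 1 * sqSize 2 u (t, Ψ a 0 0)) :=
        sqSize_le_lintegral (m := 2) rfl hu t h₁ c₁ b₁
    _ ≤ ∫⁻ a in Icc (0 : ℝ) 1, ∫⁻ b in Icc (0 : ℝ) 1, ENNReal.ofReal (curveConst 1 *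
          (curveConst 2 * sqSize 3 u (t, Ψ a b 0))) := by
        refine setLIntegral_mono' measurableSet_Icc fun a ha => ?_
        simp_rw [hmul 1]
        rw [lintegral_const_mul' _ _ ENNReal.ofReal_ne_top]
        gcongr
        exact sqSize_le_lintegral (m := 3) rfl hu t (h₂ a) (c₂ a) fun v hv s hs => b₂ v hv a ha s hs
    _ ≤ ∫⁻ a in Icc (0 : ℝ) 1, ∫⁻ b in Icc (0 : ℝ) 1, ∫⁻ c in Icc (0 : ℝ) 1,
          ENNReal.ofReal (curveConst 1 *
            (curveConst 2 * (curveConst 3 * sqSize 4 u (t, Ψ a b c)))) := by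
        refine setLIntegral_mono' measurableSet_Icc fun a ha => ?_
        refine setLIntegral_mono' measurableSet_Icc fun b hb => ?_
        simp_rw [hmul 1, hmul 2]
        rw [lintegral_const_mul' _ _ ENNReal.ofReal_ne_top,
          lintegral_const_mul' _ _ ENNReal.ofReal_ne_top]
        gcongr
        exact sqSize_le_lintegral (m := 4) rfl hu t (h₃ a b) (c₃ a b)
          fun v hv s hs => b₃ v hv a ha b hb s hs
    _ = _ := by
        have hm : ∀ (f : ℝ × E3 → ℝ), Continuous f → Measurable fun y : Fin 3 → ℝ =>
            ENNReal.ofReal (curveConst 1 * (curveConst 2 * (curveConst 3 *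
              f (t, Ψ (y 0) (y 1) (y 2))))) := fun f hf => by
          have hc : Continuous fun y : Fin 3 → ℝ => f (t, Ψ (y 0) (y 1) (y 2)) :=
            hf.comp (continuous_const.prodMk hΨ)
          exact (((hc.const_mul _).const_mul _).const_mul _).measurable.ennreal_ofReal
        rw [← lintegral_iterated _ (hm _ (sqSize_continuous 4 hu))]
        simp only [Matrix.cons_val]

theorem lintegral_E3 (F : E3 → ℝ≥0∞) :
    ∫⁻ y : Fin 3 → ℝ, F (WithLp.toLp 2 y) = ∫⁻ x, F x :=
  (EuclideanSpace.volume_preserving_symm_measurableEquiv_toLp (Fin 3)).symm.lintegral_comp_emb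
    (MeasurableEquiv.measurableEmbedding _) F

/-- The constant of the Sobolev inequalities. -/
def sobConst : ℝ := curveConst 1 * (curveConst 2 * curveConst 3)

theorem sobConst_nonneg : 0 ≤ sobConst :=
  mul_nonneg (curveConst_nonneg 1) (mul_nonneg (curveConst_nonneg 2) (curveConst_nonneg 3))

/-- The local Sobolev inequality on a cube of unit size. -/
theorem sobolev_local {u : VField} (hu : IsTest u) (t : ℝ) (x : E3) :
    ENNReal.ofReal (‖u (t, x)‖ ^ 2)
      ≤ ∫⁻ y in Metric.closedBall x 2, ENNReal.ofReal (sobConst * sqSize 4 u (t, y)) := by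
  set e : Fin 3 → E3 := fun i => EuclideanSpace.single i 1 with he
  have hn : ∀ i, ‖e i‖ ≤ 1 := fun i => by simp [he]
  have hline : ∀ (z w : E3) (s : ℝ), HasDerivAt (fun s : ℝ => z + s • w) w s := fun z w s => by
    simpa using ((hasDerivAt_id s).smul_const w).const_add z
  have hb : ∀ (v : VField) (z : E3) (i : Fin 3), ‖fderiv ℝ v (t, z) (0, e i)‖
      ≤ 4 * ∑ a ∈ words 2, ‖genWord a v (t, z)‖ := fun v z i => by
    have h0 : 0 ≤ ∑ a ∈ words 2, ‖genWord a v (t, z)‖ := Finset.sum_nonneg fun _ _ => norm_nonneg _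
    have := norm_fderiv_le_of_norm_le v (t, z) (hn i)
    linarith
  have key := sq_norm_le_lintegral_cube hu t (Ψ := fun a b c => x + c • e 2 + b • e 1 + a • e 0)
    (Ψ₁ := fun _ _ _ => e 0) (Ψ₂ := fun _ _ _ => e 1) (Ψ₃ := fun _ _ _ => e 2)
    (fun s => hline _ _ s) continuous_const
    (fun a s => by simpa using (hline (x + (0 : ℝ) • e 2) (e 1) s).add_const (a • e 0))
    (fun _ => continuous_const)
    (fun a b s => by simpa using ((hline x (e 2) s).add_const (b • e 1)).add_const (a • e 0))
    (fun _ _ => continuous_const)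
    (fun v _ s _ => hb v _ 0) (fun v _ a _ s _ => hb v _ 1) (fun v _ a _ b _ s _ => hb v _ 2)
    (by fun_prop)
  simp only [zero_smul, add_zero] at key
  refine key.trans ?_
  have hy : ∀ y : Fin 3 → ℝ, x + y 2 • e 2 + y 1 • e 1 + y 0 • e 0 = x + WithLp.toLp 2 y := by
    intro y
    have := space_eq_sum (WithLp.toLp 2 y)
    rw [this, Fin.sum_univ_three]
    simp only [he]
    abel
  simp_rw [hy]
  have hsub : ∀ y ∈ unitCube, x + WithLp.toLp 2 y ∈ Metric.closedBall x 2 := by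
    intro y hy
    rw [mem_closedBall_iff_norm, add_sub_cancel_left, EuclideanSpace.norm_eq]
    refine Real.sqrt_le_iff.2 ⟨by norm_num, ?_⟩
    simp only [Fin.sum_univ_three, Real.norm_eq_abs, sq_abs]
    have h0 := mem_unitCube.1 hy 0
    have h1 := mem_unitCube.1 hy 1
    have h2 := mem_unitCube.1 hy 2
    simp only [mem_Icc] at h0 h1 h2
    nlinarith
  set F : E3 → ℝ≥0∞ := (Metric.closedBall x 2).indicator
    fun z => ENNReal.ofReal (sobConst * sqSize 4 u (t, z)) with hF
  calc _ ≤ ∫⁻ y in unitCube, F (x + WithLp.toLp 2 y) := by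
        refine setLIntegral_mono' measurableSet_unitCube fun y hy => ?_
        rw [hF, indicator_of_mem (hsub y hy)]
        refine le_of_eq (congrArg _ ?_)
        simp only [sobConst]
        ring
    _ ≤ ∫⁻ y : Fin 3 → ℝ, F (x + WithLp.toLp 2 y) := setLIntegral_le_lintegral _ _
    _ = ∫⁻ z, F (x + z) := lintegral_E3 fun z => F (x + z)
    _ = ∫⁻ z, F z := lintegral_add_left_eq_self F x
    _ = _ := by rw [hF, lintegral_indicator Metric.isClosed_closedBall.measurableSet]

/-! ### The weighted Sobolev inequality, in spherical coordinates -/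

theorem hasDerivAt_toLp_three {f₀ f₁ f₂ : ℝ → ℝ} {d₀ d₁ d₂ s : ℝ} (h₀ : HasDerivAt f₀ d₀ s)
    (h₁ : HasDerivAt f₁ d₁ s) (h₂ : HasDerivAt f₂ d₂ s) :
    HasDerivAt (fun s => (!₂[f₀ s, f₁ s, f₂ s] : E3)) !₂[d₀, d₁, d₂] s := by
  have h : HasDerivAt (fun s => ![f₀ s, f₁ s, f₂ s]) ![d₀, d₁, d₂] s := by
    rw [hasDerivAt_pi]
    intro i
    fin_cases i
    exacts [h₀, h₁, h₂]
  exact (PiLp.continuousLinearEquiv 2 ℝ (fun _ : Fin 3 => ℝ)).symm.hasFDerivAt.comp_hasDerivAt s h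

/-- Spherical coordinates: radius, latitude and longitude. -/
def sph (ρ a b : ℝ) : E3 :=
  !₂[ρ * Real.cos a * Real.cos b, ρ * Real.cos a * Real.sin b, ρ * Real.sin a]

theorem norm_sph_sq (ρ a b : ℝ) : ‖sph ρ a b‖ ^ 2 = ρ ^ 2 := by
  rw [EuclideanSpace.norm_sq_eq]
  simp only [sph, Fin.sum_univ_three, Real.norm_eq_abs, sq_abs]
  simp only [Fin.isValue, Matrix.cons_val]
  linear_combination ρ ^ 2 * Real.cos a ^ 2 * Real.sin_sq_add_cos_sq b
    + ρ ^ 2 * Real.sin_sq_add_cos_sq a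

theorem norm_sph {ρ : ℝ} (hρ : 0 ≤ ρ) (a b : ℝ) : ‖sph ρ a b‖ = ρ := by
  have := norm_sph_sq ρ a b
  rwa [sq_eq_sq₀ (norm_nonneg _) hρ] at this

/-- Spherical coordinates as a map between coordinate spaces, with radius shifted by `R`. -/
def sphMap (R : ℝ) (y : Fin 3 → ℝ) : Fin 3 → ℝ := (sph (R + y 2) (y 0) (y 1)).ofLp

/-- The Jacobian matrix of spherical coordinates. -/
def sphJac (R : ℝ) (y : Fin 3 → ℝ) : Matrix (Fin 3) (Fin 3) ℝ :=
  !![-((R + y 2) * Real.sin (y 0) * Real.cos (y 1)), -((R + y 2) * Real.cos (y 0) * Real.sin (y 1)),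
      Real.cos (y 0) * Real.cos (y 1);
    -((R + y 2) * Real.sin (y 0) * Real.sin (y 1)), (R + y 2) * Real.cos (y 0) * Real.cos (y 1),
      Real.cos (y 0) * Real.sin (y 1);
    (R + y 2) * Real.cos (y 0), 0, Real.sin (y 0)]

theorem det_sphJac (R : ℝ) (y : Fin 3 → ℝ) :
    (sphJac R y).det = -((R + y 2) ^ 2 * Real.cos (y 0)) := by
  rw [Matrix.det_fin_three]
  simp only [sphJac, Matrix.of_apply, Matrix.cons_val]
  have h1 := Real.sin_sq_add_cos_sq (y 0)
  have h2 := Real.sin_sq_add_cos_sq (y 1)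
  linear_combination
    (-(R + y 2) ^ 2 * Real.cos (y 0)) * (h1 + (Real.cos (y 0) ^ 2 + Real.sin (y 0) ^ 2) * h2
      - 0 * h1)

theorem hasFDerivAt_sphMap (R : ℝ) (y : Fin 3 → ℝ) :
    HasFDerivAt (sphMap R) (Matrix.toLin' (sphJac R y)).toContinuousLinearMap y := by
  rw [hasFDerivAt_pi']
  have p : ∀ i : Fin 3, HasFDerivAt (fun y : Fin 3 → ℝ => y i)
      (ContinuousLinearMap.proj i : (Fin 3 → ℝ) →L[ℝ] ℝ) y := fun i => hasFDerivAt_apply i y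
  have hc : ∀ i : Fin 3, HasFDerivAt (fun y : Fin 3 → ℝ => Real.cos (y i))
      (-Real.sin (y i) • (ContinuousLinearMap.proj i : (Fin 3 → ℝ) →L[ℝ] ℝ)) y := fun i =>
    (p i).cos
  have hs : ∀ i : Fin 3, HasFDerivAt (fun y : Fin 3 → ℝ => Real.sin (y i))
      (Real.cos (y i) • (ContinuousLinearMap.proj i : (Fin 3 → ℝ) →L[ℝ] ℝ)) y := fun i =>
    (p i).sin
  intro i
  fin_cases i
  · refine ((((p 2).const_add R).mul (hc 0)).mul (hc 1)).congr_fderiv ?_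
    ext v
    simp [sphJac, Matrix.toLin'_apply, dotProduct, Fin.sum_univ_three]
    ring
  · refine ((((p 2).const_add R).mul (hc 0)).mul (hs 1)).congr_fderiv ?_
    ext v
    simp [sphJac, Matrix.toLin'_apply, dotProduct, Fin.sum_univ_three]
    ring
  · refine (((p 2).const_add R).mul (hs 0)).congr_fderiv ?_
    ext v
    simp [sphJac, Matrix.toLin'_apply, dotProduct, Fin.sum_univ_three]
    ring

/-- Both angles stay in `[0, 1]`, where latitude and longitude are determined by their sine and
cosine. -/
theorem injOn_sphMap {R : ℝ} (hR : 0 < R) : InjOn (sphMap R) unitCube := by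
  intro y hy z hz h
  have hy' := fun i => mem_unitCube.1 hy i
  have hz' := fun i => mem_unitCube.1 hz i
  simp only [mem_Icc] at hy' hz'
  have hs : sph (R + y 2) (y 0) (y 1) = sph (R + z 2) (z 0) (z 1) := WithLp.ofLp_injective 2 h
  have hρ : R + y 2 = R + z 2 := by
    rw [← norm_sph (by linarith [(hy' 2).1] : 0 ≤ R + y 2) (y 0) (y 1), hs,
      norm_sph (by linarith [(hz' 2).1] : 0 ≤ R + z 2)]
  have hpos : R + z 2 ≠ 0 := by linarith [(hz' 2).1]
  have hpi := Real.pi_gt_three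
  have e0 : y 0 = z 0 := by
    have h2 : (R + y 2) * Real.sin (y 0) = (R + z 2) * Real.sin (z 0) := congrFun h 2
    rw [hρ] at h2
    refine Real.injOn_sin ?_ ?_ (mul_left_cancel₀ hpos h2) <;> constructor <;>
      linarith [hy' 0, hz' 0, (hy' 0).1, (hy' 0).2, (hz' 0).1, (hz' 0).2]
  have hcos : Real.cos (z 0) ≠ 0 := by
    refine (Real.cos_pos_of_mem_Ioo ⟨?_, ?_⟩).ne' <;> linarith [(hz' 0).1, (hz' 0).2]
  have e1 : y 1 = z 1 := by
    have h2 : (R + y 2) * Real.cos (y 0) * Real.cos (y 1)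
        = (R + z 2) * Real.cos (z 0) * Real.cos (z 1) := congrFun h 0
    rw [hρ, e0] at h2
    refine Real.injOn_cos ?_ ?_ (mul_left_cancel₀ (mul_ne_zero hpos hcos) h2) <;> constructor <;>
      linarith [(hy' 1).1, (hy' 1).2, (hz' 1).1, (hz' 1).2]
  ext i
  fin_cases i
  exacts [e0, e1, by simpa using hρ]

/-- The Jacobian `(R + ρ)² cos a` is at least `R² / 2` on the unit cube, because `cos a ≥ 1 / 2`
for `a ≤ 1`. -/
theorem lintegral_sph_le {R : ℝ} (hR : 0 < R) (F : E3 → ℝ≥0∞) :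
    ENNReal.ofReal (R ^ 2 / 2) * ∫⁻ y in unitCube, F (sph (R + y 2) (y 0) (y 1))
      ≤ ∫⁻ x, F x := by
  calc ENNReal.ofReal (R ^ 2 / 2) * ∫⁻ y in unitCube, F (sph (R + y 2) (y 0) (y 1))
      = ∫⁻ y in unitCube, ENNReal.ofReal (R ^ 2 / 2) * F (sph (R + y 2) (y 0) (y 1)) :=
        (lintegral_const_mul' _ _ ENNReal.ofReal_ne_top).symm
    _ ≤ ∫⁻ y in unitCube, ENNReal.ofReal
          |((Matrix.toLin' (sphJac R y)).toContinuousLinearMap).det|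
            * F (WithLp.toLp 2 (sphMap R y)) := by
        refine setLIntegral_mono' measurableSet_unitCube fun y hy => ?_
        have h0 := mem_unitCube.1 hy 0
        have h2 := mem_unitCube.1 hy 2
        simp only [mem_Icc] at h0 h2
        gcongr
        · rw [LinearMap.det_toContinuousLinearMap, LinearMap.det_toLin', det_sphJac, abs_neg,
            abs_of_nonneg]
          · have hc : 1 / 2 ≤ Real.cos (y 0) := by
              have := Real.one_sub_sq_div_two_le_cos (x := y 0)
              nlinarith
            have hsq : R ^ 2 ≤ (R + y 2) ^ 2 := by nlinarith
            nlinarith [sq_nonneg R]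
          · refine mul_nonneg (sq_nonneg _) (Real.cos_nonneg_of_mem_Icc ⟨?_, ?_⟩) <;>
              linarith [Real.pi_gt_three]
        · rfl
    _ = ∫⁻ z in sphMap R '' unitCube, F (WithLp.toLp 2 z) :=
        (lintegral_image_eq_lintegral_abs_det_fderiv_mul volume measurableSet_unitCube
          (fun y _ => (hasFDerivAt_sphMap R y).hasFDerivWithinAt) (injOn_sphMap hR)
          fun z => F (WithLp.toLp 2 z)).symm
    _ ≤ ∫⁻ z, F (WithLp.toLp 2 z) := setLIntegral_le_lintegral _ _
    _ = _ := lintegral_E3 F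

/-- A point of norm `R` is the image, under a reflection, of the base point of the spherical
coordinates. -/
theorem exists_isometry_apply_eq {x : E3} :
    ∃ Q : E3 ≃ₗᵢ[ℝ] E3, Q (sph ‖x‖ 0 0) = x :=
  ⟨_, Submodule.reflection_sub (by rw [norm_sph (norm_nonneg _)])⟩

/-- The Sobolev inequality with the weight `|x|`. -/
theorem sobolev_weighted {u : VField} (hu : IsTest u) (t : ℝ) (x : E3) :
    ENNReal.ofReal (‖x‖ ^ 2 / 2) * ENNReal.ofReal (‖u (t, x)‖ ^ 2)
      ≤ ∫⁻ y, ENNReal.ofReal (sobConst * sqSize 4 u (t, y)) := by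
  rcases eq_or_ne x 0 with rfl | hx
  · simp
  set R := ‖x‖ with hRdef
  have hR : 0 < R := norm_pos_iff.2 hx
  obtain ⟨Q, hQ⟩ := exists_isometry_apply_eq (x := x)
  have hcl : ∀ {f : ℝ → E3} {f' : E3} {s : ℝ}, HasDerivAt f f' s →
      HasDerivAt (fun s => Q (f s)) (Q f') s := fun {f f' s} h =>
    (Q.toContinuousLinearEquiv.hasFDerivAt (x := f s)).comp_hasDerivAt s h
  -- the derivatives of the coordinates in latitude, longitude and radius; the first two are
  -- tangent to spheres and no longer than the radius, so that rotation fields bound them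
  set Ψ₁ : ℝ → ℝ → ℝ → E3 := fun a b c => Q !₂[-((R + c) * Real.sin a * Real.cos b),
    -((R + c) * Real.sin a * Real.sin b), (R + c) * Real.cos a] with hΨ₁
  set Ψ₂ : ℝ → ℝ → ℝ → E3 := fun a b c => Q !₂[-((R + c) * Real.cos a * Real.sin b),
    (R + c) * Real.cos a * Real.cos b, 0] with hΨ₂
  set Ψ₃ : ℝ → ℝ → ℝ → E3 := fun a b _ => Q (sph 1 a b) with hΨ₃
  have hcont : ∀ {f₀ f₁ f₂ : ℝ → ℝ}, Continuous f₀ → Continuous f₁ → Continuous f₂ →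
      Continuous fun s => Q (!₂[f₀ s, f₁ s, f₂ s] : E3) := fun {f₀ f₁ f₂} h₀ h₁ h₂ => by
    refine Q.continuous.comp ((PiLp.continuous_toLp 2 _).comp (continuous_pi fun i => ?_))
    fin_cases i
    exacts [h₀, h₁, h₂]
  have hne : ∀ a b c : ℝ, 0 ≤ c → Q (sph (R + c) a b) ≠ 0 := fun a b c hc h => by
    have := congrArg norm h
    rw [Q.norm_map, norm_sph (by linarith), norm_zero] at this
    linarith
  have hnorm : ∀ a b c : ℝ, 0 ≤ c → ‖Q (sph (R + c) a b)‖ = R + c := fun a b c hc => by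
    rw [Q.norm_map, norm_sph (by linarith)]
  have key := sq_norm_le_lintegral_cube hu t (Ψ := fun a b c => Q (sph (R + c) a b))
    (Ψ₁ := Ψ₁) (Ψ₂ := Ψ₂) (Ψ₃ := Ψ₃) ?_ ?_ ?_ ?_ ?_ ?_ ?_ ?_ ?_ ?_
  · rw [add_zero, hQ] at key
    calc _ ≤ ENNReal.ofReal (R ^ 2 / 2) * ∫⁻ y in unitCube, ENNReal.ofReal (curveConst 1 *
          (curveConst 2 * (curveConst 3 * sqSize 4 u (t, Q (sph (R + y 2) (y 0) (y 1)))))) := by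
          gcongr
      _ ≤ ∫⁻ z, ENNReal.ofReal (curveConst 1 *
          (curveConst 2 * (curveConst 3 * sqSize 4 u (t, Q z)))) :=
          lintegral_sph_le hR fun z => ENNReal.ofReal (curveConst 1 *
            (curveConst 2 * (curveConst 3 * sqSize 4 u (t, Q z))))
      _ = ∫⁻ z, ENNReal.ofReal (sobConst * sqSize 4 u (t, Q z)) := by
          refine lintegral_congr fun z => congrArg _ ?_
          simp only [sobConst]
          ring
      _ = _ := Q.measurePreserving.lintegral_comp_emb Q.toHomeomorph.measurableEmbedding
          fun z => ENNReal.ofReal (sobConst * sqSize 4 u (t, z))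
  · intro s
    refine hcl ?_
    have := hasDerivAt_toLp_three
      (((Real.hasDerivAt_cos s).const_mul (R + 0)).mul_const (Real.cos 0))
      (((Real.hasDerivAt_cos s).const_mul (R + 0)).mul_const (Real.sin 0))
      ((Real.hasDerivAt_sin s).const_mul (R + 0))
    simpa [sph] using this
  · exact hcont (by fun_prop) (by fun_prop) (by fun_prop)
  · intro a s
    refine hcl ?_
    refine (hasDerivAt_toLp_three
      ((Real.hasDerivAt_cos s).const_mul ((R + 0) * Real.cos a))
      ((Real.hasDerivAt_sin s).const_mul ((R + 0) * Real.cos a))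
      (hasDerivAt_const s ((R + 0) * Real.sin a))).congr_deriv ?_
    simp
  · exact fun a => hcont (by fun_prop) (by fun_prop) (by fun_prop)
  · intro a b s
    refine hcl ?_
    have hl : HasDerivAt (fun s : ℝ => R + s) 1 s := (hasDerivAt_id s).const_add R
    exact hasDerivAt_toLp_three ((hl.mul_const _).mul_const _) ((hl.mul_const _).mul_const _)
      (hl.mul_const _)
  · exact fun a b => continuous_const
  · intro v _ s _
    refine norm_fderiv_le_words v t (hne _ _ _ le_rfl) ?_ ?_
    · rw [hΨ₁, Q.inner_map_map, PiLp.inner_apply]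
      simp [sph, Fin.sum_univ_three]
      ring
    · rw [hnorm _ _ _ le_rfl]
      refine abs_le_of_sq_le_sq' ?_ (by linarith) |>.2
      rw [hΨ₁, Q.norm_map, EuclideanSpace.norm_sq_eq]
      simp [Fin.sum_univ_three]
      nlinarith [Real.sin_sq_add_cos_sq s]
  · intro v _ a _ s _
    refine norm_fderiv_le_words v t (hne _ _ _ le_rfl) ?_ ?_
    · rw [hΨ₂, Q.inner_map_map, PiLp.inner_apply]
      simp [sph, Fin.sum_univ_three]
      ring
    · rw [hnorm _ _ _ le_rfl]
      refine abs_le_of_sq_le_sq' ?_ (by linarith) |>.2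
      rw [hΨ₂, Q.norm_map, EuclideanSpace.norm_sq_eq]
      simp only [Fin.sum_univ_three, Real.norm_eq_abs, sq_abs, Fin.isValue, Matrix.cons_val]
      have h1 := Real.sin_sq_add_cos_sq s
      have h2 := Real.sin_sq_add_cos_sq a
      have h3 : (-((R + 0) * Real.cos a * Real.sin s)) ^ 2
          + ((R + 0) * Real.cos a * Real.cos s) ^ 2 + 0 ^ 2 = (R + 0) ^ 2 * Real.cos a ^ 2 := by
        linear_combination (R + 0) ^ 2 * Real.cos a ^ 2 * h1
      rw [h3]
      nlinarith [mul_nonneg (sq_nonneg (R + 0)) (sq_nonneg (Real.sin a))]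
  · intro v _ a _ b _ s _
    have h0 : 0 ≤ ∑ w ∈ words 2, ‖genWord w v (t, Q (sph (R + s) a b))‖ :=
      Finset.sum_nonneg fun _ _ => norm_nonneg _
    have := norm_fderiv_le_of_norm_le v (t, Q (sph (R + s) a b)) (w := Ψ₃ a b s)
      (by rw [hΨ₃, Q.norm_map, norm_sph zero_le_one])
    linarith
  · refine Q.continuous.comp ((PiLp.continuous_toLp 2 _).comp (continuous_pi fun i => ?_))
    fin_cases i <;> simp <;> fun_prop

/-! ### Square integrals and the energy -/

theorem eLpNorm_two_eq {F : Type*} [NormedAddCommGroup F] {f : E3 → F} (hf : MemLp f 2 volume) :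
    eLpNorm f 2 volume = ENNReal.ofReal √(∫ x, ‖f x‖ ^ 2) := by
  rw [hf.eLpNorm_eq_integral_rpow_norm two_ne_zero ENNReal.ofNat_ne_top, Real.sqrt_eq_rpow]
  simp

theorem lintegral_sq_eq {g : E3 → ℝ} :
    ∫⁻ x, ENNReal.ofReal (g x ^ 2) = eLpNorm g 2 volume ^ 2 := by
  have h := eLpNorm_nnreal_pow_eq_lintegral (f := g) (μ := (volume : Measure E3)) (p := 2)
    two_ne_zero
  have h2 : eLpNorm g 2 volume ^ 2 = ∫⁻ x, ‖g x‖ₑ ^ (2 : ℝ) := by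
    simpa using h
  rw [h2]
  refine lintegral_congr fun x => ?_
  rw [← ofReal_norm, ENNReal.ofReal_rpow_of_nonneg (norm_nonneg _) zero_le_two,
    Real.rpow_two, Real.norm_eq_abs, sq_abs]

/-- The restriction of a test field to a time slice. -/
theorem IsTest.slice_continuous {u : VField} (hu : IsTest u) (t : ℝ) :
    Continuous fun x : E3 => u (t, x) := hu.continuous.comp (by fun_prop)

theorem IsTest.slice_hasCompactSupport {u : VField} (hu : IsTest u) (t : ℝ) :
    HasCompactSupport fun x : E3 => u (t, x) := by
  have h : IsClosedEmbedding fun x : E3 => (t, x) :=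
    ⟨Topology.IsEmbedding.of_comp (by fun_prop) continuous_snd .id, by
      have : range (fun x : E3 => (t, x)) = {t} ×ˢ univ := by ext ⟨a, b⟩; simp [eq_comm]
      rw [this]
      exact isClosed_singleton.prod isClosed_univ⟩
  exact hu.2.comp_isClosedEmbedding h

theorem IsTest.memLp {u : VField} (hu : IsTest u) (t : ℝ) :
    MemLp (fun x : E3 => u (t, x)) 2 volume :=
  (hu.slice_continuous t).memLp_of_hasCompactSupport (hu.slice_hasCompactSupport t)

theorem classicalJet_dIdx (u : VField) (t : ℝ) (β : Fin 4) (a : List (Fin 8)) (x : E3) :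
    classicalJet u t (dIdx β :: a) x = dir (dirv β) (genWord a u) (t, x) := by
  simp only [classicalJet, genWord, gen_dIdx]

theorem classicalJet_xIdx (u : VField) (t : ℝ) (l : Fin 3) (a : List (Fin 8)) (x : E3) :
    classicalJet u t (xIdx l :: a) x = dX l (genWord a u) (t, x) :=
  classicalJet_dIdx u t l.succ a x

theorem classicalJet_dIdx_xIdx (u : VField) (t : ℝ) (β : Fin 4) (l : Fin 3) (a : List (Fin 8))
    (x : E3) : classicalJet u t (dIdx β :: xIdx l :: a) x
      = dir (dirv β) (dX l (genWord a u)) (t, x) := by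
  simp only [classicalJet, genWord, gen_dIdx, gen_xIdx]

/-- A jet whose first order derivatives of `Γ^a u` are square integrable. -/
def MemJet (D : Jet) (a : List (Fin 8)) : Prop := ∀ β, MemLp (D (dIdx β :: a)) 2 volume

theorem memJet_classicalJet {u : VField} (hu : IsTest u) (t : ℝ) (a : List (Fin 8)) :
    MemJet (classicalJet u t) a := fun β => (hu.genWord (dIdx β :: a)).memLp t

theorem MemJet.memLp_div {D : Jet} {a : List (Fin 8)} (h : MemJet D a) :
    MemLp (fun x => ∑ l : Fin 3, D (xIdx l :: a) x l) 2 volume :=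
  memLp_finsetSum _ fun l _ => (EuclideanSpace.proj l : E3 →L[ℝ] ℝ).comp_memLp' (h l.succ)

theorem energyOne_eq (c : Fin 2 → ℝ) {D : Jet} {a : List (Fin 8)} (h : MemJet D a) :
    energyOne c D a = 1 / 2 * ((∫ x, ‖D (dIdx 0 :: a) x‖ ^ 2)
      + c 1 ^ 2 * ∑ l : Fin 3, (∫ x, ‖D (xIdx l :: a) x‖ ^ 2)
      + (c 0 ^ 2 - c 1 ^ 2) * ∫ x, (∑ l : Fin 3, D (xIdx l :: a) x l) ^ 2) := by
  have hs : ∀ β, Integrable (fun x => ‖D (dIdx β :: a) x‖ ^ 2) volume := fun β =>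
    (h β).integrable_norm_pow two_ne_zero
  have hl : ∀ l : Fin 3, Integrable (fun x => ‖D (xIdx l :: a) x‖ ^ 2) volume := fun l => hs l.succ
  have hd : Integrable (fun x => (∑ l : Fin 3, D (xIdx l :: a) x l) ^ 2) volume := h.memLp_div.integrable_sq
  rw [energyOne, integral_add, integral_add, integral_const_mul, integral_const_mul,
    integral_finsetSum]
  · exact fun l _ => hl l
  · exact hs 0
  · exact (integrable_finsetSum _ fun l _ => hl l).const_mul _
  · exact (hs 0).add ((integrable_finsetSum _ fun l _ => hl l).const_mul _)
  · exact hd.const_mul _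

/-- The constant in the coercivity of the energy. -/
def coerConst (c : Fin 2 → ℝ) : ℝ := √(2 / min 1 (c 1 ^ 2))

/-- For `c₁ > c₂` the divergence term only adds to the energy. -/
theorem energyOne_coercive {c : Fin 2 → ℝ} (h1 : 0 < c 1) (h01 : c 1 < c 0) {D : Jet}
    {a : List (Fin 8)} (h : MemJet D a) (β : Fin 4) :
    min 1 (c 1 ^ 2) * ∫ x, ‖D (dIdx β :: a) x‖ ^ 2 ≤ 2 * energyOne c D a := by
  rw [energyOne_eq c h]
  have h0 : ∀ β, 0 ≤ ∫ x, ‖D (dIdx β :: a) x‖ ^ 2 := fun β => integral_nonneg fun _ => sq_nonneg _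
  have hd : 0 ≤ ∫ x, (∑ l : Fin 3, D (xIdx l :: a) x l) ^ 2 := integral_nonneg fun _ => sq_nonneg _
  have hc : 0 ≤ c 0 ^ 2 - c 1 ^ 2 := by nlinarith
  have hp : 0 ≤ (c 0 ^ 2 - c 1 ^ 2) * ∫ x, (∑ l : Fin 3, D (xIdx l :: a) x l) ^ 2 := mul_nonneg hc hd
  have hm : 0 < min 1 (c 1 ^ 2) := lt_min one_pos (by positivity)
  have hsum : 0 ≤ ∑ l : Fin 3, ∫ x, ‖D (xIdx l :: a) x‖ ^ 2 := Finset.sum_nonneg fun l _ => h0 l.succ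
  refine Fin.cases ?_ (fun l => ?_) β
  · have := mul_le_mul_of_nonneg_right (min_le_left 1 (c 1 ^ 2)) (h0 0)
    nlinarith [mul_nonneg (sq_nonneg (c 1)) hsum]
  · have e1 := mul_le_mul_of_nonneg_right (min_le_right 1 (c 1 ^ 2)) (h0 l.succ)
    have e2 : (∫ x, ‖D (dIdx l.succ :: a) x‖ ^ 2) ≤ ∑ l : Fin 3, ∫ x, ‖D (xIdx l :: a) x‖ ^ 2 :=
      Finset.single_le_sum (f := fun l : Fin 3 => ∫ x, ‖D (xIdx l :: a) x‖ ^ 2)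
        (fun l _ => h0 l.succ) (Finset.mem_univ l)
    have e3 := mul_le_mul_of_nonneg_left e2 (sq_nonneg (c 1))
    linarith [h0 0]

theorem energyOne_nonneg {c : Fin 2 → ℝ} (h1 : 0 < c 1) (h01 : c 1 < c 0) {D : Jet}
    {a : List (Fin 8)} (h : MemJet D a) : 0 ≤ energyOne c D a := by
  have hm : 0 < min 1 (c 1 ^ 2) := lt_min one_pos (by positivity)
  have h0 : 0 ≤ ∫ x, ‖D (dIdx 0 :: a) x‖ ^ 2 := integral_nonneg fun _ => sq_nonneg _
  nlinarith [energyOne_coercive h1 h01 h 0, mul_nonneg hm.le h0]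

theorem energy_eq_sum (c : Fin 2 → ℝ) (k : ℕ) (D : Jet) :
    energy c k D = ∑ a ∈ words k, energyOne c D a := sum_words k _

theorem energy_nonneg {c : Fin 2 → ℝ} (h1 : 0 < c 1) (h01 : c 1 < c 0) {k : ℕ} {D : Jet}
    (h : ∀ a ∈ words k, MemJet D a) : 0 ≤ energy c k D := by
  rw [energy_eq_sum]
  exact Finset.sum_nonneg fun a ha => energyOne_nonneg h1 h01 (h a ha)

/-- Each first derivative of `Γ^a u`, `|a| < k`, is bounded in `L²` by the energy of order `k`. -/
theorem eLpNorm_le_energy {c : Fin 2 → ℝ} (h1 : 0 < c 1) (h01 : c 1 < c 0) {k : ℕ} {D : Jet}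
    (h : ∀ a ∈ words k, MemJet D a) {a : List (Fin 8)} (ha : a.length < k) (β : Fin 4) :
    eLpNorm (D (dIdx β :: a)) 2 volume ≤ ENNReal.ofReal (coerConst c * √(energy c k D)) := by
  have ha' := mem_words.2 ha
  have hm : 0 < min 1 (c 1 ^ 2) := lt_min one_pos (by positivity)
  rw [eLpNorm_two_eq (h a ha' β), coerConst, ← Real.sqrt_mul (by positivity)]
  refine ENNReal.ofReal_le_ofReal (Real.sqrt_le_sqrt ?_)
  have e1 := energyOne_coercive h1 h01 (h a ha') β
  have e2 : energyOne c D a ≤ energy c k D := by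
    rw [energy_eq_sum]
    exact Finset.single_le_sum (f := fun a => energyOne c D a)
      (fun b hb => energyOne_nonneg h1 h01 (h b hb)) ha'
  rw [div_mul_eq_mul_div, le_div_iff₀ hm]
  linarith

/-- The square root of the energy of a test field. -/
def rootEnergy (c : Fin 2 → ℝ) (k : ℕ) (u : VField) (t : ℝ) : ℝ :=
  √(energy c k (classicalJet u t))

theorem rootEnergy_nonneg (c : Fin 2 → ℝ) (k : ℕ) (u : VField) (t : ℝ) :
    0 ≤ rootEnergy c k u t := Real.sqrt_nonneg _

theorem eLpNorm_dir_le {c : Fin 2 → ℝ} (h1 : 0 < c 1) (h01 : c 1 < c 0) {k : ℕ}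
    {u : VField} (hu : IsTest u) (t : ℝ) {a : List (Fin 8)} (ha : a.length < k) (β : Fin 4) :
    eLpNorm (fun x => dir (dirv β) (genWord a u) (t, x)) 2 volume
      ≤ ENNReal.ofReal (coerConst c * rootEnergy c k u t) := by
  have := eLpNorm_le_energy h1 h01 (fun a _ => memJet_classicalJet hu t a) ha β
  rw [rootEnergy]
  simpa only [funext (classicalJet_dIdx u t β a)] using this

theorem exists_eLpNorm_size₁_le {c : Fin 2 → ℝ} (h1 : 0 < c 1) (h01 : c 1 < c 0) (k : ℕ) :
    ∃ C : ℝ, 0 ≤ C ∧ ∀ u, IsTest u → ∀ t,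
      eLpNorm (fun x => size₁ k u (t, x)) 2 volume ≤ ENNReal.ofReal (C * rootEnergy c k u t) := by
  have hc0 : 0 ≤ coerConst c := Real.sqrt_nonneg _
  refine ⟨∑ _a ∈ words k, ∑ _β : Fin 4, coerConst c,
    Finset.sum_nonneg fun _ _ => Finset.sum_nonneg fun _ _ => hc0, fun u hu t => ?_⟩
  have e : (fun x => size₁ k u (t, x)) = ∑ a ∈ words k, ∑ β : Fin 4,
      fun x => ‖dir (dirv β) (genWord a u) (t, x)‖ := by
    funext x
    simp only [size₁, Finset.sum_apply]
  have hm : ∀ a β, AEStronglyMeasurable (fun x => ‖dir (dirv β) (genWord a u) (t, x)‖)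
      (volume : Measure E3) := fun a β =>
    (((hu.genWord a).dir _).slice_continuous t).norm.aestronglyMeasurable
  rw [e, Finset.sum_mul, ENNReal.ofReal_sum_of_nonneg fun a _ => mul_nonneg
    (Finset.sum_nonneg fun _ _ => hc0) (rootEnergy_nonneg _ _ _ _)]
  refine (eLpNorm_sum_le (fun a _ => Finset.aestronglyMeasurable_sum _ fun β _ => hm a β)
    one_le_two).trans (Finset.sum_le_sum fun a ha => ?_)
  rw [Finset.sum_mul, ENNReal.ofReal_sum_of_nonneg fun a _ => mul_nonneg
    hc0 (rootEnergy_nonneg _ _ _ _)]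
  refine (eLpNorm_sum_le (fun β _ => hm a β) one_le_two).trans (Finset.sum_le_sum fun β _ => ?_)
  rw [eLpNorm_norm]
  exact eLpNorm_dir_le h1 h01 hu t (mem_words.1 ha) β

theorem size₁_continuous (k : ℕ) {u : VField} (hu : IsTest u) : Continuous (size₁ k u) :=
  continuous_finsetSum _ fun a _ => continuous_finsetSum _ fun _ _ =>
    ((hu.genWord a).dir _).continuous.norm

theorem size₂_continuous (k : ℕ) {u : VField} (hu : IsTest u) : Continuous (size₂ k u) :=
  continuous_finsetSum _ fun a _ => continuous_finsetSum _ fun _ _ =>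
    continuous_finsetSum _ fun l _ => (((hu.genWord a).dX l).dir _).continuous.norm

/-- Second order derivatives are first order derivatives of longer words. -/
theorem size₂_le_size₁ {k n : ℕ} (h : k + 1 ≤ n) (u : VField) (p : ℝ × E3) :
    size₂ k u p ≤ (words k).card * (4 * (3 * size₁ n u p)) := by
  have hle : ∀ a ∈ words k, ∀ (β : Fin 4) (l : Fin 3),
      ‖dir (dirv β) (dX l (genWord a u)) p‖ ≤ size₁ n u p := fun a ha β l => by
    have := norm_le_size₁ (k := n) (a := xIdx l :: a) (by
      have := mem_words.1 ha
      rw [List.length_cons]; omega) β u p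
    simpa only [genWord, gen_xIdx] using this
  rw [size₂, ← nsmul_eq_mul]
  refine Finset.sum_le_card_nsmul _ _ _ fun a ha => ?_
  have := Finset.sum_le_card_nsmul (Finset.univ : Finset (Fin 4))
    (fun β => ∑ l : Fin 3, ‖dir (dirv β) (dX l (genWord a u)) p‖) (3 * size₁ n u p) fun β _ => by
      have := Finset.sum_le_card_nsmul (Finset.univ : Finset (Fin 3))
        (fun l => ‖dir (dirv β) (dX l (genWord a u)) p‖) (size₁ n u p) fun l _ => hle a ha β l
      simpa using this
  simpa using this

/-! ### Pointwise bounds by the energy -/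

theorem exists_sum_genWord_dir_le (b : ℕ) (v : ℝ × E3) : ∃ C : ℝ, 0 ≤ C ∧ ∀ u, IsTest u → ∀ p,
    ∑ a ∈ words b, ‖genWord a (dir v u) p‖ ≤ C * size₁ b u p := by
  choose C hC h using fun a => exists_genWord_dir_le a v
  refine ⟨∑ a ∈ words b, C a, Finset.sum_nonneg fun a _ => hC a, fun u hu p => ?_⟩
  rw [Finset.sum_mul]
  refine Finset.sum_le_sum fun a ha => (h a u hu p).trans ?_
  exact mul_le_mul_of_nonneg_left (size₁_mono (mem_words.1 ha) u p) (hC a)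

theorem exists_sum_genWord_dir_dir_le (b : ℕ) (v w : ℝ × E3) (hw : w.1 = 0) :
    ∃ C : ℝ, 0 ≤ C ∧ ∀ u, IsTest u → ∀ p,
      ∑ a ∈ words b, ‖genWord a (dir v (dir w u)) p‖ ≤ C * size₂ b u p := by
  choose C hC h using fun a => exists_genWord_dir_dir_le a v w hw
  refine ⟨∑ a ∈ words b, C a, Finset.sum_nonneg fun a _ => hC a, fun u hu p => ?_⟩
  rw [Finset.sum_mul]
  refine Finset.sum_le_sum fun a ha => (h a u hu p).trans ?_
  exact mul_le_mul_of_nonneg_left (size₂_mono (mem_words.1 ha) u p) (hC a)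

theorem sqSize_le_sq_sum (k : ℕ) (u : VField) (p : ℝ × E3) :
    sqSize k u p ≤ (∑ a ∈ words k, ‖genWord a u p‖) ^ 2 :=
  Finset.sum_sq_le_sq_sum_of_nonneg fun _ _ => norm_nonneg _

theorem ofReal_le_of_sq_le {x : ℝ} {A : ℝ≥0∞} (hx : 0 ≤ x)
    (h : ENNReal.ofReal (x ^ 2) ≤ A ^ 2) : ENNReal.ofReal x ≤ A := by
  rw [ENNReal.ofReal_pow hx] at h
  exact (ENNReal.pow_le_pow_left_iff two_ne_zero).1 h

/-- The supremum of a first order derivative, with the weight `1 + |x|`. -/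
theorem exists_sup_dir_le {c : Fin 2 → ℝ} (h1 : 0 < c 1) (h01 : c 1 < c 0) (b k : ℕ)
    (hbk : b + 4 ≤ k) :
    ∃ C : ℝ, 0 ≤ C ∧ ∀ u, IsTest u → ∀ t x, ∀ a : List (Fin 8), a.length ≤ b → ∀ β,
      (1 + ‖x‖) * ‖dir (dirv β) (genWord a u) (t, x)‖ ≤ C * rootEnergy c k u t := by
  choose C₁ hC₁ hr using fun β : Fin 4 => exists_sum_genWord_dir_le 4 (dirv β)
  obtain ⟨C₂, hC₂, he⟩ := exists_eLpNorm_size₁_le h1 h01 k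
  set C₁' := ∑ β, C₁ β with hC₁'
  have hC₁'0 : 0 ≤ C₁' := Finset.sum_nonneg fun β _ => hC₁ β
  set K := √sobConst * C₁' * C₂ with hK
  have hK0 : 0 ≤ K := by positivity
  refine ⟨(1 + √2) * K, by positivity, fun u hu t x a ha β => ?_⟩
  set f := dir (dirv β) (genWord a u) with hf
  have hft : IsTest f := (hu.genWord a).dir _
  have hint : ∫⁻ y, ENNReal.ofReal (sobConst * sqSize 4 f (t, y))
      ≤ ENNReal.ofReal (K * rootEnergy c k u t) ^ 2 := by
    have hpt : ∀ y, sobConst * sqSize 4 f (t, y)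
        ≤ (√sobConst * C₁') ^ 2 * (size₁ k u (t, y)) ^ 2 := fun y => by
      have e1 : ∑ w ∈ words 4, ‖genWord w f (t, y)‖ ≤ C₁' * size₁ k u (t, y) := by
        refine (hr β _ (hu.genWord a) (t, y)).trans ?_
        refine mul_le_mul ?_ (size₁_genWord_le a (by omega) u _) (size₁_nonneg _ _ _) hC₁'0
        exact Finset.single_le_sum (f := C₁) (fun β _ => hC₁ β) (Finset.mem_univ β)
      have e2 := pow_le_pow_left₀ (Finset.sum_nonneg fun _ _ => norm_nonneg _) e1 2
      calc sobConst * sqSize 4 f (t, y) ≤ sobConst * (C₁' * size₁ k u (t, y)) ^ 2 :=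
            mul_le_mul_of_nonneg_left ((sqSize_le_sq_sum 4 f _).trans e2) sobConst_nonneg
        _ = _ := by rw [mul_pow, mul_pow, Real.sq_sqrt sobConst_nonneg]; ring
    calc ∫⁻ y, ENNReal.ofReal (sobConst * sqSize 4 f (t, y))
        ≤ ∫⁻ y, ENNReal.ofReal ((√sobConst * C₁') ^ 2) * ENNReal.ofReal (size₁ k u (t, y) ^ 2) :=
          lintegral_mono fun y => by
            rw [← ENNReal.ofReal_mul (sq_nonneg _)]
            exact ENNReal.ofReal_le_ofReal (hpt y)
      _ = (ENNReal.ofReal (√sobConst * C₁') * eLpNorm (fun y => size₁ k u (t, y)) 2 volume) ^ 2 := by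
          rw [lintegral_const_mul' _ _ ENNReal.ofReal_ne_top, lintegral_sq_eq,
            ENNReal.ofReal_pow (by positivity), mul_pow]
      _ ≤ (ENNReal.ofReal (√sobConst * C₁') * ENNReal.ofReal (C₂ * rootEnergy c k u t)) ^ 2 := by
          gcongr
          exact he u hu t
      _ = _ := by
          rw [← ENNReal.ofReal_mul (by positivity), hK]
          congr 2
          ring
  have hE0 := rootEnergy_nonneg c k u t
  have l1 : ‖f (t, x)‖ ≤ K * rootEnergy c k u t := by
    have := ofReal_le_of_sq_le (norm_nonneg _)
      (((sobolev_local hft t x).trans (setLIntegral_le_lintegral _ _)).trans hint)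
    exact (ENNReal.ofReal_le_ofReal_iff (by positivity)).1 this
  have l2 : ‖x‖ / √2 * ‖f (t, x)‖ ≤ K * rootEnergy c k u t := by
    have h := (sobolev_weighted hft t x).trans hint
    rw [← ENNReal.ofReal_mul (by positivity)] at h
    have e : ‖x‖ ^ 2 / 2 * ‖f (t, x)‖ ^ 2 = (‖x‖ / √2 * ‖f (t, x)‖) ^ 2 := by
      rw [mul_pow, div_pow, Real.sq_sqrt zero_le_two]
    rw [e] at h
    exact (ENNReal.ofReal_le_ofReal_iff (by positivity)).1 (ofReal_le_of_sq_le (by positivity) h)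
  have l3 : ‖x‖ * ‖f (t, x)‖ ≤ √2 * (K * rootEnergy c k u t) := by
    have := mul_le_mul_of_nonneg_left l2 (Real.sqrt_nonneg 2)
    have e : √2 * (‖x‖ / √2 * ‖f (t, x)‖) = ‖x‖ * ‖f (t, x)‖ := by
      field_simp
    linarith
  linarith

/-! ### The radial and transverse projections -/

theorem norm_radial_le_one (x : E3) : ‖‖x‖⁻¹ • x‖ ≤ 1 := by
  rw [norm_smul, norm_inv, norm_norm]
  exact inv_mul_le_one

/-- The projections as linear maps. -/
def projL (α : Fin 2) (x : E3) : E3 →ₗ[ℝ] E3 where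
  toFun := proj α x
  map_add' v w := by
    fin_cases α <;> simp [proj, radialProj, inner_add_right, add_smul]
    abel
  map_smul' s w := by
    fin_cases α <;> simp [proj, radialProj, inner_smul_right, smul_smul, smul_sub, mul_assoc]

theorem projL_apply (α : Fin 2) (x w : E3) : projL α x w = proj α x w := rfl

theorem norm_projL_le (α : Fin 2) (x w : E3) : ‖projL α x w‖ ≤ ‖w‖ := by
  set n := ‖x‖⁻¹ • x with hn
  have h1 : ‖n‖ ≤ 1 := norm_radial_le_one x
  have h2 : ‖radialProj x w‖ ≤ ‖w‖ := by
    rw [radialProj, norm_smul]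
    calc ‖inner ℝ n w‖ * ‖n‖ ≤ (‖n‖ * ‖w‖) * ‖n‖ := by
          gcongr; exact norm_inner_le_norm n w
      _ ≤ (1 * ‖w‖) * 1 := by gcongr
      _ = ‖w‖ := by ring
  fin_cases α
  · exact h2
  · change ‖w - radialProj x w‖ ≤ ‖w‖
    refine abs_le_of_sq_le_sq' ?_ (norm_nonneg _) |>.2
    rw [norm_sub_sq_real, radialProj, inner_smul_right, norm_smul, mul_pow, Real.norm_eq_abs, sq_abs,
      real_inner_comm w n]
    have h3 : ‖n‖ ^ 2 ≤ 1 := pow_le_one₀ (norm_nonneg _) h1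
    nlinarith [sq_nonneg (inner ℝ n w : ℝ)]

theorem projL_add_eq (x w : E3) : projL 0 x w + projL 1 x w = w := by
  simp [projL_apply, proj]

theorem norm_le_sum_proj (x w : E3) : ‖w‖ ≤ ∑ α, ‖projL α x w‖ := by
  rw [Fin.sum_univ_two]
  conv_lhs => rw [← projL_add_eq x w]
  exact norm_add_le _ _

theorem abs_coord_le (x : E3) (i : Fin 3) : |x i| ≤ ‖x‖ := PiLp.norm_apply_le x i

theorem norm_sq_eq_three (x : E3) : ‖x‖ ^ 2 = x 0 ^ 2 + x 1 ^ 2 + x 2 ^ 2 := by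
  rw [EuclideanSpace.norm_sq_eq]; simp [Fin.sum_univ_three]

theorem norm_sum_coord_smul_le (x : E3) (v : Fin 3 → E3) {e : ℝ} (hv : ∀ i, ‖v i‖ ≤ e) :
    ‖∑ i, x i • v i‖ ≤ 3 * ‖x‖ * e := by
  refine (norm_sum_le _ _).trans ?_
  have : ∀ i ∈ Finset.univ, ‖x i • v i‖ ≤ ‖x‖ * e := fun i _ => by
    rw [norm_smul]
    exact mul_le_mul (abs_coord_le x i) (hv i) (norm_nonneg _) (norm_nonneg _)
  refine (Finset.sum_le_card_nsmul _ _ _ this).trans (le_of_eq ?_)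
  simp; ring

/-- The isotropic operator applied to a rank one second derivative `n ⊗ n ⊗ q`, `n = x / r`, acts by
the squared speeds on the two projections. -/
theorem projL_lame_rankOne (c : Fin 2 → ℝ) {x : E3} (hx : x ≠ 0) (q : E3) (α : Fin 2) :
    projL α x (∑ a, ∑ b, lameK c a b ((x a * x b / ‖x‖ ^ 2) • q)) = c α ^ 2 • projL α x q := by
  have hr : ‖x‖ ≠ 0 := norm_ne_zero_iff.2 hx
  have hr2 := norm_sq_eq_three x
  have key : ∑ a, ∑ b, lameK c a b ((x a * x b / ‖x‖ ^ 2) • q)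
      = c 1 ^ 2 • q + (c 0 ^ 2 - c 1 ^ 2) • radialProj x q := by
    have hip : inner ℝ x q = x 0 * q 0 + x 1 * q 1 + x 2 * q 2 := by
      rw [PiLp.inner_apply]
      simp [Fin.sum_univ_three]
      ring
    have hinv : ‖x‖⁻¹ * (‖x‖⁻¹ * inner ℝ x q) = inner ℝ x q / ‖x‖ ^ 2 := by field_simp
    ext i
    simp only [PiLp.add_apply, PiLp.smul_apply, smul_eq_mul, radialProj, inner_smul_left,
      Fin.sum_univ_three, lameK_apply]
    have e : ∀ y : ℝ, (starRingEnd ℝ) ‖x‖⁻¹ * y * (‖x‖⁻¹ * x i) = (‖x‖⁻¹ * (‖x‖⁻¹ * y)) * x i := by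
      intro y; simp; ring
    rw [e, hinv, hip]
    have h3 : (x 0 ^ 2 + x 1 ^ 2 + x 2 ^ 2) / ‖x‖ ^ 2 = 1 := by
      rw [← hr2]; exact div_self (pow_ne_zero 2 hr)
    have h4 : q i * c 1 ^ 2 = c 1 ^ 2 * q i * ((x 0 ^ 2 + x 1 ^ 2 + x 2 ^ 2) / ‖x‖ ^ 2) := by
      rw [h3]; ring
    rw [mul_comm (c 1 ^ 2) (q i), h4]
    fin_cases i <;> simp <;> ring
  rw [key, map_add, map_smul, map_smul]
  have hn : inner ℝ (‖x‖⁻¹ • x) (‖x‖⁻¹ • x) = (1 : ℝ) := by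
    rw [real_inner_self_eq_norm_sq, norm_smul, norm_inv, norm_norm, inv_mul_cancel₀ hr, one_pow]
  have hP : radialProj x (radialProj x q) = radialProj x q := by
    simp only [radialProj]
    rw [inner_smul_right, hn, mul_one]
  fin_cases α
  · change c 1 ^ 2 • radialProj x q + (c 0 ^ 2 - c 1 ^ 2) • radialProj x (radialProj x q) = _
    rw [hP, ← add_smul, add_sub_cancel]
    rfl
  · change c 1 ^ 2 • (q - radialProj x q)
      + (c 0 ^ 2 - c 1 ^ 2) • (radialProj x q - radialProj x (radialProj x q)) = _
    rw [hP, sub_self, smul_zero, add_zero]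
    rfl

/-! ### The pointwise part of the weighted estimate -/

/-- The sum of the norms of the coefficients of the isotropic operator. -/
def lameNorm (c : Fin 2 → ℝ) : ℝ := ∑ a, ∑ b, ‖lameK c a b‖

theorem lameNorm_nonneg (c : Fin 2 → ℝ) : 0 ≤ lameNorm c :=
  Finset.sum_nonneg fun a _ => Finset.sum_nonneg fun b _ => norm_nonneg (lameK c a b)

theorem norm_sum_lameK_le (c : Fin 2 → ℝ) (D : Fin 3 → Fin 3 → E3) {e : ℝ}
    (hD : ∀ a b, ‖D a b‖ ≤ e) : ‖∑ a, ∑ b, lameK c a b (D a b)‖ ≤ lameNorm c * e := by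
  rw [lameNorm, Finset.sum_mul]
  refine (norm_sum_le _ _).trans (Finset.sum_le_sum fun a _ => ?_)
  rw [Finset.sum_mul]
  refine (norm_sum_le _ _).trans (Finset.sum_le_sum fun b _ => ?_)
  refine ((lameK c a b).le_opNorm _).trans ?_
  exact mul_le_mul_of_nonneg_left (hD a b) (norm_nonneg (lameK c a b))

/-- The second derivatives at a point, as far as they are controlled by the generators: `Z`, `K`
and `H` stand for `∂_t² u`, `∂_t ∂_l u` and `∂_l ∂_m u`. -/
structure SecondDerivs (t : ℝ) (x : E3) (e : ℝ) (Z : E3) (K : Fin 3 → E3)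
    (H : Fin 3 → Fin 3 → E3) : Prop where
  symm : ∀ l m, H l m = H m l
  scal_t : ‖t • Z + ∑ l, x l • K l‖ ≤ e
  scal_x : ∀ m, ‖t • K m + ∑ l, x l • H l m‖ ≤ e
  rot_x : ∀ i j m, ‖x i • H j m - x j • H i m‖ ≤ e
  rot_t : ∀ i j, ‖x i • K j - x j • K i‖ ≤ e

theorem SecondDerivs.nonneg {t : ℝ} {x : E3} {e : ℝ} {Z : E3} {K : Fin 3 → E3}
    {H : Fin 3 → Fin 3 → E3} (h : SecondDerivs t x e Z K H) : 0 ≤ e :=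
  (norm_nonneg _).trans h.scal_t

/-- Scaling determines the second time derivative by the radial one. -/
theorem SecondDerivs.time_radial {t : ℝ} {x : E3} {e : ℝ} {Z : E3} {K : Fin 3 → E3}
    {H : Fin 3 → Fin 3 → E3} (h : SecondDerivs t x e Z K H) (ht : 0 ≤ t) :
    ‖t ^ 2 • Z - ∑ l, x l • ∑ m, x m • H l m‖ ≤ (t + 3 * ‖x‖) * e := by
  have e1 : t ^ 2 • Z - ∑ l, x l • ∑ m, x m • H l m
      = t • (t • Z + ∑ l, x l • K l) - ∑ m, x m • (t • K m + ∑ l, x l • H l m) := by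
    simp only [Fin.sum_univ_three, h.symm 1 0, h.symm 2 0, h.symm 2 1]
    module
  rw [e1, add_mul]
  refine (norm_sub_le _ _).trans (add_le_add ?_ (norm_sum_coord_smul_le x _ h.scal_x))
  rw [norm_smul, Real.norm_of_nonneg ht]
  exact mul_le_mul_of_nonneg_left h.scal_t ht

/-- The second spatial derivatives are radial up to terms controlled by the rotations. -/
theorem SecondDerivs.rankOne {t : ℝ} {x : E3} {e : ℝ} {Z : E3} {K : Fin 3 → E3}
    {H : Fin 3 → Fin 3 → E3} (h : SecondDerivs t x e Z K H) (hx : x ≠ 0) (j l : Fin 3) :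
    ‖H j l - (x j * x l / ‖x‖ ^ 2) • (‖x‖ ^ 2)⁻¹ • ∑ i, x i • ∑ m, x m • H i m‖
      ≤ 12 * e / ‖x‖ := by
  have hr : 0 < ‖x‖ := norm_pos_iff.2 hx
  have he := h.nonneg
  set r := ‖x‖ with hrdef
  have hr2 : r ^ 2 = x 0 ^ 2 + x 1 ^ 2 + x 2 ^ 2 := norm_sq_eq_three x
  -- replace `x_i x_i H_jl` first by `x_i x_j H_il` and then by `x_j x_l H_im`, multiplying by
  -- `|x|² = ∑ x_i²` where needed; each replacement is an angular derivative
  have e1 : r ^ 4 • (H j l - (x j * x l / r ^ 2) • (r ^ 2)⁻¹ • ∑ i, x i • ∑ m, x m • H i m)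
      = r ^ 2 • (∑ i, x i • (x i • H j l - x j • H i l))
        + x j • ∑ i, x i • ∑ m, x m • (x m • H l i - x l • H m i) := by
    have hc : r ^ 4 * (x j * x l / r ^ 2) * (r ^ 2)⁻¹ = x j * x l := by field_simp
    rw [smul_sub, smul_smul, smul_smul, hc,
      show r ^ 4 = r ^ 2 * (x 0 ^ 2 + x 1 ^ 2 + x 2 ^ 2) by rw [← hr2]; ring, hr2]
    simp only [Fin.sum_univ_three, h.symm 1 0, h.symm 2 0, h.symm 2 1, h.symm l]
    module
  have b1 : ‖∑ i, x i • (x i • H j l - x j • H i l)‖ ≤ 3 * r * e :=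
    norm_sum_coord_smul_le x _ fun i => h.rot_x i j l
  have b2 : ‖∑ i, x i • ∑ m, x m • (x m • H l i - x l • H m i)‖ ≤ 3 * r * (3 * r * e) :=
    norm_sum_coord_smul_le x _ fun i => norm_sum_coord_smul_le x _ fun m => h.rot_x m l i
  have b3 : r ^ 4 * ‖H j l - (x j * x l / r ^ 2) • (r ^ 2)⁻¹ • ∑ i, x i • ∑ m, x m • H i m‖
      ≤ r ^ 2 * (3 * r * e) + r * (3 * r * (3 * r * e)) := by
    have := congrArg norm e1
    rw [norm_smul, Real.norm_of_nonneg (by positivity)] at this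
    rw [this]
    refine (norm_add_le _ _).trans (add_le_add ?_ ?_)
    · rw [norm_smul, Real.norm_of_nonneg (by positivity)]
      gcongr
    · rw [norm_smul]
      exact mul_le_mul (abs_coord_le x j) b2 (norm_nonneg _) hr.le
  rw [le_div_iff₀ hr]
  have : r ^ 3 * (‖H j l - (x j * x l / r ^ 2) • (r ^ 2)⁻¹ • ∑ i, x i • ∑ m, x m • H i m‖ * r)
      ≤ r ^ 3 * (12 * e) := by nlinarith
  exact le_of_mul_le_mul_left this (by positivity)

set_option maxHeartbeats 1600000 in
/-- The weighted pointwise estimate away from the time axis. -/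
theorem exists_outer_bound (c : Fin 2 → ℝ) (h1 : 0 < c 1) (h01 : c 1 < c 0) {δ : ℝ} (hδ : 0 < δ) :
    ∃ C : ℝ, 0 ≤ C ∧ ∀ (t : ℝ) (x : E3) (e : ℝ) (Z : E3) (K : Fin 3 → E3)
      (H : Fin 3 → Fin 3 → E3) (L : E3), SecondDerivs t x e Z K H → 0 ≤ t → x ≠ 0 → δ * t ≤ ‖x‖ →
      Z - ∑ a, ∑ b, lameK c a b (H a b) = L → ∀ α,
        (∀ j l, |c α * t - ‖x‖| * ‖projL α x (H j l)‖ ≤ C * (e + t * ‖L‖)) ∧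
        (∀ l, |c α * t - ‖x‖| * ‖projL α x (K l)‖ ≤ C * (e + t * ‖L‖)) := by
  have hcα : ∀ α, 0 < c α := fun α => by fin_cases α; exacts [h1.trans h01, h1]
  have hcle : ∀ α, c α ≤ c 0 := fun α => by fin_cases α; exacts [le_rfl, h01.le]
  set N := lameNorm c with hN
  have hN0 : 0 ≤ N := lameNorm_nonneg c
  have h0 : 0 < c 0 := h1.trans h01
  set d := δ⁻¹ with hd
  have hd0 : 0 < d := inv_pos.2 hδ
  -- the bounds for the radial derivative, and for the weight divided by `r`
  set C₁ := d + 3 + d ^ 2 * (12 * N) + d with hC₁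
  set C₂ := c 0 * d + 1 with hC₂
  have hC₁0 : 0 ≤ C₁ := by positivity
  have hC₂0 : 0 ≤ C₂ := by positivity
  refine ⟨C₁ + C₂ * 12 + C₂ * (4 + d * (12 * N) + 1) + d * c 0 ^ 2 * C₁, by positivity, ?_⟩
  intro t x e Z K H L h ht hx hrt hL α
  have he := h.nonneg
  have hr : 0 < ‖x‖ := norm_pos_iff.2 hx
  set r := ‖x‖ with hrdef
  have htr : t ≤ d * r := by
    rw [hd, inv_mul_eq_div, le_div_iff₀ hδ]; linarith
  set q := (r ^ 2)⁻¹ • ∑ i, x i • ∑ m, x m • H i m with hq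
  set w := |c α * t - r| with hw
  have hw0 : 0 ≤ w := abs_nonneg _
  have hL0 : 0 ≤ t * ‖L‖ := by positivity
  have hwr : w ≤ C₂ * r := by
    rw [hw, abs_le]
    have h3 : c α * t ≤ c 0 * (d * r) := mul_le_mul (hcle α) htr ht h0.le
    have h4 : 0 ≤ c α * t := mul_nonneg (hcα α).le ht
    constructor <;> nlinarith [mul_nonneg (mul_nonneg h0.le hd0.le) hr.le]
  have hrank := h.rankOne hx
  -- the isotropic operator, up to angular terms
  have hA : ‖projL α x (∑ a, ∑ b, lameK c a b (H a b)) - c α ^ 2 • projL α x q‖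
      ≤ N * (12 * e / r) := by
    rw [← projL_lame_rankOne c hx q α, ← map_sub]
    refine (norm_projL_le _ _ _).trans ?_
    rw [← Finset.sum_sub_distrib]
    simp_rw [← Finset.sum_sub_distrib, ← map_sub]
    exact norm_sum_lameK_le c _ fun a b => hrank a b
  have hZ : Z = (∑ a, ∑ b, lameK c a b (H a b)) + L := by rw [← hL]; abel
  have hPZ : ‖projL α x Z - c α ^ 2 • projL α x q‖ ≤ N * (12 * e / r) + ‖L‖ := by
    rw [hZ, map_add, add_sub_right_comm]
    exact (norm_add_le _ _).trans (add_le_add hA (norm_projL_le _ _ _))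
  have hsum : ∑ l, x l • ∑ m, x m • H l m = r ^ 2 • q := by
    rw [hq, smul_smul, mul_inv_cancel₀ (by positivity), one_smul]
  have hT : ‖t ^ 2 • projL α x Z - r ^ 2 • projL α x q‖ ≤ (t + 3 * r) * e := by
    have := h.time_radial ht
    rw [hsum] at this
    rw [← map_smul, ← map_smul, ← map_sub]
    exact (norm_projL_le _ _ _).trans this
  -- the radial derivative
  have hq1 : w * ‖projL α x q‖ ≤ C₁ * (e + t * ‖L‖) := by
    have a1 : ‖(c α ^ 2 * t ^ 2 - r ^ 2) • projL α x q‖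
        ≤ (t + 3 * r) * e + t ^ 2 * (N * (12 * e / r) + ‖L‖) := by
      have : (c α ^ 2 * t ^ 2 - r ^ 2) • projL α x q
          = (t ^ 2 • projL α x Z - r ^ 2 • projL α x q)
            - t ^ 2 • (projL α x Z - c α ^ 2 • projL α x q) := by module
      rw [this]
      refine (norm_sub_le _ _).trans (add_le_add hT ?_)
      rw [norm_smul, Real.norm_of_nonneg (by positivity)]
      gcongr
    have a2 : ‖(c α ^ 2 * t ^ 2 - r ^ 2) • projL α x q‖ = w * (c α * t + r) * ‖projL α x q‖ := by
      rw [norm_smul, Real.norm_eq_abs, show c α ^ 2 * t ^ 2 - r ^ 2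
        = (c α * t - r) * (c α * t + r) by ring, abs_mul, abs_of_nonneg (a := c α * t + r)]
      exact add_nonneg (mul_nonneg (hcα α).le ht) hr.le
    rw [a2] at a1
    have a3 : r * (w * ‖projL α x q‖) ≤ w * (c α * t + r) * ‖projL α x q‖ := by
      have : 0 ≤ c α * t * (w * ‖projL α x q‖) := by
        have := (hcα α).le
        positivity
      nlinarith
    have a4 : (t + 3 * r) * e + t ^ 2 * (N * (12 * e / r) + ‖L‖) ≤ r * (C₁ * (e + t * ‖L‖)) := by
      have b1 : t * e ≤ d * r * e := by gcongr
      have b2 : t ^ 2 * (N * (12 * e / r)) ≤ (d * r) ^ 2 * (N * (12 * e / r)) := by gcongr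
      have b3 : (d * r) ^ 2 * (N * (12 * e / r)) = r * (d ^ 2 * (12 * N) * e) := by field_simp
      have b4 : t ^ 2 * ‖L‖ ≤ r * (d * (t * ‖L‖)) := by
        nlinarith [mul_le_mul_of_nonneg_right htr hL0]
      have b5 : r * (C₁ * (e + t * ‖L‖)) = d * r * e + 3 * r * e + r * (d ^ 2 * (12 * N) * e)
          + r * (d * (t * ‖L‖)) + (r * (d * e) + r * ((d + 3 + d ^ 2 * (12 * N)) * (t * ‖L‖))) := by
        rw [hC₁]; ring
      have b6 : 0 ≤ r * (d * e) + r * ((d + 3 + d ^ 2 * (12 * N)) * (t * ‖L‖)) := by positivity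
      rw [b5]
      linarith
    exact le_of_mul_le_mul_left (a3.trans (a1.trans a4)) hr
  have hwe : w * (e / r) ≤ C₂ * e := by
    rw [mul_div_assoc', div_le_iff₀ hr]
    nlinarith
  have hE0 : 0 ≤ e + t * ‖L‖ := by positivity
  have hCs : C₁ * (e + t * ‖L‖) + C₂ * 12 * e
      ≤ (C₁ + C₂ * 12 + C₂ * (4 + d * (12 * N) + 1) + d * c 0 ^ 2 * C₁) * (e + t * ‖L‖) := by
    have : 0 ≤ (C₂ * (4 + d * (12 * N) + 1) + d * c 0 ^ 2 * C₁) * (e + t * ‖L‖) := by positivity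
    have : 0 ≤ C₂ * 12 * (t * ‖L‖) := by positivity
    nlinarith
  refine ⟨fun j l => ?_, fun l => ?_⟩
  · refine le_trans ?_ hCs
    have a1 : projL α x (H j l) = (x j * x l / r ^ 2) • projL α x q
        + projL α x (H j l - (x j * x l / r ^ 2) • q) := by
      rw [← map_smul, ← map_add, add_sub_cancel]
    have a2 : |x j * x l / r ^ 2| ≤ 1 := by
      rw [abs_div, abs_mul, abs_of_nonneg (sq_nonneg r), div_le_one (by positivity), sq]
      exact mul_le_mul (abs_coord_le x j) (abs_coord_le x l) (abs_nonneg _) hr.le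
    have a3 : ‖projL α x (H j l)‖ ≤ ‖projL α x q‖ + 12 * e / r := by
      rw [a1]
      refine (norm_add_le _ _).trans (add_le_add ?_ ((norm_projL_le _ _ _).trans (hrank j l)))
      rw [norm_smul]
      exact mul_le_of_le_one_left (norm_nonneg _) a2
    calc w * ‖projL α x (H j l)‖ ≤ w * (‖projL α x q‖ + 12 * e / r) := by gcongr
      _ = w * ‖projL α x q‖ + 12 * (w * (e / r)) := by ring
      _ ≤ C₁ * (e + t * ‖L‖) + C₂ * 12 * e := by linarith
  · set k := ∑ i, x i • K i with hk
    have a1 : r ^ 2 • K l = x l • k + ∑ i, x i • (x i • K l - x l • K i) := by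
      rw [hk, norm_sq_eq_three x]
      simp only [Fin.sum_univ_three]
      module
    have a2 : r ^ 2 * ‖projL α x (K l)‖ ≤ r * ‖projL α x k‖ + 3 * r * e := by
      have := congrArg (fun v => ‖projL α x v‖) a1
      simp only [map_smul, map_add, norm_smul] at this
      rw [Real.norm_of_nonneg (by positivity)] at this
      rw [this]
      refine (norm_add_le _ _).trans (add_le_add ?_ ((norm_projL_le _ _ _).trans
        (norm_sum_coord_smul_le x _ fun i => h.rot_t i l)))
      rw [norm_smul]
      exact mul_le_mul_of_nonneg_right (abs_coord_le x l) (norm_nonneg _)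
    have a3 : ‖projL α x k‖ ≤ e + t * (c α ^ 2 * ‖projL α x q‖ + N * (12 * e / r) + ‖L‖) := by
      have e1 : k = (t • Z + k) - t • Z := by abel
      rw [e1, map_sub, map_smul]
      refine (norm_sub_le _ _).trans (add_le_add ((norm_projL_le _ _ _).trans h.scal_t) ?_)
      rw [norm_smul, Real.norm_of_nonneg ht]
      gcongr
      have e2 : projL α x Z = c α ^ 2 • projL α x q + (projL α x Z - c α ^ 2 • projL α x q) := by
        abel
      rw [e2]
      refine (norm_add_le _ _).trans ?_
      rw [norm_smul, Real.norm_of_nonneg (by positivity), add_assoc]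
      gcongr
    have a4 : r * ‖projL α x (K l)‖
        ≤ 4 * e + t * (c α ^ 2 * ‖projL α x q‖ + N * (12 * e / r) + ‖L‖) := by
      have : r * (r * ‖projL α x (K l)‖) ≤ r * (‖projL α x k‖ + 3 * e) := by linarith
      have := le_of_mul_le_mul_left this hr
      linarith
    have htr' : t / r ≤ d := by rw [div_le_iff₀ hr]; exact htr
    have a5 : w * ‖projL α x (K l)‖ ≤ (w * (4 * e) + t * (c α ^ 2 * (w * ‖projL α x q‖)
        + N * (12 * (w * (e / r))) + w * ‖L‖)) / r := by
      rw [le_div_iff₀ hr]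
      have := mul_le_mul_of_nonneg_left a4 hw0
      calc w * ‖projL α x (K l)‖ * r = w * (r * ‖projL α x (K l)‖) := by ring
        _ ≤ _ := this
        _ = _ := by ring
    refine a5.trans ?_
    have hcs : c α ^ 2 ≤ c 0 ^ 2 := pow_le_pow_left₀ (hcα α).le (hcle α) 2
    have b1 : t * (c α ^ 2 * (w * ‖projL α x q‖)) / r ≤ d * (c 0 ^ 2 * (C₁ * (e + t * ‖L‖))) := by
      rw [mul_div_right_comm]
      gcongr
    have b2 : t * (N * (12 * (w * (e / r)))) / r ≤ d * (N * (12 * (C₂ * e))) := by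
      rw [mul_div_right_comm]
      gcongr
    have b3 : w * (4 * e) / r ≤ 4 * (C₂ * e) := by
      calc w * (4 * e) / r = 4 * (w * (e / r)) := by ring
        _ ≤ _ := by gcongr
    have b4 : t * (w * ‖L‖) / r ≤ C₂ * (t * ‖L‖) := by
      rw [div_le_iff₀ hr]
      nlinarith [mul_le_mul_of_nonneg_right hwr hL0]
    have b5 : (w * (4 * e) + t * (c α ^ 2 * (w * ‖projL α x q‖) + N * (12 * (w * (e / r)))
        + w * ‖L‖)) / r = w * (4 * e) / r + t * (c α ^ 2 * (w * ‖projL α x q‖)) / r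
          + t * (N * (12 * (w * (e / r)))) / r + t * (w * ‖L‖) / r := by ring
    rw [b5]
    have b6 : (C₁ + C₂ * 12 + C₂ * (4 + d * (12 * N) + 1) + d * c 0 ^ 2 * C₁) * (e + t * ‖L‖)
        = 4 * (C₂ * e) + d * (c 0 ^ 2 * (C₁ * (e + t * ‖L‖))) + d * (N * (12 * (C₂ * e)))
          + C₂ * (t * ‖L‖) + ((C₁ + C₂ * 12) * (e + t * ‖L‖) + C₂ * e
          + C₂ * (4 + d * (12 * N)) * (t * ‖L‖)) := by ring
    have b7 : 0 ≤ (C₁ + C₂ * 12) * (e + t * ‖L‖) + C₂ * e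
        + C₂ * (4 + d * (12 * N)) * (t * ‖L‖) := by positivity
    rw [b6]
    linarith

/-! ### Second derivatives of test fields -/

theorem fderiv_rotA (u : VField) (l : Fin 3) (p : ℝ × E3) :
    fderiv ℝ u p (rotA l p) = angular l u p := by
  have : rotA l p = p.2 (l + 1) • ((0, EuclideanSpace.single (l + 2) 1) : ℝ × E3)
      - p.2 (l + 2) • ((0, EuclideanSpace.single (l + 1) 1) : ℝ × E3) := by
    refine Prod.ext ?_ ?_ <;> simp [rotA]
  rw [this, map_sub, map_smul, map_smul]
  rfl

theorem norm_dir_le_size₁ {k : ℕ} {a : List (Fin 8)} (ha : a.length < k) (u : VField)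
    (v p : ℝ × E3) : ‖dir v (genWord a u) p‖ ≤ dirNorm v * size₁ k u p :=
  (norm_dir_le _ v p).trans
    (mul_le_mul_of_nonneg_left (sum_norm_le_size₁ ha u p) (dirNorm_nonneg v))

/-- The vector fields of the generators, without their matrices, applied to first derivatives. -/
theorem exists_field_le : ∃ C : ℝ, 0 ≤ C ∧ ∀ u, IsTest u → ∀ p i β,
    ‖fderiv ℝ (dir (dirv β) u) p (genV i + genA i p)‖ ≤ C * size₁ 2 u p := by
  set D : Fin 8 → Fin 4 → ℝ := fun i β =>
    dirNorm (dirv β) + dirNorm (genA i (dirv β)) + ‖genM i‖ * dirNorm (dirv β) with hD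
  have hD0 : ∀ i β, 0 ≤ D i β := fun i β => add_nonneg (add_nonneg (dirNorm_nonneg _)
    (dirNorm_nonneg _)) (mul_nonneg (norm_nonneg (genM i)) (dirNorm_nonneg _))
  refine ⟨∑ i, ∑ β, D i β, Finset.sum_nonneg fun i _ => Finset.sum_nonneg fun β _ => hD0 i β,
    fun u hu p i β => ?_⟩
  have e : fderiv ℝ (dir (dirv β) u) p (genV i + genA i p)
      = dir (dirv β) (gen i u) p - dir (genA i (dirv β)) u p - genM i (dir (dirv β) u p) := by
    have e1 := gen_apply i (dir (dirv β) u) p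
    have e2 := congrFun (dir_gen hu i (dirv β)) p
    rw [Pi.add_apply, e1] at e2
    rw [e2]
    abel
  have b1 : ‖dir (dirv β) (gen i u) p‖ ≤ dirNorm (dirv β) * size₁ 2 u p :=
    norm_dir_le_size₁ (a := [i]) (by simp) u _ p
  have b2 : ∀ v, ‖dir v u p‖ ≤ dirNorm v * size₁ 2 u p := fun v =>
    norm_dir_le_size₁ (a := []) (by simp) u v p
  have b3 : ‖genM i (dir (dirv β) u p)‖ ≤ ‖genM i‖ * (dirNorm (dirv β) * size₁ 2 u p) :=
    ((genM i).le_opNorm _).trans (mul_le_mul_of_nonneg_left (b2 _) (norm_nonneg (genM i)))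
  have b4 : ‖fderiv ℝ (dir (dirv β) u) p (genV i + genA i p)‖ ≤ D i β * size₁ 2 u p := by
    rw [e]
    refine (norm_sub_le _ _).trans ((add_le_add ((norm_sub_le _ _).trans
      (add_le_add b1 (b2 _))) b3).trans (le_of_eq ?_))
    rw [hD]; ring
  refine b4.trans (mul_le_mul_of_nonneg_right ?_ (size₁_nonneg _ _ _))
  exact (Finset.single_le_sum (fun β _ => hD0 i β) (Finset.mem_univ β)).trans
    (Finset.single_le_sum (f := fun i => ∑ β, D i β)
      (fun i _ => Finset.sum_nonneg fun β _ => hD0 i β) (Finset.mem_univ i))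

theorem norm_rot_le {w : VField} {p : ℝ × E3} {e : ℝ} (he : 0 ≤ e)
    (h : ∀ l, ‖angular l w p‖ ≤ e) (i j : Fin 3) :
    ‖p.2 i • dX j w p - p.2 j • dX i w p‖ ≤ e := by
  by_cases hij : i = j
  · simpa [hij] using he
  · have h0 := h 0
    have h1 := h 1
    have h2 := h 2
    have r0 := (norm_sub_rev _ _).trans_le h0
    have r1 := (norm_sub_rev _ _).trans_le h1
    have r2 := (norm_sub_rev _ _).trans_le h2
    fin_cases i <;> fin_cases j <;> first | exact absurd rfl hij | assumption

/-- The second derivatives of a test field are controlled by the generators. -/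
theorem exists_secondDerivs : ∃ C : ℝ, 0 ≤ C ∧ ∀ u, IsTest u → ∀ (t : ℝ) (x : E3),
    SecondDerivs t x (C * size₁ 2 u (t, x)) (dT (dT u) (t, x)) (fun l => dT (dX l u) (t, x))
      (fun l m => dX l (dX m u) (t, x)) := by
  obtain ⟨C, hC, h⟩ := exists_field_le
  refine ⟨C, hC, fun u hu t x => ?_⟩
  have he : 0 ≤ C * size₁ 2 u (t, x) := mul_nonneg hC (size₁_nonneg _ _ _)
  have hs : ∀ β, ‖t • dT (dir (dirv β) u) (t, x) + ∑ l, x l • dX l (dir (dirv β) u) (t, x)‖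
      ≤ C * size₁ 2 u (t, x) := fun β => by
    have h7 := h u hu (t, x) 7 β
    have e : (genV 7 + genA 7 (t, x) : ℝ × E3) = (t, x) := by simp [genV, genA]
    rw [e] at h7
    rwa [← dir_eq_sum (dir (dirv β) u) (t, x) (t, x)]
  have ha : ∀ β l, ‖angular l (dir (dirv β) u) (t, x)‖ ≤ C * size₁ 2 u (t, x) := fun β l => by
    rw [← fderiv_rotA]
    have h4 := h u hu (t, x) 4 β
    have h5 := h u hu (t, x) 5 β
    have h6 := h u hu (t, x) 6 β
    fin_cases l
    · simpa [genV, genA] using h4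
    · simpa [genV, genA] using h5
    · simpa [genV, genA] using h6
  have hcomm : ∀ l, dX l (dT u) = dT (dX l u) := fun l => dir_comm hu _ _
  refine ⟨fun l m => congrFun (dir_comm hu _ _) _, ?_, fun m => hs m.succ,
    fun i j m => norm_rot_le he (ha m.succ) i j, fun i j => ?_⟩
  · simp_rw [← hcomm]
    exact hs 0
  · simp_rw [← hcomm]
    exact norm_rot_le he (ha 0) i j

/-! ### The weighted estimate near the time axis -/

/-- Two integrations by parts exchange the directions `v` and `w`; the second derivatives of `G`
cancel and only derivatives of the weight `W` remain. -/
theorem integral_swap {W F G : E3 → ℝ} (hW : ContDiff ℝ ∞ W) (hF : ContDiff ℝ ∞ F)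
    (hG : ContDiff ℝ ∞ G) (hFc : HasCompactSupport F) (v w : E3) :
    ∫ x, W x * (fderiv ℝ F x v * fderiv ℝ G x w - fderiv ℝ F x w * fderiv ℝ G x v)
      = ∫ x, F x * (fderiv ℝ W x w * fderiv ℝ G x v - fderiv ℝ W x v * fderiv ℝ G x w) := by
  have hd : ∀ {g : E3 → ℝ}, ContDiff ℝ ∞ g → ∀ v, ContDiff ℝ ∞ fun x => fderiv ℝ g x v :=
    fun hg v => (hg.fderiv_right (by simp)).clm_apply contDiff_const
  have hdF : ∀ {g : E3 → ℝ}, ContDiff ℝ ∞ g → Differentiable ℝ g :=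
    fun hg => hg.differentiable (by simp)
  have hFd : ∀ v, HasCompactSupport fun x => fderiv ℝ F x v := fun v => hFc.fderiv_apply ℝ v
  have hI : ∀ {g f : E3 → ℝ}, Continuous g → Continuous f → HasCompactSupport f →
      Integrable (fun x => g x * f x) volume := fun hg hf hc =>
    (hg.mul hf).integrable_of_hasCompactSupport hc.mul_left
  have key : ∀ v w : E3, ∫ x, W x * fderiv ℝ G x w * fderiv ℝ F x v
      = -∫ x, (fderiv ℝ W x v * fderiv ℝ G x w
          + W x * fderiv ℝ (fderiv ℝ G) x v w) * F x := by
    intro v w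
    have hP : ContDiff ℝ ∞ fun x => W x * fderiv ℝ G x w := hW.mul (hd hG w)
    have e : ∀ x, fderiv ℝ (fun x => W x * fderiv ℝ G x w) x v
        = fderiv ℝ W x v * fderiv ℝ G x w + W x * fderiv ℝ (fderiv ℝ G) x v w := by
      intro x
      have hG2 : HasFDerivAt (fun x => fderiv ℝ G x w) ((fderiv ℝ (fderiv ℝ G) x).flip w) x := by
        have := ((hG.fderiv_right (m := ∞) (by simp)).differentiable (by simp) x).hasFDerivAt.clm_apply
          (hasFDerivAt_const w x)
        simpa using this
      have hm : HasFDerivAt (fun x => W x * fderiv ℝ G x w) _ x := (hdF hW x).hasFDerivAt.mul hG2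
      rw [hm.fderiv]
      simp
      ring
    have := integral_mul_fderiv_eq_neg_fderiv_mul_of_integrable (μ := (volume : Measure E3))
      (f := fun x => W x * fderiv ℝ G x w) (g := F) (v := v)
      (hI (hd hP v).continuous hF.continuous hFc) (hI hP.continuous (hd hF v).continuous (hFd v))
      (hI hP.continuous hF.continuous hFc) (fun x _ => hdF hP x) (fun x _ => hdF hF x)
    rw [this]
    simp_rw [e]
  have hsymm : ∀ x, fderiv ℝ (fderiv ℝ G) x v w = fderiv ℝ (fderiv ℝ G) x w v := fun x =>
    (hG.contDiffAt.isSymmSndFDerivAt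
      (by simpa using WithTop.coe_le_coe.2 (le_top : (2 : ℕ∞) ≤ ⊤))) v w
  have hG2 : ∀ v w : E3, Continuous fun x => fderiv ℝ (fderiv ℝ G) x v w := fun v w =>
    (((hG.fderiv_right (m := ∞) (by simp)).fderiv_right (m := ∞) (by simp)).clm_apply
      contDiff_const).clm_apply contDiff_const |>.continuous
  have l1 : ∫ x, W x * (fderiv ℝ F x v * fderiv ℝ G x w - fderiv ℝ F x w * fderiv ℝ G x v)
      = (∫ x, W x * fderiv ℝ G x w * fderiv ℝ F x v)
        - ∫ x, W x * fderiv ℝ G x v * fderiv ℝ F x w := by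
    rw [← integral_sub (hI (hW.mul (hd hG w)).continuous (hd hF v).continuous (hFd v))
      (hI (hW.mul (hd hG v)).continuous (hd hF w).continuous (hFd w))]
    exact integral_congr_ae (.of_forall fun x => by ring)
  rw [l1, key v w, key w v, neg_sub_neg, ← integral_sub]
  · refine integral_congr_ae (.of_forall fun x => ?_)
    simp only [hsymm x]
    ring
  · exact hI (((hd hW w).continuous.mul (hd hG v).continuous).add
      (hW.continuous.mul (hG2 w v))) hF.continuous hFc
  · exact hI (((hd hW v).continuous.mul (hd hG w).continuous).add
      (hW.continuous.mul (hG2 v w))) hF.continuous hFc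

/-- The Hilbert–Schmidt norm of the second spatial derivatives at time `t`. -/
def hess (u : VField) (t : ℝ) (x : E3) : ℝ := √(∑ l, ∑ m, ‖dX l (dX m u) (t, x)‖ ^ 2)

theorem hess_nonneg (u : VField) (t : ℝ) (x : E3) : 0 ≤ hess u t x := Real.sqrt_nonneg _

theorem sq_hess (u : VField) (t : ℝ) (x : E3) :
    hess u t x ^ 2 = ∑ l, ∑ m, ‖dX l (dX m u) (t, x)‖ ^ 2 :=
  Real.sq_sqrt (Finset.sum_nonneg fun _ _ => Finset.sum_nonneg fun _ _ => sq_nonneg _)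

theorem norm_dX_dX_le_hess (u : VField) (t : ℝ) (x : E3) (l m : Fin 3) :
    ‖dX l (dX m u) (t, x)‖ ≤ hess u t x := by
  refine Real.le_sqrt_of_sq_le ?_
  exact (Finset.single_le_sum (f := fun m => ‖dX l (dX m u) (t, x)‖ ^ 2)
    (fun _ _ => sq_nonneg _) (Finset.mem_univ m)).trans
    (Finset.single_le_sum (f := fun l => ∑ m, ‖dX l (dX m u) (t, x)‖ ^ 2)
      (fun _ _ => Finset.sum_nonneg fun _ _ => sq_nonneg _) (Finset.mem_univ l))

theorem hess_continuous {u : VField} (hu : IsTest u) (t : ℝ) : Continuous (hess u t) :=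
  Real.continuous_sqrt.comp (continuous_finsetSum _ fun l _ => continuous_finsetSum _ fun m _ =>
    (((hu.dX m).dX l).slice_continuous t).norm.pow 2)

theorem hess_hasCompactSupport {u : VField} (hu : IsTest u) (t : ℝ) :
    HasCompactSupport (hess u t) := by
  refine HasCompactSupport.intro
    (K := ⋃ l : Fin 3, ⋃ m : Fin 3, tsupport fun x : E3 => dX l (dX m u) (t, x))
    (isCompact_iUnion fun l => isCompact_iUnion fun m =>
      (((hu.dX m).dX l).slice_hasCompactSupport t)) fun x hx => ?_
  have h : ∀ l m, dX l (dX m u) (t, x) = 0 := fun l m => by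
    by_contra h
    exact hx (mem_iUnion.2 ⟨l, mem_iUnion.2 ⟨m, subset_tsupport _ h⟩⟩)
  simp [hess, h]

theorem sq_norm_sum_coord_smul_le (x : E3) (v : Fin 3 → E3) :
    ‖∑ i, x i • v i‖ ^ 2 ≤ ‖x‖ ^ 2 * ∑ i, ‖v i‖ ^ 2 := by
  have h1 : ‖∑ i, x i • v i‖ ≤ ∑ i, |x i| * ‖v i‖ :=
    (norm_sum_le _ _).trans (le_of_eq (Finset.sum_congr rfl fun i _ => by
      rw [norm_smul, Real.norm_eq_abs]))
  refine (pow_le_pow_left₀ (norm_nonneg _) h1 2).trans ?_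
  refine (Finset.sum_mul_sq_le_sq_mul_sq _ _ _).trans (le_of_eq ?_)
  rw [EuclideanSpace.norm_sq_eq]
  simp

theorem norm_radial_second_le (u : VField) (t : ℝ) (x : E3) :
    ‖∑ l, x l • ∑ m, x m • dX l (dX m u) (t, x)‖ ≤ ‖x‖ ^ 2 * hess u t x := by
  refine abs_le_of_sq_le_sq' ?_ (mul_nonneg (sq_nonneg _) (hess_nonneg u t x)) |>.2
  refine (sq_norm_sum_coord_smul_le x _).trans ?_
  rw [mul_pow, sq_hess, sq (‖x‖ ^ 2), mul_assoc]
  refine mul_le_mul_of_nonneg_left ?_ (sq_nonneg _)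
  rw [Finset.mul_sum]
  exact Finset.sum_le_sum fun l _ => sq_norm_sum_coord_smul_le x _

/-- The square of the Lamé operator is the square of the full Hessian plus squares plus terms
that vanish on integration by parts, in which two derivatives are exchanged. -/
theorem sq_symbol_eq (a d : ℝ) (H : Fin 3 → Fin 3 → Fin 3 → ℝ) (hH : ∀ l m i, H l m i = H m l i) :
    ∑ i, (a * ∑ l, H l l i + d * ∑ k, H i k k) ^ 2
      = a ^ 2 * ∑ l, ∑ m, ∑ i, H l m i ^ 2 + (2 * a * d + d ^ 2) * ∑ l, (∑ k, H l k k) ^ 2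
        + a ^ 2 * ∑ i, ∑ l, ∑ k, (H l l i * H k k i - H k l i * H l k i)
        + 2 * a * d * ∑ i, ∑ l, ∑ k, (H l l i * H i k k - H i l i * H l k k) := by
  simp only [Fin.sum_univ_three, hH 1 0, hH 2 0, hH 2 1]
  ring

theorem IsTest.contDiff_coord {w : VField} (hw : IsTest w) (t : ℝ) (i : Fin 3) :
    ContDiff ℝ ∞ fun x : E3 => w (t, x) i :=
  (EuclideanSpace.proj i : E3 →L[ℝ] ℝ).contDiff.comp (hw.1.comp (by fun_prop))

theorem IsTest.hasCompactSupport_coord {w : VField} (hw : IsTest w) (t : ℝ) (i : Fin 3) :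
    HasCompactSupport fun x : E3 => w (t, x) i :=
  (hw.slice_hasCompactSupport t).mono fun x hx h => hx (by simp [h])

theorem IsTest.fderiv_coord {w : VField} (hw : IsTest w) (t : ℝ) (i a : Fin 3) (x : E3) :
    fderiv ℝ (fun x : E3 => w (t, x) i) x (EuclideanSpace.single a 1) = PrestressedElastic.dX a w (t, x) i := by
  have h1 : HasFDerivAt (fun y : E3 => (t, y)) (ContinuousLinearMap.inr ℝ ℝ E3) x :=
    hasFDerivAt_prodMk_right t x
  have h2 : HasFDerivAt (fun y : E3 => w (t, y)) _ x :=
    (hw.differentiable (t, x)).hasFDerivAt.comp x h1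
  have h3 : HasFDerivAt (fun y : E3 => w (t, y) i) _ x :=
    (EuclideanSpace.proj i : E3 →L[ℝ] ℝ).hasFDerivAt.comp x h2
  rw [h3.fderiv]
  rfl

theorem lame_coord (c : Fin 2 → ℝ) (u : VField) (p : ℝ × E3) (i : Fin 3) :
    lame c u p i = c 1 ^ 2 * ∑ l, dX l (dX l u) p i
      + (c 0 ^ 2 - c 1 ^ 2) * ∑ k, dX i (dX k u) p k := by
  have e : lame c u p = ∑ a, ∑ b, lameK c a b (dX a (dX b u) p) := by
    simp only [lame, Finset.sum_apply]
  rw [e]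
  simp only [Fin.sum_univ_three, PiLp.add_apply, lameK_apply]
  fin_cases i <;> simp <;> ring

/-- Exchanging two derivatives under the weight `χ²` costs a derivative of `χ` and trades a second
derivative for a first one. -/
theorem abs_integral_swap_le {u : VField} (hu : IsTest u) (t : ℝ) {χ : E3 → ℝ} {B : ℝ}
    (hχ : ContDiff ℝ ∞ χ) (hχ0 : ∀ x, 0 ≤ χ x) (hB : ∀ x, ‖fderiv ℝ χ x‖ ≤ B)
    (a b l k i j : Fin 3) :
    |∫ x, χ x ^ 2 * (dX a (dX l u) (t, x) i * dX b (dX k u) (t, x) j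
        - dX b (dX l u) (t, x) i * dX a (dX k u) (t, x) j)|
      ≤ ∫ x, 4 * B * (size₁ 2 u (t, x) * (χ x * hess u t x)) := by
  have h := integral_swap (hχ.pow 2) ((hu.dX l).contDiff_coord t i) ((hu.dX k).contDiff_coord t j)
    ((hu.dX l).hasCompactSupport_coord t i) (EuclideanSpace.single a 1) (EuclideanSpace.single b 1)
  simp only [IsTest.fderiv_coord (hu.dX l), IsTest.fderiv_coord (hu.dX k)] at h
  rw [h]
  have hB0 : 0 ≤ B := (norm_nonneg _).trans (hB 0)
  refine abs_integral_le_integral_abs.trans (integral_mono_of_nonneg (.of_forall fun _ => abs_nonneg _) ?_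
    (.of_forall fun x => ?_))
  · refine Continuous.integrable_of_hasCompactSupport ?_ ?_
    · exact continuous_const.mul ((((size₁_continuous 2 hu).comp (by fun_prop : Continuous fun x : E3 => (t, x)))).mul
        (hχ.continuous.mul (hess_continuous hu t)))
    · exact (((hess_hasCompactSupport hu t).mul_left).mul_left).mul_left
  · have hW : ∀ c : Fin 3, |fderiv ℝ (fun x => χ x ^ 2) x (EuclideanSpace.single c 1)| ≤ 2 * χ x * B := by
      intro c
      have h1 : HasFDerivAt (fun x => χ x ^ 2) _ x :=
        ((hχ.differentiable (by simp) x).hasFDerivAt).pow 2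
      rw [h1.fderiv]
      have h2 : |fderiv ℝ χ x (EuclideanSpace.single c 1)| ≤ B :=
        ((fderiv ℝ χ x).le_opNorm _).trans (by simpa using hB x)
      simp [abs_mul, abs_of_nonneg (hχ0 x)]
      have := hχ0 x
      gcongr
    have hF : |dX l u (t, x) i| ≤ size₁ 2 u (t, x) :=
      (abs_coord_le _ i).trans (norm_le_size₁ (a := []) (by simp) l.succ u _)
    have hG : ∀ c : Fin 3, |dX c (dX k u) (t, x) j| ≤ hess u t x := fun c =>
      (abs_coord_le _ j).trans (norm_dX_dX_le_hess u t x c k)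
    have hh := hess_nonneg u t x
    have hc := hχ0 x
    have hs := size₁_nonneg 2 u (t, x)
    simp only [abs_mul]
    calc _ ≤ size₁ 2 u (t, x) * (2 * χ x * B * hess u t x + 2 * χ x * B * hess u t x) := by
          refine mul_le_mul hF ((abs_sub _ _).trans (add_le_add ?_ ?_)) (abs_nonneg _) hs
          · rw [abs_mul]
            exact mul_le_mul (hW b) (hG a) (abs_nonneg _) (by positivity)
          · rw [abs_mul]
            exact mul_le_mul (hW a) (hG b) (abs_nonneg _) (by positivity)
      _ = _ := by ring

/-- Gårding's inequality with a cutoff, in divergence form: the second derivatives can be exchanged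
at the expense of first derivatives. -/
theorem exists_cutoff_coercive (c : Fin 2 → ℝ) (h1 : 0 < c 1) (h01 : c 1 < c 0) :
    ∃ M : ℝ, 0 ≤ M ∧ ∀ u, IsTest u → ∀ (t : ℝ) (χ : E3 → ℝ) (B : ℝ), ContDiff ℝ ∞ χ →
      (∀ x, 0 ≤ χ x) → (∀ x, ‖fderiv ℝ χ x‖ ≤ B) →
      ∫ x, c 1 ^ 4 * (χ x ^ 2 * hess u t x ^ 2)
        ≤ ∫ x, (χ x ^ 2 * ‖lame c u (t, x)‖ ^ 2
          + M * (4 * B * (size₁ 2 u (t, x) * (χ x * hess u t x)))) := by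
  set a := c 1 ^ 2 with ha
  set d := c 0 ^ 2 - c 1 ^ 2 with hd
  have hd0 : 0 ≤ d := by rw [hd]; nlinarith
  have ha0 : 0 ≤ a := sq_nonneg _
  refine ⟨27 * a ^ 2 + 27 * (2 * a * d), by positivity, fun u hu t χ B hχ hχ0 hB => ?_⟩
  set S : Fin 3 → Fin 3 → Fin 3 → Fin 3 → Fin 3 → Fin 3 → E3 → ℝ := fun p b l k i j x =>
    χ x ^ 2 * (dX p (dX l u) (t, x) i * dX b (dX k u) (t, x) j
        - dX b (dX l u) (t, x) i * dX p (dX k u) (t, x) j) with hS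
  set P := ∫ x, 4 * B * (size₁ 2 u (t, x) * (χ x * hess u t x)) with hP
  have hSle : ∀ p b l k i j, -P ≤ ∫ x, S p b l k i j x := fun p b l k i j =>
    (abs_le.1 (abs_integral_swap_le hu t hχ hχ0 hB p b l k i j)).1
  have hco : ∀ l m i, Continuous fun x : E3 => dX l (dX m u) (t, x) i := fun l m i =>
    (((hu.dX m).dX l).contDiff_coord t i).continuous
  have hcs : ∀ l m i, HasCompactSupport fun x : E3 => dX l (dX m u) (t, x) i := fun l m i =>
    (((hu.dX m).dX l).hasCompactSupport_coord t i)
  have hSI : ∀ p b l k i j, Integrable (S p b l k i j) volume := fun p b l k i j => by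
    refine Continuous.integrable_of_hasCompactSupport
      ((hχ.continuous.pow 2).mul (((hco _ _ _).mul (hco _ _ _)).sub ((hco _ _ _).mul (hco _ _ _)))) ?_
    exact HasCompactSupport.mul_left (((hcs p l i).mul_right).sub ((hcs b l i).mul_right))
  have hsz : Continuous fun x : E3 => size₁ 2 u (t, x) :=
    (size₁_continuous 2 hu).comp (by fun_prop)
  have hHI : Integrable (fun x => c 1 ^ 4 * (χ x ^ 2 * hess u t x ^ 2)) volume := by
    refine Continuous.integrable_of_hasCompactSupport
      (continuous_const.mul ((hχ.continuous.pow 2).mul ((hess_continuous hu t).pow 2))) ?_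
    exact ((hess_hasCompactSupport hu t).comp_left (g := fun y => y ^ 2) (by simp)).mul_left.mul_left
  have hLI : Integrable (fun x => χ x ^ 2 * ‖lame c u (t, x)‖ ^ 2) volume := by
    refine Continuous.integrable_of_hasCompactSupport
      ((hχ.continuous.pow 2).mul (((hu.lame c).slice_continuous t).norm.pow 2)) ?_
    exact (((hu.lame c).slice_hasCompactSupport t).comp_left (g := fun y => ‖y‖ ^ 2)
      (by simp)).mul_left
  have hPI : Integrable (fun x => 4 * B * (size₁ 2 u (t, x) * (χ x * hess u t x))) volume := by
    refine Continuous.integrable_of_hasCompactSupport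
      (continuous_const.mul (hsz.mul (hχ.continuous.mul (hess_continuous hu t)))) ?_
    exact (((hess_hasCompactSupport hu t).mul_left).mul_left).mul_left
  -- the terms of `sq_symbol_eq` that integration by parts removes up to lower order
  set R : E3 → ℝ := fun x => a ^ 2 * ∑ i, ∑ l, ∑ k, S l k l k i i x
    + 2 * a * d * ∑ i, ∑ l, ∑ k, S l i l k i k x with hR
  have hI1 : Integrable (fun x => ∑ i, ∑ l, ∑ k, S l k l k i i x) volume :=
    integrable_finsetSum _ fun i _ => integrable_finsetSum _ fun l _ =>
      integrable_finsetSum _ fun k _ => hSI _ _ _ _ _ _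
  have hI2 : Integrable (fun x => ∑ i, ∑ l, ∑ k, S l i l k i k x) volume :=
    integrable_finsetSum _ fun i _ => integrable_finsetSum _ fun l _ =>
      integrable_finsetSum _ fun k _ => hSI _ _ _ _ _ _
  have hRI : Integrable R volume := (hI1.const_mul _).add (hI2.const_mul _)
  -- each of the two sums has `27` terms, one for each triple of indices
  have hRle : -((27 * a ^ 2 + 27 * (2 * a * d)) * P) ≤ ∫ x, R x := by
    rw [hR, integral_add (hI1.const_mul _) (hI2.const_mul _), integral_const_mul,
      integral_const_mul, integral_finsetSum _ fun i _ => integrable_finsetSum _ fun l _ =>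
        integrable_finsetSum _ fun k _ => hSI _ _ _ _ _ _,
      integral_finsetSum _ fun i _ => integrable_finsetSum _ fun l _ =>
        integrable_finsetSum _ fun k _ => hSI _ _ _ _ _ _]
    have e : ∀ F : Fin 3 → Fin 3 → Fin 3 → E3 → ℝ, (∀ i l k, Integrable (F i l k) volume) →
        (∀ i l k, -P ≤ ∫ x, F i l k x) → -(27 * P) ≤ ∑ i, ∫ x, ∑ l, ∑ k, F i l k x := by
      intro F hF hFP
      have e1 : ∀ i, ∫ x, ∑ l, ∑ k, F i l k x = ∑ l, ∑ k, ∫ x, F i l k x := fun i => by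
        rw [integral_finsetSum _ fun l _ => integrable_finsetSum _ fun k _ => hF i l k]
        exact Finset.sum_congr rfl fun l _ => integral_finsetSum _ fun k _ => hF i l k
      simp_rw [e1]
      calc -(27 * P) = ∑ _i : Fin 3, ∑ _l : Fin 3, ∑ _k : Fin 3, -P := by simp; ring
        _ ≤ _ := Finset.sum_le_sum fun i _ => Finset.sum_le_sum fun l _ =>
          Finset.sum_le_sum fun k _ => hFP i l k
    have e1 := e (fun i l k => S l k l k i i) (fun _ _ _ => hSI _ _ _ _ _ _)
      fun _ _ _ => hSle _ _ _ _ _ _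
    have e2 := e (fun i l k => S l i l k i k) (fun _ _ _ => hSI _ _ _ _ _ _)
      fun _ _ _ => hSle _ _ _ _ _ _
    have e3 := mul_le_mul_of_nonneg_left e1 (sq_nonneg a)
    have e4 := mul_le_mul_of_nonneg_left e2 (by positivity : 0 ≤ 2 * a * d)
    linarith
  -- pointwise the square of the Lamé operator dominates `c₂⁴` times that of the Hessian, up to `R`
  have hpt : ∀ x, c 1 ^ 4 * (χ x ^ 2 * hess u t x ^ 2) + R x
      ≤ χ x ^ 2 * ‖lame c u (t, x)‖ ^ 2 := by
    intro x
    have hsy : ∀ l m i, dX l (dX m u) (t, x) i = dX m (dX l u) (t, x) i := fun l m i => by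
      rw [show dX l (dX m u) = dX m (dX l u) from dir_comm hu _ _]
    have e1 : ‖lame c u (t, x)‖ ^ 2 = ∑ i, (a * ∑ l, dX l (dX l u) (t, x) i
        + d * ∑ k, dX i (dX k u) (t, x) k) ^ 2 := by
      rw [EuclideanSpace.norm_sq_eq]
      exact Finset.sum_congr rfl fun i _ => by rw [lame_coord, Real.norm_eq_abs, sq_abs]
    have e2 : hess u t x ^ 2 = ∑ l, ∑ m, ∑ i, dX l (dX m u) (t, x) i ^ 2 := by
      rw [sq_hess]
      exact Finset.sum_congr rfl fun l _ => Finset.sum_congr rfl fun m _ => by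
        rw [EuclideanSpace.norm_sq_eq]
        simp
    have e3 := sq_symbol_eq a d (fun l m i => dX l (dX m u) (t, x) i) hsy
    have e4 : R x = χ x ^ 2 * (a ^ 2 * ∑ i, ∑ l, ∑ k, (dX l (dX l u) (t, x) i * dX k (dX k u) (t, x) i
          - dX k (dX l u) (t, x) i * dX l (dX k u) (t, x) i)
        + 2 * a * d * ∑ i, ∑ l, ∑ k, (dX l (dX l u) (t, x) i * dX i (dX k u) (t, x) k
          - dX i (dX l u) (t, x) i * dX l (dX k u) (t, x) k)) := by
      simp only [hR, hS, ← Finset.mul_sum]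
      ring
    have e5 : 0 ≤ χ x ^ 2 * ((2 * a * d + d ^ 2) * ∑ l, (∑ k, dX l (dX k u) (t, x) k) ^ 2) :=
      mul_nonneg (sq_nonneg _) (mul_nonneg (by positivity)
        (Finset.sum_nonneg fun _ _ => sq_nonneg _))
    have e6 : c 1 ^ 4 = a ^ 2 := by rw [ha]; ring
    rw [e1, e2, e3, e4, e6]
    linarith
  have hint := integral_mono (hHI.add hRI) hLI hpt
  rw [integral_add' hHI hRI] at hint
  have hMP : ∫ x, (27 * a ^ 2 + 27 * (2 * a * d)) * (4 * B * (size₁ 2 u (t, x) * (χ x * hess u t x)))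
      = (27 * a ^ 2 + 27 * (2 * a * d)) * P := integral_const_mul _ _
  rw [integral_add hLI (hPI.const_mul _), hMP]
  linarith

theorem memLp_size₁ {c : Fin 2 → ℝ} (h1 : 0 < c 1) (h01 : c 1 < c 0) (k : ℕ) {u : VField}
    (hu : IsTest u) (t : ℝ) : MemLp (fun x : E3 => size₁ k u (t, x)) 2 volume := by
  obtain ⟨C, _, h⟩ := exists_eLpNorm_size₁_le h1 h01 k
  have hc : Continuous fun x : E3 => size₁ k u (t, x) :=
    (size₁_continuous k hu).comp (by fun_prop)
  exact ⟨hc.aestronglyMeasurable, (h u hu t).trans_lt ENNReal.ofReal_lt_top⟩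

theorem ofReal_integral_sq {g : E3 → ℝ} (hg : MemLp g 2 volume) :
    ENNReal.ofReal (∫ x, g x ^ 2) = eLpNorm g 2 volume ^ 2 := by
  rw [← lintegral_sq_eq, ofReal_integral_eq_lintegral_ofReal hg.integrable_sq
    (.of_forall fun _ => sq_nonneg _)]

/-- Gårding's inequality near the time axis, where scaling makes the second time derivative small
compared to the second spatial derivatives. -/
theorem exists_inner_sq_le (c : Fin 2 → ℝ) (h1 : 0 < c 1) (h01 : c 1 < c 0) :
    ∃ K : ℝ, 0 ≤ K ∧ ∀ u, IsTest u → ∀ t : ℝ, 0 < t → ∃ χ : E3 → ℝ, Continuous χ ∧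
      (∀ x, 0 ≤ χ x) ∧ (∀ x, ‖x‖ < c 1 / 4 * t → χ x = 1) ∧
      ∫ x, (t * (χ x * hess u t x)) ^ 2
        ≤ K * ((∫ x, size₁ 2 u (t, x) ^ 2) + t ^ 2 * ∫ x, ‖waveOp c u (t, x)‖ ^ 2) := by
  obtain ⟨M, hM, hcoer⟩ := exists_cutoff_coercive c h1 h01
  obtain ⟨Cs, hCs, hsec⟩ := exists_secondDerivs
  set δ := c 1 / 4 with hδ
  have hδ0 : 0 < δ := by positivity
  -- the cutoff is a fixed bump function scaled by `t`, so that its gradient is of order `1 / t`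
  let f : ContDiffBump (0 : E3) := ⟨δ, 2 * δ, hδ0, by linarith⟩
  have hfd : ContDiff ℝ ∞ (f : E3 → ℝ) := f.contDiff
  obtain ⟨B₀, hB₀⟩ := (f.hasCompactSupport.fderiv (𝕜 := ℝ)).exists_bound_of_continuous
    (hfd.fderiv_right (m := ∞) (by simp)).continuous
  have hB₀0 : 0 ≤ B₀ := (norm_nonneg _).trans (hB₀ 0)
  set K₁ := (1 + 6 * δ) * Cs with hK₁
  set K₂ := 3 * K₁ ^ 2 + (4 * M * B₀) ^ 2 / c 1 ^ 4 with hK₂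
  have hK₁0 : 0 ≤ K₁ := by positivity
  have hK₂0 : 0 ≤ K₂ := by positivity
  refine ⟨16 / (9 * c 1 ^ 4) * (K₂ + 3), by positivity, fun u hu t ht => ?_⟩
  have htn : t ≠ 0 := ht.ne'
  have hlin : ContDiff ℝ ∞ fun x : E3 => t⁻¹ • x := by fun_prop
  set χ : E3 → ℝ := fun x => f (t⁻¹ • x) with hχ
  have hχd : ContDiff ℝ ∞ χ := hfd.comp hlin
  have hχ0 : ∀ x, 0 ≤ χ x := fun x => f.nonneg
  have hχ1 : ∀ x, χ x ≤ 1 := fun x => f.le_one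
  have hnorm : ∀ x : E3, ‖t⁻¹ • x‖ = ‖x‖ / t := fun x => by
    rw [norm_smul, norm_inv, Real.norm_of_nonneg ht.le]; ring
  have hχB : ∀ x, ‖fderiv ℝ χ x‖ ≤ B₀ / t := fun x => by
    have hd : HasFDerivAt χ ((fderiv ℝ (f : E3 → ℝ) (t⁻¹ • x)).comp
        (t⁻¹ • ContinuousLinearMap.id ℝ E3)) x :=
      ((hfd.differentiable (by simp) _).hasFDerivAt).comp x
        ((t⁻¹ • ContinuousLinearMap.id ℝ E3).hasFDerivAt)
    rw [hd.fderiv]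
    refine (ContinuousLinearMap.opNorm_comp_le _ _).trans ?_
    rw [norm_smul, norm_inv, Real.norm_of_nonneg ht.le, div_eq_mul_inv]
    refine mul_le_mul (hB₀ _) ?_ (mul_nonneg (inv_nonneg.2 ht.le) (norm_nonneg _)) hB₀0
    exact mul_le_of_le_one_right (inv_nonneg.2 ht.le) ContinuousLinearMap.norm_id_le
  refine ⟨χ, hχd.continuous, hχ0, fun x hx => f.one_of_mem_closedBall ?_, ?_⟩
  · rw [mem_closedBall_zero_iff, hnorm, div_le_iff₀ ht]
    exact hx.le
  have hs2 : Integrable (fun x => size₁ 2 u (t, x) ^ 2) volume :=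
    (memLp_size₁ h1 h01 2 hu t).integrable_sq
  have hW2 : Integrable (fun x => ‖waveOp c u (t, x)‖ ^ 2) volume :=
    ((hu.waveOp c).memLp t).norm.integrable_sq
  have hH2 : Integrable (fun x => χ x ^ 2 * hess u t x ^ 2) volume := by
    refine Continuous.integrable_of_hasCompactSupport
      ((hχd.continuous.pow 2).mul ((hess_continuous hu t).pow 2)) ?_
    exact ((hess_hasCompactSupport hu t).comp_left (g := fun y => y ^ 2) (by simp)).mul_left
  -- the coefficient `7 / 16` is `3 / 16` from the time derivatives and `1 / 4` from the cutoff;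
  -- being less than one, it lets the Hessian be absorbed
  have hpt : ∀ x, χ x ^ 2 * ‖lame c u (t, x)‖ ^ 2
      + M * (4 * (B₀ / t) * (size₁ 2 u (t, x) * (χ x * hess u t x)))
      ≤ 7 / 16 * c 1 ^ 4 * (χ x ^ 2 * hess u t x ^ 2) + (K₂ / t ^ 2 * size₁ 2 u (t, x) ^ 2
        + 3 * ‖waveOp c u (t, x)‖ ^ 2) := by
    intro x
    set s := size₁ 2 u (t, x) with hs
    set h := hess u t x with hh
    set W := waveOp c u (t, x) with hW
    have hs0 : 0 ≤ s := size₁_nonneg _ _ _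
    have hh0 : 0 ≤ h := hess_nonneg _ _ _
    -- on the support of the cutoff `|x| ≤ c₂ t / 2`, hence `|x|² / t² ≤ c₂² / 4`, and scaling bounds
    -- `∂ₜ²u` by this factor times the Hessian
    have b1 : χ x * ‖lame c u (t, x)‖ ≤ c 1 ^ 2 / 4 * (χ x * h) + K₁ * (s / t) + ‖W‖ := by
      by_cases hx : χ x = 0
      · rw [hx, zero_mul, zero_mul, mul_zero, zero_add]
        positivity
      have hxr : ‖x‖ ≤ 2 * δ * t := by
        have : t⁻¹ • x ∈ Function.support (f : E3 → ℝ) := hx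
        rw [f.support_eq, mem_ball_zero_iff, hnorm, div_lt_iff₀ ht] at this
        exact this.le
      have r1 := (hsec u hu t x).time_radial ht.le
      have r2 := norm_radial_second_le u t x
      have r3 : t ^ 2 * ‖dT (dT u) (t, x)‖ ≤ ‖x‖ ^ 2 * h + (t + 3 * ‖x‖) * (Cs * s) := by
        have e : t ^ 2 • dT (dT u) (t, x) = (t ^ 2 • dT (dT u) (t, x)
            - ∑ l, x l • ∑ m, x m • dX l (dX m u) (t, x))
            + ∑ l, x l • ∑ m, x m • dX l (dX m u) (t, x) := by abel
        have := congrArg norm e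
        rw [norm_smul, Real.norm_of_nonneg (sq_nonneg t)] at this
        rw [this]
        refine (norm_add_le _ _).trans ?_
        linarith
      have r4 : t ^ 2 * ‖dT (dT u) (t, x)‖ ≤ t ^ 2 * (c 1 ^ 2 / 4 * h + K₁ * (s / t)) := by
        refine r3.trans ?_
        have e1 : ‖x‖ ^ 2 * h ≤ (2 * δ * t) ^ 2 * h := by gcongr
        have e2 : (t + 3 * ‖x‖) * (Cs * s) ≤ (t + 3 * (2 * δ * t)) * (Cs * s) := by gcongr
        have e3 : t ^ 2 * (c 1 ^ 2 / 4 * h + K₁ * (s / t))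
            = (2 * δ * t) ^ 2 * h + (t + 3 * (2 * δ * t)) * (Cs * s) := by
          rw [hK₁, hδ]; field_simp; ring
        linarith
      have r5 := le_of_mul_le_mul_left r4 (by positivity)
      have r6 : ‖lame c u (t, x)‖ ≤ ‖dT (dT u) (t, x)‖ + ‖W‖ := by
        have : lame c u (t, x) = dT (dT u) (t, x) - W := by
          rw [hW, waveOp, Pi.sub_apply]; abel
        rw [this]
        exact norm_sub_le _ _
      have r7 : χ x * (K₁ * (s / t) + ‖W‖) ≤ K₁ * (s / t) + ‖W‖ :=
        mul_le_of_le_one_left (by positivity) (hχ1 x)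
      have r8 := mul_le_mul_of_nonneg_left (r6.trans (add_le_add_left r5 ‖W‖)) (hχ0 x)
      linarith
    have b2 : χ x ^ 2 * ‖lame c u (t, x)‖ ^ 2
        ≤ 3 * ((c 1 ^ 2 / 4 * (χ x * h)) ^ 2 + (K₁ * (s / t)) ^ 2 + ‖W‖ ^ 2) := by
      rw [← mul_pow]
      refine (pow_le_pow_left₀ (mul_nonneg (hχ0 x) (norm_nonneg _)) b1 2).trans ?_
      nlinarith [sq_nonneg (c 1 ^ 2 / 4 * (χ x * h) - K₁ * (s / t)),
        sq_nonneg (c 1 ^ 2 / 4 * (χ x * h) - ‖W‖), sq_nonneg (K₁ * (s / t) - ‖W‖)]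
    -- the inequality of the means, with a small weight on the Hessian
    have b3 : M * (4 * (B₀ / t) * (s * (χ x * h)))
        ≤ c 1 ^ 4 / 4 * (χ x * h) ^ 2 + (4 * M * B₀) ^ 2 / c 1 ^ 4 * (s / t) ^ 2 := by
      have e1 : (c 1 ^ 2 / 2 * (χ x * h) - 4 * M * B₀ / c 1 ^ 2 * (s / t)) ^ 2
          = c 1 ^ 4 / 4 * (χ x * h) ^ 2 + (4 * M * B₀) ^ 2 / c 1 ^ 4 * (s / t) ^ 2
            - M * (4 * (B₀ / t) * (s * (χ x * h))) := by
        field_simp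
        ring
      linarith [sq_nonneg (c 1 ^ 2 / 2 * (χ x * h) - 4 * M * B₀ / c 1 ^ 2 * (s / t))]
    have e : K₂ / t ^ 2 * s ^ 2 = 3 * (K₁ * (s / t)) ^ 2
        + (4 * M * B₀) ^ 2 / c 1 ^ 4 * (s / t) ^ 2 := by
      rw [hK₂]; field_simp
    rw [e]
    nlinarith
  have hc := hcoer u hu t χ (B₀ / t) hχd hχ0 hχB
  have hmono := hc.trans (integral_mono_of_nonneg (.of_forall fun x => add_nonneg
    (mul_nonneg (sq_nonneg _) (sq_nonneg _)) (mul_nonneg hM (mul_nonneg (by positivity)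
      (mul_nonneg (size₁_nonneg _ _ _) (mul_nonneg (hχ0 x) (hess_nonneg _ _ _))))))
    ((hH2.const_mul _).add ((hs2.const_mul _).add (hW2.const_mul _))) (.of_forall hpt))
  rw [integral_const_mul, integral_add' (hH2.const_mul _) ((hs2.const_mul _).add (hW2.const_mul _)),
    integral_add' (hs2.const_mul _) (hW2.const_mul _), integral_const_mul, integral_const_mul,
    integral_const_mul] at hmono
  have hI : ∫ x, (t * (χ x * hess u t x)) ^ 2 = t ^ 2 * ∫ x, χ x ^ 2 * hess u t x ^ 2 := by
    rw [← integral_const_mul]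
    exact integral_congr_ae (.of_forall fun x => by ring)
  rw [hI]
  set I := ∫ x, χ x ^ 2 * hess u t x ^ 2
  set A := ∫ x, size₁ 2 u (t, x) ^ 2 with hA
  set D := ∫ x, ‖waveOp c u (t, x)‖ ^ 2 with hD
  have hA0 : 0 ≤ A := integral_nonneg fun _ => sq_nonneg _
  have hD0 : 0 ≤ D := integral_nonneg fun _ => sq_nonneg _
  have e1 : 9 / 16 * c 1 ^ 4 * I ≤ K₂ / t ^ 2 * A + 3 * D := by linarith
  have e2 : t ^ 2 * (9 / 16 * c 1 ^ 4 * I) ≤ K₂ * A + 3 * (t ^ 2 * D) := by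
    refine (mul_le_mul_of_nonneg_left e1 (sq_nonneg t)).trans (le_of_eq ?_)
    field_simp
  have e3 : t ^ 2 * I = 16 / (9 * c 1 ^ 4) * (t ^ 2 * (9 / 16 * c 1 ^ 4 * I)) := by field_simp
  rw [e3, mul_assoc _ (K₂ + 3)]
  refine mul_le_mul_of_nonneg_left (e2.trans ?_) (by positivity)
  nlinarith [mul_nonneg (sq_nonneg t) hD0]

/-- The square root of `exists_inner_sq_le`; at the initial time both sides carry the factor `t`. -/
theorem exists_inner_le (c : Fin 2 → ℝ) (h1 : 0 < c 1) (h01 : c 1 < c 0) :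
    ∃ K : ℝ, 0 ≤ K ∧ ∀ u, IsTest u → ∀ t : ℝ, 0 ≤ t → ∃ χ : E3 → ℝ, Continuous χ ∧
      (∀ x, 0 ≤ χ x) ∧ (∀ x, ‖x‖ < c 1 / 4 * t → χ x = 1) ∧
      eLpNorm (fun x => t * (χ x * hess u t x)) 2 volume
        ≤ ENNReal.ofReal K * (eLpNorm (fun x => size₁ 2 u (t, x)) 2 volume
          + ENNReal.ofReal t * eLpNorm (fun x => waveOp c u (t, x)) 2 volume) := by
  obtain ⟨K, hK, h⟩ := exists_inner_sq_le c h1 h01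
  refine ⟨√K, Real.sqrt_nonneg _, fun u hu t ht => ?_⟩
  rcases ht.eq_or_lt with rfl | ht
  · refine ⟨fun _ => 1, continuous_const, fun _ => zero_le_one, fun _ _ => rfl, ?_⟩
    simp
  obtain ⟨χ, hχ, hχ0, hχ1, hle⟩ := h u hu t ht
  refine ⟨χ, hχ, hχ0, hχ1, ?_⟩
  have hm : MemLp (fun x => t * (χ x * hess u t x)) 2 volume :=
    (continuous_const.mul (hχ.mul (hess_continuous hu t))).memLp_of_hasCompactSupport
      (hess_hasCompactSupport hu t).mul_left.mul_left
  have hs := memLp_size₁ h1 h01 2 hu t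
  have hW := ((hu.waveOp c).memLp t).norm
  rw [← ENNReal.pow_le_pow_left_iff two_ne_zero, ← ofReal_integral_sq hm]
  refine (ENNReal.ofReal_le_ofReal hle).trans ?_
  have hA0 : 0 ≤ ∫ x, size₁ 2 u (t, x) ^ 2 := integral_nonneg fun _ => sq_nonneg _
  have hD0 : 0 ≤ ∫ x, ‖waveOp c u (t, x)‖ ^ 2 := integral_nonneg fun _ => sq_nonneg _
  rw [ENNReal.ofReal_mul hK, ENNReal.ofReal_add hA0 (by positivity), ENNReal.ofReal_mul (sq_nonneg t),
    ofReal_integral_sq hs, ofReal_integral_sq hW, eLpNorm_norm, ENNReal.ofReal_pow ht.le, mul_pow,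
    ← ENNReal.ofReal_pow (Real.sqrt_nonneg K), Real.sq_sqrt hK, ← mul_pow]
  refine mul_le_mul_right ?_ _
  rw [add_sq]
  gcongr
  exact le_self_add

theorem sqrt_one_add_sq_le (w : ℝ) : √(1 + w ^ 2) ≤ 1 + |w| := by
  rw [Real.sqrt_le_left (by positivity)]
  nlinarith [abs_nonneg w, sq_abs w]

/-- The weighted second derivatives, pointwise: outside the cone `|x| < c₂ t / 4` by
`exists_outer_bound`, inside it by the Hessian, where the cutoff equals one. -/
theorem exists_weighted_pointwise (c : Fin 2 → ℝ) (h1 : 0 < c 1) (h01 : c 1 < c 0) :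
    ∃ C : ℝ, 0 ≤ C ∧ ∀ u, IsTest u → ∀ t : ℝ, 0 ≤ t → ∀ χ : E3 → ℝ, (∀ x, 0 ≤ χ x) →
      (∀ x, ‖x‖ < c 1 / 4 * t → χ x = 1) → ∀ α β l (x : E3), x ≠ 0 →
      √(1 + (c α * t - ‖x‖) ^ 2) * ‖projL α x (dir (dirv β) (dX l u) (t, x))‖
        ≤ C * (size₁ 2 u (t, x) + t * ‖waveOp c u (t, x)‖ + t * (χ x * hess u t x)) := by
  have hδ : 0 < c 1 / 4 := by positivity
  obtain ⟨C₁, hC₁, hout⟩ := exists_outer_bound c h1 h01 hδ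
  obtain ⟨Cs, hCs, hsec⟩ := exists_secondDerivs
  have h0 : 0 < c 0 := h1.trans h01
  set D := c 0 + c 1 / 4 with hD
  have hD0 : 0 < D := by positivity
  set N := D * (1 + Cs + 3 * (c 1 / 4)) with hN
  have hN0 : 0 ≤ N := by positivity
  refine ⟨1 + (C₁ * (Cs + 1) + N), by positivity, fun u hu t ht χ hχ0 hχ1 α β l x hx => ?_⟩
  have hs := hsec u hu t x
  set s := size₁ 2 u (t, x)
  set h := hess u t x
  set W := waveOp c u (t, x) with hW
  set V := dir (dirv β) (dX l u) (t, x) with hV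
  have hs0 : 0 ≤ s := size₁_nonneg _ _ _
  have hh0 : 0 ≤ h := hess_nonneg _ _ _
  have hc0 := hχ0 x
  have hR0 : 0 ≤ s + t * ‖W‖ + t * (χ x * h) := by positivity
  have hVs : ‖V‖ ≤ s := by
    have := norm_le_size₁ (k := 2) (a := [xIdx l]) (by simp) β u (t, x)
    simp only [genWord, gen_xIdx] at this
    exact this
  have key : |c α * t - ‖x‖| * ‖projL α x V‖
      ≤ (C₁ * (Cs + 1) + N) * (s + t * ‖W‖ + t * (χ x * h)) := by
    by_cases hrt : c 1 / 4 * t ≤ ‖x‖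
    · have hL : dT (dT u) (t, x) - ∑ a, ∑ b, lameK c a b (dX a (dX b u) (t, x)) = W := by
        rw [hW, waveOp, Pi.sub_apply, lame]
        simp only [Finset.sum_apply]
      have ho := hout t x _ _ _ _ W hs ht hx hrt hL α
      have hb : |c α * t - ‖x‖| * ‖projL α x V‖ ≤ C₁ * (Cs * s + t * ‖W‖) := by
        revert hV
        refine Fin.cases ?_ (fun j => ?_) β
        · intro hV
          rw [hV]
          exact ho.2 l
        · intro hV
          rw [hV]
          exact ho.1 j l
      refine hb.trans ?_
      have p1 : 0 ≤ N * (s + t * ‖W‖ + t * (χ x * h)) := by positivity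
      have p2 : 0 ≤ C₁ * (s + Cs * (t * ‖W‖) + (Cs + 1) * (t * (χ x * h))) := by positivity
      linarith
    · push Not at hrt
      rw [hχ1 x hrt, one_mul]
      have hw : |c α * t - ‖x‖| ≤ D * t := by
        have hcα : 0 < c α ∧ c α ≤ c 0 := by
          fin_cases α
          exacts [⟨h0, le_rfl⟩, ⟨h1, h01.le⟩]
        have := norm_nonneg x
        have := mul_le_mul_of_nonneg_right hcα.2 ht
        have := mul_nonneg hcα.1.le ht
        rw [abs_le, hD]
        constructor <;> nlinarith
      have htV : t * ‖V‖ ≤ (1 + Cs + 3 * (c 1 / 4)) * (s + t * h) := by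
        have hcase : t * ‖V‖ ≤ t * h + (Cs * s + 3 * (c 1 / 4 * t) * h) := by
          revert hV
          refine Fin.cases ?_ (fun j => ?_) β
          · intro hV
            have e : t • V = (t • V + ∑ i, x i • dX i (dX l u) (t, x))
                - ∑ i, x i • dX i (dX l u) (t, x) := by abel
            have := congrArg norm e
            rw [norm_smul, Real.norm_of_nonneg ht] at this
            rw [this]
            have b1 := hs.scal_x l
            have b2 := norm_sum_coord_smul_le x (fun i => dX i (dX l u) (t, x))
              fun i => norm_dX_dX_le_hess u t x i l
            have b3 : 3 * ‖x‖ * h ≤ 3 * (c 1 / 4 * t) * h := by gcongr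
            rw [hV] at *
            refine (norm_sub_le _ _).trans ((add_le_add b1 (b2.trans b3)).trans ?_)
            have : 0 ≤ t * h := by positivity
            linarith
          · intro hV
            have : ‖V‖ ≤ h := by rw [hV]; exact norm_dX_dX_le_hess u t x j l
            have p1 : 0 ≤ Cs * s + 3 * (c 1 / 4 * t) * h := by positivity
            have := mul_le_mul_of_nonneg_left this ht
            linarith
        have p2 : 0 ≤ (1 + 3 * (c 1 / 4)) * s + Cs * (t * h) := by positivity
        linarith
      have b1 : |c α * t - ‖x‖| * ‖projL α x V‖ ≤ N * (s + t * h) := by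
        calc |c α * t - ‖x‖| * ‖projL α x V‖ ≤ D * t * ‖V‖ :=
              mul_le_mul hw (norm_projL_le _ _ _) (norm_nonneg _) (by positivity)
          _ = D * (t * ‖V‖) := by ring
          _ ≤ D * ((1 + Cs + 3 * (c 1 / 4)) * (s + t * h)) := by gcongr
          _ = _ := by rw [hN]; ring
      have p1 : 0 ≤ N * (t * ‖W‖) := by positivity
      have p2 : 0 ≤ C₁ * (Cs + 1) * (s + t * ‖W‖ + t * h) := by positivity
      linarith
  have hP : ‖projL α x V‖ ≤ s + t * ‖W‖ + t * (χ x * h) := by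
    have : 0 ≤ t * ‖W‖ + t * (χ x * h) := by positivity
    linarith [norm_projL_le α x V]
  calc √(1 + (c α * t - ‖x‖) ^ 2) * ‖projL α x V‖
      ≤ (1 + |c α * t - ‖x‖|) * ‖projL α x V‖ := by
        gcongr
        exact sqrt_one_add_sq_le _
    _ = ‖projL α x V‖ + |c α * t - ‖x‖| * ‖projL α x V‖ := by ring
    _ ≤ _ := by
      rw [add_mul, one_mul]
      exact add_le_add hP key

/-- The weighted estimate: the weighted second derivatives of a test field are controlled by two
generators and by the wave operator with the weight `t`. -/
theorem exists_weighted_le (c : Fin 2 → ℝ) (h1 : 0 < c 1) (h01 : c 1 < c 0) :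
    ∃ C : ℝ, 0 ≤ C ∧ ∀ u, IsTest u → ∀ t : ℝ, 0 ≤ t → ∀ α β l,
      eLpNorm (fun x : E3 => √(1 + (c α * t - ‖x‖) ^ 2) • projL α x (dir (dirv β) (dX l u) (t, x)))
        2 volume ≤ ENNReal.ofReal C * (eLpNorm (fun x => size₁ 2 u (t, x)) 2 volume
          + ENNReal.ofReal t * eLpNorm (fun x => waveOp c u (t, x)) 2 volume) := by
  obtain ⟨K, hK, hin⟩ := exists_inner_le c h1 h01
  obtain ⟨C, hC, hpt⟩ := exists_weighted_pointwise c h1 h01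
  refine ⟨C * (1 + K), by positivity, fun u hu t ht α β l => ?_⟩
  obtain ⟨χ, hχ, hχ0, hχ1, hle⟩ := hin u hu t ht
  set g₁ : E3 → ℝ := fun x => size₁ 2 u (t, x) with hg₁
  set g₂ : E3 → ℝ := fun x => t * ‖waveOp c u (t, x)‖ with hg₂
  set g₃ : E3 → ℝ := fun x => t * (χ x * hess u t x) with hg₃
  have m₁ : AEStronglyMeasurable g₁ volume := (memLp_size₁ h1 h01 2 hu t).1
  have m₂ : AEStronglyMeasurable g₂ volume :=
    (continuous_const.mul ((hu.waveOp c).slice_continuous t).norm).aestronglyMeasurable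
  have m₃ : AEStronglyMeasurable g₃ volume :=
    (continuous_const.mul (hχ.mul (hess_continuous hu t))).aestronglyMeasurable
  have hae : ∀ᵐ x : E3, ‖√(1 + (c α * t - ‖x‖) ^ 2) • projL α x (dir (dirv β) (dX l u) (t, x))‖
      ≤ C * ‖(g₁ + g₂ + g₃) x‖ := by
    have h0 : ∀ᵐ x : E3, x ≠ 0 := by
      simp [ae_iff, measure_singleton]
    filter_upwards [h0] with x hx
    rw [norm_smul, Real.norm_of_nonneg (Real.sqrt_nonneg _)]
    refine (hpt u hu t ht χ hχ0 hχ1 α β l x hx).trans ?_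
    exact mul_le_mul_of_nonneg_left (le_abs_self _) hC
  have e₂ : eLpNorm g₂ 2 volume = ENNReal.ofReal t * eLpNorm (fun x => waveOp c u (t, x)) 2 volume := by
    have : g₂ = t • fun x => ‖waveOp c u (t, x)‖ := rfl
    rw [this, eLpNorm_const_smul, eLpNorm_norm, Real.enorm_eq_ofReal ht]
  rw [← e₂] at hle ⊢
  refine (eLpNorm_le_mul_eLpNorm_of_ae_le_mul hae 2).trans ?_
  rw [ENNReal.ofReal_mul hC, mul_assoc]
  refine mul_le_mul_right ?_ _
  refine (eLpNorm_add_le (m₁.add m₂) m₃ one_le_two).trans ?_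
  refine (add_le_add (eLpNorm_add_le m₁ m₂ one_le_two) hle).trans (le_of_eq ?_)
  rw [ENNReal.ofReal_add zero_le_one hK, ENNReal.ofReal_one]
  ring

/-! ### The weighted norm of test fields -/

theorem weightedNorm_eq (c : Fin 2 → ℝ) (k : ℕ) (t : ℝ) (D : Jet) :
    weightedNorm c k t D = ∑ α : Fin 2, ∑ β : Fin 4, ∑ l : Fin 3, ∑ a ∈ words (k - 1),
      eLpNorm (fun x : E3 => √(1 + (c α * t - ‖x‖) ^ 2) •
        proj α x (D (dIdx β :: xIdx l :: a) x)) 2 volume := by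
  rw [weightedNorm]
  exact Finset.sum_congr rfl fun α _ => Finset.sum_congr rfl fun β _ =>
    Finset.sum_congr rfl fun l _ => sum_words (k - 1) fun a =>
      eLpNorm (fun x : E3 => √(1 + (c α * t - ‖x‖) ^ 2) •
        proj α x (D (dIdx β :: xIdx l :: a) x)) 2 volume

/-- A single term of the weighted norm of a test field. -/
def weightedTerm (c : Fin 2 → ℝ) (α : Fin 2) (β : Fin 4) (l : Fin 3) (u : VField) (t : ℝ) :
    E3 → E3 :=
  fun x => √(1 + (c α * t - ‖x‖) ^ 2) • projL α x (dir (dirv β) (dX l u) (t, x))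

theorem weightedNorm_classicalJet (c : Fin 2 → ℝ) (k : ℕ) (u : VField) (t : ℝ) :
    weightedNorm c k t (classicalJet u t) = ∑ α : Fin 2, ∑ β : Fin 4, ∑ l : Fin 3,
      ∑ a ∈ words (k - 1), eLpNorm (weightedTerm c α β l (genWord a u) t) 2 volume := by
  rw [weightedNorm_eq]
  simp only [classicalJet_dIdx_xIdx]
  rfl

/-- The linear estimate for all words: the weighted norm is controlled by the energy and by the
wave operator. -/
theorem exists_weightedNorm_le (c : Fin 2 → ℝ) (h1 : 0 < c 1) (h01 : c 1 < c 0) (k : ℕ) :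
    ∃ C : ℝ, 0 ≤ C ∧ ∀ u, IsTest u → ∀ t : ℝ, 0 ≤ t →
      weightedNorm c k t (classicalJet u t) ≤ ENNReal.ofReal C * (ENNReal.ofReal (rootEnergy c k u t)
        + ENNReal.ofReal t * ∑ b ∈ words (k - 1),
          eLpNorm (fun x => genWord b (waveOp c u) (t, x)) 2 volume) := by
  obtain ⟨C₁, hC₁, hlin⟩ := exists_weighted_le c h1 h01
  obtain ⟨C₂, hC₂, hsz⟩ := exists_eLpNorm_size₁_le h1 h01 k
  choose C₃ hC₃ hcomm using exists_waveOp_genWord_le c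
  set M := ∑ a ∈ words (k - 1), C₃ a with hM
  have hM0 : 0 ≤ M := Finset.sum_nonneg fun a _ => hC₃ a
  set K := C₁ * (C₂ + M) with hK
  have hK0 : 0 ≤ K := by positivity
  refine ⟨∑ _α : Fin 2, ∑ _β : Fin 4, ∑ _l : Fin 3, ∑ _a ∈ words (k - 1), K,
    Finset.sum_nonneg fun _ _ => Finset.sum_nonneg fun _ _ => Finset.sum_nonneg fun _ _ =>
      Finset.sum_nonneg fun _ _ => hK0, fun u hu t ht => ?_⟩
  set S := ∑ b ∈ words (k - 1), eLpNorm (fun x => genWord b (waveOp c u) (t, x)) 2 volume with hS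
  have hterm : ∀ α β l, ∀ a ∈ words (k - 1),
      eLpNorm (weightedTerm c α β l (genWord a u) t) 2 volume
        ≤ ENNReal.ofReal K * (ENNReal.ofReal (rootEnergy c k u t) + ENNReal.ofReal t * S) := by
    intro α β l a ha
    have hal := mem_words.1 ha
    refine (hlin _ (hu.genWord a) t ht α β l).trans ?_
    have e1 : eLpNorm (fun x => size₁ 2 (genWord a u) (t, x)) 2 volume
        ≤ ENNReal.ofReal C₂ * ENNReal.ofReal (rootEnergy c k u t) := by
      rw [← ENNReal.ofReal_mul hC₂]
      refine le_trans (eLpNorm_mono_real fun x => ?_) (hsz u hu t)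
      rw [Real.norm_of_nonneg (size₁_nonneg _ _ _)]
      exact size₁_genWord_le a (by omega) u _
    have e2 : eLpNorm (fun x => waveOp c (genWord a u) (t, x)) 2 volume ≤ ENNReal.ofReal M * S := by
      have e3 : eLpNorm (fun x => waveOp c (genWord a u) (t, x)) 2 volume
          ≤ ENNReal.ofReal (C₃ a) * eLpNorm (∑ b ∈ words (k - 1),
              fun x => ‖genWord b (waveOp c u) (t, x)‖) 2 volume := by
        refine eLpNorm_le_mul_eLpNorm_of_ae_le_mul (.of_forall fun x => ?_) 2
        refine (hcomm a u hu (t, x)).trans (mul_le_mul_of_nonneg_left ?_ (hC₃ a))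
        rw [Finset.sum_apply, Real.norm_of_nonneg (Finset.sum_nonneg fun _ _ => norm_nonneg _)]
        exact Finset.sum_le_sum_of_subset_of_nonneg (words_mono (by omega))
          fun _ _ _ => norm_nonneg _
      refine e3.trans (mul_le_mul' (ENNReal.ofReal_le_ofReal
        (Finset.single_le_sum (fun a _ => hC₃ a) ha)) ?_)
      refine (eLpNorm_sum_le (fun b _ => (((hu.waveOp c).genWord b).slice_continuous
        t).norm.aestronglyMeasurable) one_le_two).trans (le_of_eq ?_)
      exact Finset.sum_congr rfl fun b _ => eLpNorm_norm _
    rw [hK, ENNReal.ofReal_mul hC₁, mul_assoc]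
    refine mul_le_mul_right ?_ _
    rw [ENNReal.ofReal_add hC₂ hM0]
    calc _ ≤ ENNReal.ofReal C₂ * ENNReal.ofReal (rootEnergy c k u t)
          + ENNReal.ofReal t * (ENNReal.ofReal M * S) := by gcongr
      _ ≤ ENNReal.ofReal C₂ * ENNReal.ofReal (rootEnergy c k u t)
          + ENNReal.ofReal t * (ENNReal.ofReal M * S)
          + (ENNReal.ofReal C₂ * (ENNReal.ofReal t * S)
            + ENNReal.ofReal M * ENNReal.ofReal (rootEnergy c k u t)) := le_self_add
      _ = _ := by ring
  rw [weightedNorm_classicalJet, ENNReal.ofReal_sum_of_nonneg fun _ _ => Finset.sum_nonneg fun _ _ =>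
    Finset.sum_nonneg fun _ _ => Finset.sum_nonneg fun _ _ => hK0, Finset.sum_mul]
  refine Finset.sum_le_sum fun α _ => ?_
  rw [ENNReal.ofReal_sum_of_nonneg fun _ _ => Finset.sum_nonneg fun _ _ =>
    Finset.sum_nonneg fun _ _ => hK0, Finset.sum_mul]
  refine Finset.sum_le_sum fun β _ => ?_
  rw [ENNReal.ofReal_sum_of_nonneg fun _ _ => Finset.sum_nonneg fun _ _ => hK0, Finset.sum_mul]
  refine Finset.sum_le_sum fun l _ => ?_
  rw [ENNReal.ofReal_sum_of_nonneg fun _ _ => hK0, Finset.sum_mul]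
  exact Finset.sum_le_sum fun a ha => hterm α β l a ha

/-- The weighted norm of a test field, as a real number. -/
def weightedReal (c : Fin 2 → ℝ) (k : ℕ) (u : VField) (t : ℝ) : ℝ :=
  (weightedNorm c k t (classicalJet u t)).toReal

theorem weightedReal_nonneg (c : Fin 2 → ℝ) (k : ℕ) (u : VField) (t : ℝ) :
    0 ≤ weightedReal c k u t := ENNReal.toReal_nonneg

theorem weightedNorm_ne_top {c : Fin 2 → ℝ} (h1 : 0 < c 1) (h01 : c 1 < c 0) (k : ℕ) {u : VField}
    (hu : IsTest u) {t : ℝ} (ht : 0 ≤ t) : weightedNorm c k t (classicalJet u t) ≠ ⊤ := by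
  obtain ⟨C, _, h⟩ := exists_weightedNorm_le c h1 h01 k
  refine ((h u hu t ht).trans_lt ?_).ne
  refine ENNReal.mul_lt_top ENNReal.ofReal_lt_top (ENNReal.add_lt_top.2 ⟨ENNReal.ofReal_lt_top, ?_⟩)
  refine ENNReal.mul_lt_top ENNReal.ofReal_lt_top (ENNReal.sum_lt_top.2 fun b _ => ?_)
  exact (((hu.waveOp c).genWord b).memLp t).2

theorem ofReal_weightedReal {c : Fin 2 → ℝ} (h1 : 0 < c 1) (h01 : c 1 < c 0) (k : ℕ) {u : VField}
    (hu : IsTest u) {t : ℝ} (ht : 0 ≤ t) :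
    ENNReal.ofReal (weightedReal c k u t) = weightedNorm c k t (classicalJet u t) :=
  ENNReal.ofReal_toReal (weightedNorm_ne_top h1 h01 k hu ht)

/-- The pointwise size of the weighted second derivatives of `Γ^a u`, over all words `a` of length
less than `k`. -/
def weightedSize (c : Fin 2 → ℝ) (k : ℕ) (u : VField) (t : ℝ) (x : E3) : ℝ :=
  ∑ α : Fin 2, ∑ β : Fin 4, ∑ l : Fin 3, ∑ a ∈ words k, ‖weightedTerm c α β l (genWord a u) t x‖

theorem weightedSize_nonneg (c : Fin 2 → ℝ) (k : ℕ) (u : VField) (t : ℝ) (x : E3) :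
    0 ≤ weightedSize c k u t x :=
  Finset.sum_nonneg fun _ _ => Finset.sum_nonneg fun _ _ => Finset.sum_nonneg fun _ _ =>
    Finset.sum_nonneg fun _ _ => norm_nonneg _

theorem measurable_projL (α : Fin 2) {f : E3 → E3} (hf : Measurable f) :
    Measurable fun x => projL α x (f x) := by
  have h : Measurable fun x => radialProj x (f x) := by
    unfold radialProj
    fun_prop
  fin_cases α
  · exact h
  · exact hf.sub h

theorem weightedTerm_measurable (c : Fin 2 → ℝ) (α : Fin 2) (β : Fin 4) (l : Fin 3) {u : VField}
    (hu : IsTest u) (t : ℝ) : Measurable (weightedTerm c α β l u t) := by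
  have h := measurable_projL α (((hu.dX l).dir (dirv β)).slice_continuous t).measurable
  have hw : Measurable fun x : E3 => √(1 + (c α * t - ‖x‖) ^ 2) := by fun_prop
  exact hw.smul h

theorem eLpNorm_weightedSize_le {c : Fin 2 → ℝ} (h1 : 0 < c 1) (h01 : c 1 < c 0) {k m : ℕ}
    (hkm : k + 1 ≤ m) {u : VField} (hu : IsTest u) {t : ℝ} (ht : 0 ≤ t) :
    eLpNorm (weightedSize c k u t) 2 volume ≤ ENNReal.ofReal (weightedReal c m u t) := by
  rw [ofReal_weightedReal h1 h01 m hu ht, weightedNorm_classicalJet]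
  have hm : ∀ α β l a, AEStronglyMeasurable
      (fun x => ‖weightedTerm c α β l (genWord a u) t x‖) (volume : Measure E3) := fun α β l a =>
    (weightedTerm_measurable c α β l (hu.genWord a) t).norm.aestronglyMeasurable
  have e : weightedSize c k u t = ∑ α : Fin 2, ∑ β : Fin 4, ∑ l : Fin 3, ∑ a ∈ words k,
      fun x => ‖weightedTerm c α β l (genWord a u) t x‖ := by
    funext x
    simp only [weightedSize, Finset.sum_apply]
  rw [e]
  refine (eLpNorm_sum_le (fun α _ => Finset.aestronglyMeasurable_sum _ fun β _ =>
    Finset.aestronglyMeasurable_sum _ fun l _ => Finset.aestronglyMeasurable_sum _ fun a _ =>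
      hm α β l a) one_le_two).trans (Finset.sum_le_sum fun α _ => ?_)
  refine (eLpNorm_sum_le (fun β _ => Finset.aestronglyMeasurable_sum _ fun l _ =>
    Finset.aestronglyMeasurable_sum _ fun a _ => hm α β l a) one_le_two).trans
    (Finset.sum_le_sum fun β _ => ?_)
  refine (eLpNorm_sum_le (fun l _ => Finset.aestronglyMeasurable_sum _ fun a _ => hm α β l a)
    one_le_two).trans (Finset.sum_le_sum fun l _ => ?_)
  refine (eLpNorm_sum_le (fun a _ => hm α β l a) one_le_two).trans ?_
  simp only [eLpNorm_norm]
  exact Finset.sum_le_sum_of_subset (words_mono (by omega))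

/-- Time is controlled by the radius and the distance to either light cone. -/
theorem mul_norm_le_weights {c : Fin 2 → ℝ} (h01 : c 1 < c 0) {t : ℝ} (ht : 0 ≤ t) (x V : E3) :
    c 1 * t * ‖V‖ ≤ 2 * ‖x‖ * ‖V‖ + ∑ α, √(1 + (c α * t - ‖x‖) ^ 2) * ‖projL α x V‖ := by
  have hα : ∀ α, c 1 * t * ‖projL α x V‖
      ≤ ‖x‖ * ‖V‖ + √(1 + (c α * t - ‖x‖) ^ 2) * ‖projL α x V‖ := by
    intro α
    have e1 : c 1 * t ≤ ‖x‖ + √(1 + (c α * t - ‖x‖) ^ 2) := by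
      have : c 1 ≤ c α := by fin_cases α; exacts [h01.le, le_rfl]
      have := mul_le_mul_of_nonneg_right this ht
      have : c α * t - ‖x‖ ≤ √(1 + (c α * t - ‖x‖) ^ 2) :=
        Real.le_sqrt_of_sq_le (by linarith)
      linarith
    refine (mul_le_mul_of_nonneg_right e1 (norm_nonneg _)).trans ?_
    rw [add_mul]
    gcongr
    exact norm_projL_le α x V
  have h0 := hα 0
  have h1 := hα 1
  rw [Fin.sum_univ_two]
  by_cases hc : 0 ≤ c 1 * t
  · have := mul_le_mul_of_nonneg_left (norm_le_sum_proj x V) hc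
    rw [Fin.sum_univ_two] at this
    linarith
  · have e1 : c 1 * t * ‖V‖ ≤ 0 := mul_nonpos_of_nonpos_of_nonneg (not_le.1 hc).le (norm_nonneg _)
    refine e1.trans (by positivity)

theorem mul_size₂_le {c : Fin 2 → ℝ} (h01 : c 1 < c 0) (k : ℕ) (u : VField) {t : ℝ} (ht : 0 ≤ t)
    (x : E3) : c 1 * t * size₂ k u (t, x)
      ≤ 2 * (‖x‖ * size₂ k u (t, x)) + weightedSize c k u t x := by
  have e : weightedSize c k u t x = ∑ a ∈ words k, ∑ β : Fin 4, ∑ l : Fin 3, ∑ α : Fin 2,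
      √(1 + (c α * t - ‖x‖) ^ 2) * ‖projL α x (dir (dirv β) (dX l (genWord a u)) (t, x))‖ := by
    have e1 : ∀ α β l a, ‖weightedTerm c α β l (genWord a u) t x‖ = √(1 + (c α * t - ‖x‖) ^ 2)
        * ‖projL α x (dir (dirv β) (dX l (genWord a u)) (t, x))‖ := fun α β l a => by
      rw [weightedTerm, norm_smul, Real.norm_of_nonneg (Real.sqrt_nonneg _)]
    simp only [weightedSize, e1]
    rw [Finset.sum_comm]
    conv_lhs => enter [2, β]; rw [Finset.sum_comm]
    conv_lhs => enter [2, β, 2, l]; rw [Finset.sum_comm]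
    conv_lhs => enter [2, β]; rw [Finset.sum_comm]
    rw [Finset.sum_comm]
  rw [e, size₂, Finset.mul_sum, Finset.mul_sum, Finset.mul_sum, ← Finset.sum_add_distrib]
  refine Finset.sum_le_sum fun a _ => ?_
  rw [Finset.mul_sum, Finset.mul_sum, Finset.mul_sum, ← Finset.sum_add_distrib]
  refine Finset.sum_le_sum fun β _ => ?_
  rw [Finset.mul_sum, Finset.mul_sum, Finset.mul_sum, ← Finset.sum_add_distrib]
  refine Finset.sum_le_sum fun l _ => ?_
  rw [← mul_assoc 2]
  exact mul_norm_le_weights h01 ht x _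

/-! ### The quadratic estimates -/

/-- The Sobolev inequality for all first derivatives of `Γ^a u`, with the weight `1 + |x|`. -/
theorem exists_sup_size₁_le {c : Fin 2 → ℝ} (h1 : 0 < c 1) (h01 : c 1 < c 0) (b k : ℕ)
    (hbk : b + 4 ≤ k) : ∃ C : ℝ, 0 ≤ C ∧ ∀ u, IsTest u → ∀ t x,
      (1 + ‖x‖) * size₁ (b + 1) u (t, x) ≤ C * rootEnergy c k u t := by
  obtain ⟨C, hC, h⟩ := exists_sup_dir_le h1 h01 b k hbk
  refine ⟨∑ _a ∈ words (b + 1), ∑ _β : Fin 4, C,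
    Finset.sum_nonneg fun _ _ => Finset.sum_nonneg fun _ _ => hC, fun u hu t x => ?_⟩
  rw [size₁, Finset.mul_sum, Finset.sum_mul]
  refine Finset.sum_le_sum fun a ha => ?_
  rw [Finset.mul_sum, Finset.sum_mul]
  exact Finset.sum_le_sum fun β _ => h u hu t x a (Nat.lt_succ_iff.1 (mem_words.1 ha)) β

theorem exists_eLpNorm_size₂_le {c : Fin 2 → ℝ} (h1 : 0 < c 1) (h01 : c 1 < c 0) {k n : ℕ}
    (h : k + 1 ≤ n) : ∃ C : ℝ, 0 ≤ C ∧ ∀ u, IsTest u → ∀ t,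
      eLpNorm (fun x => size₂ k u (t, x)) 2 volume ≤ ENNReal.ofReal (C * rootEnergy c n u t) := by
  obtain ⟨C, hC, hs⟩ := exists_eLpNorm_size₁_le h1 h01 n
  set N : ℝ := (words k).card * (4 * 3) with hN
  have hN0 : 0 ≤ N := by positivity
  refine ⟨N * C, by positivity, fun u hu t => ?_⟩
  rw [mul_assoc, ENNReal.ofReal_mul hN0]
  refine (eLpNorm_le_mul_eLpNorm_of_ae_le_mul (g := fun x => size₁ n u (t, x))
    (.of_forall fun x => ?_) 2).trans (mul_le_mul_right (hs u hu t) _)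
  rw [Real.norm_of_nonneg (size₂_nonneg _ _ _), Real.norm_of_nonneg (size₁_nonneg _ _ _), hN]
  refine (size₂_le_size₁ h u _).trans (le_of_eq (by ring))

/-- The product of first and second derivatives, with the weight `t`: the first derivatives are
estimated in the supremum norm. -/
theorem exists_mul_sup_size₁_le {c : Fin 2 → ℝ} (h1 : 0 < c 1) (h01 : c 1 < c 0) (b d k m : ℕ)
    (hbk : b + 4 ≤ k) (hdm : d + 2 ≤ m) : ∃ C : ℝ, 0 ≤ C ∧ ∀ u, IsTest u → ∀ t : ℝ, 0 ≤ t →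
      eLpNorm (fun x => t * (size₁ (b + 1) u (t, x) * size₂ (d + 1) u (t, x))) 2 volume
        ≤ ENNReal.ofReal (C * (rootEnergy c k u t
          * (rootEnergy c m u t + weightedReal c m u t))) := by
  obtain ⟨C₁, hC₁, hsup⟩ := exists_sup_size₁_le h1 h01 b k hbk
  obtain ⟨C₂, hC₂, hsz⟩ := exists_eLpNorm_size₂_le h1 h01 (k := d + 1) (n := m) (by omega)
  refine ⟨(c 1)⁻¹ * C₁ * (2 * C₂ + 1), by positivity, fun u hu t ht => ?_⟩
  set E := rootEnergy c k u t with hE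
  have hE0 : 0 ≤ E := rootEnergy_nonneg _ _ _ _
  have hEm : 0 ≤ rootEnergy c m u t := rootEnergy_nonneg _ _ _ _
  have hX0 := weightedReal_nonneg c m u t
  set K := (c 1)⁻¹ * (C₁ * E) with hK
  have hK0 : 0 ≤ K := by positivity
  have hpt : ∀ x : E3, ‖t * (size₁ (b + 1) u (t, x) * size₂ (d + 1) u (t, x))‖
      ≤ K * ‖((2 : ℝ) • (fun x => size₂ (d + 1) u (t, x)) + weightedSize c (d + 1) u t) x‖ := by
    intro x
    have hf0 := size₁_nonneg (b + 1) u (t, x)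
    have hg0 := size₂_nonneg (d + 1) u (t, x)
    have hw0 := weightedSize_nonneg c (d + 1) u t x
    have hs := hsup u hu t x
    have ht' := mul_size₂_le h01 (d + 1) u ht x
    simp only [Pi.add_apply, Pi.smul_apply, smul_eq_mul]
    rw [Real.norm_of_nonneg (by positivity), Real.norm_of_nonneg (by positivity)]
    set f := size₁ (b + 1) u (t, x)
    set g := size₂ (d + 1) u (t, x)
    set w := weightedSize c (d + 1) u t x
    have hx0 := norm_nonneg x
    have a1 : c 1 * (t * (f * g)) ≤ C₁ * E * (2 * g + w) := by
      have b1 : f ≤ C₁ * E := by nlinarith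
      have b2 : ‖x‖ * f ≤ C₁ * E := by nlinarith
      calc c 1 * (t * (f * g)) = f * (c 1 * t * g) := by ring
        _ ≤ f * (2 * (‖x‖ * g) + w) := by gcongr
        _ = 2 * (‖x‖ * f) * g + f * w := by ring
        _ ≤ 2 * (C₁ * E) * g + C₁ * E * w := by gcongr
        _ = _ := by ring
    rw [hK, mul_assoc, inv_mul_eq_div, le_div_iff₀ h1]
    linarith
  have mg : AEStronglyMeasurable (fun x : E3 => size₂ (d + 1) u (t, x)) volume :=
    ((size₂_continuous (d + 1) hu).comp (by fun_prop : Continuous fun x : E3 => (t, x))).aestronglyMeasurable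
  have mw : AEStronglyMeasurable (weightedSize c (d + 1) u t) (volume : Measure E3) := by
    refine Measurable.aestronglyMeasurable ?_
    unfold weightedSize
    exact Finset.measurable_fun_sum _ fun α _ => Finset.measurable_fun_sum _ fun β _ =>
      Finset.measurable_fun_sum _ fun l _ => Finset.measurable_fun_sum _ fun a _ =>
        (weightedTerm_measurable c α β l (hu.genWord a) t).norm
  refine (eLpNorm_le_mul_eLpNorm_of_ae_le_mul (.of_forall hpt) 2).trans ?_
  have h2 : eLpNorm ((2 : ℝ) • (fun x => size₂ (d + 1) u (t, x)) + weightedSize c (d + 1) u t) 2 volume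
      ≤ ENNReal.ofReal (2 * (C₂ * rootEnergy c m u t) + weightedReal c m u t) := by
    refine (eLpNorm_add_le (mg.const_smul _) mw one_le_two).trans ?_
    rw [ENNReal.ofReal_add (by positivity) hX0, ENNReal.ofReal_mul zero_le_two, eLpNorm_const_smul,
      Real.enorm_eq_ofReal zero_le_two]
    exact add_le_add (mul_le_mul_right (hsz u hu t) _)
      (eLpNorm_weightedSize_le h1 h01 (by omega) hu ht)
  refine (mul_le_mul_right h2 _).trans ?_
  rw [← ENNReal.ofReal_mul hK0]
  refine ENNReal.ofReal_le_ofReal ?_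
  have e : (c 1)⁻¹ * C₁ * (2 * C₂ + 1) * (E * (rootEnergy c m u t + weightedReal c m u t))
      = K * (2 * (C₂ * rootEnergy c m u t) + weightedReal c m u t)
        + K * (rootEnergy c m u t + 2 * C₂ * weightedReal c m u t) := by rw [hK]; ring
  rw [e]
  have : 0 ≤ K * (rootEnergy c m u t + 2 * C₂ * weightedReal c m u t) := by positivity
  linarith

/-- A second derivative with the weight `t`, near the time axis and for large times: the ball of
radius two lies well inside of the light cones. -/
theorem exists_mul_norm_le_weighted {c : Fin 2 → ℝ} (h1 : 0 < c 1) (h01 : c 1 < c 0) (d m : ℕ)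
    (hdm : d + 5 ≤ m) (β : Fin 4) (l : Fin 3) : ∃ C : ℝ, 0 ≤ C ∧ ∀ u, IsTest u → ∀ t : ℝ,
      16 ≤ c 1 * t → ∀ x : E3, ‖x‖ ≤ c 1 * t / 4 → ∀ a : List (Fin 8), a.length ≤ d →
        t * ‖dir (dirv β) (dX l (genWord a u)) (t, x)‖ ≤ C * weightedReal c m u t := by
  obtain ⟨C, hC, hmov⟩ := exists_sum_genWord_dir_dir_le 4 (dirv β) (dirv l.succ) rfl
  set K := √sobConst * C * (4 / c 1) with hK
  have hK0 : 0 ≤ K := by positivity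
  refine ⟨K, hK0, fun u hu t ht x hx a ha => ?_⟩
  have ht0 : 0 < t := by
    by_contra h
    have := mul_nonneg h1.le (neg_nonneg.2 (not_lt.1 h))
    linarith
  have hX0 := weightedReal_nonneg c m u t
  set g := dir (dirv β) (dX l (genWord a u)) with hg
  have hgt : IsTest g := ((hu.genWord a).dX l).dir _
  -- for `c₂ t ≥ 16` a ball of radius `2` about `x` stays within `|y| ≤ 3 c₂ t / 8`, where both
  -- weights `|c_α t - |y||` are at least a multiple of `t`
  have hpt : ∀ y ∈ Metric.closedBall x 2, t ^ 2 * (sobConst * sqSize 4 g (t, y))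
      ≤ K ^ 2 * weightedSize c (d + 4) u t y ^ 2 := by
    intro y hy
    have hyn : ‖y‖ ≤ 3 * (c 1 * t) / 8 := by
      have e1 : ‖y‖ ≤ ‖y - x‖ + ‖x‖ := by simpa using norm_add_le (y - x) x
      rw [mem_closedBall_iff_norm] at hy
      linarith
    have hw := mul_size₂_le h01 (d + 4) u ht0.le y
    set s := size₂ (d + 4) u (t, y) with hs
    have hs0 : 0 ≤ s := size₂_nonneg _ _ _
    have e1 : t * s ≤ 4 / c 1 * weightedSize c (d + 4) u t y := by
      rw [div_mul_eq_mul_div, le_div_iff₀ h1]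
      have := mul_le_mul_of_nonneg_right hyn hs0
      linarith
    have e2 : ∑ w ∈ words 4, ‖genWord w g (t, y)‖ ≤ C * s :=
      (hmov _ (hu.genWord a) (t, y)).trans
        (mul_le_mul_of_nonneg_left (size₂_genWord_le a (by omega) u _) hC)
    have e3 : sqSize 4 g (t, y) ≤ (C * s) ^ 2 := (sqSize_le_sq_sum 4 g _).trans
      (pow_le_pow_left₀ (Finset.sum_nonneg fun _ _ => norm_nonneg _) e2 2)
    calc t ^ 2 * (sobConst * sqSize 4 g (t, y)) ≤ t ^ 2 * (sobConst * (C * s) ^ 2) := by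
          have := sobConst_nonneg
          gcongr
      _ = (√sobConst * C) ^ 2 * (t * s) ^ 2 := by
          rw [mul_pow (√sobConst), Real.sq_sqrt sobConst_nonneg]; ring
      _ ≤ (√sobConst * C) ^ 2 * (4 / c 1 * weightedSize c (d + 4) u t y) ^ 2 := by gcongr
      _ = _ := by rw [hK]; ring
  have hint : ENNReal.ofReal ((t * ‖g (t, x)‖) ^ 2)
      ≤ ENNReal.ofReal (K * weightedReal c m u t) ^ 2 := by
    rw [mul_pow, ENNReal.ofReal_mul (sq_nonneg t)]
    refine (mul_le_mul_right (sobolev_local hgt t x) _).trans ?_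
    rw [← lintegral_const_mul' _ _ ENNReal.ofReal_ne_top]
    calc ∫⁻ y in Metric.closedBall x 2, ENNReal.ofReal (t ^ 2) * ENNReal.ofReal (sobConst * sqSize 4 g (t, y))
        ≤ ∫⁻ y in Metric.closedBall x 2,
            ENNReal.ofReal (K ^ 2) * ENNReal.ofReal (weightedSize c (d + 4) u t y ^ 2) := by
          refine setLIntegral_mono' Metric.isClosed_closedBall.measurableSet fun y hy => ?_
          rw [← ENNReal.ofReal_mul (sq_nonneg _), ← ENNReal.ofReal_mul (sq_nonneg _)]
          exact ENNReal.ofReal_le_ofReal (hpt y hy)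
      _ ≤ ∫⁻ y, ENNReal.ofReal (K ^ 2) * ENNReal.ofReal (weightedSize c (d + 4) u t y ^ 2) :=
          setLIntegral_le_lintegral _ _
      _ = (ENNReal.ofReal K * eLpNorm (weightedSize c (d + 4) u t) 2 volume) ^ 2 := by
          rw [lintegral_const_mul' _ _ ENNReal.ofReal_ne_top, lintegral_sq_eq,
            ENNReal.ofReal_pow hK0, mul_pow]
      _ ≤ (ENNReal.ofReal K * ENNReal.ofReal (weightedReal c m u t)) ^ 2 := by
          gcongr
          exact eLpNorm_weightedSize_le h1 h01 (by omega) hu ht0.le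
      _ = _ := by rw [← ENNReal.ofReal_mul hK0]
  exact (ENNReal.ofReal_le_ofReal_iff (by positivity)).1
    (ofReal_le_of_sq_le (by positivity) hint)

/-- Second derivatives gain a factor `t`: for `|x|` comparable to `t` from the weight `1 + |x|` of
the Sobolev inequality, near the time axis from the weighted norm. -/
theorem exists_sup_size₂_le {c : Fin 2 → ℝ} (h1 : 0 < c 1) (h01 : c 1 < c 0) (d m : ℕ)
    (hdm : d + 5 ≤ m) : ∃ C : ℝ, 0 ≤ C ∧ ∀ u, IsTest u → ∀ t : ℝ, 0 ≤ t → ∀ x,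
      t * size₂ (d + 1) u (t, x) ≤ C * (rootEnergy c m u t + weightedReal c m u t) := by
  obtain ⟨C₁, hC₁, hsup⟩ := exists_sup_size₁_le h1 h01 (d + 1) m (by omega)
  choose C₂ hC₂ hin using exists_mul_norm_le_weighted h1 h01 d m hdm
  set N : ℝ := (words (d + 1)).card * (4 * 3) with hN
  have hN0 : 0 ≤ N := by positivity
  set S := ∑ _a ∈ words (d + 1), ∑ β, ∑ l, C₂ β l with hS
  have hS0 : 0 ≤ S := Finset.sum_nonneg fun _ _ => Finset.sum_nonneg fun β _ =>
    Finset.sum_nonneg fun l _ => hC₂ β l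
  refine ⟨N * C₁ * (16 / c 1) + S, by positivity, fun u hu t ht x => ?_⟩
  have hE0 : 0 ≤ rootEnergy c m u t := rootEnergy_nonneg _ _ _ _
  have hX0 := weightedReal_nonneg c m u t
  have hout : t ≤ 16 / c 1 * (1 + ‖x‖) →
      t * size₂ (d + 1) u (t, x) ≤ N * C₁ * (16 / c 1) * rootEnergy c m u t := by
    intro h
    have e1 := size₂_le_size₁ (k := d + 1) (n := d + 1 + 1) le_rfl u (t, x)
    have e2 := hsup u hu t x
    have e3 := size₁_nonneg (d + 1 + 1) u (t, x)
    calc t * size₂ (d + 1) u (t, x)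
        ≤ 16 / c 1 * (1 + ‖x‖) * ((words (d + 1)).card * (4 * (3 * size₁ (d + 1 + 1) u (t, x)))) :=
          mul_le_mul h e1 (size₂_nonneg _ _ _) (by positivity)
      _ = N * (16 / c 1) * ((1 + ‖x‖) * size₁ (d + 1 + 1) u (t, x)) := by rw [hN]; ring
      _ ≤ N * (16 / c 1) * (C₁ * rootEnergy c m u t) := by gcongr
      _ = _ := by ring
  have hfin : ∀ A B : ℝ, 0 ≤ A → 0 ≤ B → A * rootEnergy c m u t ≤ (A + B) * (rootEnergy c m u t
      + weightedReal c m u t) ∧ B * weightedReal c m u t ≤ (A + B) * (rootEnergy c m u t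
      + weightedReal c m u t) := fun A B hA hB => by
    constructor <;> nlinarith [mul_nonneg hA hE0, mul_nonneg hA hX0, mul_nonneg hB hE0,
      mul_nonneg hB hX0]
  by_cases hcase : 16 ≤ c 1 * t ∧ ‖x‖ ≤ c 1 * t / 4
  · refine le_trans ?_ (hfin _ _ (by positivity) hS0).2
    rw [size₂, Finset.mul_sum, hS, Finset.sum_mul]
    refine Finset.sum_le_sum fun a ha => ?_
    rw [Finset.mul_sum, Finset.sum_mul]
    refine Finset.sum_le_sum fun β _ => ?_
    rw [Finset.mul_sum, Finset.sum_mul]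
    exact Finset.sum_le_sum fun l _ => hin β l u hu t hcase.1 x hcase.2 a
      (Nat.lt_succ_iff.1 (mem_words.1 ha))
  · refine (hout ?_).trans (hfin _ _ (by positivity) hS0).1
    rw [div_mul_eq_mul_div, le_div_iff₀ h1]
    rcases not_and_or.1 hcase with h | h
    · linarith [norm_nonneg x]
    · linarith [norm_nonneg x]

/-- The product of first and second derivatives, with the weight `t`: the second derivatives are
estimated in the supremum norm. -/
theorem exists_mul_sup_size₂_le {c : Fin 2 → ℝ} (h1 : 0 < c 1) (h01 : c 1 < c 0) (b d k m : ℕ)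
    (hbk : b + 1 ≤ k) (hdm : d + 5 ≤ m) : ∃ C : ℝ, 0 ≤ C ∧ ∀ u, IsTest u → ∀ t : ℝ, 0 ≤ t →
      eLpNorm (fun x => t * (size₁ (b + 1) u (t, x) * size₂ (d + 1) u (t, x))) 2 volume
        ≤ ENNReal.ofReal (C * (rootEnergy c k u t
          * (rootEnergy c m u t + weightedReal c m u t))) := by
  obtain ⟨C₁, hC₁, hsz⟩ := exists_eLpNorm_size₁_le h1 h01 k
  obtain ⟨C₂, hC₂, hsup⟩ := exists_sup_size₂_le h1 h01 d m hdm
  refine ⟨C₂ * C₁, by positivity, fun u hu t ht => ?_⟩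
  have hEm : 0 ≤ rootEnergy c m u t := rootEnergy_nonneg _ _ _ _
  have hX0 := weightedReal_nonneg c m u t
  set K := C₂ * (rootEnergy c m u t + weightedReal c m u t) with hK
  have hK0 : 0 ≤ K := by positivity
  refine (eLpNorm_le_mul_eLpNorm_of_ae_le_mul (g := fun x => size₁ k u (t, x)) (c := K)
    (.of_forall fun x => ?_) 2).trans ((mul_le_mul_right (hsz u hu t) _).trans (le_of_eq ?_))
  · have hf0 := size₁_nonneg (b + 1) u (t, x)
    have hg0 := size₂_nonneg (d + 1) u (t, x)
    rw [Real.norm_of_nonneg (by positivity), Real.norm_of_nonneg (size₁_nonneg _ _ _)]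
    calc t * (size₁ (b + 1) u (t, x) * size₂ (d + 1) u (t, x))
        = t * size₂ (d + 1) u (t, x) * size₁ (b + 1) u (t, x) := by ring
      _ ≤ K * size₁ k u (t, x) :=
        mul_le_mul (hsup u hu t ht x) (size₁_mono hbk u _) hf0 hK0
  · rw [← ENNReal.ofReal_mul hK0]
    congr 1
    rw [hK]; ring

/-! ### The weighted estimate for the quadratic equation -/

/-- A bilinear expression in divergence form, expanded by the product rule. -/
def quad (Q : Fin 3 → Fin 3 → Fin 3 → E3 →L[ℝ] E3 →L[ℝ] E3) (u v : VField) : VField :=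
  ∑ l, ∑ m, ∑ n, ((fun p => Q l m n (dX l (dX m u) p) (dX n v p))
    + fun p => Q l m n (dX m u p) (dX l (dX n v) p))

theorem IsTest.quadTerm {u v : VField} (hu : IsTest u) (hv : IsTest v)
    (Q : Fin 3 → Fin 3 → Fin 3 → E3 →L[ℝ] E3 →L[ℝ] E3) (l m n : Fin 3) :
    IsTest ((fun p => Q l m n (PrestressedElastic.dX l (PrestressedElastic.dX m u) p)
      (PrestressedElastic.dX n v p))
    + fun p => Q l m n (PrestressedElastic.dX m u p)
      (PrestressedElastic.dX l (PrestressedElastic.dX n v) p)) :=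
  (((hu.dX m).dX l).bil (hv.dX n) _).add ((hu.dX m).bil ((hv.dX n).dX l) _)

theorem IsTest.quad {u v : VField} (hu : IsTest u) (hv : IsTest v)
    (Q : Fin 3 → Fin 3 → Fin 3 → E3 →L[ℝ] E3 →L[ℝ] E3) : IsTest (quad Q u v) :=
  IsTest.sum fun l _ => IsTest.sum fun m _ => IsTest.sum fun n _ => hu.quadTerm hv Q l m n

/-- The product rule for a bilinear expression; the sizes enter with at most `|a|` generators in
total. -/
theorem exists_genWord_quad_le (Q : Fin 3 → Fin 3 → Fin 3 → E3 →L[ℝ] E3 →L[ℝ] E3)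
    (a : List (Fin 8)) : ∃ C : ℝ, 0 ≤ C ∧ ∀ u v, IsTest u → IsTest v → ∀ p,
      ‖genWord a (quad Q u v) p‖ ≤ C * ∑ q ∈ wordPairs a.length,
        (size₁ (q.1.length + 1) v p * size₂ (q.2.length + 1) u p
          + size₁ (q.1.length + 1) u p * size₂ (q.2.length + 1) v p) := by
  choose C₀ hC₀ hL using fun l m n => exists_genWord_bil_le a (Q l m n)
  choose C₀' hC₀' hL' using fun l m n => exists_genWord_bil_le a (Q l m n).flip
  choose C₁ hC₁ h₁ using fun (b : List (Fin 8)) (m : Fin 3) => exists_genWord_dir_le b (dirv m.succ)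
  choose C₂ hC₂ h₂ using fun (b : List (Fin 8)) (l m : Fin 3) =>
    exists_genWord_dir_dir_le b (dirv l.succ) (dirv m.succ) rfl
  set M₁ := ∑ b ∈ words (a.length + 1), ∑ m, C₁ b m with hM₁
  set M₂ := ∑ b ∈ words (a.length + 1), ∑ l, ∑ m, C₂ b l m with hM₂
  have hM₁0 : 0 ≤ M₁ := Finset.sum_nonneg fun _ _ => Finset.sum_nonneg fun _ _ => hC₁ _ _
  have hM₂0 : 0 ≤ M₂ := Finset.sum_nonneg fun _ _ => Finset.sum_nonneg fun _ _ =>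
    Finset.sum_nonneg fun _ _ => hC₂ _ _ _
  refine ⟨∑ l, ∑ m, ∑ n, (C₀ l m n + C₀' l m n) * (M₁ * M₂), Finset.sum_nonneg fun l _ =>
    Finset.sum_nonneg fun m _ => Finset.sum_nonneg fun n _ =>
      mul_nonneg (add_nonneg (hC₀ l m n) (hC₀' l m n)) (by positivity), fun u v hu hv p => ?_⟩
  have hprod : ∀ u v, IsTest u → IsTest v → ∀ l m n, ∑ q ∈ wordPairs a.length,
      ‖genWord q.1 (dX n u) p‖ * ‖genWord q.2 (dX l (dX m v)) p‖
        ≤ M₁ * M₂ * ∑ q ∈ wordPairs a.length,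
          size₁ (q.1.length + 1) u p * size₂ (q.2.length + 1) v p := by
    intro u v hu hv l m n
    rw [Finset.mul_sum]
    refine Finset.sum_le_sum fun q hq => ?_
    have hq' := mem_wordPairs.1 hq
    have b1 : C₁ q.1 n ≤ M₁ := (Finset.single_le_sum (f := fun m => C₁ q.1 m) (fun m _ => hC₁ _ m)
      (Finset.mem_univ n)).trans (Finset.single_le_sum (f := fun b => ∑ m, C₁ b m)
        (fun b _ => Finset.sum_nonneg fun m _ => hC₁ b m)
        (mem_words.2 (by omega) : q.1 ∈ words (a.length + 1)))
    have b2 : C₂ q.2 l m ≤ M₂ := ((Finset.single_le_sum (f := fun m => C₂ q.2 l m)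
      (fun m _ => hC₂ _ l m) (Finset.mem_univ m)).trans
      (Finset.single_le_sum (f := fun l => ∑ m, C₂ q.2 l m)
        (fun l _ => Finset.sum_nonneg fun m _ => hC₂ _ l m) (Finset.mem_univ l))).trans
      (Finset.single_le_sum (f := fun b => ∑ l, ∑ m, C₂ b l m)
        (fun b _ => Finset.sum_nonneg fun l _ => Finset.sum_nonneg fun m _ => hC₂ b l m)
        (mem_words.2 (by omega) : q.2 ∈ words (a.length + 1)))
    have s1 := size₁_nonneg (q.1.length + 1) u p
    have s2 := size₂_nonneg (q.2.length + 1) v p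
    calc _ ≤ (C₁ q.1 n * size₁ (q.1.length + 1) u p) * (C₂ q.2 l m * size₂ (q.2.length + 1) v p) :=
          mul_le_mul (h₁ q.1 n u hu p) (h₂ q.2 l m v hv p) (norm_nonneg _)
            (mul_nonneg (hC₁ _ _) s1)
      _ ≤ (M₁ * size₁ (q.1.length + 1) u p) * (M₂ * size₂ (q.2.length + 1) v p) := by
          have := hC₂ q.2 l m
          gcongr
      _ = _ := by ring
  rw [Finset.sum_add_distrib]
  set S := ∑ q ∈ wordPairs a.length, size₁ (q.1.length + 1) v p * size₂ (q.2.length + 1) u p with hS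
  set S' := ∑ q ∈ wordPairs a.length, size₁ (q.1.length + 1) u p * size₂ (q.2.length + 1) v p
    with hS'
  have hS0 : 0 ≤ S := Finset.sum_nonneg fun q _ => mul_nonneg (size₁_nonneg _ _ _)
    (size₂_nonneg _ _ _)
  have hS'0 : 0 ≤ S' := Finset.sum_nonneg fun q _ => mul_nonneg (size₁_nonneg _ _ _)
    (size₂_nonneg _ _ _)
  have hterm : ∀ l m n, ‖genWord a ((fun p => Q l m n (dX l (dX m u) p) (dX n v p))
      + fun p => Q l m n (dX m u p) (dX l (dX n v) p)) p‖
        ≤ (C₀ l m n + C₀' l m n) * (M₁ * M₂) * (S + S') := by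
    intro l m n
    rw [genWord_add a (((hu.dX m).dX l).bil (hv.dX n) _) ((hu.dX m).bil ((hv.dX n).dX l) _),
      Pi.add_apply]
    refine (norm_add_le _ _).trans ?_
    have t1 := (hL' l m n _ _ (hv.dX n) ((hu.dX m).dX l) p).trans
      (mul_le_mul_of_nonneg_left (hprod v u hv hu l m n) (hC₀' l m n))
    have t2 := (hL l m n _ _ (hu.dX m) ((hv.dX n).dX l) p).trans
      (mul_le_mul_of_nonneg_left (hprod u v hu hv l n m) (hC₀ l m n))
    simp only [ContinuousLinearMap.flip_apply] at t1
    have p1 : 0 ≤ C₀ l m n * (M₁ * M₂ * S) := mul_nonneg (hC₀ l m n) (by positivity)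
    have p2 : 0 ≤ C₀' l m n * (M₁ * M₂ * S') := mul_nonneg (hC₀' l m n) (by positivity)
    linarith
  rw [quad, genWord_sum a fun l _ => IsTest.sum fun m _ => IsTest.sum fun n _ =>
    hu.quadTerm hv Q l m n, Finset.sum_apply, Finset.sum_mul]
  refine (norm_sum_le _ _).trans (Finset.sum_le_sum fun l _ => ?_)
  rw [genWord_sum a fun m _ => IsTest.sum fun n _ => hu.quadTerm hv Q l m n,
    Finset.sum_apply, Finset.sum_mul]
  refine (norm_sum_le _ _).trans (Finset.sum_le_sum fun m _ => ?_)
  rw [genWord_sum a fun n _ => hu.quadTerm hv Q l m n, Finset.sum_apply, Finset.sum_mul]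
  exact (norm_sum_le _ _).trans (Finset.sum_le_sum fun n _ => hterm l m n)

/-- Products of two factors, one with first and one with second derivatives, control all
generators applied to the quadratic term. -/
theorem exists_eLpNorm_quad_le (Q : Fin 3 → Fin 3 → Fin 3 → E3 →L[ℝ] E3 →L[ℝ] E3)
    (a : List (Fin 8)) (B : VField → ℝ → ℝ)
    (h : ∀ b d : ℕ, b + d ≤ a.length → ∃ C : ℝ, 0 ≤ C ∧ ∀ u, IsTest u → ∀ t : ℝ, 0 ≤ t →
      eLpNorm (fun x => t * (size₁ (b + 1) u (t, x) * size₂ (d + 1) u (t, x))) 2 volume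
        ≤ ENNReal.ofReal (C * B u t)) (hB : ∀ u t, 0 ≤ B u t) :
    ∃ C : ℝ, 0 ≤ C ∧ ∀ u, IsTest u → ∀ t : ℝ, 0 ≤ t →
      ENNReal.ofReal t * eLpNorm (fun x => genWord a (quad Q u u) (t, x)) 2 volume
        ≤ ENNReal.ofReal (C * B u t) := by
  obtain ⟨C₀, hC₀, hq⟩ := exists_genWord_quad_le Q a
  have h' : ∀ q : List (Fin 8) × List (Fin 8), ∃ C : ℝ, 0 ≤ C ∧ (q ∈ wordPairs a.length →
      ∀ u, IsTest u → ∀ t : ℝ, 0 ≤ t →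
        eLpNorm (fun x => t * (size₁ (q.1.length + 1) u (t, x) * size₂ (q.2.length + 1) u (t, x)))
          2 volume ≤ ENNReal.ofReal (C * B u t)) := by
    intro q
    by_cases hqm : q ∈ wordPairs a.length
    · obtain ⟨C, hC, hu⟩ := h _ _ (mem_wordPairs.1 hqm)
      exact ⟨C, hC, fun _ => hu⟩
    · exact ⟨0, le_rfl, fun hm => absurd hm hqm⟩
  choose C₁ hC₁ h₁ using h'
  refine ⟨C₀ * 2 * ∑ q ∈ wordPairs a.length, C₁ q,
    mul_nonneg (by positivity) (Finset.sum_nonneg fun q _ => hC₁ q), fun u hu t ht => ?_⟩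
  have hcont : ∀ q : List (Fin 8) × List (Fin 8), AEStronglyMeasurable (fun x : E3 =>
      t * (size₁ (q.1.length + 1) u (t, x) * size₂ (q.2.length + 1) u (t, x))) volume := fun q => by
    have hi : Continuous fun x : E3 => (t, x) := by fun_prop
    exact (continuous_const.mul (((size₁_continuous _ hu).comp hi).mul
      ((size₂_continuous _ hu).comp hi))).aestronglyMeasurable
  have e1 : ENNReal.ofReal t * eLpNorm (fun x => genWord a (quad Q u u) (t, x)) 2 volume
      = eLpNorm (t • fun x => genWord a (quad Q u u) (t, x)) 2 volume := by
    rw [eLpNorm_const_smul, Real.enorm_eq_ofReal ht]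
  rw [e1]
  refine (eLpNorm_le_mul_eLpNorm_of_ae_le_mul (c := C₀ * 2) (g := ∑ q ∈ wordPairs a.length,
    fun x => t * (size₁ (q.1.length + 1) u (t, x) * size₂ (q.2.length + 1) u (t, x)))
    (.of_forall fun x => ?_) 2).trans ?_
  · have hs : ∀ q : List (Fin 8) × List (Fin 8),
        0 ≤ size₁ (q.1.length + 1) u (t, x) * size₂ (q.2.length + 1) u (t, x) := fun q =>
      mul_nonneg (size₁_nonneg _ _ _) (size₂_nonneg _ _ _)
    rw [Finset.sum_apply, Real.norm_of_nonneg (Finset.sum_nonneg fun q _ => mul_nonneg ht (hs q)),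
      Pi.smul_apply, norm_smul, Real.norm_of_nonneg ht, ← Finset.mul_sum]
    refine (mul_le_mul_of_nonneg_left (hq u u hu hu (t, x)) ht).trans (le_of_eq ?_)
    rw [Finset.sum_add_distrib]
    ring
  · rw [mul_assoc (C₀ * 2), ENNReal.ofReal_mul (by positivity : 0 ≤ C₀ * 2), Finset.sum_mul,
      ENNReal.ofReal_sum_of_nonneg fun q _ => mul_nonneg (hC₁ q) (hB u t)]
    refine mul_le_mul_right ((eLpNorm_sum_le (fun q _ => hcont q) one_le_two).trans ?_) _
    exact Finset.sum_le_sum fun q hq => h₁ q hq u hu t ht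

/-- The linear estimate, with the wave operator replaced by a quadratic expression and a
remainder. -/
theorem exists_weightedReal_le {c : Fin 2 → ℝ} (h1 : 0 < c 1) (h01 : c 1 < c 0)
    (Q : Fin 3 → Fin 3 → Fin 3 → E3 →L[ℝ] E3 →L[ℝ] E3) (k : ℕ) (B : VField → ℝ → ℝ)
    (h : ∀ b d : ℕ, b + d + 2 ≤ k → ∃ C : ℝ, 0 ≤ C ∧ ∀ u, IsTest u → ∀ t : ℝ, 0 ≤ t →
      eLpNorm (fun x => t * (size₁ (b + 1) u (t, x) * size₂ (d + 1) u (t, x))) 2 volume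
        ≤ ENNReal.ofReal (C * B u t)) (hB : ∀ u t, 0 ≤ B u t) :
    ∃ C : ℝ, 0 ≤ C ∧ ∀ u, IsTest u → ∀ t : ℝ, 0 ≤ t → ∀ ρ : ℝ, 0 ≤ ρ →
      (∀ b ∈ words (k - 1), ENNReal.ofReal t *
        eLpNorm (fun x => genWord b (waveOp c u - quad Q u u) (t, x)) 2 volume ≤ ENNReal.ofReal ρ) →
      weightedReal c k u t ≤ C * (rootEnergy c k u t + ρ + B u t) := by
  obtain ⟨C₀, hC₀, hlin⟩ := exists_weightedNorm_le c h1 h01 k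
  have h' : ∀ a : List (Fin 8), ∃ C : ℝ, 0 ≤ C ∧ (a ∈ words (k - 1) → ∀ u, IsTest u → ∀ t : ℝ,
      0 ≤ t → ENNReal.ofReal t * eLpNorm (fun x => genWord a (quad Q u u) (t, x)) 2 volume
        ≤ ENNReal.ofReal (C * B u t)) := by
    intro a
    by_cases ha : a ∈ words (k - 1)
    · have hal := mem_words.1 ha
      obtain ⟨C, hC, hu⟩ := exists_eLpNorm_quad_le Q a B (fun b d hbd => h b d (by omega)) hB
      exact ⟨C, hC, fun _ => hu⟩
    · exact ⟨0, le_rfl, fun hm => absurd hm ha⟩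
  choose C₁ hC₁ h₁ using h'
  set M := ∑ a ∈ words (k - 1), C₁ a with hM
  have hM0 : 0 ≤ M := Finset.sum_nonneg fun a _ => hC₁ a
  set N := ((words (k - 1)).card : ℝ) with hN
  have hN0 : 0 ≤ N := by positivity
  refine ⟨C₀ * (1 + N + M), by positivity, fun u hu t ht ρ hρ hR => ?_⟩
  have hE0 := rootEnergy_nonneg c k u t
  have hB0 := hB u t
  have hsum : ENNReal.ofReal t * ∑ b ∈ words (k - 1),
      eLpNorm (fun x => genWord b (waveOp c u) (t, x)) 2 volume
        ≤ ENNReal.ofReal (N * ρ + M * B u t) := by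
    have e : N * ρ + M * B u t = ∑ b ∈ words (k - 1), (ρ + C₁ b * B u t) := by
      rw [Finset.sum_add_distrib, Finset.sum_const, nsmul_eq_mul, hM, Finset.sum_mul]
    rw [e, ENNReal.ofReal_sum_of_nonneg fun b _ => add_nonneg hρ (mul_nonneg (hC₁ b) hB0),
      Finset.mul_sum]
    refine Finset.sum_le_sum fun b hb => ?_
    have e2 : (fun x => genWord b (waveOp c u) (t, x))
        = (fun x => genWord b (waveOp c u - quad Q u u) (t, x))
          + fun x => genWord b (quad Q u u) (t, x) := by
      funext x
      rw [Pi.add_apply, genWord_sub b (hu.waveOp c) (hu.quad hu Q), Pi.sub_apply, sub_add_cancel]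
    rw [e2, ENNReal.ofReal_add hρ (mul_nonneg (hC₁ b) hB0)]
    refine (mul_le_mul_right (eLpNorm_add_le
      (((((hu.waveOp c).sub (hu.quad hu Q)).genWord b).slice_continuous t).aestronglyMeasurable)
      ((((hu.quad hu Q).genWord b).slice_continuous t).aestronglyMeasurable) one_le_two) _).trans ?_
    rw [mul_add]
    exact add_le_add (hR b hb) (h₁ b hb u hu t ht)
  have hfin : ENNReal.ofReal (weightedReal c k u t)
      ≤ ENNReal.ofReal (C₀ * (rootEnergy c k u t + (N * ρ + M * B u t))) := by
    rw [ofReal_weightedReal h1 h01 k hu ht, ENNReal.ofReal_mul hC₀,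
      ENNReal.ofReal_add hE0 (by positivity)]
    exact (hlin u hu t ht).trans (by gcongr)
  refine ((ENNReal.ofReal_le_ofReal_iff (by positivity)).1 hfin).trans ?_
  rw [mul_assoc]
  refine mul_le_mul_of_nonneg_left ?_ hC₀
  have p1 : 0 ≤ (N + M) * rootEnergy c k u t := by positivity
  have p2 : 0 ≤ (1 + M) * ρ := by positivity
  have p3 : 0 ≤ (1 + N) * B u t := by positivity
  linarith

/-- The weighted estimate for test fields that solve the quadratic equation up to a remainder. -/
theorem exists_weighted_quad_le {c : Fin 2 → ℝ} (h1 : 0 < c 1) (h01 : c 1 < c 0)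
    (Q : Fin 3 → Fin 3 → Fin 3 → E3 →L[ℝ] E3 →L[ℝ] E3) {κ : ℕ} (hκ : 8 ≤ κ) :
    ∃ ε : ℝ, 0 < ε ∧ ∃ C : ℝ, 0 ≤ C ∧ ∀ u, IsTest u → ∀ t : ℝ, 0 ≤ t → ∀ ρ : ℝ, 0 ≤ ρ →
      (∀ b ∈ words (κ - 1), ENNReal.ofReal t *
        eLpNorm (fun x => genWord b (waveOp c u - quad Q u u) (t, x)) 2 volume ≤ ENNReal.ofReal ρ) →
      rootEnergy c (κ - 2) u t ≤ ε →
      weightedReal c (κ - 2) u t ≤ C * (rootEnergy c (κ - 2) u t + ρ) ∧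
      weightedReal c κ u t ≤ C * (rootEnergy c κ u t * (1 + rootEnergy c (κ - 2) u t)
        + ρ * (1 + rootEnergy c κ u t)) := by
  have hE0 : ∀ k u t, 0 ≤ rootEnergy c k u t := fun k u t => rootEnergy_nonneg c k u t
  have hX0 : ∀ k u t, 0 ≤ weightedReal c k u t := fun k u t => weightedReal_nonneg c k u t
  set B₁ : VField → ℝ → ℝ := fun u t => rootEnergy c (κ - 2) u t
    * (rootEnergy c (κ - 2) u t + weightedReal c (κ - 2) u t) with hB₁
  set B₂ : VField → ℝ → ℝ := fun u t => rootEnergy c (κ - 2) u t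
      * (rootEnergy c κ u t + weightedReal c κ u t)
    + rootEnergy c κ u t * (rootEnergy c (κ - 2) u t + weightedReal c (κ - 2) u t) with hB₂
  have hB₁0 : ∀ u t, 0 ≤ B₁ u t := fun u t => mul_nonneg (hE0 _ _ _) (add_nonneg (hE0 _ _ _) (hX0 _ _ _))
  have hB₂0 : ∀ u t, 0 ≤ B₂ u t := fun u t => add_nonneg
    (mul_nonneg (hE0 _ _ _) (add_nonneg (hE0 _ _ _) (hX0 _ _ _)))
    (mul_nonneg (hE0 _ _ _) (add_nonneg (hE0 _ _ _) (hX0 _ _ _)))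
  obtain ⟨C₁, hC₁, hlow⟩ := exists_weightedReal_le h1 h01 Q (κ - 2) B₁ (fun b d hbd => by
    by_cases hb : b + 4 ≤ κ - 2
    · exact exists_mul_sup_size₁_le h1 h01 b d (κ - 2) (κ - 2) hb (by omega)
    · exact exists_mul_sup_size₂_le h1 h01 b d (κ - 2) (κ - 2) (by omega) (by omega)) hB₁0
  -- the low norm carries the supremum in the first case and the weight in the others
  obtain ⟨C₂, hC₂, hhigh⟩ := exists_weightedReal_le h1 h01 Q κ B₂ (fun b d hbd => by
    have hle : ∀ u t, rootEnergy c κ u t * (rootEnergy c (κ - 2) u t + weightedReal c (κ - 2) u t)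
        ≤ B₂ u t := fun u t =>
      le_add_of_nonneg_left (mul_nonneg (hE0 _ _ _) (add_nonneg (hE0 _ _ _) (hX0 _ _ _)))
    by_cases hb : b + 6 ≤ κ
    · obtain ⟨C, hC, h⟩ := exists_mul_sup_size₁_le h1 h01 b d (κ - 2) κ (by omega) (by omega)
      refine ⟨C, hC, fun u hu t ht => (h u hu t ht).trans (ENNReal.ofReal_le_ofReal
        (mul_le_mul_of_nonneg_left ?_ hC))⟩
      exact le_add_of_nonneg_right (mul_nonneg (hE0 _ _ _) (add_nonneg (hE0 _ _ _) (hX0 _ _ _)))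
    by_cases hb' : b + 4 ≤ κ
    · obtain ⟨C, hC, h⟩ := exists_mul_sup_size₁_le h1 h01 b d κ (κ - 2) hb' (by omega)
      exact ⟨C, hC, fun u hu t ht => (h u hu t ht).trans (ENNReal.ofReal_le_ofReal
        (mul_le_mul_of_nonneg_left (hle u t) hC))⟩
    · obtain ⟨C, hC, h⟩ := exists_mul_sup_size₂_le h1 h01 b d κ (κ - 2) (by omega) (by omega)
      exact ⟨C, hC, fun u hu t ht => (h u hu t ht).trans (ENNReal.ofReal_le_ofReal
        (mul_le_mul_of_nonneg_left (hle u t) hC))⟩) hB₂0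
  -- with this smallness the products of the low energy with a weighted norm are at most half of
  -- that weighted norm
  set ε := 1 / (2 * (C₁ + C₂) + 1) with hε
  have hε0 : 0 < ε := by positivity
  have hε1 : ε ≤ 1 := by
    rw [hε, div_le_one (by positivity)]
    linarith
  have hε2 : (C₁ + C₂) * ε ≤ 1 / 2 := by
    rw [hε, mul_one_div, div_le_div_iff₀ (by positivity) two_pos]
    linarith
  refine ⟨ε, hε0, 4 * C₁ + 2 * C₂ * (2 + 4 * C₁), by positivity, fun u hu t ht ρ hρ hR hsmall => ?_⟩
  have a1 := hlow u hu t ht ρ hρ (fun b hb => hR b (words_mono (by omega) hb))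
  have a2 := hhigh u hu t ht ρ hρ hR
  simp only [hB₁] at a1
  simp only [hB₂] at a2
  have e0 := hE0 (κ - 2) u t
  have E0 := hE0 κ u t
  have x0 := hX0 (κ - 2) u t
  have X0 := hX0 κ u t
  set e := rootEnergy c (κ - 2) u t
  set E := rootEnergy c κ u t
  set x := weightedReal c (κ - 2) u t
  set X := weightedReal c κ u t
  have s1 : C₁ * e ≤ 1 / 2 := by nlinarith
  have s2 : C₂ * e ≤ 1 / 2 := by nlinarith
  have b1 : x ≤ 4 * C₁ * (e + ρ) := by
    have := mul_le_mul_of_nonneg_right s1 x0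
    have : C₁ * (e * e) ≤ C₁ * (1 * e) := by gcongr; linarith
    have := mul_nonneg hC₁ hρ
    linarith
  have b2 : X ≤ 2 * C₂ * (2 + 4 * C₁) * (E * (1 + e) + ρ * (1 + E)) := by
    have p1 := mul_le_mul_of_nonneg_right s2 X0
    have p2 : C₂ * (E * x) ≤ C₂ * (E * (4 * C₁ * (e + ρ))) := by gcongr
    have p3 : 0 ≤ C₂ * (E + ρ + 2 * (E * ρ) + 4 * C₁ * (E + ρ)) := by positivity
    linarith
  constructor
  · refine b1.trans (mul_le_mul_of_nonneg_right ?_ (by positivity))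
    have : 0 ≤ 2 * C₂ * (2 + 4 * C₁) := by positivity
    linarith
  · refine b2.trans (mul_le_mul_of_nonneg_right ?_ (by positivity))
    linarith

/-! ### Isotropy -/

/-- Conjugation by a matrix, as a linear map. -/
def conjL (Q : Matrix (Fin 3) (Fin 3) ℝ) :
    Matrix (Fin 3) (Fin 3) ℝ →L[ℝ] Matrix (Fin 3) (Fin 3) ℝ :=
  LinearMap.toContinuousLinearMap
    ((LinearMap.mulLeft ℝ Q).comp (LinearMap.mulRight ℝ Q.transpose))

theorem conjL_apply (Q H : Matrix (Fin 3) (Fin 3) ℝ) : conjL Q H = Q * (H * Q.transpose) := rfl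

/-- The second derivative of `σ` at `lam I`, as a bilinear map. -/
def hessian (σ : Matrix (Fin 3) (Fin 3) ℝ → ℝ) (lam : ℝ) :
    Matrix (Fin 3) (Fin 3) ℝ →L[ℝ] Matrix (Fin 3) (Fin 3) ℝ →L[ℝ] ℝ :=
  fderiv ℝ (fderiv ℝ σ) (lam • 1)

theorem coeffA_eq (σ : Matrix (Fin 3) (Fin 3) ℝ → ℝ) (lam : ℝ) (i j l m : Fin 3) :
    coeffA σ lam i j l m = hessian σ lam (Matrix.single i l 1) (Matrix.single j m 1) := by
  rw [coeffA, iteratedFDeriv_two_apply]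
  rfl

theorem posDet_mem_nhds {F : Matrix (Fin 3) (Fin 3) ℝ} (hF : 0 < F.det) :
    {F : Matrix (Fin 3) (Fin 3) ℝ | 0 < F.det} ∈ 𝓝 F :=
  (isOpen_lt continuous_const (Continuous.matrix_det continuous_id)).mem_nhds hF

theorem det_smul_one_pos {lam : ℝ} (hlam : 0 < lam) :
    0 < (lam • (1 : Matrix (Fin 3) (Fin 3) ℝ)).det := by
  rw [Matrix.det_smul, Matrix.det_one, mul_one]
  positivity

theorem contDiffAt_of_posDet {σ : Matrix (Fin 3) (Fin 3) ℝ → ℝ}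
    (hσ : ContDiffOn ℝ 3 σ {F : Matrix (Fin 3) (Fin 3) ℝ | 0 < F.det}) {F : Matrix (Fin 3) (Fin 3) ℝ}
    (hF : 0 < F.det) : ContDiffAt ℝ 3 σ F :=
  hσ.contDiffAt (posDet_mem_nhds hF)

theorem hessian_symm {σ : Matrix (Fin 3) (Fin 3) ℝ → ℝ}
    (hσ : ContDiffOn ℝ 3 σ {F : Matrix (Fin 3) (Fin 3) ℝ | 0 < F.det}) {lam : ℝ} (hlam : 0 < lam)
    (H K : Matrix (Fin 3) (Fin 3) ℝ) : hessian σ lam H K = hessian σ lam K H :=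
  ((contDiffAt_of_posDet hσ (det_smul_one_pos hlam)).isSymmSndFDerivAt (by norm_num)) H K

/-- A proper rotation `Q` gives `σ (Q F Qᵀ) = σ F`, and conjugation fixes `lam I`; two
differentiations at `lam I` leave the second derivative invariant. -/
theorem hessian_conj {σ : Matrix (Fin 3) (Fin 3) ℝ → ℝ}
    (hσ : ContDiffOn ℝ 3 σ {F : Matrix (Fin 3) (Fin 3) ℝ | 0 < F.det}) (hiso : IsIsotropic σ)
    {lam : ℝ} (hlam : 0 < lam) {Q : Matrix (Fin 3) (Fin 3) ℝ}
    (hQ : Q ∈ Matrix.specialOrthogonalGroup (Fin 3) ℝ) (H K : Matrix (Fin 3) (Fin 3) ℝ) :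
    hessian σ lam (conjL Q H) (conjL Q K) = hessian σ lam H K := by
  have hQ' := Matrix.mem_specialOrthogonalGroup_iff.1 hQ
  have hQQ : Q * Q.transpose = 1 := (Matrix.mem_orthogonalGroup_iff (Fin 3) ℝ).1 hQ'.1
  have hQT : Q.transpose ∈ Matrix.specialOrthogonalGroup (Fin 3) ℝ := by
    rw [Matrix.mem_specialOrthogonalGroup_iff, Matrix.mem_orthogonalGroup_iff, Matrix.det_transpose]
    exact ⟨(Matrix.mem_orthogonalGroup_iff' (Fin 3) ℝ).1 hQ'.1, hQ'.2⟩
  have hdet : ∀ F, (conjL Q F).det = F.det := fun F => by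
    rw [conjL_apply, Matrix.det_mul, Matrix.det_mul, Matrix.det_transpose, hQ'.2]; ring
  have hinv : ∀ F, 0 < F.det → σ (conjL Q F) = σ F := fun F hF => by
    have h1 : 0 < (F * Q.transpose).det := by
      rw [Matrix.det_mul, Matrix.det_transpose, hQ'.2, mul_one]; exact hF
    rw [conjL_apply, (hiso _ h1 Q hQ).1, (hiso F hF _ hQT).2]
  have hfix : conjL Q (lam • 1) = lam • 1 := by
    rw [map_smul, conjL_apply, one_mul, hQQ]
  have hd1 : ∀ F : Matrix (Fin 3) (Fin 3) ℝ, 0 < F.det →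
      fderiv ℝ σ F = (fderiv ℝ σ (conjL Q F)).comp (conjL Q) := fun F hF => by
    have e : (fun F => σ (conjL Q F)) =ᶠ[𝓝 F] σ := by
      filter_upwards [posDet_mem_nhds hF] with G hG using hinv G hG
    rw [← e.fderiv_eq]
    have hs : DifferentiableAt ℝ σ (conjL Q F) :=
      (contDiffAt_of_posDet hσ (by rw [hdet]; exact hF)).differentiableAt (by norm_num)
    exact (hs.hasFDerivAt.comp F (conjL Q).hasFDerivAt).fderiv
  have hpos := det_smul_one_pos hlam
  have hs2 : DifferentiableAt ℝ (fderiv ℝ σ) (lam • 1) :=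
    ((contDiffAt_of_posDet hσ hpos).fderiv_right (m := 2) (by norm_num)).differentiableAt
      (by norm_num)
  have h1 : HasFDerivAt (fun F => fderiv ℝ σ F K) ((hessian σ lam).flip K) (lam • 1) := by
    have := hs2.hasFDerivAt.clm_apply (hasFDerivAt_const K (lam • 1))
    refine this.congr_fderiv (ContinuousLinearMap.ext fun G => ?_)
    change fderiv ℝ σ (lam • 1) 0 + hessian σ lam G K = hessian σ lam G K
    rw [map_zero, zero_add]
  have h2 : HasFDerivAt (fun F => fderiv ℝ σ (conjL Q F) (conjL Q K))
      (((hessian σ lam).flip (conjL Q K)).comp (conjL Q)) (lam • 1) := by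
    have h3 : HasFDerivAt (fun F => fderiv ℝ σ F (conjL Q K)) ((hessian σ lam).flip (conjL Q K))
        (conjL Q (lam • 1)) := by
      rw [hfix]
      have := hs2.hasFDerivAt.clm_apply (hasFDerivAt_const (conjL Q K) (lam • 1))
      refine this.congr_fderiv (ContinuousLinearMap.ext fun G => ?_)
      change fderiv ℝ σ (lam • 1) 0 + hessian σ lam G (conjL Q K) = hessian σ lam G (conjL Q K)
      rw [map_zero, zero_add]
    exact h3.comp (lam • 1) (conjL Q).hasFDerivAt
  have e2 : (fun F => fderiv ℝ σ F K) =ᶠ[𝓝 (lam • 1)]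
      fun F => fderiv ℝ σ (conjL Q F) (conjL Q K) := by
    filter_upwards [posDet_mem_nhds hpos] with G hG
    exact congrArg (fun L => L K) (hd1 G hG)
  have h4 := h1.unique (h2.congr_of_eventuallyEq e2)
  exact (congrArg (fun L => L H) h4).symm

theorem conjL_single (Q : Matrix (Fin 3) (Fin 3) ℝ) (i l : Fin 3) :
    conjL Q (Matrix.single i l 1) = ∑ a, ∑ b, (Q a i * Q b l) • Matrix.single a b (1 : ℝ) := by
  ext p q
  rw [conjL_apply, Matrix.mul_apply]
  simp only [Matrix.sum_apply, Matrix.smul_apply, Matrix.mul_apply, Matrix.single_apply,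
    Matrix.transpose_apply, smul_eq_mul]
  fin_cases p <;> fin_cases q <;> fin_cases i <;> fin_cases l <;> simp [Fin.sum_univ_three]

/-- The coefficients form an isotropic tensor: they are unchanged when both axes, of the
deformation and of the gradient, are rotated simultaneously. -/
theorem coeffA_conj {σ : Matrix (Fin 3) (Fin 3) ℝ → ℝ}
    (hσ : ContDiffOn ℝ 3 σ {F : Matrix (Fin 3) (Fin 3) ℝ | 0 < F.det}) (hiso : IsIsotropic σ)
    {lam : ℝ} (hlam : 0 < lam) {Q : Matrix (Fin 3) (Fin 3) ℝ}
    (hQ : Q ∈ Matrix.specialOrthogonalGroup (Fin 3) ℝ) (i j l m : Fin 3) :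
    coeffA σ lam i j l m = ∑ a, ∑ b, ∑ p, ∑ q,
      Q a i * Q b l * (Q p j * Q q m) * coeffA σ lam a p b q := by
  rw [coeffA_eq, hessian_symm hσ hlam, ← hessian_conj hσ hiso hlam hQ, conjL_single, conjL_single]
  simp only [map_sum, map_smul, sum_apply, smul_apply, smul_eq_mul,
    coeffA_eq, Finset.mul_sum]
  refine Finset.sum_congr rfl fun a _ => Finset.sum_congr rfl fun b _ =>
    Finset.sum_congr rfl fun p _ => Finset.sum_congr rfl fun q _ => ?_
  rw [hessian_symm hσ hlam]
  ring

theorem mem_specialOrthogonal {Q : Matrix (Fin 3) (Fin 3) ℝ} (h : Q * Q.transpose = 1)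
    (hd : Q.det = 1) : Q ∈ Matrix.specialOrthogonalGroup (Fin 3) ℝ :=
  ⟨(Matrix.mem_orthogonalGroup_iff (Fin 3) ℝ).2 h, hd⟩

/-- The rotation by `π` about the axis `k`, which reverses the other two axes. -/
def flipQ (k : Fin 3) : Matrix (Fin 3) (Fin 3) ℝ := Matrix.diagonal fun i => if i = k then 1 else -1

/-- The cyclic permutation of the axes. -/
def cycQ : Matrix (Fin 3) (Fin 3) ℝ := !![0, 0, 1; 1, 0, 0; 0, 1, 0]

/-- The exchange of the first two axes, with a reflection of the third. -/
def swapQ : Matrix (Fin 3) (Fin 3) ℝ := !![0, 1, 0; 1, 0, 0; 0, 0, -1]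

/-- A rotation of the first two axes by the angle of a Pythagorean triangle. -/
def turnQ : Matrix (Fin 3) (Fin 3) ℝ := !![3 / 5, 4 / 5, 0; -4 / 5, 3 / 5, 0; 0, 0, 1]

theorem flipQ_mem (k : Fin 3) : flipQ k ∈ Matrix.specialOrthogonalGroup (Fin 3) ℝ := by
  refine mem_specialOrthogonal ?_ ?_
  · rw [flipQ, Matrix.diagonal_transpose, Matrix.diagonal_mul_diagonal, ← Matrix.diagonal_one]
    congr 1
    funext i
    split_ifs <;> norm_num
  · rw [flipQ, Matrix.det_diagonal]
    fin_cases k <;> simp [Fin.prod_univ_three]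

theorem cycQ_mem : cycQ ∈ Matrix.specialOrthogonalGroup (Fin 3) ℝ := by
  refine mem_specialOrthogonal ?_ (by simp [cycQ, Matrix.det_fin_three])
  ext i j
  fin_cases i <;> fin_cases j <;> simp [cycQ, Matrix.mul_apply, Fin.sum_univ_three]

theorem swapQ_mem : swapQ ∈ Matrix.specialOrthogonalGroup (Fin 3) ℝ := by
  refine mem_specialOrthogonal ?_ (by simp [swapQ, Matrix.det_fin_three])
  ext i j
  fin_cases i <;> fin_cases j <;> simp [swapQ, Matrix.mul_apply, Fin.sum_univ_three]

theorem turnQ_mem : turnQ ∈ Matrix.specialOrthogonalGroup (Fin 3) ℝ := by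
  refine mem_specialOrthogonal ?_ (by simp [turnQ, Matrix.det_fin_three]; norm_num)
  ext i j
  fin_cases i <;> fin_cases j <;> simp [turnQ, Matrix.mul_apply, Fin.sum_univ_three] <;> norm_num

/-- The symmetric part of the second derivative at `lam I` is that of the isotropic operator. -/
theorem coeffA_symm_part {σ : Matrix (Fin 3) (Fin 3) ℝ → ℝ}
    (hσ : ContDiffOn ℝ 3 σ {F : Matrix (Fin 3) (Fin 3) ℝ | 0 < F.det}) (hiso : IsIsotropic σ)
    {lam : ℝ} (hlam : 0 < lam) (i j l m : Fin 3) :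
    coeffA σ lam i j l m + coeffA σ lam i j m l
      = (if i = j ∧ l = m then 2 * coeffA σ lam 1 1 0 0 else 0)
        + (coeffA σ lam 0 0 0 0 - coeffA σ lam 1 1 0 0)
          * ((if i = l ∧ j = m then 1 else 0) + if i = m ∧ j = l then 1 else 0) := by
  set a := coeffA σ lam with ha
  have hsym : ∀ i j l m, a i j l m = a j i m l := fun i j l m => by
    rw [ha, coeffA_eq, coeffA_eq, hessian_symm hσ hlam]
  have hflip : ∀ k i j l m, a i j l m = (if i = k then 1 else -1) * (if l = k then 1 else -1)
      * ((if j = k then 1 else -1) * (if m = k then 1 else -1)) * a i j l m := fun k i j l m => by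
    have := coeffA_conj hσ hiso hlam (flipQ_mem k) i j l m
    simpa [flipQ, Matrix.diagonal_apply, ha] using this
  have hcyc : ∀ i j l m, a i j l m = a (i + 1) (j + 1) (l + 1) (m + 1) := fun i j l m => by
    have := coeffA_conj hσ hiso hlam cycQ_mem i j l m
    rw [show a i j l m = _ from this]
    have hc : ∀ p q : Fin 3, cycQ p q = if p = q + 1 then 1 else 0 := by
      intro p q
      fin_cases p <;> fin_cases q <;> rfl
    simp [hc, ha]
  have hswap : a 0 0 1 1 = a 1 1 0 0 := by
    have := coeffA_conj hσ hiso hlam swapQ_mem 0 0 1 1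
    simpa [swapQ, Fin.sum_univ_three, ha] using this
  -- an odd number of indices equal to `k` forces the coefficient to vanish
  have hzero : ∀ i j l m, ¬(i = j ∧ l = m) → ¬(i = l ∧ j = m) → ¬(i = m ∧ j = l) →
      a i j l m = 0 := by
    intro i j l m h1 h2 h3
    have hk : ∃ k, (if i = k then 1 else -1) * (if l = k then 1 else -1)
        * ((if j = k then 1 else -1) * (if m = k then 1 else -1)) = (-1 : ℤ) := by
      revert i j l m
      decide
    obtain ⟨k, hk⟩ := hk
    have hk' := congrArg (Int.cast : ℤ → ℝ) hk
    push_cast at hk'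
    have := hflip k i j l m
    rw [hk'] at this
    linarith
  have hα : ∀ i, a i i i i = a 0 0 0 0 := by
    have h0 := hcyc 0 0 0 0
    have h1 := hcyc 1 1 1 1
    intro i
    fin_cases i
    exacts [rfl, h0.symm, (h0.trans h1).symm]
  have hβ : ∀ i l, i ≠ l → a i i l l = a 1 1 0 0 := by
    have h0 := hcyc 0 0 1 1
    have h1 := hcyc 1 1 2 2
    have h2 := hcyc 1 1 0 0
    have h3 := hcyc 2 2 1 1
    intro i l hil
    fin_cases i <;> fin_cases l
    exacts [absurd rfl hil, hswap, (h3.symm.trans h2.symm), rfl, absurd rfl hil,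
      h0.symm.trans hswap, (h0.trans h1).symm.trans hswap, h2.symm, absurd rfl hil]
  -- the 3-4-5 rotation turns the `0000` entry into a combination of the three kinds of surviving
  -- coefficients, and its rational entries keep the relation linear with rational weights
  have hturn : a 0 1 0 1 + a 0 1 1 0 = a 0 0 0 0 - a 1 1 0 0 := by
    have h := coeffA_conj hσ hiso hlam turnQ_mem 0 0 0 0
    simp only [Fin.sum_univ_three, ← ha] at h
    rw [hzero 0 0 0 1 (by decide) (by decide) (by decide),
      hzero 0 0 1 0 (by decide) (by decide) (by decide),
      hzero 0 1 0 0 (by decide) (by decide) (by decide),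
      hzero 1 0 0 0 (by decide) (by decide) (by decide),
      hzero 1 1 1 0 (by decide) (by decide) (by decide),
      hzero 1 1 0 1 (by decide) (by decide) (by decide),
      hzero 1 0 1 1 (by decide) (by decide) (by decide),
      hzero 0 1 1 1 (by decide) (by decide) (by decide),
      hα 1, hβ 0 1 (by decide), hsym 1 0 1 0, hsym 1 0 0 1] at h
    simp [turnQ] at h
    linarith
  have hmix : ∀ i j, i ≠ j → a i j i j + a i j j i = a 0 0 0 0 - a 1 1 0 0 := by
    have h0 := hcyc 0 1 0 1
    have h1 := hcyc 0 1 1 0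
    have h2 := hcyc 1 2 1 2
    have h3 := hcyc 1 2 2 1
    have s0 := hsym 0 1 0 1
    have s1 := hsym 0 1 1 0
    have s2 := hsym 1 2 1 2
    have s3 := hsym 1 2 2 1
    have s4 := hsym 2 0 2 0
    have s5 := hsym 2 0 0 2
    simp only [show (0 : Fin 3) + 1 = 1 from rfl, show (1 : Fin 3) + 1 = 2 from rfl,
      show (2 : Fin 3) + 1 = 0 from rfl] at h0 h1 h2 h3
    intro i j hij
    fin_cases i <;> fin_cases j <;> first | exact absurd rfl hij | skip
    · exact hturn
    · change a 0 2 0 2 + a 0 2 2 0 = _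
      linarith
    · change a 1 0 1 0 + a 1 0 0 1 = _
      linarith
    · change a 1 2 1 2 + a 1 2 2 1 = _
      linarith
    · change a 2 0 2 0 + a 2 0 0 2 = _
      linarith
    · change a 2 1 2 1 + a 2 1 1 2 = _
      linarith
  by_cases h1 : i = j ∧ l = m
  · obtain ⟨rfl, rfl⟩ := h1
    by_cases hil : i = l
    · subst hil
      simp only [hα i, and_self, if_true]
      ring
    · simp [hβ i l hil, hil]
      ring
  by_cases h2 : i = l ∧ j = m
  · obtain ⟨rfl, rfl⟩ := h2
    have hij : i ≠ j := fun h => h1 ⟨h, h⟩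
    simp [hmix i j hij, hij]
  by_cases h3 : i = m ∧ j = l
  · obtain ⟨rfl, rfl⟩ := h3
    have hij : i ≠ j := fun h => h1 ⟨h, h.symm⟩
    rw [add_comm, hmix i j hij]
    simp [hij]
  · rw [hzero i j l m h1 h2 h3, hzero i j m l (fun h => h1 ⟨h.1, h.2.symm⟩) h3 h2]
    simp [h1, h2, h3]

theorem sq_speed {σ : Matrix (Fin 3) (Fin 3) ℝ → ℝ} {lam : ℝ} (h : IsHyperbolic σ lam) :
    speed σ lam 0 ^ 2 = coeffA σ lam 0 0 0 0 ∧ speed σ lam 1 ^ 2 = coeffA σ lam 1 1 0 0 := by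
  have h1 : 0 < √(coeffA σ lam 1 1 0 0) ^ 2 := h.1
  have h0 : 0 < √(coeffA σ lam 0 0 0 0) ^ 2 := (mul_pos (by norm_num) h.1).trans h.2
  constructor
  · exact Real.sq_sqrt (Real.sqrt_pos.1 ((Real.sqrt_nonneg _).lt_of_ne fun h => by
      rw [← h] at h0; norm_num at h0)).le
  · exact Real.sq_sqrt (Real.sqrt_pos.1 ((Real.sqrt_nonneg _).lt_of_ne fun h => by
      rw [← h] at h1; norm_num at h1)).le

theorem speed_one_pos {σ : Matrix (Fin 3) (Fin 3) ℝ → ℝ} {lam : ℝ} (h : IsHyperbolic σ lam) :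
    0 < speed σ lam 1 := by
  have h0 : 0 ≤ speed σ lam 1 := Real.sqrt_nonneg _
  have := h.1
  exact h0.lt_of_ne fun he => by rw [← he] at this; norm_num at this

theorem speed_one_lt {σ : Matrix (Fin 3) (Fin 3) ℝ → ℝ} {lam : ℝ} (h : IsHyperbolic σ lam) :
    speed σ lam 1 < speed σ lam 0 := by
  have h0 : 0 ≤ speed σ lam 0 := Real.sqrt_nonneg _
  refine lt_of_pow_lt_pow_left₀ 2 h0 ?_
  linarith [h.1, h.2]

/-- For an isotropic stored energy the linear operator is the isotropic one. -/
theorem opA_eq_lame {σ : Matrix (Fin 3) (Fin 3) ℝ → ℝ}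
    (hσ : ContDiffOn ℝ 3 σ {F : Matrix (Fin 3) (Fin 3) ℝ | 0 < F.det}) (hiso : IsIsotropic σ)
    {lam : ℝ} (hlam : 0 < lam) (hhyp : IsHyperbolic σ lam) {u : VField} (hu : IsTest u) :
    opA σ lam u = lame (speed σ lam) u := by
  funext p
  ext i
  obtain ⟨s0, s1⟩ := sq_speed hhyp
  rw [lame_coord, s0, s1]
  set α := coeffA σ lam 0 0 0 0
  set β := coeffA σ lam 1 1 0 0
  change ∑ j, ∑ l, ∑ m, coeffA σ lam i j l m * dX l (dX m u) p j = _
  have hswap : ∀ j l m, dX l (dX m u) p j = dX m (dX l u) p j := fun j l m => by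
    rw [show dX l (dX m u) = dX m (dX l u) from dir_comm hu _ _]
  have h2 : ∀ j, 2 * ∑ l, ∑ m, coeffA σ lam i j l m * dX l (dX m u) p j
      = ∑ l, ∑ m, (coeffA σ lam i j l m + coeffA σ lam i j m l) * dX l (dX m u) p j := by
    intro j
    have h3 : ∑ l, ∑ m, coeffA σ lam i j m l * dX l (dX m u) p j
        = ∑ l, ∑ m, coeffA σ lam i j l m * dX l (dX m u) p j := by
      rw [Finset.sum_comm]
      exact Finset.sum_congr rfl fun l _ => Finset.sum_congr rfl fun m _ => by rw [hswap j m l]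
    simp only [add_mul, Finset.sum_add_distrib]
    rw [h3]
    ring
  have h4 : 2 * ∑ j, ∑ l, ∑ m, coeffA σ lam i j l m * dX l (dX m u) p j
      = 2 * (β * ∑ l, dX l (dX l u) p i + (α - β) * ∑ k, dX i (dX k u) p k) := by
    rw [Finset.mul_sum, Finset.sum_congr rfl fun j _ => h2 j]
    simp only [coeffA_symm_part hσ hiso hlam]
    simp only [Fin.sum_univ_three]
    fin_cases i
    · simp [hswap 1 1 0, hswap 2 2 0, α, β]
      ring
    · simp [hswap 0 0 1, hswap 2 2 1, α, β]
      ring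
    · simp [hswap 0 0 2, hswap 1 1 2, α, β]
      ring
  linarith

/-! ### The quadratic operator -/

/-- The bilinear maps of the quadratic operator. -/
def opNQ (σ : Matrix (Fin 3) (Fin 3) ℝ → ℝ) (lam : ℝ) (l m n : Fin 3) : E3 →L[ℝ] E3 →L[ℝ] E3 :=
  ∑ i, ∑ j, ∑ k, coeffB σ lam i j k l m n •
    (EuclideanSpace.proj j : E3 →L[ℝ] ℝ).smulRight
      ((EuclideanSpace.proj k : E3 →L[ℝ] ℝ).smulRight (EuclideanSpace.single i (1 : ℝ)))

theorem opNQ_apply (σ : Matrix (Fin 3) (Fin 3) ℝ → ℝ) (lam : ℝ) (l m n : Fin 3) (v w : E3)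
    (i : Fin 3) : opNQ σ lam l m n v w i = ∑ j, ∑ k, coeffB σ lam i j k l m n * (v j * w k) := by
  simp only [opNQ, sum_apply, smul_apply, ContinuousLinearMap.smulRight_apply, PiLp.smul_apply,
    WithLp.ofLp_sum, Finset.sum_apply, smul_eq_mul, PiLp.proj_apply]
  rw [Finset.sum_eq_single i (fun b _ hb => by simp [hb.symm]) (by simp)]
  simp

theorem opN_eq_quad (σ : Matrix (Fin 3) (Fin 3) ℝ → ℝ) (lam : ℝ) {u : VField}
    {p : ℝ × E3} (hu : ∀ m, DifferentiableAt ℝ (dX m u) p) :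
    opN σ lam u u p = quad (opNQ σ lam) u u p := by
  ext i
  change ∑ j, ∑ k, ∑ l, ∑ m, ∑ n, coeffB σ lam i j k l m n *
      fderiv ℝ (fun q => dX m u q j * dX n u q k) p (0, EuclideanSpace.single l 1) = _
  have hd : ∀ j k l m n, fderiv ℝ (fun q => dX m u q j * dX n u q k) p (0, EuclideanSpace.single l 1)
      = dX l (dX m u) p j * dX n u p k + dX m u p j * dX l (dX n u) p k := by
    intro j k l m n
    have hc : ∀ m j, HasFDerivAt (fun q => dX m u q j)
        ((EuclideanSpace.proj j : E3 →L[ℝ] ℝ).comp (fderiv ℝ (dX m u) p)) p := fun m j =>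
      (EuclideanSpace.proj j : E3 →L[ℝ] ℝ).hasFDerivAt.comp p (hu m).hasFDerivAt
    have hm : HasFDerivAt (fun q => dX m u q j * dX n u q k) _ p := (hc m j).mul (hc n k)
    rw [hm.fderiv]
    change dX m u p j * dX l (dX n u) p k + dX n u p k * dX l (dX m u) p j = _
    ring
  simp only [hd, quad, Finset.sum_apply, Pi.add_apply, WithLp.ofLp_sum, PiLp.add_apply, opNQ_apply]
  have e : ∀ F : Fin 3 → Fin 3 → Fin 3 → Fin 3 → Fin 3 → ℝ,
      ∑ j, ∑ k, ∑ l, ∑ m, ∑ n, F j k l m n = ∑ l, ∑ m, ∑ n, ∑ j, ∑ k, F j k l m n := by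
    intro F
    simp only [Fin.sum_univ_three]
    ring
  rw [e]
  refine Finset.sum_congr rfl fun l _ => Finset.sum_congr rfl fun m _ => Finset.sum_congr rfl
    fun n _ => ?_
  rw [← Finset.sum_add_distrib]
  refine Finset.sum_congr rfl fun j _ => ?_
  rw [← Finset.sum_add_distrib]
  refine Finset.sum_congr rfl fun k _ => ?_
  ring

/-! ### Comparison of energies -/

theorem integral_norm_add_sq_le {F : Type*} [NormedAddCommGroup F] {f g : E3 → F}
    (hf : MemLp f 2 volume) (hg : MemLp g 2 volume) :
    ∫ x, ‖f x + g x‖ ^ 2 ≤ 2 * (∫ x, ‖f x‖ ^ 2) + 2 * ∫ x, ‖g x‖ ^ 2 := by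
  have h1 := hf.integrable_norm_pow two_ne_zero
  have h2 := hg.integrable_norm_pow two_ne_zero
  have h3 := (hf.add hg).integrable_norm_pow two_ne_zero
  rw [← integral_const_mul, ← integral_const_mul, ← integral_add (h1.const_mul _) (h2.const_mul _)]
  refine integral_mono h3 ((h1.const_mul _).add (h2.const_mul _)) fun x => ?_
  have := norm_add_le (f x) (g x)
  have h0 := norm_nonneg (f x + g x)
  change ‖f x + g x‖ ^ 2 ≤ 2 * ‖f x‖ ^ 2 + 2 * ‖g x‖ ^ 2
  nlinarith [sq_nonneg (‖f x‖ - ‖g x‖)]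

/-- The parallelogram bound for the energy, which is a nonnegative quadratic form. -/
theorem energyOne_add_le {c : Fin 2 → ℝ} (h1 : 0 < c 1) (h01 : c 1 < c 0) {D D' : Jet}
    {a : List (Fin 8)} (h : MemJet D a) (h' : MemJet D' a) :
    energyOne c (D + D') a ≤ 2 * energyOne c D a + 2 * energyOne c D' a := by
  have hs : MemJet (D + D') a := fun β => (h β).add (h' β)
  rw [energyOne_eq c h, energyOne_eq c h', energyOne_eq c hs]
  have hc : 0 ≤ c 0 ^ 2 - c 1 ^ 2 := by nlinarith
  have e0 := integral_norm_add_sq_le (h 0) (h' 0)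
  have el : ∑ l : Fin 3, (∫ x, ‖(D + D') (xIdx l :: a) x‖ ^ 2)
      ≤ 2 * (∑ l : Fin 3, ∫ x, ‖D (xIdx l :: a) x‖ ^ 2)
        + 2 * ∑ l : Fin 3, ∫ x, ‖D' (xIdx l :: a) x‖ ^ 2 := by
    rw [Finset.mul_sum, Finset.mul_sum, ← Finset.sum_add_distrib]
    exact Finset.sum_le_sum fun l _ => integral_norm_add_sq_le (h l.succ) (h' l.succ)
  have ed : ∫ x, (∑ l : Fin 3, (D + D') (xIdx l :: a) x l) ^ 2
      ≤ 2 * (∫ x, (∑ l : Fin 3, D (xIdx l :: a) x l) ^ 2)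
        + 2 * ∫ x, (∑ l : Fin 3, D' (xIdx l :: a) x l) ^ 2 := by
    have := integral_norm_add_sq_le h.memLp_div h'.memLp_div
    simp only [Real.norm_eq_abs, sq_abs, ← Finset.sum_add_distrib] at this
    exact this
  have el' := mul_le_mul_of_nonneg_left el (sq_nonneg (c 1))
  have ed' := mul_le_mul_of_nonneg_left ed hc
  change (∫ x, ‖(D + D') (dIdx 0 :: a) x‖ ^ 2) ≤ _ at e0
  linarith

theorem energy_add_le {c : Fin 2 → ℝ} (h1 : 0 < c 1) (h01 : c 1 < c 0) {k : ℕ} {D D' : Jet}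
    (h : ∀ a ∈ words k, MemJet D a) (h' : ∀ a ∈ words k, MemJet D' a) :
    energy c k (D + D') ≤ 2 * energy c k D + 2 * energy c k D' := by
  simp only [energy_eq_sum, Finset.mul_sum, ← Finset.sum_add_distrib]
  exact Finset.sum_le_sum fun a ha => energyOne_add_le h1 h01 (h a ha) (h' a ha)

theorem sqrt_energy_add_le {c : Fin 2 → ℝ} (h1 : 0 < c 1) (h01 : c 1 < c 0) {k : ℕ} {D D' : Jet}
    (h : ∀ a ∈ words k, MemJet D a) (h' : ∀ a ∈ words k, MemJet D' a) :
    √(energy c k (D + D')) ≤ 2 * √(energy c k D) + 2 * √(energy c k D') := by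
  have hD := energy_nonneg h1 h01 h
  have hD' := energy_nonneg h1 h01 h'
  refine Real.sqrt_le_iff.2 ⟨by positivity, (energy_add_le h1 h01 h h').trans ?_⟩
  nlinarith [Real.sq_sqrt hD, Real.sq_sqrt hD', mul_nonneg (Real.sqrt_nonneg (energy c k D))
    (Real.sqrt_nonneg (energy c k D'))]

theorem classicalJet_sub {u v : VField} (hu : IsTest u) (hv : IsTest v) (t : ℝ) :
    classicalJet (u - v) t = classicalJet u t - classicalJet v t := by
  funext a x
  simp only [classicalJet, genWord_sub a hu hv, Pi.sub_apply]

theorem rootEnergy_le_add {c : Fin 2 → ℝ} (h1 : 0 < c 1) (h01 : c 1 < c 0) (k : ℕ) {u v : VField}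
    (hu : IsTest u) (hv : IsTest v) (t : ℝ) :
    rootEnergy c k u t ≤ 2 * rootEnergy c k (u - v) t + 2 * rootEnergy c k v t := by
  have h := sqrt_energy_add_le h1 h01 (k := k) (fun a _ => memJet_classicalJet (hu.sub hv) t a)
    (fun a _ => memJet_classicalJet hv t a)
  rwa [classicalJet_sub hu hv, sub_add_cancel, ← classicalJet_sub hu hv] at h

theorem rootEnergy_sub_le {c : Fin 2 → ℝ} (h1 : 0 < c 1) (h01 : c 1 < c 0) (k : ℕ) {u v : VField}
    (hu : IsTest u) (hv : IsTest v) (t : ℝ) :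
    rootEnergy c k (u - v) t ≤ 2 * rootEnergy c k u t + 2 * rootEnergy c k v t := by
  have e : ∀ a, energyOne c (-classicalJet v t) a = energyOne c (classicalJet v t) a := fun a => by
    simp only [energyOne, Pi.neg_apply, norm_neg, PiLp.neg_apply, Finset.sum_neg_distrib, neg_sq]
  have h := sqrt_energy_add_le h1 h01 (k := k) (fun a _ => memJet_classicalJet hu t a)
    (D' := -classicalJet v t) (fun a _ β => (memJet_classicalJet hv t a β).neg)
  rwa [← sub_eq_add_neg, ← classicalJet_sub hu hv, energy_eq_sum _ _ (-classicalJet v t),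
    Finset.sum_congr rfl fun a _ => e a, ← energy_eq_sum] at h

/-- The energy tends to zero with the square integrals of the derivatives. -/
theorem tendsto_energy_zero {c : Fin 2 → ℝ} (h1 : 0 < c 1) (h01 : c 1 < c 0) {k : ℕ} {D : ℕ → Jet}
    (hm : ∀ n, ∀ a ∈ words k, MemJet (D n) a)
    (h : ∀ a ∈ words k, ∀ β, Tendsto (fun n => eLpNorm (D n (dIdx β :: a)) 2 volume) atTop (𝓝 0)) :
    Tendsto (fun n => energy c k (D n)) atTop (𝓝 0) := by
  have hI : ∀ a ∈ words k, ∀ β, Tendsto (fun n => ∫ x, ‖D n (dIdx β :: a) x‖ ^ 2) atTop (𝓝 0) := by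
    intro a ha β
    have h2 := ((ENNReal.tendsto_toReal ENNReal.zero_ne_top).comp (h a ha β)).pow 2
    simp only [ENNReal.toReal_zero, ne_eq, OfNat.ofNat_ne_zero, not_false_eq_true, zero_pow] at h2
    refine h2.congr fun n => ?_
    rw [Function.comp_apply, eLpNorm_two_eq (hm n a ha β), ENNReal.toReal_ofReal (Real.sqrt_nonneg _),
      Real.sq_sqrt (integral_nonneg fun _ => sq_nonneg _)]
  have hc : 0 ≤ c 0 ^ 2 - c 1 ^ 2 := by nlinarith
  have hone : ∀ a ∈ words k, Tendsto (fun n => energyOne c (D n) a) atTop (𝓝 0) := by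
    intro a ha
    have hl : Tendsto (fun n => ∑ l : Fin 3, ∫ x, ‖D n (xIdx l :: a) x‖ ^ 2) atTop (𝓝 0) := by
      have := tendsto_finsetSum (Finset.univ : Finset (Fin 3)) fun l _ => hI a ha l.succ
      rwa [Finset.sum_const_zero] at this
    have hlim : Tendsto (fun n => 1 / 2 * ((∫ x, ‖D n (dIdx 0 :: a) x‖ ^ 2)
        + c 1 ^ 2 * (∑ l : Fin 3, ∫ x, ‖D n (xIdx l :: a) x‖ ^ 2)
        + (c 0 ^ 2 - c 1 ^ 2) * (3 * ∑ l : Fin 3, ∫ x, ‖D n (xIdx l :: a) x‖ ^ 2))) atTop (𝓝 0) := by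
      have := (((hI a ha 0).add (hl.const_mul (c 1 ^ 2))).add
        ((hl.const_mul 3).const_mul (c 0 ^ 2 - c 1 ^ 2))).const_mul (1 / 2)
      simpa only [mul_zero, add_zero] using this
    refine squeeze_zero (fun n => energyOne_nonneg h1 h01 (hm n a ha)) (fun n => ?_) hlim
    rw [energyOne_eq c (hm n a ha)]
    have hi : ∀ l : Fin 3, Integrable (fun x => ‖D n (xIdx l :: a) x‖ ^ 2) volume := fun l =>
      (hm n a ha l.succ).integrable_norm_pow two_ne_zero
    have hd : ∫ x, (∑ l : Fin 3, D n (xIdx l :: a) x l) ^ 2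
        ≤ 3 * ∑ l : Fin 3, ∫ x, ‖D n (xIdx l :: a) x‖ ^ 2 := by
      rw [← integral_finsetSum _ fun l _ => hi l, ← integral_const_mul]
      refine integral_mono (hm n a ha).memLp_div.integrable_sq
        ((integrable_finsetSum _ fun l _ => hi l).const_mul _) fun x => ?_
      have e := sq_sum_le_card_mul_sum_sq (s := (Finset.univ : Finset (Fin 3)))
        (f := fun l => D n (xIdx l :: a) x l)
      rw [Finset.card_univ, Fintype.card_fin, Nat.cast_ofNat] at e
      refine e.trans (mul_le_mul_of_nonneg_left (Finset.sum_le_sum fun l _ => ?_) (by norm_num))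
      exact sq_le_sq' (abs_le.1 (abs_coord_le _ l)).1 (abs_le.1 (abs_coord_le _ l)).2
    have := mul_le_mul_of_nonneg_left hd hc
    linarith
  simp only [energy_eq_sum]
  simpa using tendsto_finsetSum _ hone

/-- The energy of a test field is bounded in time. -/
theorem exists_rootEnergy_le (c : Fin 2 → ℝ) (k : ℕ) {u : VField} (hu : IsTest u) :
    ∃ B : ℝ, ∀ t, rootEnergy c k u t ≤ B := by
  have hone : ∀ a, ∃ B : ℝ, ∀ t, energyOne c (classicalJet u t) a ≤ B := by
    intro a
    have hw := hu.genWord a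
    set Φ : (ℝ × E3 →L[ℝ] E3) → ℝ := fun L => ‖L (dirv 0)‖ ^ 2 + c 1 ^ 2 * ∑ l : Fin 3,
      ‖L (dirv l.succ)‖ ^ 2 + (c 0 ^ 2 - c 1 ^ 2) * (∑ l : Fin 3, L (dirv l.succ) l) ^ 2 with hΦ
    have hΦc : Continuous Φ := by fun_prop
    have hΦ0 : Φ 0 = 0 := by simp [hΦ]
    set g : ℝ × E3 → ℝ := fun p => Φ (fderiv ℝ (genWord a u) p) with hg
    have hgs : HasCompactSupport g := (hw.2.fderiv ℝ).comp_left hΦ0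
    have hgc : Continuous g := hΦc.comp hw.fderiv_contDiff.continuous
    obtain ⟨M, hM⟩ := hgs.exists_bound_of_continuous hgc
    set K := Prod.snd '' tsupport g with hK
    have hKc : IsCompact K := hgs.isCompact.image continuous_snd
    refine ⟨1 / 2 * (M * volume.real K), fun t => ?_⟩
    have e : energyOne c (classicalJet u t) a = 1 / 2 * ∫ x, g (t, x) := by
      simp only [energyOne, classicalJet_dIdx, classicalJet_xIdx]
      rfl
    rw [e]
    refine mul_le_mul_of_nonneg_left ?_ (by norm_num)
    rw [← setIntegral_eq_integral_of_forall_compl_eq_zero (s := K) fun x hx => ?_]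
    · exact (le_abs_self _).trans (norm_setIntegral_le_of_norm_le_const hKc.measure_lt_top
        fun x _ => hM (t, x))
    · by_contra h
      exact hx ⟨(t, x), subset_tsupport g h, rfl⟩
  choose B hB using hone
  refine ⟨√(∑ a ∈ words k, B a), fun t => Real.sqrt_le_sqrt ?_⟩
  rw [energy_eq_sum]
  exact Finset.sum_le_sum fun a _ => hB a t

/-! ### Weak and strong convergence in `L²` at each time -/

/-- Uniformly in time, the sequence is Cauchy in `L²(ℝ³)`. -/
def L2Cauchy (T : ℝ) (f : ℕ → VField) : Prop :=
  ∀ ε : ℝ, 0 < ε → ∃ N : ℕ, ∀ m n : ℕ, N ≤ m → N ≤ n → ∀ t ∈ Ico 0 T,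
    eLpNorm (fun x : E3 => f m (t, x) - f n (t, x)) 2 volume ≤ ENNReal.ofReal ε

/-- Uniformly in time, the sequence tends to zero in `L²(ℝ³)`. -/
def L2Null (T : ℝ) (f : ℕ → VField) : Prop :=
  ∀ ε : ℝ, 0 < ε → ∃ N : ℕ, ∀ n : ℕ, N ≤ n → ∀ t ∈ Ico 0 T,
    eLpNorm (fun x : E3 => f n (t, x)) 2 volume ≤ ENNReal.ofReal ε

/-- Smooth compactly supported functions on space. -/
def IsCutoff (χ : E3 → ℝ) : Prop := ContDiff ℝ ∞ χ ∧ HasCompactSupport χ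

/-- The integral of a field at time `t` against a function. -/
def pairing (χ : E3 → ℝ) (f : VField) (t : ℝ) : E3 := ∫ x, χ x • f (t, x)

/-- At each positive time the sequence tends to zero as a distribution on `ℝ³`. -/
def WeakNull (T : ℝ) (f : ℕ → VField) : Prop :=
  ∀ t ∈ Ioo 0 T, ∀ χ, IsCutoff χ → Tendsto (fun n => pairing χ (f n) t) atTop (𝓝 0)

theorem L2Null.tendsto {T : ℝ} {f : ℕ → VField} (h : L2Null T f) {t : ℝ} (ht : t ∈ Ico 0 T) :
    Tendsto (fun n => eLpNorm (fun x : E3 => f n (t, x)) 2 volume) atTop (𝓝 0) := by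
  refine ENNReal.tendsto_nhds_zero.2 fun ε hε => ?_
  obtain ⟨r, hr, hrε⟩ := ENNReal.lt_iff_exists_real_btwn.1 hε
  have hr' : 0 < r := ENNReal.ofReal_pos.1 hrε.1
  obtain ⟨N, hN⟩ := h r hr'
  filter_upwards [eventually_ge_atTop N] with n hn
  exact (hN n hn t ht).trans hrε.2.le

theorem IsCutoff.memLp {χ : E3 → ℝ} (h : IsCutoff χ) : MemLp χ 2 volume :=
  h.1.continuous.memLp_of_hasCompactSupport h.2

theorem IsCutoff.mul {χ g : E3 → ℝ} (h : IsCutoff χ) (hg : ContDiff ℝ ∞ g) :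
    IsCutoff fun x => χ x * g x := ⟨h.1.mul hg, h.2.mul_right⟩

theorem IsCutoff.fderiv_apply {χ : E3 → ℝ} (h : IsCutoff χ) (v : E3) :
    IsCutoff fun x => fderiv ℝ χ x v :=
  ⟨(h.1.fderiv_right (by simp)).clm_apply contDiff_const, h.2.fderiv_apply ℝ v⟩

theorem enorm_integral_smul_le {χ : E3 → ℝ} {f : E3 → E3} (hχ : MemLp χ 2 volume)
    (hf : MemLp f 2 volume) :
    ‖∫ x, χ x • f x‖ₑ ≤ eLpNorm χ 2 volume * eLpNorm f 2 volume := by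
  refine (enorm_integral_le_lintegral_enorm _).trans ?_
  rw [← eLpNorm_one_eq_lintegral_enorm]
  rw [show (fun x => χ x • f x) = χ • f from rfl]
  exact eLpNorm_smul_le_mul_eLpNorm (p := 2) (q := 2) (r := 1) hf.1 hχ.1

theorem integrable_pairing {χ : E3 → ℝ} (hχ : IsCutoff χ) {f : VField} (hf : IsTest f) (t : ℝ) :
    Integrable (fun x => χ x • f (t, x)) volume :=
  (hχ.1.continuous.smul (hf.slice_continuous t)).integrable_of_hasCompactSupport hχ.2.smul_right

theorem pairing_sub {χ : E3 → ℝ} (hχ : IsCutoff χ) {f g : VField} (hf : IsTest f) (hg : IsTest g)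
    (t : ℝ) : pairing χ f t - pairing χ g t = ∫ x, χ x • (f (t, x) - g (t, x)) := by
  have h := integral_sub (integrable_pairing hχ hf t) (integrable_pairing hχ hg t)
  simp only [smul_sub]
  exact h.symm

theorem hasDerivAt_pairing {χ : E3 → ℝ} (hχ : IsCutoff χ) {f : VField} (hf : IsTest f) (t : ℝ) :
    HasDerivAt (pairing χ f) (pairing χ (dT f) t) t := by
  obtain ⟨M, hM⟩ := hf.dT.2.exists_bound_of_continuous hf.dT.continuous
  refine (hasDerivAt_integral_of_dominated_loc_of_deriv_le (s := univ)
    (F := fun s x => χ x • f (s, x)) (F' := fun s x => χ x • dT f (s, x))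
    (bound := fun x => ‖χ x‖ * M) univ_mem
    (.of_forall fun s => (integrable_pairing hχ hf s).1) (integrable_pairing hχ hf t)
    (integrable_pairing hχ hf.dT t).1 (.of_forall fun x s _ => ?_) ?_
    (.of_forall fun x s _ => ?_)).2
  · rw [norm_smul]
    exact mul_le_mul_of_nonneg_left (hM _) (norm_nonneg _)
  · exact ((hχ.1.continuous.integrable_of_hasCompactSupport hχ.2).norm).mul_const _
  · have h1 : HasDerivAt (fun s : ℝ => (s, x)) ((1 : ℝ), (0 : E3)) s :=
      (hasDerivAt_id s).prodMk (hasDerivAt_const s x)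
    exact ((hf.differentiable (s, x)).hasFDerivAt.comp_hasDerivAt s h1).const_smul (χ x)

/-- Integration by parts. -/
theorem pairing_dX {χ : E3 → ℝ} (hχ : IsCutoff χ) {f : VField} (hf : IsTest f) (l : Fin 3)
    (t : ℝ) : pairing χ (dX l f) t
      = -pairing (fun x => fderiv ℝ χ x (EuclideanSpace.single l 1)) f t := by
  have hd : ∀ x : E3, HasFDerivAt (fun x => f (t, x))
      ((fderiv ℝ f (t, x)).comp (ContinuousLinearMap.inr ℝ ℝ E3)) x := fun x =>
    (hf.differentiable (t, x)).hasFDerivAt.comp x (hasFDerivAt_prodMk_right t x)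
  have e : ∀ x : E3, fderiv ℝ (fun x => f (t, x)) x (EuclideanSpace.single l 1)
      = dX l f (t, x) := fun x => by
    rw [(hd x).fderiv]
    rfl
  have h := integral_smul_fderiv_eq_neg_fderiv_smul_of_integrable (μ := (volume : Measure E3))
    (f := χ) (g := fun x => f (t, x)) (v := EuclideanSpace.single l (1 : ℝ))
    (integrable_pairing (hχ.fderiv_apply _) hf t)
    (by simpa only [e] using integrable_pairing hχ (hf.dX l) t) (integrable_pairing hχ hf t)
    (fun x _ => hχ.1.differentiable (by simp) x) (fun x _ => (hd x).differentiableAt)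
  simp only [e] at h
  exact h

theorem WeakNull.dX {T : ℝ} {f : ℕ → VField} (hf : ∀ n, IsTest (f n)) (h : WeakNull T f)
    (l : Fin 3) : WeakNull T fun n => PrestressedElastic.dX l (f n) := fun t ht χ hχ => by
  simp only [fun n => pairing_dX hχ (hf n) l t]
  simpa using (h t ht _ (hχ.fderiv_apply _)).neg

/-- The time derivative is controlled by differentiating the pairings: their derivatives converge
uniformly, and the limit of the pairings is zero. -/
theorem WeakNull.dT {T : ℝ} {f : ℕ → VField} (hf : ∀ n, IsTest (f n)) (h : WeakNull T f)
    (hc : L2Cauchy T fun n => PrestressedElastic.dT (f n)) :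
    WeakNull T fun n => PrestressedElastic.dT (f n) := by
  intro t ht χ hχ
  set G : ℕ → ℝ → E3 := fun n s => pairing χ (PrestressedElastic.dT (f n)) s with hG
  have hunif : UniformCauchySeqOn G atTop (Ioo 0 T) := by
    refine Metric.uniformCauchySeqOn_iff.2 fun ε hε => ?_
    set M := (eLpNorm χ 2 volume).toReal with hM
    have hM0 : 0 ≤ M := ENNReal.toReal_nonneg
    obtain ⟨N, hN⟩ := hc (ε / (M + 1) / 2) (by positivity)
    refine ⟨N, fun m hm n hn s hs => ?_⟩
    rw [dist_eq_norm, hG, pairing_sub hχ (hf m).dT (hf n).dT]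
    have h1 := enorm_integral_smul_le hχ.memLp (((hf m).dT.memLp s).sub ((hf n).dT.memLp s))
    have h2 := hN m n hm hn s ⟨hs.1.le, hs.2⟩
    have h3 : ‖∫ x, χ x • (PrestressedElastic.dT (f m) (s, x) - PrestressedElastic.dT (f n) (s, x))‖ₑ
        ≤ ENNReal.ofReal (M * (ε / (M + 1) / 2)) := by
      refine h1.trans ?_
      rw [ENNReal.ofReal_mul hM0, hM, ENNReal.ofReal_toReal hχ.memLp.2.ne]
      exact mul_le_mul_right h2 _
    rw [← ofReal_norm, ENNReal.ofReal_le_ofReal_iff (by positivity)] at h3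
    refine h3.trans_lt ?_
    have : M * (ε / (M + 1) / 2) = ε * (M / (M + 1)) / 2 := by ring
    have h4 : M / (M + 1) ≤ 1 := (div_le_one (by positivity)).2 (by linarith)
    nlinarith
  have hlim : ∀ s ∈ Ioo 0 T, ∃ y, Tendsto (fun n => G n s) atTop (𝓝 y) := fun s hs =>
    cauchySeq_tendsto_of_complete (hunif.cauchySeq hs)
  choose! g hg using hlim
  have hd := hasDerivAt_of_tendstoUniformlyOn isOpen_Ioo
    (hunif.tendstoUniformlyOn_of_tendsto hg) (f := fun n => pairing χ (f n)) (g := fun _ => 0)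
    (.of_forall fun n s _ => hasDerivAt_pairing hχ (hf n) s) (fun s hs => h s hs χ hχ) ht
  have e : g t = 0 := hd.unique (hasDerivAt_const t 0)
  exact e ▸ hg t ht

/-- Integration by parts moves the spatial part of a generator to the cutoff; the time derivative
is treated by `WeakNull.dT`. -/
theorem WeakNull.gen {T : ℝ} {f : ℕ → VField} (hf : ∀ n, IsTest (f n)) (h : WeakNull T f)
    (hc : L2Cauchy T fun n => PrestressedElastic.dT (f n)) (i : Fin 8) :
    WeakNull T fun n => PrestressedElastic.gen i (f n) := by
  intro t ht χ hχ
  set V : E3 → ℝ × E3 := fun x => genV i + genA i (t, x) with hV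
  have hVc : ContDiff ℝ ∞ V := by fun_prop
  have hV1 : IsCutoff fun x => χ x * (V x).1 := hχ.mul hVc.fst
  have hV2 : ∀ l : Fin 3, IsCutoff fun x => χ x * (V x).2 l := fun l =>
    hχ.mul ((EuclideanSpace.proj l : E3 →L[ℝ] ℝ).contDiff.comp hVc.snd)
  have e : ∀ n, pairing χ (PrestressedElastic.gen i (f n)) t
      = pairing (fun x => χ x * (V x).1) (PrestressedElastic.dT (f n)) t
        + ∑ l : Fin 3, pairing (fun x => χ x * (V x).2 l) (PrestressedElastic.dX l (f n)) t
        + genM i (pairing χ (f n) t) := by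
    intro n
    have i1 := integrable_pairing hV1 (hf n).dT t
    have i2 := fun l => integrable_pairing (hV2 l) ((hf n).dX l) t
    have i3 := integrable_pairing hχ (hf n) t
    simp only [pairing]
    have hs := integrable_finsetSum (Finset.univ : Finset (Fin 3)) fun l _ => i2 l
    rw [← ContinuousLinearMap.integral_comp_comm _ i3, ← integral_finsetSum _ fun l _ => i2 l,
      ← integral_add i1 hs]
    refine Eq.trans ?_ (integral_add (i1.add hs) ((genM i).integrable_comp i3))
    refine integral_congr_ae (.of_forall fun x => ?_)
    change χ x • PrestressedElastic.gen i (f n) (t, x)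
      = (χ x * (V x).1) • PrestressedElastic.dT (f n) (t, x)
        + ∑ l, (χ x * (V x).2 l) • PrestressedElastic.dX l (f n) (t, x) + genM i (χ x • f n (t, x))
    have := dir_eq_sum (f n) (V x) (t, x)
    rw [gen_apply]
    change χ x • (dir (V x) (f n) (t, x) + genM i (f n (t, x))) = _
    rw [this]
    simp only [smul_add, mul_smul, Finset.smul_sum, map_smul]
  simp only [e]
  have h1 := h.dT hf hc t ht _ hV1
  have h2 := tendsto_finsetSum (Finset.univ : Finset (Fin 3)) fun l _ => h.dX hf l t ht _ (hV2 l)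
  have h3 := ((genM i).continuous.tendsto _).comp (h t ht χ hχ)
  simpa using (h1.add h2).add h3

theorem WeakNull.genWord {T : ℝ} {f : ℕ → VField} (hf : ∀ n, IsTest (f n)) (h : WeakNull T f)
    {k : ℕ} (hc : ∀ a : List (Fin 8), a.length < k →
      L2Cauchy T fun n => PrestressedElastic.dT (PrestressedElastic.genWord a (f n)))
    {a : List (Fin 8)} (ha : a.length ≤ k) :
    WeakNull T fun n => PrestressedElastic.genWord a (f n) := by
  induction a with
  | nil => exact h
  | cons i a ih =>
    rw [List.length_cons] at ha
    exact (ih (by omega)).gen (fun n => (hf n).genWord a) (hc a (by omega)) i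

/-- Completeness of `L²`, for representatives. -/
theorem exists_L2_limit {f : ℕ → E3 → E3} (hf : ∀ n, MemLp (f n) 2 volume)
    (h : ∀ ε : ℝ, 0 < ε → ∃ N : ℕ, ∀ m n : ℕ, N ≤ m → N ≤ n →
      eLpNorm (fun x => f m x - f n x) 2 volume ≤ ENNReal.ofReal ε) :
    ∃ g, MemLp g 2 volume ∧
      Tendsto (fun n => eLpNorm (fun x => f n x - g x) 2 volume) atTop (𝓝 0) := by
  have hC : CauchySeq fun n => (hf n).toLp (f n) := by
    refine EMetric.cauchySeq_iff.2 fun ε hε => ?_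
    obtain ⟨r, hr, hrε⟩ := ENNReal.lt_iff_exists_real_btwn.1 hε
    obtain ⟨N, hN⟩ := h r (ENNReal.ofReal_pos.1 hrε.1)
    refine ⟨N, fun m hm n hn => ?_⟩
    rw [Lp.edist_toLp_toLp]
    exact (hN m n hm hn).trans_lt hrε.2
  obtain ⟨G, hG⟩ := cauchySeq_tendsto_of_complete hC
  refine ⟨G, Lp.memLp G, ?_⟩
  have := (Lp.tendsto_Lp_iff_tendsto_eLpNorm'' f hf G (Lp.memLp G)).1 (by rwa [Lp.toLp_coeFn])
  exact this

/-- A sequence that is Cauchy in `L²` uniformly in time has a strong limit at each time; a weak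
limit zero identifies it as zero. -/
theorem L2Cauchy.l2Null {T : ℝ} {f : ℕ → VField} (hf : ∀ n, IsTest (f n)) (hc : L2Cauchy T f)
    (h : WeakNull T f) : L2Null T f := by
  have hpos : ∀ t ∈ Ioo 0 T,
      Tendsto (fun n => eLpNorm (fun x : E3 => f n (t, x)) 2 volume) atTop (𝓝 0) := by
    intro t ht
    obtain ⟨g, hg, hlim⟩ := exists_L2_limit (fun n => (hf n).memLp t) fun ε hε => by
      obtain ⟨N, hN⟩ := hc ε hε
      exact ⟨N, fun m n hm hn => hN m n hm hn t ⟨ht.1.le, ht.2⟩⟩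
    have hg0 : ∀ᵐ x, g x = 0 := by
      refine ae_eq_zero_of_integral_contDiff_smul_eq_zero (hg.locallyIntegrable one_le_two)
        fun χ h1 h2 => ?_
      have hχ : IsCutoff χ := ⟨h1, h2⟩
      have hi : Integrable (fun x => χ x • g x) volume := memLp_one_iff_integrable.1 (hg.smul hχ.memLp)
      have hz : Tendsto (fun n => pairing χ (f n) t - ∫ x, χ x • g x) atTop (𝓝 0) := by
        rw [tendsto_zero_iff_enorm_tendsto_zero]
        have h3 : Tendsto (fun n => eLpNorm χ 2 volume
            * eLpNorm (fun x => f n (t, x) - g x) 2 volume) atTop (𝓝 0) := by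
          simpa using ENNReal.Tendsto.const_mul hlim (.inr hχ.memLp.2.ne)
        refine tendsto_of_tendsto_of_tendsto_of_le_of_le tendsto_const_nhds h3
          (fun n => zero_le) fun n => ?_
        change ‖pairing χ (f n) t - ∫ x, χ x • g x‖ₑ ≤ _
        rw [pairing, ← integral_sub (integrable_pairing hχ (hf n) t) hi]
        simp only [← smul_sub]
        exact enorm_integral_smul_le hχ.memLp (((hf n).memLp t).sub hg)
      have h4 := (h t ht χ hχ).sub hz
      simp only [sub_sub_cancel, sub_zero] at h4
      exact tendsto_nhds_unique tendsto_const_nhds h4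
    refine hlim.congr fun n => eLpNorm_congr_ae ?_
    filter_upwards [hg0] with x hx
    rw [hx, sub_zero]
  intro ε hε
  obtain ⟨N, hN⟩ := hc ε hε
  have hle : ∀ n, N ≤ n → ∀ t ∈ Ioo 0 T,
      eLpNorm (fun x : E3 => f n (t, x)) 2 volume ≤ ENNReal.ofReal ε := by
    intro n hn t ht
    have h1 : Tendsto (fun m => ENNReal.ofReal ε + eLpNorm (fun x : E3 => f m (t, x)) 2 volume)
        atTop (𝓝 (ENNReal.ofReal ε)) := by
      simpa using tendsto_const_nhds.add (hpos t ht)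
    refine ge_of_tendsto h1 ?_
    filter_upwards [eventually_ge_atTop N] with m hm
    have := eLpNorm_add_le (((hf n).memLp t).sub ((hf m).memLp t)).1 ((hf m).memLp t).1 one_le_two
    rw [sub_add_cancel] at this
    exact this.trans (add_le_add (hN n m hn hm t ⟨ht.1.le, ht.2⟩) le_rfl)
  refine ⟨N, fun n hn t ht => ?_⟩
  rcases ht.1.eq_or_lt with rfl | ht0
  -- The initial time is the limit of later times.
  · set s : ℕ → ℝ := fun j => T / (j + 2) with hs
    have hsI : ∀ j, s j ∈ Ioo 0 T := fun j =>
      ⟨div_pos ht.2 (by positivity), div_lt_self ht.2 (by linarith [(Nat.cast_nonneg j : (0:ℝ) ≤ j)])⟩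
    have hs0 : Tendsto s atTop (𝓝 0) :=
      tendsto_const_nhds.div_atTop (tendsto_atTop_add_const_right _ _ tendsto_natCast_atTop_atTop)
    refine (Lp.eLpNorm_lim_le_liminf_eLpNorm (f := fun j x => f n (s j, x))
      (fun j => ((hf n).memLp _).1) _ (.of_forall fun x => ?_)).trans ?_
    · have hcx : Continuous fun r : ℝ => f n (r, x) := (hf n).continuous.comp (by fun_prop)
      exact (hcx.tendsto 0).comp hs0
    · exact liminf_le_of_le (by isBoundedDefault) fun b hb => by
        obtain ⟨j, hj⟩ := hb.exists
        exact hj.trans (hle n hn _ (hsI j))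
  · exact hle n hn t ⟨ht0, ht.2⟩

theorem weakNull_of_tendsto {T : ℝ} {f : ℕ → VField} (hf : ∀ n, IsTest (f n))
    (hlim : ∀ t ∈ Ioo 0 T, ∀ x, Tendsto (fun n => f n (t, x)) atTop (𝓝 0))
    (hb : ∀ t ∈ Ioo 0 T, ∃ M : E3 → ℝ, Continuous M ∧ ∀ᶠ n in atTop, ∀ x, ‖f n (t, x)‖ ≤ M x) :
    WeakNull T f := by
  intro t ht χ hχ
  obtain ⟨M, hMc, hM⟩ := hb t ht
  have h := tendsto_integral_filter_of_dominated_convergence (μ := (volume : Measure E3))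
    (F := fun n x => χ x • f n (t, x)) (f := fun _ => (0 : E3)) (l := atTop)
    (fun x => ‖χ x‖ * M x) (.of_forall fun n => (integrable_pairing hχ (hf n) t).1)
    (hM.mono fun n hn => .of_forall fun x => by
      rw [norm_smul]; exact mul_le_mul_of_nonneg_left (hn x) (norm_nonneg _))
    ((hχ.1.continuous.norm.mul hMc).integrable_of_hasCompactSupport hχ.2.norm.mul_right)
    (.of_forall fun x => by simpa using (hlim t ht x).const_smul (χ x))
  simpa [pairing] using h

/-! ### Approximating sequences -/

theorem exists_size₁_le {c : Fin 2 → ℝ} (h1 : 0 < c 1) (h01 : c 1 < c 0) (b k : ℕ)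
    (hbk : b + 4 ≤ k) : ∃ C : ℝ, 0 ≤ C ∧ ∀ u, IsTest u → ∀ t x,
      size₁ (b + 1) u (t, x) ≤ C * rootEnergy c k u t := by
  obtain ⟨C, hC, h⟩ := exists_sup_size₁_le h1 h01 b k hbk
  refine ⟨C, hC, fun u hu t x => le_trans ?_ (h u hu t x)⟩
  exact le_mul_of_one_le_left (size₁_nonneg _ _ _) (by linarith [norm_nonneg x])

theorem norm_fderiv_genWord_le {k : ℕ} {a : List (Fin 8)} (ha : a.length < k) (u : VField)
    (p : ℝ × E3) : ‖fderiv ℝ (genWord a u) p‖ ≤ 4 * size₁ k u p := by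
  refine ContinuousLinearMap.opNorm_le_bound _
    (mul_nonneg (by norm_num) (size₁_nonneg _ _ _)) fun v => ?_
  refine (norm_dir_le_size₁ ha u v p).trans ?_
  have hv : dirNorm v ≤ 4 * ‖v‖ := by
    have h2 : ∀ l, |v.2 l| ≤ ‖v‖ := fun l => (abs_coord_le _ l).trans (norm_snd_le v)
    have h3 : |v.1| ≤ ‖v‖ := norm_fst_le v
    rw [dirNorm, Fin.sum_univ_three]
    linarith [h2 0, h2 1, h2 2]
  calc dirNorm v * size₁ k u p ≤ 4 * ‖v‖ * size₁ k u p :=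
        mul_le_mul_of_nonneg_right hv (size₁_nonneg _ _ _)
    _ = _ := by ring

theorem Approximates.l2Cauchy {c : Fin 2 → ℝ} (h1 : 0 < c 1) (h01 : c 1 < c 0) {κ : ℕ} {T : ℝ}
    {φ : ℕ → VField} {u : VField} (h : Approximates c κ T φ u) {a : List (Fin 8)}
    (ha : a.length < κ) (β : Fin 4) : L2Cauchy T fun n => genWord (dIdx β :: a) (φ n) := by
  intro ε hε
  have hc0 : 0 ≤ coerConst c := Real.sqrt_nonneg _
  obtain ⟨N, hN⟩ := h.2.1 (ε / (coerConst c + 1)) (by positivity)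
  refine ⟨N, fun m n hm hn t ht => ?_⟩
  have hmn := (h.1 m).sub (h.1 n)
  have e := eLpNorm_le_energy h1 h01 (fun a _ => memJet_classicalJet hmn t a) ha β
  rw [show (fun x => genWord (dIdx β :: a) (φ m) (t, x) - genWord (dIdx β :: a) (φ n) (t, x))
    = classicalJet (φ m - φ n) t (dIdx β :: a) by rw [classicalJet_sub (h.1 m) (h.1 n)]; rfl]
  refine e.trans (ENNReal.ofReal_le_ofReal ?_)
  refine (mul_le_mul_of_nonneg_left (hN m n hm hn t ht) hc0).trans ?_
  rw [mul_div_assoc', div_le_iff₀ (by positivity)]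
  nlinarith

theorem Approximates.sub {c : Fin 2 → ℝ} (h1 : 0 < c 1) (h01 : c 1 < c 0) {κ : ℕ} {T : ℝ}
    {φ ψ : ℕ → VField} {u : VField} (h : Approximates c κ T φ u) (h' : Approximates c κ T ψ u) :
    Approximates c κ T (fun n => φ n - ψ n) 0 := by
  refine ⟨fun n => (h.1 n).sub (h'.1 n), fun ε hε => ?_, fun t ht x => ?_⟩
  · obtain ⟨N, hN⟩ := h.2.1 (ε / 4) (by positivity)
    obtain ⟨N', hN'⟩ := h'.2.1 (ε / 4) (by positivity)
    refine ⟨max N N', fun m n hm hn t ht => ?_⟩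
    have e := rootEnergy_sub_le h1 h01 κ ((h.1 m).sub (h.1 n)) ((h'.1 m).sub (h'.1 n)) t
    rw [sub_sub_sub_comm] at e
    have e1 := hN m n (le_of_max_le_left hm) (le_of_max_le_left hn) t ht
    have e2 := hN' m n (le_of_max_le_right hm) (le_of_max_le_right hn) t ht
    simp only [rootEnergy] at e
    linarith
  · simpa using (h.2.2 t ht x).sub (h'.2.2 t ht x)

theorem Approximates.exists_rootEnergy_le {c : Fin 2 → ℝ} (h1 : 0 < c 1) (h01 : c 1 < c 0) {κ : ℕ}
    {T : ℝ} {φ : ℕ → VField} {u : VField} (h : Approximates c κ T φ u) :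
    ∃ B : ℝ, 0 ≤ B ∧ ∃ N : ℕ, ∀ n, N ≤ n → ∀ t ∈ Ico 0 T, rootEnergy c κ (φ n) t ≤ B := by
  obtain ⟨N, hN⟩ := h.2.1 1 one_pos
  obtain ⟨B, hB⟩ := PrestressedElastic.exists_rootEnergy_le c κ (h.1 N)
  have hB0 : 0 ≤ B := (rootEnergy_nonneg _ _ _ _).trans (hB 0)
  refine ⟨2 + 2 * B, by positivity, N, fun n hn t ht => ?_⟩
  have e := rootEnergy_le_add h1 h01 κ (h.1 n) (h.1 N) t
  have e1 : rootEnergy c κ (φ n - φ N) t ≤ 1 := hN n N hn le_rfl t ht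
  linarith [hB t]

/-- The limit zero of an approximating sequence forces the derivatives to tend to zero. -/
theorem Approximates.l2Null {c : Fin 2 → ℝ} (h1 : 0 < c 1) (h01 : c 1 < c 0) {κ : ℕ} (hκ : 4 ≤ κ)
    {T : ℝ} {φ : ℕ → VField} (h : Approximates c κ T φ 0) {a : List (Fin 8)}
    (ha : a.length < κ) (β : Fin 4) : L2Null T fun n => genWord (dIdx β :: a) (φ n) := by
  have hbase : WeakNull T φ := by
    refine weakNull_of_tendsto h.1 (fun t ht x => h.2.2 t ⟨ht.1.le, ht.2⟩ x) fun t ht => ?_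
    have ht' : t ∈ Ico 0 T := ⟨ht.1.le, ht.2⟩
    obtain ⟨C, hC, hsup⟩ := exists_size₁_le h1 h01 0 κ hκ
    obtain ⟨B, hB, N, hN⟩ := h.exists_rootEnergy_le h1 h01
    refine ⟨fun x => 1 + 4 * (C * B) * ‖x‖, by fun_prop, ?_⟩
    have h0 := (h.2.2 t ht' 0).norm
    simp only [Pi.zero_apply, norm_zero] at h0
    filter_upwards [h0.eventually_le_const one_pos, eventually_ge_atTop N] with n hn hnN x
    have hd : ∀ y : E3, HasFDerivAt (fun x => φ n (t, x))
        ((fderiv ℝ (φ n) (t, y)).comp (ContinuousLinearMap.inr ℝ ℝ E3)) y := fun y =>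
      ((h.1 n).differentiable (t, y)).hasFDerivAt.comp y (hasFDerivAt_prodMk_right t y)
    have hb : ∀ y : E3, ‖(fderiv ℝ (φ n) (t, y)).comp (ContinuousLinearMap.inr ℝ ℝ E3)‖
        ≤ 4 * (C * B) := fun y => by
      have e1 := norm_fderiv_genWord_le (k := 0 + 1) (a := []) (by simp) (φ n) (t, y)
      have e2 := hsup _ (h.1 n) t y
      have e3 := mul_le_mul_of_nonneg_left (hN n hnN t ht') hC
      rw [genWord_nil] at e1
      refine (ContinuousLinearMap.opNorm_comp_le _ _).trans ?_
      refine (mul_le_of_le_one_right (norm_nonneg _)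
        (ContinuousLinearMap.norm_inr_le_one ℝ ℝ E3)).trans ?_
      linarith
    have hm := convex_univ.norm_image_sub_le_of_norm_hasFDerivWithin_le
      (fun y _ => (hd y).hasFDerivWithinAt) (fun y _ => hb y) (mem_univ (0 : E3)) (mem_univ x)
    rw [sub_zero] at hm
    have := norm_add_le (φ n (t, x) - φ n (t, 0)) (φ n (t, 0))
    rw [sub_add_cancel] at this
    linarith
  refine L2Cauchy.l2Null (fun n => (h.1 n).genWord _) (h.l2Cauchy h1 h01 ha β) ?_
  refine WeakNull.genWord h.1 hbase (k := κ) (fun b hb => ?_) (by rw [List.length_cons]; omega)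
  have := h.l2Cauchy h1 h01 hb 0
  simp only [genWord, gen_dIdx] at this
  exact this

/-! ### Convergence of the derivatives -/

theorem tendsto_fderiv_of_uniformCauchySeqOn {f : ℕ → VField} {g : VField} {S : Set (ℝ × E3)}
    (hS : IsOpen S) (hf : ∀ n, Differentiable ℝ (f n))
    (hc : UniformCauchySeqOn (fun n => fderiv ℝ (f n)) atTop S)
    (hlim : ∀ p ∈ S, Tendsto (fun n => f n p) atTop (𝓝 (g p))) {p : ℝ × E3} (hp : p ∈ S) :
    DifferentiableAt ℝ g p ∧ Tendsto (fun n => fderiv ℝ (f n) p) atTop (𝓝 (fderiv ℝ g p)) := by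
  have hex : ∀ q ∈ S, ∃ L, Tendsto (fun n => fderiv ℝ (f n) q) atTop (𝓝 L) := fun q hq =>
    cauchySeq_tendsto_of_complete (hc.cauchySeq hq)
  choose! L hL using hex
  have h := hasFDerivAt_of_tendstoUniformlyOn hS (hc.tendstoUniformlyOn_of_tendsto hL)
    (fun n q _ => (hf n q).hasFDerivAt) hlim hp
  exact ⟨h.differentiableAt, h.fderiv ▸ hL p hp⟩

theorem Approximates.uniformCauchySeqOn {c : Fin 2 → ℝ} (h1 : 0 < c 1) (h01 : c 1 < c 0) {κ : ℕ}
    {T : ℝ} {φ : ℕ → VField} {u : VField} (h : Approximates c κ T φ u) {a : List (Fin 8)}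
    (ha : a.length + 4 ≤ κ) :
    UniformCauchySeqOn (fun n => fderiv ℝ (genWord a (φ n))) atTop (Ioo 0 T ×ˢ univ) := by
  refine Metric.uniformCauchySeqOn_iff.2 fun ε hε => ?_
  obtain ⟨C, hC, hsup⟩ := exists_size₁_le h1 h01 a.length κ ha
  obtain ⟨N, hN⟩ := h.2.1 (ε / (4 * C + 1) / 2) (by positivity)
  refine ⟨N, fun m hm n hn p hp => ?_⟩
  have hd := ((h.1 m).genWord a).differentiable p
  have hd' := ((h.1 n).genWord a).differentiable p
  rw [dist_eq_norm, ← fderiv_sub hd hd', ← genWord_sub a (h.1 m) (h.1 n)]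
  have e1 := norm_fderiv_genWord_le (Nat.lt_succ_self a.length) (φ m - φ n) p
  have e2 := hsup _ ((h.1 m).sub (h.1 n)) p.1 p.2
  have e3 : rootEnergy c κ (φ m - φ n) p.1 ≤ ε / (4 * C + 1) / 2 :=
    hN m n hm hn p.1 ⟨hp.1.1.le, hp.1.2⟩
  have e4 := mul_le_mul_of_nonneg_left e3 hC
  have e5 : 4 * (C * (ε / (4 * C + 1) / 2)) < ε := by
    have : 4 * (C * (ε / (4 * C + 1) / 2)) = ε * (4 * C / (4 * C + 1)) / 2 := by ring
    have h4 : 4 * C / (4 * C + 1) ≤ 1 := (div_le_one (by positivity)).2 (by linarith)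
    nlinarith
  exact (e1.trans (mul_le_mul_of_nonneg_left (e2.trans e4) (by norm_num))).trans_lt e5

/-- The limit of an approximating sequence is twice differentiable at positive times, and the
derivatives converge. -/
theorem Approximates.tendsto_dir {c : Fin 2 → ℝ} (h1 : 0 < c 1) (h01 : c 1 < c 0) {κ : ℕ}
    (hκ : 5 ≤ κ) {T : ℝ} {φ : ℕ → VField} {u : VField} (h : Approximates c κ T φ u)
    {p : ℝ × E3} (hp : p ∈ Ioo 0 T ×ˢ (univ : Set E3)) :
    (∀ v, Tendsto (fun n => dir v (φ n) p) atTop (𝓝 (dir v u p))) ∧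
    ∀ β, DifferentiableAt ℝ (dir (dirv β) u) p ∧
      ∀ w, Tendsto (fun n => dir w (dir (dirv β) (φ n)) p) atTop (𝓝 (dir w (dir (dirv β) u) p)) := by
  have hS : IsOpen (Ioo 0 T ×ˢ (univ : Set E3)) := isOpen_Ioo.prod isOpen_univ
  have happ : ∀ {F : ℕ → ℝ × E3 →L[ℝ] E3} {L : ℝ × E3 →L[ℝ] E3}, Tendsto F atTop (𝓝 L) →
      ∀ v, Tendsto (fun n => F n v) atTop (𝓝 (L v)) := fun hF v =>
    ((ContinuousLinearMap.apply ℝ E3 v).continuous.tendsto _).comp hF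
  have hu0 := h.uniformCauchySeqOn h1 h01 (a := []) (by simp; omega)
  have hone : ∀ q ∈ Ioo 0 T ×ˢ (univ : Set E3), ∀ v,
      Tendsto (fun n => dir v (φ n) q) atTop (𝓝 (dir v u q)) := fun q hq =>
    happ (tendsto_fderiv_of_uniformCauchySeqOn hS (fun n => (h.1 n).differentiable) hu0
      (fun r hr => h.2.2 r.1 ⟨hr.1.1.le, hr.1.2⟩ r.2) hq).2
  refine ⟨hone p hp, fun β => ?_⟩
  have hu1 := h.uniformCauchySeqOn h1 h01 (a := [dIdx β]) (by simp; omega)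
  simp only [genWord, gen_dIdx] at hu1
  obtain ⟨hd, hlim⟩ := tendsto_fderiv_of_uniformCauchySeqOn hS
    (fun n => ((h.1 n).dir (dirv β)).differentiable) hu1 (fun r hr => hone r hr _) hp
  exact ⟨hd, happ hlim⟩

theorem tendsto_quad (Q : Fin 3 → Fin 3 → Fin 3 → E3 →L[ℝ] E3 →L[ℝ] E3) {φ : ℕ → VField}
    {u : VField} {p : ℝ × E3} (h1 : ∀ m, Tendsto (fun n => dX m (φ n) p) atTop (𝓝 (dX m u p)))
    (h2 : ∀ l m, Tendsto (fun n => dX l (dX m (φ n)) p) atTop (𝓝 (dX l (dX m u) p))) :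
    Tendsto (fun n => quad Q (φ n) (φ n) p) atTop (𝓝 (quad Q u u p)) := by
  have hb : ∀ (K : E3 →L[ℝ] E3 →L[ℝ] E3) {f g : ℕ → E3} {v w : E3}, Tendsto f atTop (𝓝 v) →
      Tendsto g atTop (𝓝 w) → Tendsto (fun i => K (f i) (g i)) atTop (𝓝 (K v w)) := by
    intro K f g v w hf hg
    exact (K.isBoundedBilinearMap.continuous.tendsto (v, w)).comp (hf.prodMk_nhds hg)
  simp only [quad, Finset.sum_apply, Pi.add_apply]
  exact tendsto_finsetSum _ fun l _ => tendsto_finsetSum _ fun m _ => tendsto_finsetSum _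
    fun n _ => (hb (Q l m n) (h2 l m) (h1 n)).add (hb (Q l m n) (h1 m) (h2 l n))

/-- Along an approximating sequence of a solution, the equation holds in the limit. -/
theorem Approximates.tendsto_residual {σ : Matrix (Fin 3) (Fin 3) ℝ → ℝ}
    (hσ : ContDiffOn ℝ 3 σ {F : Matrix (Fin 3) (Fin 3) ℝ | 0 < F.det}) (hiso : IsIsotropic σ)
    {lam : ℝ} (hlam : 0 < lam) (hhyp : IsHyperbolic σ lam) {κ : ℕ} (hκ : 5 ≤ κ) {T : ℝ}
    {φ : ℕ → VField} {u : VField} (h : Approximates (speed σ lam) κ T φ u)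
    (hsol : IsSolution σ lam T u) {t : ℝ} (ht : t ∈ Ioo 0 T) (x : E3) :
    Tendsto (fun n => (waveOp (speed σ lam) (φ n) - quad (opNQ σ lam) (φ n) (φ n)) (t, x))
      atTop (𝓝 0) := by
  obtain ⟨hone, htwo⟩ := h.tendsto_dir (speed_one_pos hhyp) (speed_one_lt hhyp) hκ
    (p := (t, x)) ⟨ht, mem_univ x⟩
  have hA : Tendsto (fun n => opA σ lam (φ n) (t, x)) atTop (𝓝 (opA σ lam u (t, x))) := by
    refine ((PiLp.continuous_toLp 2 fun _ : Fin 3 => ℝ).tendsto _).comp (tendsto_pi_nhds.2 fun i => ?_)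
    refine tendsto_finsetSum _ fun j _ => tendsto_finsetSum _ fun l _ => tendsto_finsetSum _
      fun m _ => Tendsto.const_mul _ ?_
    exact ((EuclideanSpace.proj j : E3 →L[ℝ] ℝ).continuous.tendsto _).comp ((htwo m.succ).2 _)
  have hQ := tendsto_quad (opNQ σ lam) (fun m => hone (dirv (Fin.succ m)))
    (fun l m => (htwo (Fin.succ m)).2 (dirv (Fin.succ l)))
  have hlim := (((htwo 0).2 (dirv 0)).sub hA).sub hQ
  have e0 : dir (dirv 0) (dir (dirv 0) u) (t, x) - opA σ lam u (t, x)
      - quad (opNQ σ lam) u u (t, x) = 0 := by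
    rw [← opN_eq_quad σ lam fun m => (htwo m.succ).1]
    exact sub_eq_zero.2 (hsol t ht x)
  rw [e0] at hlim
  refine hlim.congr fun n => ?_
  rw [opA_eq_lame hσ hiso hlam hhyp (h.1 n)]
  rfl

/-! ### Convergence of the residual -/

/-- Generators of order `|b|` applied to the wave operator are first derivatives of words of
generators of order at most `|b| + 1`. -/
theorem exists_genWord_waveOp_le (c : Fin 2 → ℝ) (b : List (Fin 8)) : ∃ C : ℝ, 0 ≤ C ∧
    ∀ u, IsTest u → ∀ p, ‖genWord b (waveOp c u) p‖ ≤ C * size₁ (b.length + 2) u p := by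
  induction b using List.reverseRecOn with
  | nil =>
    refine ⟨1 + ∑ a, ∑ b, ‖lameK c a b‖, by positivity, fun u hu p => ?_⟩
    have h0 : ‖dT (dT u) p‖ ≤ size₁ 2 u p := by
      have := norm_le_size₁ (k := 2) (a := [dIdx 0]) (by simp) 0 u p
      simp only [genWord, gen_dIdx] at this
      exact this
    have hX : ∀ a b, ‖dX a (dX b u) p‖ ≤ size₁ 2 u p := fun a b => by
      have := norm_le_size₁ (k := 2) (a := [xIdx b]) (by simp) a.succ u p
      simp only [genWord, gen_xIdx] at this
      exact this
    rw [genWord_nil, List.length_nil, waveOp, Pi.sub_apply, add_mul, one_mul]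
    refine (norm_sub_le _ _).trans (add_le_add h0 ?_)
    simp only [lame, Finset.sum_apply, Finset.sum_mul]
    refine norm_sum_le_of_le _ fun a _ => norm_sum_le_of_le _ fun b _ => ?_
    exact (lameK c a b).le_of_opNorm_le_of_le le_rfl (hX a b)
  | append_singleton b i ih =>
    obtain ⟨C, hC, h⟩ := ih
    refine ⟨C + 2 * C, by positivity, fun u hu p => ?_⟩
    have e : genWord (b ++ [i]) (waveOp c u) p = genWord b (waveOp c (gen i u)) p
        - (if i = 7 then (2 : ℝ) else 0) • genWord b (waveOp c u) p := by
      have hg : genWord (b ++ [i]) (waveOp c u) = genWord b (gen i (waveOp c u)) := by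
        rw [genWord_append]
        rfl
      rw [waveOp_gen hu, genWord_add b ((hu.waveOp c).gen i) ((hu.waveOp c).const_smul _),
        genWord_smul b (hu.waveOp c), hg]
      exact (add_sub_cancel_right _ _).symm
    have hk : ‖(if i = 7 then (2 : ℝ) else 0)‖ ≤ 2 := by split_ifs <;> simp
    have hlen : (b ++ [i]).length = b.length + 1 := by simp
    rw [e, hlen, add_mul]
    refine (norm_sub_le _ _).trans (add_le_add ((h _ (hu.gen i) p).trans ?_) ?_)
    · exact mul_le_mul_of_nonneg_left (size₁_genWord_le [i] (by simp) u p) hC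
    · rw [norm_smul, mul_assoc]
      refine mul_le_mul hk ((h u hu p).trans ?_) (norm_nonneg _) zero_le_two
      exact mul_le_mul_of_nonneg_left (size₁_mono (by omega) u p) hC

theorem exists_eLpNorm_waveOp_le {c : Fin 2 → ℝ} (h1 : 0 < c 1) (h01 : c 1 < c 0) {κ : ℕ}
    {b : List (Fin 8)} (hb : b.length + 2 ≤ κ) : ∃ C : ℝ, 0 ≤ C ∧ ∀ u, IsTest u → ∀ t,
      eLpNorm (fun x => genWord b (waveOp c u) (t, x)) 2 volume
        ≤ ENNReal.ofReal (C * rootEnergy c κ u t) := by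
  obtain ⟨C, hC, h⟩ := exists_genWord_waveOp_le c b
  obtain ⟨C', hC', h'⟩ := exists_eLpNorm_size₁_le h1 h01 κ
  refine ⟨C * C', by positivity, fun u hu t => ?_⟩
  rw [mul_assoc, ENNReal.ofReal_mul hC]
  refine (eLpNorm_le_mul_eLpNorm_of_ae_le_mul (c := C) (g := fun x => size₁ κ u (t, x))
    (.of_forall fun x => ?_) 2).trans (mul_le_mul_right (h' u hu t) _)
  rw [Real.norm_of_nonneg (size₁_nonneg _ _ _)]
  exact (h u hu _).trans (mul_le_mul_of_nonneg_left (size₁_mono hb u _) hC)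

/-- In each product one factor has few enough generators for the Sobolev inequality. -/
theorem exists_eLpNorm_mul_size_le {c : Fin 2 → ℝ} (h1 : 0 < c 1) (h01 : c 1 < c 0) {κ : ℕ}
    (hκ : 8 ≤ κ) {b d : ℕ} (hbd : b + d + 2 ≤ κ) : ∃ C : ℝ, 0 ≤ C ∧
      ∀ u v, IsTest u → IsTest v → ∀ t,
        eLpNorm (fun x => size₁ (b + 1) u (t, x) * size₂ (d + 1) v (t, x)) 2 volume
          ≤ ENNReal.ofReal (C * (rootEnergy c κ u t * rootEnergy c κ v t)) := by
  have hprod : ∀ {f g : E3 → ℝ} {A B : ℝ}, 0 ≤ A → (∀ x, 0 ≤ f x ∧ f x ≤ A) →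
      eLpNorm g 2 volume ≤ ENNReal.ofReal B →
        eLpNorm (fun x => f x * g x) 2 volume ≤ ENNReal.ofReal (A * B) := by
    intro f g A B hA hf hg
    rw [ENNReal.ofReal_mul hA]
    refine (eLpNorm_le_mul_eLpNorm_of_ae_le_mul (c := A) (g := g)
      (.of_forall fun x => ?_) 2).trans (mul_le_mul_right hg _)
    rw [norm_mul, Real.norm_of_nonneg (hf x).1]
    exact mul_le_mul_of_nonneg_right (hf x).2 (norm_nonneg _)
  have hE := rootEnergy_nonneg c κ
  by_cases hb : b + 4 ≤ κ
  · obtain ⟨C₁, hC₁, hs⟩ := exists_size₁_le h1 h01 b κ hb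
    obtain ⟨C₂, hC₂, hn⟩ := exists_eLpNorm_size₂_le h1 h01 (k := d + 1) (n := κ) (by omega)
    refine ⟨C₁ * C₂, by positivity, fun u v hu hv t => ?_⟩
    refine (hprod (mul_nonneg hC₁ (hE u t)) (fun x => ⟨size₁_nonneg _ _ _, hs u hu t x⟩)
      (hn v hv t)).trans (le_of_eq ?_)
    congr 1
    ring
  · obtain ⟨C₁, hC₁, hs⟩ := exists_size₁_le h1 h01 (d + 1) κ (by omega)
    obtain ⟨C₂, hC₂, hn⟩ := exists_eLpNorm_size₁_le h1 h01 κ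
    set K : ℝ := (words (d + 1)).card * (4 * 3) with hK
    have hK0 : 0 ≤ K := by positivity
    refine ⟨K * C₁ * C₂, by positivity, fun u v hu hv t => ?_⟩
    have hf : ∀ x, 0 ≤ size₂ (d + 1) v (t, x)
        ∧ size₂ (d + 1) v (t, x) ≤ K * (C₁ * rootEnergy c κ v t) := fun x => by
      refine ⟨size₂_nonneg _ _ _, (size₂_le_size₁ le_rfl v (t, x)).trans ?_⟩
      rw [← mul_assoc 4, ← mul_assoc]
      exact mul_le_mul_of_nonneg_left (hs v hv t x) hK0
    have hg : eLpNorm (fun x => size₁ (b + 1) u (t, x)) 2 volume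
        ≤ ENNReal.ofReal (C₂ * rootEnergy c κ u t) := by
      refine (eLpNorm_mono_real fun x => ?_).trans (hn u hu t)
      rw [Real.norm_of_nonneg (size₁_nonneg _ _ _)]
      exact size₁_mono (by omega) u _
    have hp := hprod (mul_nonneg hK0 (mul_nonneg hC₁ (hE v t))) hf hg
    simp only [mul_comm (size₁ _ u _)]
    refine hp.trans (le_of_eq ?_)
    congr 1
    ring

/-- The quadratic term is continuous from the energy space into `L²` with up to `κ - 2`
generators, without any gain in time. -/
theorem exists_eLpNorm_genWord_quad_le {c : Fin 2 → ℝ} (h1 : 0 < c 1) (h01 : c 1 < c 0)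
    (Q : Fin 3 → Fin 3 → Fin 3 → E3 →L[ℝ] E3 →L[ℝ] E3) {κ : ℕ} (hκ : 8 ≤ κ) {a : List (Fin 8)}
    (ha : a.length + 2 ≤ κ) : ∃ C : ℝ, 0 ≤ C ∧ ∀ u v, IsTest u → IsTest v → ∀ t,
      eLpNorm (fun x => genWord a (quad Q u v) (t, x)) 2 volume
        ≤ ENNReal.ofReal (C * (rootEnergy c κ u t * rootEnergy c κ v t)) := by
  obtain ⟨C₀, hC₀, hq⟩ := exists_genWord_quad_le Q a
  have h' : ∀ q : List (Fin 8) × List (Fin 8), ∃ C : ℝ, 0 ≤ C ∧ (q ∈ wordPairs a.length →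
      ∀ u v, IsTest u → IsTest v → ∀ t,
        eLpNorm (fun x => size₁ (q.1.length + 1) u (t, x) * size₂ (q.2.length + 1) v (t, x))
          2 volume ≤ ENNReal.ofReal (C * (rootEnergy c κ u t * rootEnergy c κ v t))) := by
    intro q
    by_cases hqm : q ∈ wordPairs a.length
    · have := mem_wordPairs.1 hqm
      obtain ⟨C, hC, hu⟩ := exists_eLpNorm_mul_size_le h1 h01 hκ
        (b := q.1.length) (d := q.2.length) (by omega)
      exact ⟨C, hC, fun _ => hu⟩
    · exact ⟨0, le_rfl, fun hm => absurd hm hqm⟩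
  choose C₁ hC₁ h₁ using h'
  refine ⟨C₀ * ∑ q ∈ wordPairs a.length, 2 * C₁ q,
    mul_nonneg hC₀ (Finset.sum_nonneg fun q _ => mul_nonneg zero_le_two (hC₁ q)),
    fun u v hu hv t => ?_⟩
  have hE : 0 ≤ rootEnergy c κ u t * rootEnergy c κ v t :=
    mul_nonneg (rootEnergy_nonneg _ _ _ _) (rootEnergy_nonneg _ _ _ _)
  have hm : ∀ (i j : ℕ) {u v : VField}, IsTest u → IsTest v → AEStronglyMeasurable
      (fun x : E3 => size₁ i u (t, x) * size₂ j v (t, x)) volume := fun i j u v hu hv => by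
    have hi : Continuous fun x : E3 => (t, x) := by fun_prop
    exact (((size₁_continuous _ hu).comp hi).mul
      ((size₂_continuous _ hv).comp hi)).aestronglyMeasurable
  rw [mul_assoc, ENNReal.ofReal_mul hC₀, Finset.sum_mul, ENNReal.ofReal_sum_of_nonneg fun q _ =>
    mul_nonneg (mul_nonneg zero_le_two (hC₁ q)) hE]
  refine (eLpNorm_le_mul_eLpNorm_of_ae_le_mul (c := C₀) (g := ∑ q ∈ wordPairs a.length,
    ((fun x => size₁ (q.1.length + 1) v (t, x) * size₂ (q.2.length + 1) u (t, x))
      + fun x => size₁ (q.1.length + 1) u (t, x) * size₂ (q.2.length + 1) v (t, x)))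
    (.of_forall fun x => ?_) 2).trans (mul_le_mul_right ?_ _)
  · rw [Finset.sum_apply, Real.norm_of_nonneg]
    · exact hq u v hu hv (t, x)
    · exact Finset.sum_nonneg fun q _ => add_nonneg
        (mul_nonneg (size₁_nonneg _ _ _) (size₂_nonneg _ _ _))
        (mul_nonneg (size₁_nonneg _ _ _) (size₂_nonneg _ _ _))
  · refine (eLpNorm_sum_le (fun q _ => (hm _ _ hv hu).add (hm _ _ hu hv)) one_le_two).trans
      (Finset.sum_le_sum fun q hq => ?_)
    refine (eLpNorm_add_le (hm _ _ hv hu) (hm _ _ hu hv) one_le_two).trans ?_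
    refine (add_le_add (h₁ q hq v u hv hu t) (h₁ q hq u v hu hv t)).trans (le_of_eq ?_)
    rw [mul_comm (rootEnergy c κ v t), ← ENNReal.ofReal_add (mul_nonneg (hC₁ q) hE)
      (mul_nonneg (hC₁ q) hE)]
    congr 1
    ring

theorem dX_sub (l : Fin 3) {u v : VField} (hu : IsTest u) (hv : IsTest v) :
    dX l (u - v) = dX l u - dX l v := by
  simp only [← gen_xIdx]
  exact gen_sub _ hu hv

theorem waveOp_sub (c : Fin 2 → ℝ) {u v : VField} (hu : IsTest u) (hv : IsTest v) :
    waveOp c (u - v) = waveOp c u - waveOp c v := by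
  have hT : ∀ {u v : VField}, IsTest u → IsTest v → dT (u - v) = dT u - dT v :=
    fun hu hv => gen_sub 0 hu hv
  simp only [waveOp, lame, dX_sub _ hu hv, fun a b => dX_sub a (hu.dX b) (hv.dX b), hT hu hv,
    hT hu.dT hv.dT, Pi.sub_apply, map_sub]
  funext p
  simp only [Pi.sub_apply, Finset.sum_apply, Finset.sum_sub_distrib]
  abel

theorem quad_sub (Q : Fin 3 → Fin 3 → Fin 3 → E3 →L[ℝ] E3 →L[ℝ] E3) {u v : VField}
    (hu : IsTest u) (hv : IsTest v) :
    quad Q u u - quad Q v v = quad Q (u - v) u + quad Q v (u - v) := by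
  funext p
  simp only [quad, Pi.sub_apply, Pi.add_apply, Finset.sum_apply, ← Finset.sum_sub_distrib,
    ← Finset.sum_add_distrib]
  refine Finset.sum_congr rfl fun l _ => Finset.sum_congr rfl fun m _ =>
    Finset.sum_congr rfl fun n _ => ?_
  simp only [dX_sub _ hu hv, fun a b => dX_sub a (hu.dX b) (hv.dX b), Pi.sub_apply, map_sub,
    sub_apply]
  abel

/-- The residual depends on the approximant by one linear and one bilinear map that are bounded
in the energy, hence it is Cauchy along an approximating sequence. -/
theorem Approximates.l2Cauchy_residual {c : Fin 2 → ℝ} (h1 : 0 < c 1) (h01 : c 1 < c 0)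
    (Q : Fin 3 → Fin 3 → Fin 3 → E3 →L[ℝ] E3 →L[ℝ] E3) {κ : ℕ} (hκ : 8 ≤ κ) {T : ℝ}
    {φ : ℕ → VField} {u : VField} (h : Approximates c κ T φ u) {b : List (Fin 8)}
    (hb : b.length + 2 ≤ κ) :
    L2Cauchy T fun n => genWord b (waveOp c (φ n) - quad Q (φ n) (φ n)) := by
  intro ε hε
  obtain ⟨C₁, hC₁, hL⟩ := exists_eLpNorm_waveOp_le h1 h01 hb
  obtain ⟨C₂, hC₂, hQ⟩ := exists_eLpNorm_genWord_quad_le h1 h01 Q hκ hb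
  obtain ⟨B, hB, N, hN⟩ := h.exists_rootEnergy_le h1 h01
  set K := C₁ + (C₂ * B + C₂ * B) with hK
  have hK0 : 0 ≤ K := by positivity
  obtain ⟨N', hN'⟩ := h.2.1 (ε / (K + 1)) (by positivity)
  refine ⟨max N N', fun m n hm hn t ht => ?_⟩
  have um := h.1 m
  have un := h.1 n
  have hd := um.sub un
  set ψ := φ m - φ n with hψ
  have q1 := hd.quad um Q
  have q2 := un.quad hd Q
  have e : (fun x => genWord b (waveOp c (φ m) - quad Q (φ m) (φ m)) (t, x)
        - genWord b (waveOp c (φ n) - quad Q (φ n) (φ n)) (t, x))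
      = (fun x => genWord b (waveOp c ψ) (t, x))
        - ((fun x => genWord b (quad Q ψ (φ m)) (t, x))
          + fun x => genWord b (quad Q (φ n) ψ) (t, x)) := by
    have e1 : (waveOp c (φ m) - quad Q (φ m) (φ m)) - (waveOp c (φ n) - quad Q (φ n) (φ n))
        = waveOp c ψ - (quad Q ψ (φ m) + quad Q (φ n) ψ) := by
      rw [hψ, waveOp_sub c um un, ← quad_sub Q um un]
      abel
    have e2 := genWord_sub b ((um.waveOp c).sub (um.quad um Q)) ((un.waveOp c).sub (un.quad un Q))
    rw [e1, genWord_sub b (hd.waveOp c) (q1.add q2), genWord_add b q1 q2] at e2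
    funext x
    exact (congrFun e2 (t, x)).symm
  have hψE : rootEnergy c κ ψ t ≤ ε / (K + 1) :=
    hN' m n (le_of_max_le_right hm) (le_of_max_le_right hn) t ht
  have hψ0 := rootEnergy_nonneg c κ ψ t
  have hBm := hN m (le_of_max_le_left hm) t ht
  have hBn := hN n (le_of_max_le_left hn) t ht
  rw [e]
  refine (eLpNorm_sub_le (((hd.waveOp c).genWord b).memLp t).1
    (((q1.genWord b).memLp t).1.add ((q2.genWord b).memLp t).1) one_le_two).trans ?_
  refine (add_le_add (hL ψ hd t) ((eLpNorm_add_le ((q1.genWord b).memLp t).1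
    ((q2.genWord b).memLp t).1 one_le_two).trans
      (add_le_add (hQ ψ _ hd um t) (hQ _ ψ un hd t)))).trans ?_
  have p1 : 0 ≤ C₂ * (rootEnergy c κ ψ t * rootEnergy c κ (φ m) t) :=
    mul_nonneg hC₂ (mul_nonneg hψ0 (rootEnergy_nonneg _ _ _ _))
  have p2 : 0 ≤ C₂ * (rootEnergy c κ (φ n) t * rootEnergy c κ ψ t) :=
    mul_nonneg hC₂ (mul_nonneg (rootEnergy_nonneg _ _ _ _) hψ0)
  rw [← ENNReal.ofReal_add p1 p2, ← ENNReal.ofReal_add (mul_nonneg hC₁ hψ0) (add_nonneg p1 p2)]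
  refine ENNReal.ofReal_le_ofReal ?_
  have l1 := mul_le_mul_of_nonneg_left (mul_le_mul_of_nonneg_left hBm hψ0) hC₂
  have l2 := mul_le_mul_of_nonneg_left (mul_le_mul_of_nonneg_right hBn hψ0) hC₂
  have l3 : K * rootEnergy c κ ψ t ≤ K * (ε / (K + 1)) := mul_le_mul_of_nonneg_left hψE hK0
  have l4 : K * (ε / (K + 1)) ≤ ε := by
    rw [mul_div_assoc', div_le_iff₀ (by positivity)]
    nlinarith
  rw [hK] at l3
  linarith

/-- Fatou's lemma identifies the `L²` limit with the pointwise one, so the convergence to zero is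
even strong; the weak form is what differentiation preserves. -/
theorem L2Cauchy.weakNull {T : ℝ} {f : ℕ → VField} (hf : ∀ n, IsTest (f n)) (hc : L2Cauchy T f)
    (hlim : ∀ t ∈ Ioo 0 T, ∀ x, Tendsto (fun n => f n (t, x)) atTop (𝓝 0)) : WeakNull T f := by
  intro t ht χ hχ
  have hz : Tendsto (fun n => eLpNorm (fun x => f n (t, x)) 2 volume) atTop (𝓝 0) := by
    refine ENNReal.tendsto_nhds_zero.2 fun ε hε => ?_
    obtain ⟨r, hr, hrε⟩ := ENNReal.lt_iff_exists_real_btwn.1 hε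
    obtain ⟨N, hN⟩ := hc r (ENNReal.ofReal_pos.1 hrε.1)
    filter_upwards [eventually_ge_atTop N] with n hn
    refine (Lp.eLpNorm_lim_le_liminf_eLpNorm (f := fun m x => f n (t, x) - f m (t, x))
      (fun m => (((hf n).memLp t).sub ((hf m).memLp t)).1) _ (.of_forall fun x => ?_)).trans ?_
    · simpa using (hlim t ht x).const_sub (f n (t, x))
    · refine liminf_le_of_le (by isBoundedDefault) fun b hb => ?_
      obtain ⟨m, hm, hmN⟩ := (hb.and (eventually_ge_atTop N)).exists
      exact (hm.trans (hN n m hn hmN t ⟨ht.1.le, ht.2⟩)).trans hrε.2.le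
  rw [tendsto_zero_iff_enorm_tendsto_zero]
  have h3 : Tendsto (fun n => eLpNorm χ 2 volume * eLpNorm (fun x => f n (t, x)) 2 volume)
      atTop (𝓝 0) := by
    simpa using ENNReal.Tendsto.const_mul hz (.inr hχ.memLp.2.ne)
  exact tendsto_of_tendsto_of_tendsto_of_le_of_le tendsto_const_nhds h3
    (fun n => zero_le) fun n => enorm_integral_smul_le hχ.memLp ((hf n).memLp t)

/-- The residuals of the approximants, with up to `κ - 2` generators, tend to zero in `L²`
uniformly in time: they are Cauchy there, and their limit is zero in the sense of distributions
because the equation holds pointwise in the limit. -/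
theorem Approximates.l2Null_residual {σ : Matrix (Fin 3) (Fin 3) ℝ → ℝ}
    (hσ : ContDiffOn ℝ 3 σ {F : Matrix (Fin 3) (Fin 3) ℝ | 0 < F.det}) (hiso : IsIsotropic σ)
    {lam : ℝ} (hlam : 0 < lam) (hhyp : IsHyperbolic σ lam) {κ : ℕ} (hκ : 8 ≤ κ) {T : ℝ}
    {φ : ℕ → VField} {u : VField} (h : Approximates (speed σ lam) κ T φ u)
    (hsol : IsSolution σ lam T u) {b : List (Fin 8)} (hb : b.length + 2 ≤ κ) :
    L2Null T fun n =>
      genWord b (waveOp (speed σ lam) (φ n) - quad (opNQ σ lam) (φ n) (φ n)) := by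
  have h1 := speed_one_pos hhyp
  have h01 := speed_one_lt hhyp
  have hR : ∀ n, IsTest (waveOp (speed σ lam) (φ n) - quad (opNQ σ lam) (φ n) (φ n)) := fun n =>
    ((h.1 n).waveOp _).sub ((h.1 n).quad (h.1 n) _)
  have hw : WeakNull T fun n => waveOp (speed σ lam) (φ n) - quad (opNQ σ lam) (φ n) (φ n) :=
    (h.l2Cauchy_residual h1 h01 (opNQ σ lam) hκ (b := []) (by simp; omega)).weakNull hR
      fun t ht x => h.tendsto_residual hσ hiso hlam hhyp (by omega) hsol ht x
  refine L2Cauchy.l2Null (fun n => (hR n).genWord b)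
    (h.l2Cauchy_residual h1 h01 (opNQ σ lam) hκ hb) ?_
  refine hw.genWord hR (k := κ - 2) (fun a ha => ?_) (by omega)
  have := h.l2Cauchy_residual h1 h01 (opNQ σ lam) hκ (b := dIdx 0 :: a)
    (by rw [List.length_cons]; omega)
  simp only [genWord, gen_dIdx] at this
  exact this

/-! ### The jet of an element of the solution space -/

/-- The jet is the limit of the derivatives of every approximating sequence. -/
theorem Approximates.tendsto_jet {c : Fin 2 → ℝ} (h1 : 0 < c 1) (h01 : c 1 < c 0) {κ : ℕ}
    (hκ : 4 ≤ κ) {T : ℝ} {φ : ℕ → VField} {u : VField} (h : Approximates c κ T φ u) {t : ℝ}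
    (ht : t ∈ Ico 0 T) {a : List (Fin 8)} (ha : a.length < κ) (β : Fin 4) :
    MemLp (jet c κ T u t (dIdx β :: a)) 2 volume ∧
      Tendsto (fun n => eLpNorm ((classicalJet (φ n) t - jet c κ T u t) (dIdx β :: a)) 2 volume)
        atTop (𝓝 0) := by
  obtain ⟨g, hg, hlim⟩ := exists_L2_limit
    (fun n => ((h.1 n).genWord (dIdx β :: a)).memLp t) fun ε hε => by
      obtain ⟨N, hN⟩ := h.l2Cauchy h1 h01 ha β ε hε
      exact ⟨N, fun m n hm hn => hN m n hm hn t ht⟩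
  have hs : IsStrongDeriv c κ T u t (dIdx β :: a) (jet c κ T u t (dIdx β :: a)) :=
    Classical.epsilon_spec (p := IsStrongDeriv c κ T u t (dIdx β :: a)) ⟨g, hg, φ, h, hlim⟩
  obtain ⟨hm, ψ, hψ, hψlim⟩ := hs
  refine ⟨hm, ?_⟩
  have hd := ((h.sub h1 h01 hψ).l2Null h1 h01 hκ ha β).tendsto ht
  have hsum := hd.add hψlim
  rw [add_zero] at hsum
  refine tendsto_of_tendsto_of_tendsto_of_le_of_le tendsto_const_nhds hsum
    (fun n => zero_le) fun n => ?_
  have um := ((h.1 n).sub (hψ.1 n)).genWord (dIdx β :: a)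
  have uψ := (hψ.1 n).genWord (dIdx β :: a)
  have e : (classicalJet (φ n) t - jet c κ T u t) (dIdx β :: a)
      = (fun x => genWord (dIdx β :: a) (φ n - ψ n) (t, x))
        + fun x => classicalJet (ψ n) t (dIdx β :: a) x - jet c κ T u t (dIdx β :: a) x := by
    rw [genWord_sub _ (h.1 n) (hψ.1 n)]
    funext x
    exact (sub_add_sub_cancel _ _ _).symm
  rw [e]
  exact eLpNorm_add_le (um.memLp t).1 ((uψ.memLp t).sub hm).1 one_le_two

theorem Approximates.memJet {c : Fin 2 → ℝ} (h1 : 0 < c 1) (h01 : c 1 < c 0) {κ : ℕ}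
    (hκ : 4 ≤ κ) {T : ℝ} {φ : ℕ → VField} {u : VField} (h : Approximates c κ T φ u) {t : ℝ}
    (ht : t ∈ Ico 0 T) {k : ℕ} (hk : k ≤ κ) : ∀ a ∈ words k, MemJet (jet c κ T u t) a :=
  fun _ ha β => (h.tendsto_jet h1 h01 hκ ht ((mem_words.1 ha).trans_le hk) β).1

/-- The energies of an approximating sequence are bounded by the energy of the jet, up to a factor
and an error that tends to zero. -/
theorem Approximates.exists_rootEnergy_le_jet {c : Fin 2 → ℝ} (h1 : 0 < c 1) (h01 : c 1 < c 0)
    {κ : ℕ} (hκ : 4 ≤ κ) {T : ℝ} {φ : ℕ → VField} {u : VField} (h : Approximates c κ T φ u)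
    {t : ℝ} (ht : t ∈ Ico 0 T) {k : ℕ} (hk : k ≤ κ) : ∃ δ : ℕ → ℝ, Tendsto δ atTop (𝓝 0) ∧
      ∀ n, rootEnergy c k (φ n) t ≤ 2 * √(energy c k (jet c κ T u t)) + δ n := by
  have hJ := h.memJet h1 h01 hκ ht hk
  have hD : ∀ n, ∀ a ∈ words k, MemJet (classicalJet (φ n) t - jet c κ T u t) a := fun n a ha β =>
    (memJet_classicalJet (h.1 n) t a β).sub (hJ a ha β)
  refine ⟨fun n => 2 * √(energy c k (classicalJet (φ n) t - jet c κ T u t)), ?_, fun n => ?_⟩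
  · have := tendsto_energy_zero h1 h01 hD fun a ha β =>
      (h.tendsto_jet h1 h01 hκ ht ((mem_words.1 ha).trans_le hk) β).2
    simpa using this.sqrt.const_mul 2
  · have := sqrt_energy_add_le h1 h01 (hD n) hJ
    rw [sub_add_cancel] at this
    rw [rootEnergy]
    linarith

/-- Superadditivity of the lower limit, for finite sums. -/
theorem sum_le_liminf_sum {ι : Type*} (s : Finset ι) {f : ι → ℝ≥0∞} {F : ι → ℕ → ℝ≥0∞}
    (h : ∀ i ∈ s, f i ≤ liminf (F i) atTop) :
    ∑ i ∈ s, f i ≤ liminf (fun n => ∑ i ∈ s, F i n) atTop := by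
  classical
  induction s using Finset.induction_on with
  | empty => simp
  | insert i s hi ih =>
    simp only [Finset.sum_insert hi]
    refine (add_le_add (h i (Finset.mem_insert_self i s))
      (ih fun j hj => h j (Finset.mem_insert_of_mem hj))).trans ?_
    have hmono : ∀ G : ℕ → ℝ≥0∞, Monotone fun n => ⨅ i, ⨅ (_ : i ≥ n), G i := fun G m n hmn =>
      le_iInf₂ fun j hj => iInf₂_le j (hmn.trans hj)
    simp only [liminf_eq_iSup_iInf_of_nat]
    rw [ENNReal.iSup_add_iSup_of_monotone (hmono _) (hmono _)]
    exact iSup_mono fun n => le_iInf₂ fun j hj => add_le_add (iInf₂_le j hj) (iInf₂_le j hj)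

/-- The weighted norm is lower semicontinuous. -/
theorem weightedNorm_le_of_tendsto {c : Fin 2 → ℝ} {k : ℕ} {t : ℝ} {φ : ℕ → VField}
    (hφ : ∀ n, IsTest (φ n)) {J : Jet}
    (hJ : ∀ a ∈ words k, ∀ β, MemLp (J (dIdx β :: a)) 2 volume)
    (hlim : ∀ a ∈ words k, ∀ β,
      Tendsto (fun n => eLpNorm ((classicalJet (φ n) t - J) (dIdx β :: a)) 2 volume) atTop (𝓝 0))
    {L : ℕ → ℝ} {ℓ : ℝ} (hL : Tendsto L atTop (𝓝 ℓ))
    (hle : ∀ᶠ n in atTop, weightedNorm c k t (classicalJet (φ n) t) ≤ ENNReal.ofReal (L n)) :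
    weightedNorm c k t J ≤ ENNReal.ofReal ℓ := by
  -- One subsequence along which all the derivatives converge almost everywhere.
  set G : ℕ → E3 → ℝ := fun n => ∑ a ∈ words k, ∑ β : Fin 4,
    fun x => ‖(classicalJet (φ n) t - J) (dIdx β :: a) x‖ with hG
  have hmem : ∀ n, ∀ a ∈ words k, ∀ β,
      AEStronglyMeasurable ((classicalJet (φ n) t - J) (dIdx β :: a)) volume := fun n a ha β =>
    (memJet_classicalJet (hφ n) t a β).1.sub (hJ a ha β).1
  have hGm : ∀ n, AEStronglyMeasurable (G n) volume := fun n =>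
    Finset.aestronglyMeasurable_sum _ fun a ha =>
      Finset.aestronglyMeasurable_sum _ fun β _ => (hmem n a ha β).norm
  have hG0 : Tendsto (fun n => eLpNorm (G n - fun _ => 0) 2 volume) atTop (𝓝 0) := by
    have hs := tendsto_finsetSum (words k) fun a ha =>
      tendsto_finsetSum (Finset.univ : Finset (Fin 4)) fun β _ => hlim a ha β
    simp only [Finset.sum_const_zero] at hs
    refine tendsto_of_tendsto_of_tendsto_of_le_of_le tendsto_const_nhds hs
      (fun n => zero_le) fun n => ?_
    rw [show (G n - fun _ => 0) = G n from sub_zero _]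
    refine (eLpNorm_sum_le (fun a ha => Finset.aestronglyMeasurable_sum _ fun β _ =>
      (hmem n a ha β).norm) one_le_two).trans (Finset.sum_le_sum fun a ha => ?_)
    refine (eLpNorm_sum_le (fun β _ => (hmem n a ha β).norm) one_le_two).trans
      (Finset.sum_le_sum fun β _ => ?_)
    rw [eLpNorm_norm]
  obtain ⟨ns, hns, hae⟩ := (tendstoInMeasure_of_tendsto_eLpNorm (g := fun _ => (0 : ℝ)) two_ne_zero
    hGm aestronglyMeasurable_const hG0).exists_seq_tendsto_ae
  have hconv : ∀ᵐ x, ∀ a ∈ words k, ∀ β, Tendsto (fun i => classicalJet (φ (ns i)) t (dIdx β :: a) x)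
      atTop (𝓝 (J (dIdx β :: a) x)) := by
    filter_upwards [hae] with x hx a ha β
    rw [tendsto_iff_norm_sub_tendsto_zero]
    refine squeeze_zero (fun _ => norm_nonneg _) (fun i => ?_) hx
    simp only [hG, Finset.sum_apply]
    exact (Finset.single_le_sum (f := fun β : Fin 4 =>
      ‖(classicalJet (φ (ns i)) t - J) (dIdx β :: a) x‖)
        (fun _ _ => norm_nonneg _) (Finset.mem_univ β)).trans
      (Finset.single_le_sum (f := fun a => ∑ β : Fin 4,
        ‖(classicalJet (φ (ns i)) t - J) (dIdx β :: a) x‖)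
        (fun _ _ => Finset.sum_nonneg fun _ _ => norm_nonneg _) ha)
  have key : weightedNorm c k t J
      ≤ liminf (fun i => weightedNorm c k t (classicalJet (φ (ns i)) t)) atTop := by
    simp only [weightedNorm_classicalJet]
    rw [weightedNorm_eq]
    refine sum_le_liminf_sum _ fun α _ => sum_le_liminf_sum _ fun β _ =>
      sum_le_liminf_sum _ fun l _ => sum_le_liminf_sum _ fun a ha => ?_
    refine Lp.eLpNorm_lim_le_liminf_eLpNorm
      (fun i => (weightedTerm_measurable c α β l ((hφ (ns i)).genWord a) t).aestronglyMeasurable) _ ?_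
    filter_upwards [hconv] with x hx
    have hw := hx (xIdx l :: a) (mem_words.2 (by
      have := mem_words.1 ha
      rw [List.length_cons]; omega)) β
    simp only [classicalJet_dIdx_xIdx] at hw
    exact (((projL α x).continuous_of_finiteDimensional.tendsto _).comp hw).const_smul _
  have hL' : Tendsto (fun i => ENNReal.ofReal (L (ns i))) atTop (𝓝 (ENNReal.ofReal ℓ)) :=
    ENNReal.tendsto_ofReal (hL.comp hns.tendsto_atTop)
  refine key.trans ?_
  rw [← hL'.liminf_eq]
  exact liminf_le_liminf (hns.tendsto_atTop.eventually hle)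

end

end PrestressedElastic

theorem proposition3p4
    (σ : Matrix (Fin 3) (Fin 3) ℝ → ℝ)
    (hσ : ContDiffOn ℝ 3 σ {F : Matrix (Fin 3) (Fin 3) ℝ | 0 < F.det})
    (hiso : IsIsotropic σ)
    (lam : ℝ) (hlam : 0 < lam) (hhyp : IsHyperbolic σ lam)
    (κ : ℕ) (hκ : 8 ≤ κ) :
    ∃ ε : ℝ, 0 < ε ∧ ∃ C : ℝ, 0 < C ∧
      ∀ T : ℝ, 0 < T → ∀ u : VField,
        MemSpace (speed σ lam) κ T u →
        IsSolution σ lam T u →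
        (∀ t ∈ Ico 0 T, energy (speed σ lam) (κ - 2) (jet (speed σ lam) κ T u t) ≤ ε) →
        ∀ t ∈ Ico 0 T,
          weightedNorm (speed σ lam) (κ - 2) t (jet (speed σ lam) κ T u t) ≤
              ENNReal.ofReal
                (C * √(energy (speed σ lam) (κ - 2) (jet (speed σ lam) κ T u t))) ∧
          weightedNorm (speed σ lam) κ t (jet (speed σ lam) κ T u t) ≤
              ENNReal.ofReal
                (C * √(energy (speed σ lam) κ (jet (speed σ lam) κ T u t)) *
                  (1 + √(energy (speed σ lam) (κ - 2) (jet (speed σ lam) κ T u t)))) := by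
  have h1 := speed_one_pos hhyp
  have h01 := speed_one_lt hhyp
  obtain ⟨ε, hε, C, hC, hA⟩ := exists_weighted_quad_le h1 h01 (opNQ σ lam) hκ
  -- The root energies of the approximants exceed twice that of `u` by a null sequence, so a
  -- quarter of the threshold for test fields leaves room for it.
  refine ⟨(ε / 4) ^ 2, by positivity, 4 * C + 1, by positivity, ?_⟩
  rintro T - u ⟨φ, hφ⟩ hsol hsmall t ht
  have hsm := hsmall t ht
  set c := speed σ lam with hc
  set J := jet c κ T u t with hJ
  set Q := opNQ σ lam with hQ
  set R : ℕ → VField := fun n => waveOp c (φ n) - quad Q (φ n) (φ n) with hR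
  have hRt : ∀ n, IsTest (R n) := fun n => ((hφ.1 n).waveOp _).sub ((hφ.1 n).quad (hφ.1 n) _)
  obtain ⟨δ, hδ, hδE⟩ := hφ.exists_rootEnergy_le_jet h1 h01 (by omega) ht (Nat.sub_le κ 2)
  obtain ⟨δ', hδ', hδE'⟩ := hφ.exists_rootEnergy_le_jet h1 h01 (by omega) ht (le_refl κ)
  set e := √(energy c (κ - 2) J) with he
  set e' := √(energy c κ J) with he'
  have he0 : 0 ≤ e := Real.sqrt_nonneg _
  have he0' : 0 ≤ e' := Real.sqrt_nonneg _
  -- The weighted size of the residual; at the initial time it vanishes by the factor `t`.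
  set r : ℕ → ℝ≥0∞ := fun n => ∑ b ∈ words (κ - 1),
    ENNReal.ofReal t * eLpNorm (fun x => genWord b (R n) (t, x)) 2 volume with hr
  have hr0 : Tendsto r atTop (𝓝 0) := by
    have hb : ∀ b ∈ words (κ - 1), Tendsto (fun n => ENNReal.ofReal t
        * eLpNorm (fun x => genWord b (R n) (t, x)) 2 volume) atTop (𝓝 0) := fun b hb => by
      have hlen := mem_words.1 hb
      have := (hφ.l2Null_residual hσ hiso hlam hhyp hκ hsol (b := b) (by omega)).tendsto ht
      simpa using ENNReal.Tendsto.const_mul this (.inr ENNReal.ofReal_ne_top)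
    have := tendsto_finsetSum _ hb
    rwa [Finset.sum_const_zero] at this
  have hrtop : ∀ n, r n ≠ ⊤ := fun n => ENNReal.sum_ne_top.2 fun b _ =>
    ENNReal.mul_ne_top ENNReal.ofReal_ne_top (((hRt n).genWord b).memLp t).2.ne
  set ρ : ℕ → ℝ := fun n => (r n).toReal with hρ
  have hρ0 : Tendsto ρ atTop (𝓝 0) := (ENNReal.tendsto_toReal ENNReal.zero_ne_top).comp hr0
  have hmain : ∀ᶠ n in atTop,
      weightedReal c (κ - 2) (φ n) t ≤ C * ((2 * e + δ n) + ρ n) ∧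
      weightedReal c κ (φ n) t ≤ C * ((2 * e' + δ' n) * (1 + (2 * e + δ n))
        + ρ n * (1 + (2 * e' + δ' n))) := by
    have hes : e ≤ ε / 4 := Real.sqrt_le_iff.2 ⟨by positivity, hsm⟩
    filter_upwards [hδ.eventually_le_const (by positivity : 0 < ε / 2)] with n hn
    have hE := hδE n
    have hE' := hδE' n
    have hp := rootEnergy_nonneg c (κ - 2) (φ n) t
    have hp' := rootEnergy_nonneg c κ (φ n) t
    have hρn : 0 ≤ ρ n := ENNReal.toReal_nonneg
    obtain ⟨a1, a2⟩ := hA (φ n) (hφ.1 n) t ht.1 (ρ n) hρn (fun b hb => by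
      rw [hρ, ENNReal.ofReal_toReal (hrtop n)]
      exact Finset.single_le_sum (f := fun b => ENNReal.ofReal t
        * eLpNorm (fun x => genWord b (R n) (t, x)) 2 volume) (fun _ _ => zero_le) hb)
      (by linarith)
    refine ⟨a1.trans (mul_le_mul_of_nonneg_left (by linarith) hC),
      a2.trans (mul_le_mul_of_nonneg_left (add_le_add ?_ ?_) hC)⟩
    · exact mul_le_mul hE' (by linarith) (by linarith) (hp'.trans hE')
    · exact mul_le_mul_of_nonneg_left (by linarith) hρn
  have hwt : ∀ {k : ℕ}, k ≤ κ → ∀ {L : ℕ → ℝ} {ℓ : ℝ}, Tendsto L atTop (𝓝 ℓ) →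
      (∀ᶠ n in atTop, weightedReal c k (φ n) t ≤ L n) →
        weightedNorm c k t J ≤ ENNReal.ofReal ℓ := fun {k} hk {L ℓ} hL hle =>
    weightedNorm_le_of_tendsto hφ.1
      (fun a ha β => hφ.memJet h1 h01 (by omega) ht hk a ha β)
      (fun a ha β => (hφ.tendsto_jet h1 h01 (by omega) ht ((mem_words.1 ha).trans_le hk) β).2) hL
      (hle.mono fun n hn => by
        rw [← ofReal_weightedReal h1 h01 k (hφ.1 n) ht.1]
        exact ENNReal.ofReal_le_ofReal hn)
  have hs := hδ.const_add (2 * e)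
  have hs' := hδ'.const_add (2 * e')
  refine ⟨(hwt (Nat.sub_le κ 2) ((hs.add hρ0).const_mul C) (hmain.mono fun _ h => h.1)).trans
    (ENNReal.ofReal_le_ofReal ?_), (hwt le_rfl (((hs'.mul (hs.const_add 1)).add
      (hρ0.mul (hs'.const_add 1))).const_mul C) (hmain.mono fun _ h => h.2)).trans
    (ENNReal.ofReal_le_ofReal ?_)⟩
  · nlinarith [mul_nonneg hC he0]
  · have h2 : 0 ≤ C * e' := mul_nonneg hC he0'
    have h3 : 0 ≤ C * e' * e := mul_nonneg h2 he0
    nlinarith [mul_nonneg he0' he0]
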